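/- Let $n\ge 1$, let $S=\{s_1,\dots,s_n\}$ be $n$ distinct points of $\mathbb P^1=\mathbb C\cup\{\infty\}$, and let $\mu_1,\dots,\mu_n$ be rational numbers with $0<\mu_j<1$. Let $L$ be a Deligne–Mostow local system with these data, i.e. a complex local system of rank $1$ on $\mathbb P^1\setminus S$ such that continuing flat sections along a small counterclockwise circle around $s_j$ multiplies them by $\alpha_j=e^{2\pi i\mu_j}$. Let $IH_1(\mathbb P^1,L)$ be the first intersection homology group (middle perversity) of $\mathbb P^1$, stratified by $S$ and its complement, with coefficients in $L$. Then $L$ carries a flat positive definite Hermitian metric $h$ (equivalently, an identification $L^\vee\cong\overline L$). For every such $h$ there is a unique sesquilinear form $\mathrm{Int}$ on $IH_1(\mathbb P^1,L)$ (linear in the first and conjugate linear in the second variable), the intersection pairing, such that for any two polygonal cycles $\xi,\eta$ in $\mathbb C\setminus S$ in general position $$\mathrm{Int}([\xi],[\eta])=\sum_{p\in \xi\cap\eta}\varepsilon_p(\xi,\eta)\,h(\xi_p,\eta_p),$$ where the sum is over the crossings of a segment of $\xi$ with a segment of $\eta$, $\varepsilon_p(\xi,\eta)=\pm1$ is the orientation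 sign of the crossing (for the standard orientation of $\mathbb C$), and $\xi_p,\eta_p\in L_p$ are the values of the coefficient sections at $p$. The form $\Psi=i\cdot\mathrm{Int}$ is Hermitian and nondegenerate, and its signature is $$\Bigl(\sum_{j=1}^n\mu_j-1,\ \sum_{j=1}^n(1-\mu_j)-1\Bigr):$$ both numbers are non-negative integers, the first one is the dimension of a maximal positive definite subspace of $IH_1(\mathbb P^1,L)$ and the second one is the dimension of a maximal negative definite subspace. In particular, if $\sum_j\mu_j=2$, then $n\ge3$ and the signature of $\Psi$ is $(1,n-3)$. -/

import Mathlib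

universe u

namespace DeligneMostow

open Complex CategoryTheory

/-- The complex projective line `ℙ¹ = ℂ ∪ {∞}` with its usual topology. -/
abbrev P1 : Type := OnePoint ℂ

/-! ### Local systems -/

/-- A complex local system on `ℙ¹ ∖ S`: a representation of the fundamental groupoid. -/
abbrev LocalSystem (S : Set P1) : Type (u + 1) :=
  FundamentalGroupoid {x : P1 // x ∉ S} ⥤ ModuleCat.{u} ℂ

/-- The fibre of a local system at a point. -/
abbrev LocalSystem.fibre {S : Set P1} (L : LocalSystem.{u} S) (x : {x : P1 // x ∉ S}) : Type u :=
  L.obj (FundamentalGroupoid.mk x)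

/-- Continuation of flat sections along a path. -/
noncomputable def LocalSystem.transport {S : Set P1} (L : LocalSystem.{u} S) {x y : {x : P1 // x ∉ S}}
    (γ : Path x y) : L.fibre x →ₗ[ℂ] L.fibre y :=
  (L.map (FundamentalGroupoid.fromPath (Path.Homotopic.Quotient.mk γ))).hom

/-- `γ` is a circle around `s j`, parametrised counterclockwise as seen from `s j`, such that no
other `s k` lies on it or inside it. If `s j = ∞` this is a clockwise circle in `ℂ` that has all
the other points in its interior. -/
def IsPositiveCircle {n : ℕ} (s : Fin n → P1) (j : Fin n) {x : {x : P1 // x ∉ Set.range s}}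
    (γ : Path x x) : Prop :=
  (∃ (c : ℂ) (r : ℝ), s j = (c : P1) ∧ 0 < r ∧
      (∀ k, k ≠ j → ∀ w : ℂ, s k = (w : P1) → r < ‖w - c‖) ∧
      ∀ t : unitInterval,
        (γ t : P1) = ((c + r * exp (2 * Real.pi * I * ((t : ℝ) : ℂ)) : ℂ) : P1)) ∨
  (s j = OnePoint.infty ∧ ∃ r : ℝ, 0 < r ∧
      (∀ k, ∀ w : ℂ, s k = (w : P1) → ‖w‖ < r) ∧
      ∀ t : unitInterval,
        (γ t : P1) = ((r * exp (-(2 * Real.pi * I * ((t : ℝ) : ℂ))) : ℂ) : P1))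

/-- The local monodromy of `L` at `s j` is multiplication by `α`. -/
def HasLocalMonodromy {n : ℕ} {s : Fin n → P1} (L : LocalSystem.{u} (Set.range s)) (j : Fin n)
    (α : ℂ) : Prop :=
  ∀ (x : {x : P1 // x ∉ Set.range s}) (γ : Path x x), IsPositiveCircle s j γ →
    ∀ v : L.fibre x, L.transport γ v = α • v

/-- A Deligne-Mostow local system: rank one, and the local monodromy at `s j` is
`exp (2 π i μ j)` with `μ j` rational. -/
structure IsDeligneMostow {n : ℕ} (s : Fin n → P1) (μ : Fin n → ℚ)
    (L : LocalSystem.{u} (Set.range s)) : Prop where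
  rank_one : ∀ x, Module.finrank ℂ (L.fibre x) = 1
  monodromy : ∀ j, HasLocalMonodromy L j (exp (2 * Real.pi * I * (μ j : ℂ)))

/-- A flat positive definite Hermitian metric on `L`, linear in the first and conjugate linear in
the second variable. This is the same as an identification of the dual of `L` with the complex
conjugate of `L` (up to sign, when `L` has rank one). -/
structure FlatMetric {S : Set P1} (L : LocalSystem.{u} S) where
  form : ∀ x, L.fibre x →ₗ[ℂ] L.fibre x →ₗ⋆[ℂ] ℂ
  conj_symm : ∀ x v w, form x v w = starRingEnd ℂ (form x w v)
  pos : ∀ x v, v ≠ 0 → 0 < (form x v v).re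
  flat : ∀ {x y : {x : P1 // x ∉ S}} (γ : Path x y) (v w : L.fibre x),
    form y (L.transport γ v) (L.transport γ w) = form x v w

/-- The metric on vectors of fibres over two points that are equal. -/
noncomputable def FlatMetric.pair {S : Set P1} {L : LocalSystem.{u} S} (h : FlatMetric L)
    {x y : {x : P1 // x ∉ S}} (e : x = y) (v : L.fibre x) (w : L.fibre y) : ℂ :=
  h.form x v (e ▸ w)

/-! ### Intersection chains with coefficients in a local system -/

/-- The standard `i`-simplex. -/
abbrev Simplex (i : ℕ) : Type := stdSimplex ℝ (Fin (i + 1))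

/-- The inclusion of the `k`-th face. -/
noncomputable def faceMap (i : ℕ) (k : Fin (i + 2)) : C(Simplex i, Simplex (i + 1)) where
  toFun := stdSimplex.map k.succAbove
  continuous_toFun := stdSimplex.continuous_map _

/-- The part of a singular simplex that is mapped to the nonsingular locus `ℙ¹ ∖ S`. -/
abbrev Regular (S : Set P1) {i : ℕ} (σ : C(Simplex i, P1)) : Type := {t : Simplex i // σ t ∉ S}

/-- `σ` as a map from its regular part to `ℙ¹ ∖ S`. -/
noncomputable def regularMap (S : Set P1) {i : ℕ} (σ : C(Simplex i, P1)) :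
    C(Regular S σ, {x : P1 // x ∉ S}) where
  toFun t := ⟨σ t, t.2⟩
  continuous_toFun := by fun_prop

/-- Flat sections of `L` over a singular simplex, that is, over its regular part. -/
noncomputable def FlatSection {S : Set P1} (L : LocalSystem.{u} S) {i : ℕ} (σ : C(Simplex i, P1)) :
    Submodule ℂ (∀ t : Regular S σ, L.fibre (regularMap S σ t)) where
  carrier := {v | ∀ (t t' : Regular S σ) (δ : Path t t'),
    L.transport (δ.map (regularMap S σ).continuous) (v t) = v t'}
  add_mem' {v w} hv hw t t' δ := by
    rw [Pi.add_apply, Pi.add_apply, map_add, hv, hw]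
  zero_mem' t t' δ := by
    rw [Pi.zero_apply, Pi.zero_apply, map_zero]
  smul_mem' c v hv t t' δ := by
    rw [Pi.smul_apply, Pi.smul_apply, map_smul, hv]

/-- The vector space of flat sections of `L` over `σ`. -/
def Coefficient {S : Set P1} (L : LocalSystem.{u} S) {i : ℕ} (σ : C(Simplex i, P1)) : Type u :=
  FlatSection L σ

noncomputable instance {S : Set P1} (L : LocalSystem.{u} S) {i : ℕ} (σ : C(Simplex i, P1)) :
    AddCommGroup (Coefficient L σ) :=
  inferInstanceAs (AddCommGroup (FlatSection L σ))

noncomputable instance {S : Set P1} (L : LocalSystem.{u} S) {i : ℕ} (σ : C(Simplex i, P1)) :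
    Module ℂ (Coefficient L σ) :=
  inferInstanceAs (Module ℂ (FlatSection L σ))

/-- Restriction of flat sections to the `k`-th face. -/
noncomputable def restrictFace {S : Set P1} (L : LocalSystem.{u} S) {i : ℕ} (σ : C(Simplex (i + 1), P1))
    (k : Fin (i + 2)) : Coefficient L σ →ₗ[ℂ] Coefficient L (σ.comp (faceMap i k)) where
  toFun v := ⟨fun t => v.1 ⟨faceMap i k t, t.2⟩, fun t t' δ =>
    v.2 ⟨faceMap i k t, t.2⟩ ⟨faceMap i k t', t'.2⟩
      (δ.map (f := fun r : Regular S (σ.comp (faceMap i k)) =>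
        (⟨faceMap i k r, r.2⟩ : Regular S σ)) (by fun_prop))⟩
  map_add' _ _ := rfl
  map_smul' _ _ := rfl

/-- `L`-valued singular `i`-chains in `ℙ¹`: finite sums of singular simplices, each with a flat
section of `L` over (the regular part of) the simplex as its coefficient. -/
abbrev Chain {S : Set P1} (L : LocalSystem.{u} S) (i : ℕ) : Type u :=
  Π₀ σ : C(Simplex i, P1), Coefficient L σ

open Classical in
/-- The boundary operator: the alternating sum of the faces. -/
noncomputable def boundary {S : Set P1} (L : LocalSystem.{u} S) (i : ℕ) :
    Chain L (i + 1) →ₗ[ℂ] Chain L i :=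
  DFinsupp.lsum ℂ fun σ => ∑ k : Fin (i + 2), ((-1 : ℂ) ^ (k : ℕ)) •
    (DFinsupp.lsingle (R := ℂ) (M := fun τ : C(Simplex i, P1) => Coefficient L τ)
      (σ.comp (faceMap i k)) ∘ₗ restrictFace L σ k)

/-- Admissibility of a singular `i`-simplex for a stratum `S` of codimension `2` and a perversity
`p` with `p 2 = 0`: the preimage of `S` lies in the `(i - 2)`-skeleton of the simplex, that is,
each of its points has at most `i - 1` nonzero barycentric coordinates. -/
def IsAdmissible (S : Set P1) {i : ℕ} (σ : C(Simplex i, P1)) : Prop :=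
  ∀ t : Simplex i, σ t ∈ S → {k | t k ≠ 0}.ncard + 1 ≤ i

/-- The chains all of whose simplices are admissible. -/
def AdmissibleChain {S : Set P1} (L : LocalSystem.{u} S) (i : ℕ) : Submodule ℂ (Chain L i) where
  carrier := {ξ | ∀ σ, ξ σ ≠ 0 → IsAdmissible S σ}
  add_mem' {ξ η} hξ hη σ h := by
    by_cases h1 : ξ σ = 0
    · by_cases h2 : η σ = 0
      · exact absurd (by rw [DFinsupp.add_apply, h1, h2, add_zero]) h
      · exact hη σ h2
    · exact hξ σ h1
  zero_mem' _ h := absurd rfl h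
  smul_mem' c ξ hξ σ h := hξ σ fun h0 => h (by rw [DFinsupp.smul_apply, h0, smul_zero])

/-- The intersection chains `IC_{i+1}(ℙ¹, L)`: the chain and its boundary are admissible. -/
noncomputable def IntersectionChain {S : Set P1} (L : LocalSystem.{u} S) (i : ℕ) :
    Submodule ℂ (Chain L (i + 1)) :=
  AdmissibleChain L (i + 1) ⊓ (AdmissibleChain L i).comap (boundary L i)

/-- The intersection `1`-cycles. -/
noncomputable def IntersectionCycle {S : Set P1} (L : LocalSystem.{u} S) :
    Submodule ℂ (Chain L 1) :=
  IntersectionChain L 0 ⊓ LinearMap.ker (boundary L 0)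

/-- The boundaries of intersection `2`-chains. -/
noncomputable def IntersectionBoundary {S : Set P1} (L : LocalSystem.{u} S) :
    Submodule ℂ (Chain L 1) :=
  (IntersectionChain L 1).map (boundary L 1)

/-- The intersection homology group `IH_1(ℙ¹, L)`. -/
abbrev IH1 {S : Set P1} (L : LocalSystem.{u} S) : Type u :=
  IntersectionCycle L ⧸ (IntersectionBoundary L).comap (IntersectionCycle L).subtype

/-- The class of an intersection `1`-cycle. -/
noncomputable def IH1.mk {S : Set P1} (L : LocalSystem.{u} S) (ξ : IntersectionCycle L) : IH1 L :=
  Submodule.Quotient.mk ξ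

/-! ### The intersection pairing -/

/-- The singular `1`-simplex `σ` is the straight segment in `ℂ` from `a` to `b`. -/
def IsSegment (σ : C(Simplex 1, P1)) (a b : ℂ) : Prop :=
  a ≠ b ∧ ∀ t : Simplex 1, σ t = (((t 0 : ℝ) * a + (t 1 : ℝ) * b : ℂ) : P1)

/-- A chain is polygonal if all its simplices are straight segments in `ℂ`. -/
def IsPolygonal {S : Set P1} {L : LocalSystem.{u} S} (ξ : Chain L 1) : Prop :=
  ∀ σ, ξ σ ≠ 0 → ∃ a b : ℂ, IsSegment σ a b

/-- Two polygonal chains are in general position if no end point of a segment of one of them lies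
on a segment of the other. Two segments of them are then disjoint, or they cross in a single
interior point, with linearly independent directions. -/
def InGeneralPosition {S : Set P1} {L : LocalSystem.{u} S} (ξ η : Chain L 1) : Prop :=
  ∀ σ τ, ξ σ ≠ 0 → η τ ≠ 0 → ∀ (k : Fin 2) (t : Simplex 1),
    σ (stdSimplex.vertex k) ≠ τ t ∧ σ t ≠ τ (stdSimplex.vertex k)

/-- The coordinate of a point of `ℂ ⊆ ℙ¹` (with the value `0` at `∞`, which is never used). -/
noncomputable def coord (x : P1) : ℂ := x.elim 0 id

/-- The direction of a straight segment. -/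
noncomputable def direction (σ : C(Simplex 1, P1)) : ℂ :=
  coord (σ (stdSimplex.vertex 1)) - coord (σ (stdSimplex.vertex 0))

/-- The local orientation number of two crossing segments: `1` if their directions form a
positively oriented basis of `ℂ`, and `-1` if they form a negatively oriented basis. -/
noncomputable def orientationNumber (σ τ : C(Simplex 1, P1)) : ℂ :=
  (Real.sign (starRingEnd ℂ (direction σ) * direction τ).im : ℂ)

open Classical in
/-- The intersection number of two crossing segments with coefficients: the sum over all crossing
points of the orientation number times the metric, applied to the values of the two sections. -/
noncomputable def segmentIntersection {S : Set P1} {L : LocalSystem.{u} S} (h : FlatMetric L)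
    (σ τ : C(Simplex 1, P1)) (v : Coefficient L σ) (w : Coefficient L τ) : ℂ :=
  ∑ᶠ p : Regular S σ × Regular S τ,
    if e : regularMap S σ p.1 = regularMap S τ p.2 then
      orientationNumber σ τ * h.pair e (v.1 p.1) (w.1 p.2)
    else 0

open Classical in
/-- The geometric intersection number of two polygonal chains in general position. -/
noncomputable def intersectionNumber {S : Set P1} {L : LocalSystem.{u} S} (h : FlatMetric L)
    (ξ η : Chain L 1) : ℂ :=
  ∑ σ ∈ ξ.support, ∑ τ ∈ η.support, segmentIntersection h σ τ (ξ σ) (η τ)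

/-- `B` is the intersection pairing on `IH_1(ℙ¹, L)`: on the classes of polygonal cycles in general
position it is the geometric intersection number. -/
def IsIntersectionPairing {S : Set P1} {L : LocalSystem.{u} S} (h : FlatMetric L)
    (B : IH1 L →ₗ[ℂ] IH1 L →ₗ⋆[ℂ] ℂ) : Prop :=
  ∀ ξ η : IntersectionCycle L, IsPolygonal ξ.1 → IsPolygonal η.1 → InGeneralPosition ξ.1 η.1 →
    B (IH1.mk L ξ) (IH1.mk L η) = intersectionNumber h ξ.1 η.1

/-! ### Hermitian forms -/

/-- `B` is a Hermitian form. -/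
def IsHermitianForm {V : Type*} [AddCommGroup V] [Module ℂ V] (B : V →ₗ[ℂ] V →ₗ⋆[ℂ] ℂ) : Prop :=
  ∀ v w, B v w = starRingEnd ℂ (B w v)

/-- `B` is nondegenerate, `p` is the largest dimension of a positive definite subspace, and `q` is
the largest dimension of a negative definite subspace. -/
def HasSignature {V : Type*} [AddCommGroup V] [Module ℂ V] (B : V →ₗ[ℂ] V →ₗ⋆[ℂ] ℂ)
    (p q : ℕ) : Prop :=
  (∀ v, (∀ w, B v w = 0) → v = 0) ∧
  IsGreatest {d : ℕ | ∃ W : Submodule ℂ V, Module.Finite ℂ W ∧ Module.finrank ℂ W = d ∧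
    ∀ v ∈ W, v ≠ 0 → 0 < (B v v).re} p ∧
  IsGreatest {d : ℕ | ∃ W : Submodule ℂ V, Module.Finite ℂ W ∧ Module.finrank ℂ W = d ∧
    ∀ v ∈ W, v ≠ 0 → (B v v).re < 0} q

end DeligneMostow

namespace DeligneMostow
open Complex CategoryTheory Filter Topology

/-! ### Primitives of local cocycles -/

/-! Frames. On `ℂ ∖ S` the local system has a single-valued, nowhere vanishing frame which transport
along a segment multiplies by the phase `exp (i ∑ ν_j θ_j)`, where `θ_j` is the angle under which
the segment is seen from `z_j` (`Config.exists_frame`). The connection form is thus `i ∑ ν_j dθ_j`.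
Transport is unimodular, which gives a flat metric, and the monodromy of a large circle, known a
second time from the behaviour at `∞`, shows that `∑ μ_j` is an integer.

The pairing. A polygonal cycle `η` defines a cocycle near the diagonal: a pair of nearby points is
sent to the signed crossings of the segment between them with `η`, weighted by the conjugate
coefficients of `η`. Crossing numbers are expressed through angles. Near a vertex of `η` the terms
that are not additive cancel because `∂η = 0` (`PolyCycle.eventually_val_add`), and near `S` the
cocycle is zero. It therefore has primitives on simplices, including those that run into `S`, and
integrates to a functional on `1`-chains that kills boundaries
(`LocalCocycle.chainIntegral_boundary`). On polygonal chains in general position with `η` this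
functional is the geometric intersection number (`dual_eq`).

Generators. Order the finite points by a generic real linear function. As the monodromy `α_j`
differs from `1`, every additive homotopy invariant function of paths has a potential around `z_j`,
obtained by dividing its value on a loop by `α_j - 1` (`Config.IsolatingSet.exists_potential`). The
difference of the potentials of two neighbours is the value of the function on the regularized arc
that joins them: a segment whose ends are closed up by squares around the two points with
coefficients `(α_j - 1)⁻¹` and `-(α_{j+1} - 1)⁻¹`, up to the phases of the frame. If the function
vanishes on these arcs, the potentials glue. When `∞` is not singular one overlap has no arc, and
there the triviality of a large loop replaces it (`PathCocycle.eq_on_last_overlap`). Applied to the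
class of a path modulo boundaries and arcs, this shows that `N = n - 2` arcs generate `IH_1`.

The signature. Pushing an arc off itself by a parallel copy computes the Gram matrix. It is
tridiagonal, with diagonal entries `i/2 (cot πν_k + cot πν_{k+1})` and entries of modulus `1 / (2
sin πν_{k+1})` next to the diagonal, between the arcs that start at `z_k` and `z_{k+1}`. Let `B_i`
be a starting value plus the partial sums of the `πν_j`. Completing squares turns `Ψ` into `-1/2 ∑
sin B_i sin B_{i+1} / sin πν_i · |g_{i+1} - g_i|²` with `g_0 = g_{N+1} = 0`. The number of negative
weights is the number of multiples of `π` that the sequence `B` passes. With the starting value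
slightly above `0` there are `p = ∑ μ_j - 1` of them, and slightly below `0` there are `p + 1`; this
yields a negative definite subspace of dimension at least `N - p` and a positive definite one of
dimension at least `p` (`IsTridiagonal.hasSignature`).

The Gram matrix is therefore nondegenerate, so the arcs form a basis, and the functionals above
assemble to the pairing. It is unique because each arc is homologous, up to a phase, to small
displaced arcs in general position with any given polygonal cycle. -/

/-- `F` is a primitive of `D` near the diagonal. -/
def IsPrimitive {Y A : Type*} [TopologicalSpace Y] [AddCommGroup A] (D : Y → Y → A) (F : Y → A) :
    Prop :=
  ∀ x, ∃ N ∈ 𝓝 x, ∀ a ∈ N, ∀ b ∈ N, F b - F a = D a b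

/-- `D` is additive near the diagonal. -/
def IsLocallyAdditive {Y A : Type*} [TopologicalSpace Y] [AddCommGroup A] (D : Y → Y → A) : Prop :=
  ∀ x, ∃ N ∈ 𝓝 x, ∀ a ∈ N, ∀ b ∈ N, ∀ c ∈ N, D a c = D a b + D b c

/-- The difference of two primitives is locally constant, hence constant. This makes every integral
below independent of the chosen primitive. -/
theorem IsPrimitive.sub_eq {Y A : Type*} [TopologicalSpace Y] [PreconnectedSpace Y]
    [AddCommGroup A] {D : Y → Y → A} {F G : Y → A} (hF : IsPrimitive D F) (hG : IsPrimitive D G)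
    (x y : Y) : F y - F x = G y - G x := by
  have h : IsLocallyConstant fun y => F y - G y := by
    rw [IsLocallyConstant.iff_eventually_eq]
    intro x
    obtain ⟨N, hN, h1⟩ := hF x
    obtain ⟨N', hN', h2⟩ := hG x
    filter_upwards [hN, hN'] with y hy hy'
    have e1 := h1 x (mem_of_mem_nhds hN) y hy
    have e2 := h2 x (mem_of_mem_nhds hN') y hy'
    rw [sub_eq_sub_iff_sub_eq_sub, e1, e2]
  have : F y - G y = F x - G x := h.apply_eq_of_preconnectedSpace y x
  rwa [sub_eq_sub_iff_sub_eq_sub] at this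

theorem IsPrimitive.comp {Y Z A : Type*} [TopologicalSpace Y] [TopologicalSpace Z]
    [AddCommGroup A] {D : Y → Y → A} {F : Y → A} (hF : IsPrimitive D F) {f : Z → Y}
    (hf : Continuous f) : IsPrimitive (fun a b => D (f a) (f b)) (F ∘ f) := by
  intro x
  obtain ⟨N, hN, h⟩ := hF (f x)
  exact ⟨f ⁻¹' N, hf.continuousAt hN, fun a ha b hb => h _ ha _ hb⟩

theorem IsPrimitive.add {Y A : Type*} [TopologicalSpace Y] [AddCommGroup A] {D D' : Y → Y → A}
    {F F' : Y → A} (hF : IsPrimitive D F) (hF' : IsPrimitive D' F') :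
    IsPrimitive (fun a b => D a b + D' a b) (fun y => F y + F' y) := by
  intro x
  obtain ⟨N, hN, h⟩ := hF x
  obtain ⟨N', hN', h'⟩ := hF' x
  refine ⟨N ∩ N', inter_mem hN hN', fun a ha b hb => ?_⟩
  simp only [← h a ha.1 b hb.1, ← h' a ha.2 b hb.2]
  abel

/-- A local cocycle on a compact convex set has a primitive. -/
theorem exists_isPrimitive {E A : Type*} [NormedAddCommGroup E] [NormedSpace ℝ E] [AddCommGroup A]
    {K : Set E} (hK : Convex ℝ K) (hc : IsCompact K) {D : K → K → A} (hD : IsLocallyAdditive D) :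
    ∃ F, IsPrimitive D F := by
  rcases K.eq_empty_or_nonempty with rfl | ⟨t₀, ht₀⟩
  · exact ⟨fun _ => 0, fun x => x.2.elim⟩
  have : CompactSpace K := isCompact_iff_compactSpace.mp hc
  -- A Lebesgue number makes the additivity uniform: `key` applies to any three points within `δ` of
  -- a common point.
  choose N hN hadd using hD
  obtain ⟨δ, hδ, hball⟩ := lebesgue_number_lemma_of_metric (s := (Set.univ : Set K))
    (c := fun x => interior (N x)) isCompact_univ (fun _ => isOpen_interior)
    (fun x _ => Set.mem_iUnion.2 ⟨x, mem_interior_iff_mem_nhds.2 (hN x)⟩)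
  have key : ∀ x a b c : K, dist a x < δ → dist b x < δ → dist c x < δ →
      D a c = D a b + D b c := by
    intro x a b c ha hb hc
    obtain ⟨i, hi⟩ := hball x trivial
    exact hadd i a (interior_subset (hi ha)) b (interior_subset (hi hb)) c
      (interior_subset (hi hc))
  obtain ⟨C, hC⟩ := hc.isBounded.subset_closedBall (t₀ : E)
  obtain ⟨n, hn⟩ := exists_nat_gt (max 0 (C / (δ / 2)))
  have hn0 : (0 : ℝ) < n := lt_of_le_of_lt (le_max_left _ _) hn
  have hCn : C / n < δ / 2 := by
    rw [div_lt_iff₀ hn0]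
    have := lt_of_le_of_lt (le_max_right _ _) hn
    rw [div_lt_iff₀ (by positivity)] at this
    linarith
  -- The cap at `1` keeps the contraction towards `t₀` defined for all `i`; only `i ≤ n` matters.
  let r : ℕ → ℝ := fun i => min ((i : ℝ) / n) 1
  have hr0 : ∀ i, 0 ≤ r i := fun i => le_min (by positivity) zero_le_one
  have hr1 : ∀ i, r i ≤ 1 := fun i => min_le_right _ _
  have hrs : ∀ i, |r (i + 1) - r i| ≤ 1 / n := by
    intro i
    refine (abs_min_sub_min_le_max _ _ _ _).trans ?_
    rw [sub_self, abs_zero, ← sub_div, Nat.cast_add, Nat.cast_one, add_sub_cancel_left,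
      abs_of_pos (by positivity)]
    exact max_le le_rfl (by positivity)
  let P : ℕ → K → K := fun i t => ⟨(t₀ : E) + r i • ((t : E) - t₀),
    hK.add_smul_sub_mem ht₀ t.2 ⟨hr0 i, hr1 i⟩⟩
  have hP0 : ∀ t, P 0 t = ⟨t₀, ht₀⟩ := fun t => Subtype.ext (by simp [P, r])
  have hPn : ∀ t, P n t = t := fun t => Subtype.ext (by
    simp [P, r, div_self hn0.ne'])
  have hd1 : ∀ i t, dist (P (i + 1) t) (P i t) < δ / 2 := by
    intro i t
    rw [Subtype.dist_eq, dist_eq_norm]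
    have : (P (i + 1) t : E) - P i t = (r (i + 1) - r i) • ((t : E) - t₀) := by
      simp only [P]; module
    rw [this, norm_smul, Real.norm_eq_abs]
    have h2 : ‖(t : E) - t₀‖ ≤ C := by simpa [dist_eq_norm] using hC t.2
    calc _ ≤ 1 / n * C := mul_le_mul (hrs i) h2 (norm_nonneg _) (by positivity)
      _ = C / n := by ring
      _ < δ / 2 := hCn
  have hd2 : ∀ i t t', dist (P i t') (P i t) ≤ dist t' t := by
    intro i t t'
    rw [Subtype.dist_eq, Subtype.dist_eq, dist_eq_norm, dist_eq_norm]
    have : (P i t' : E) - P i t = r i • ((t' : E) - t) := by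
      simp only [P]; module
    rw [this, norm_smul, Real.norm_eq_abs, abs_of_nonneg (hr0 i)]
    exact mul_le_of_le_one_left (norm_nonneg _) (hr1 i)
  -- The primitive sums `D` along the segment from `t₀` to `t`, cut into `n` steps that are shorter
  -- than `δ / 2`.
  refine ⟨fun t => ∑ i ∈ Finset.range n, D (P i t) (P (i + 1) t), fun x =>
    ⟨Metric.ball x (δ / 4), Metric.ball_mem_nhds _ (by positivity), fun t ht t' ht' => ?_⟩⟩
  have htt : dist t' t < δ / 2 := by
    have := dist_triangle_right t' t x
    rw [Metric.mem_ball] at ht ht'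
    linarith
  -- The two subdivided segments span a ladder of small quadrilaterals. Additivity on the two
  -- triangles of each one lets the rung move from `0` to `k`.
  have step : ∀ k, ∑ i ∈ Finset.range k, D (P i t') (P (i + 1) t') + D (P 0 t) (P 0 t') =
      ∑ i ∈ Finset.range k, D (P i t) (P (i + 1) t) + D (P k t) (P k t') := by
    intro k
    induction k with
    | zero => simp
    | succ k ih =>
      have h1 := hd1 k t
      have h2 := hd1 k t'
      have h3 := (hd2 k t t').trans_lt htt
      have h4 : dist (P (k + 1) t') (P k t) < δ := by
        have := dist_triangle (P (k + 1) t') (P k t') (P k t)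
        linarith
      have e1 := key (P k t) (P k t) (P (k + 1) t) (P (k + 1) t') (by simpa using hδ)
        (by linarith) h4
      have e2 := key (P k t) (P k t) (P k t') (P (k + 1) t') (by simpa using hδ)
        (by linarith) h4
      rw [Finset.sum_range_succ, Finset.sum_range_succ, add_assoc _ (D _ _) (D (P (k + 1) t) _),
        ← e1, e2, ← add_assoc, ← ih]
      abel
  have h0 : D (P 0 t) (P 0 t') = 0 := by
    rw [hP0, hP0]
    have := key ⟨t₀, ht₀⟩ ⟨t₀, ht₀⟩ ⟨t₀, ht₀⟩ ⟨t₀, ht₀⟩ (by simpa using hδ)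
      (by simpa using hδ) (by simpa using hδ)
    exact left_eq_add.mp this
  have := step n
  rw [h0, add_zero, hPn, hPn] at this
  simp only [this, add_sub_cancel_left]

/-- A local cocycle on a normed space has a primitive if closed balls are compact. -/
theorem exists_isPrimitive_of_properSpace {E A : Type*} [NormedAddCommGroup E] [NormedSpace ℝ E]
    [ProperSpace E] [AddCommGroup A] {D : E → E → A} (hD : IsLocallyAdditive D) :
    ∃ F, IsPrimitive D F := by
  have h : ∀ n : ℕ, ∃ F : Metric.closedBall (0 : E) n → A,
      IsPrimitive (fun a b : Metric.closedBall (0 : E) n => D a b) F := fun n =>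
    exists_isPrimitive (convex_closedBall _ _) (isCompact_closedBall _ _) fun x => by
      obtain ⟨N, hN, h⟩ := hD x.1
      exact ⟨Subtype.val ⁻¹' N, continuous_subtype_val.continuousAt hN,
        fun a ha b hb c hc => h _ ha _ hb _ hc⟩
  choose F hF using h
  have z : ∀ n : ℕ, (0 : E) ∈ Metric.closedBall (0 : E) n := fun n => by simp
  have mem : ∀ {x : E} {n : ℕ}, ⌈‖x‖⌉₊ ≤ n → x ∈ Metric.closedBall (0 : E) n := by
    intro x n hn
    rw [mem_closedBall_zero_iff]
    exact (Nat.le_ceil _).trans (Nat.cast_le.2 hn)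
  -- Primitives on the balls of integral radius are normalised to vanish at `0`; by connectedness of
  -- the balls the value then does not depend on the radius.
  let G : E → A := fun x => F ⌈‖x‖⌉₊ ⟨x, mem le_rfl⟩ - F ⌈‖x‖⌉₊ ⟨0, z _⟩
  have hG : ∀ (n : ℕ) (x : E) (hx : ⌈‖x‖⌉₊ ≤ n), G x = F n ⟨x, mem hx⟩ - F n ⟨0, z _⟩ := by
    intro n x hx
    have hsub : Metric.closedBall (0 : E) ⌈‖x‖⌉₊ ⊆ Metric.closedBall (0 : E) n :=
      Metric.closedBall_subset_closedBall (Nat.cast_le.2 hx)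
    have : PreconnectedSpace (Metric.closedBall (0 : E) ⌈‖x‖⌉₊) :=
      isPreconnected_iff_preconnectedSpace.mp (convex_closedBall _ _).isPreconnected
    exact IsPrimitive.sub_eq (hF _)
      ((hF n).comp (f := Set.inclusion hsub) (continuous_inclusion hsub)) ⟨0, z _⟩ ⟨x, mem le_rfl⟩
  refine ⟨G, fun x => ?_⟩
  have hx : x ∈ Metric.closedBall (0 : E) (⌈‖x‖⌉₊ + 1 : ℕ) := mem (by omega)
  obtain ⟨N, hN, h⟩ := hF (⌈‖x‖⌉₊ + 1) ⟨x, hx⟩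
  rw [nhds_subtype_eq_comap, mem_comap] at hN
  obtain ⟨N', hN', hsub⟩ := hN
  refine ⟨N' ∩ Metric.ball x 1, inter_mem hN' (Metric.ball_mem_nhds _ one_pos),
    fun a ha b hb => ?_⟩
  have hb1 : ∀ y ∈ Metric.ball x 1, ⌈‖y‖⌉₊ ≤ ⌈‖x‖⌉₊ + 1 := by
    intro y hy
    rw [Nat.ceil_le]
    push_cast
    have h1 := Nat.le_ceil ‖x‖
    have h2 := norm_le_norm_add_norm_sub' y x
    rw [Metric.mem_ball, dist_eq_norm] at hy
    linarith
  rw [hG _ a (hb1 a ha.2), hG _ b (hb1 b hb.2)]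
  have : _ = D a b := h ⟨a, mem (hb1 a ha.2)⟩ (hsub ha.1) ⟨b, mem (hb1 b hb.2)⟩ (hsub hb.1)
  rw [← this]
  abel

/-! ### Paths -/

/-- A property of paths that is local, and compatible with concatenation and homotopy, holds for
all paths. -/
theorem path_induction {Y : Type*} [TopologicalSpace Y] {P : ∀ {x y : Y}, Path x y → Prop}
    (hloc : ∀ x : Y, ∃ N ∈ 𝓝 x, ∀ {a b : Y} (γ : Path a b), (∀ t, γ t ∈ N) → P γ)
    (htrans : ∀ {x y z : Y} (γ : Path x y) (δ : Path y z), P γ → P δ → P (γ.trans δ))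
    (hhom : ∀ {x y : Y} (γ δ : Path x y), γ.Homotopic δ → P γ → P δ)
    {x y : Y} (γ : Path x y) : P γ := by
  choose N hN hP using hloc
  obtain ⟨t, ht0, hmono, ⟨n, hn⟩, hsub⟩ := exists_monotone_Icc_subset_open_cover_unitInterval
    (c := fun x => γ ⁻¹' interior (N x)) (fun x => isOpen_interior.preimage γ.continuous)
    (fun s _ => Set.mem_iUnion.2 ⟨γ s, mem_interior_iff_mem_nhds.2 (hN _)⟩)
  have step : ∀ k, P (γ.subpath 0 (t k)) := by
    intro k
    induction k with
    | zero =>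
      obtain ⟨i, hi⟩ := hsub 0
      refine hP i _ fun s => ?_
      have : (γ.subpath 0 (t 0)) s ∈ Set.range (γ.subpath 0 (t 0)) := ⟨s, rfl⟩
      rw [ht0, Path.range_subpath, Set.uIcc_self, Set.image_singleton, Set.mem_singleton_iff] at this
      rw [ht0, this]
      exact interior_subset (hi (by rw [ht0]; exact ⟨le_rfl, by simp⟩))
    | succ k ih =>
      refine hhom _ _ ⟨Path.Homotopy.subpathTransSubpath γ 0 (t k) (t (k + 1))⟩
        (htrans _ _ ih ?_)
      obtain ⟨i, hi⟩ := hsub k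
      refine hP i _ fun s => ?_
      have : (γ.subpath (t k) (t (k + 1))) s ∈ Set.range (γ.subpath (t k) (t (k + 1))) := ⟨s, rfl⟩
      rw [Path.range_subpath_of_le _ _ _ (hmono (Nat.le_succ k))] at this
      obtain ⟨r, hr, hrs⟩ := this
      rw [← hrs]
      exact interior_subset (hi hr)
  have h1 := step n
  rw [hn n le_rfl] at h1
  -- The subpath over `[0, 1]` has end points `γ 0` and `γ 1`, which equal `x` and `y` only
  -- propositionally.
  have key : ∀ {a b : Y} (p : Path a b) (ha : a = x) (hb : b = y), p = γ.cast ha hb → P p → P γ := by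
    rintro a b p rfl rfl rfl h
    exact h
  exact key _ γ.source γ.target (Path.subpath_zero_one γ) h1

/-- Paths that factor through a simply connected space are homotopic. -/
theorem homotopic_of_factor {Y Z : Type*} [TopologicalSpace Y] [TopologicalSpace Z]
    [SimplyConnectedSpace Z] (f : C(Z, Y)) {x y : Y} (γ δ : Path x y) (g g' : C(unitInterval, Z))
    (hg : ∀ t, f (g t) = γ t) (hg' : ∀ t, f (g' t) = δ t) (h0 : g 0 = g' 0) (h1 : g 1 = g' 1) :
    γ.Homotopic δ := by
  have hx : x = f (g 0) := by rw [hg, γ.source]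
  have hy : y = f (g 1) := by rw [hg, γ.target]
  subst hx hy
  let p : Path (g 0) (g 1) := ⟨g, rfl, rfl⟩
  let q : Path (g 0) (g 1) := ⟨g', h0.symm, h1.symm⟩
  have := (SimplyConnectedSpace.paths_homotopic p q).map f
  have e1 : γ = p.map f.continuous := Path.ext (funext fun t => (hg t).symm)
  have e2 : δ = q.map f.continuous := Path.ext (funext fun t => (hg' t).symm)
  rwa [e1, e2]

theorem Convex.simplyConnectedSpace {E : Type*} [AddCommGroup E] [Module ℝ E] [TopologicalSpace E]
    [ContinuousAdd E] [ContinuousSMul ℝ E] {K : Set E} (hK : Convex ℝ K) (hne : K.Nonempty) :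
    SimplyConnectedSpace K :=
  have := hK.contractibleSpace hne
  inferInstance

/-- Paths in a convex set that is mapped to a space. -/
theorem homotopic_of_convex {E Y : Type*} [AddCommGroup E] [Module ℝ E] [TopologicalSpace E]
    [ContinuousAdd E] [ContinuousSMul ℝ E] [TopologicalSpace Y] {K : Set E} (hK : Convex ℝ K)
    (f : C(K, Y)) {x y : Y} (γ δ : Path x y) (g g' : C(unitInterval, E)) (hgK : ∀ t, g t ∈ K)
    (hgK' : ∀ t, g' t ∈ K) (hg : ∀ t, f ⟨g t, hgK t⟩ = γ t) (hg' : ∀ t, f ⟨g' t, hgK' t⟩ = δ t)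
    (h0 : g 0 = g' 0) (h1 : g 1 = g' 1) : γ.Homotopic δ := by
  have := Convex.simplyConnectedSpace hK ⟨_, hgK 0⟩
  exact homotopic_of_factor f γ δ ⟨fun t => ⟨g t, hgK t⟩, by fun_prop⟩
    ⟨fun t => ⟨g' t, hgK' t⟩, by fun_prop⟩ hg hg' (Subtype.ext h0) (Subtype.ext h1)

end DeligneMostow
namespace DeligneMostow
open Complex CategoryTheory Filter Topology

/-! ### Transport -/

section Transport

variable {S : Set P1} (L : LocalSystem.{u} S)

/-- The nonsingular locus. -/
abbrev Pt (S : Set P1) : Type := {x : P1 // x ∉ S}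

theorem transport_refl (x : Pt S) (v : L.fibre x) : L.transport (Path.refl x) v = v := by
  have : L.map (FundamentalGroupoid.fromPath (Path.Homotopic.Quotient.mk (Path.refl x))) = 𝟙 _ :=
    L.map_id (FundamentalGroupoid.mk x)
  rw [LocalSystem.transport, this]
  rfl

theorem transport_trans {x y z : Pt S} (γ : Path x y) (δ : Path y z) (v : L.fibre x) :
    L.transport (γ.trans δ) v = L.transport δ (L.transport γ v) := by
  have : L.map (FundamentalGroupoid.fromPath (Path.Homotopic.Quotient.mk (γ.trans δ))) =
      L.map (FundamentalGroupoid.fromPath (Path.Homotopic.Quotient.mk γ)) ≫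
      L.map (FundamentalGroupoid.fromPath (Path.Homotopic.Quotient.mk δ)) := by
    rw [← L.map_comp]; rfl
  rw [LocalSystem.transport, this]
  rfl

variable {L}

theorem transport_eq {x y : Pt S} {γ δ : Path x y} (h : γ.Homotopic δ) :
    L.transport γ = L.transport δ := by
  rw [LocalSystem.transport, LocalSystem.transport, Path.Homotopic.Quotient.eq.2 h]

theorem transport_symm_apply {x y : Pt S} (γ : Path x y) (v : L.fibre x) :
    L.transport γ.symm (L.transport γ v) = v := by
  rw [← transport_trans, transport_eq (Path.Homotopic.trans_symm γ), transport_refl]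

theorem transport_apply_symm {x y : Pt S} (γ : Path x y) (v : L.fibre y) :
    L.transport γ (L.transport γ.symm v) = v := by
  rw [← transport_trans, transport_eq (Path.Homotopic.symm_trans γ), transport_refl]

theorem transport_injective {x y : Pt S} (γ : Path x y) : Function.Injective (L.transport γ) :=
  Function.LeftInverse.injective (transport_symm_apply γ)

/-- Pointwise equal paths may have end points that are not definitionally equal, so their transports
live in different types and are compared heterogeneously. -/
theorem transport_heq {x y x' y' : Pt S} {γ : Path x y} {γ' : Path x' y'} (h : ∀ t, γ t = γ' t)
    {v : L.fibre x} {v' : L.fibre x'} (hv : HEq v v') :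
    HEq (L.transport γ v) (L.transport γ' v') := by
  have hx : x = x' := by rw [← γ.source, h, γ'.source]
  have hy : y = y' := by rw [← γ.target, h, γ'.target]
  subst hx hy
  have : γ = γ' := Path.ext (funext h)
  subst this
  rw [eq_of_heq hv]

/-- Concatenation of paths that lift to a simply connected space. -/
theorem trans_homotopic_of_factor {Y Z : Type*} [TopologicalSpace Y] [TopologicalSpace Z]
    [SimplyConnectedSpace Z] (f : C(Z, Y)) {x y z : Y} (γ : Path x y) (δ : Path y z) (ε : Path x z)
    (g g' g'' : C(unitInterval, Z)) (hg : ∀ t, f (g t) = γ t) (hg' : ∀ t, f (g' t) = δ t)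
    (hg'' : ∀ t, f (g'' t) = ε t) (h1 : g 1 = g' 0) (h2 : g 0 = g'' 0) (h3 : g' 1 = g'' 1) :
    (γ.trans δ).Homotopic ε := by
  let p : Path (g 0) (g 1) := ⟨g, rfl, rfl⟩
  let q : Path (g 1) (g' 1) := ⟨g', h1.symm, rfl⟩
  refine homotopic_of_factor f _ _ (p.trans q).toContinuousMap g'' (fun t => ?_) hg'' ?_ ?_
  · change f ((p.trans q) t) = _
    rw [Path.trans_apply, Path.trans_apply]
    split_ifs
    · exact hg _
    · exact hg' _
  · simpa using h2
  · simpa using h3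

theorem transport_factor {Z : Type*} [TopologicalSpace Z]
    [SimplyConnectedSpace Z] (f : C(Z, Pt S)) {x y z : Pt S} (γ : Path x y) (δ : Path y z)
    (ε : Path x z)
    (g g' g'' : C(unitInterval, Z)) (hg : ∀ t, f (g t) = γ t) (hg' : ∀ t, f (g' t) = δ t)
    (hg'' : ∀ t, f (g'' t) = ε t) (h1 : g 1 = g' 0) (h2 : g 0 = g'' 0) (h3 : g' 1 = g'' 1)
    (v : L.fibre x) : L.transport δ (L.transport γ v) = L.transport ε v := by
  rw [← transport_trans, transport_eq (trans_homotopic_of_factor f γ δ ε g g' g'' hg hg' hg'' h1 h2 h3)]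

/-! ### The affine part -/

/-- The points of `ℂ` that are not in `S`. -/
def fin (S : Set P1) : Set ℂ := {x | (x : P1) ∉ S}

/-- A point of `ℂ ∖ S`. -/
abbrev pt {x : ℂ} (hx : x ∈ fin S) : Pt S := ⟨x, hx⟩

theorem continuous_coe_P1 : Continuous ((↑) : ℂ → P1) := OnePoint.continuous_coe

theorem isOpenEmbedding_coe_P1 : IsOpenEmbedding ((↑) : ℂ → P1) := OnePoint.isOpenEmbedding_coe

/-- The parametrised segment from `a` to `b`. -/
noncomputable def lineC (a b : ℂ) : C(unitInterval, ℂ) where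
  toFun t := a + ((t : ℝ) : ℂ) * (b - a)
  continuous_toFun := by fun_prop

@[simp] theorem lineC_zero (a b : ℂ) : lineC a b 0 = a := by simp [lineC]
@[simp] theorem lineC_one (a b : ℂ) : lineC a b 1 = b := by simp [lineC]

theorem lineC_mem_segment (a b : ℂ) (t : unitInterval) : lineC a b t ∈ segment ℝ a b := by
  rw [segment_eq_image']
  exact ⟨t, t.2, by simp [lineC]⟩

theorem lineC_mem {K : Set ℂ} (hK : Convex ℝ K) {a b : ℂ} (ha : a ∈ K) (hb : b ∈ K)
    (t : unitInterval) : lineC a b t ∈ K :=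
  hK.segment_subset ha hb (lineC_mem_segment a b t)

/-- The straight path from `a` to `b`. -/
noncomputable def segPath {a b : ℂ} (h : segment ℝ a b ⊆ fin S) :
    Path (pt (h (left_mem_segment ℝ a b))) (pt (h (right_mem_segment ℝ a b))) where
  toFun t := pt (h (lineC_mem_segment a b t))
  continuous_toFun := (continuous_coe_P1.comp (lineC a b).continuous).subtype_mk _
  source' := by simp
  target' := by simp

/-- A path in `ℂ ∖ S` from a function to `ℂ`. -/
noncomputable def mkPath (g : C(unitInterval, ℂ)) (h : ∀ t, g t ∈ fin S) {a b : ℂ} (ha : a ∈ fin S)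
    (hb : b ∈ fin S) (h0 : g 0 = a) (h1 : g 1 = b) : Path (pt ha) (pt hb) where
  toFun t := pt (h t)
  continuous_toFun := (continuous_coe_P1.comp g.continuous).subtype_mk _
  source' := by simp [h0]
  target' := by simp [h1]

/-- The inclusion of a subset of `ℂ ∖ S`. -/
noncomputable def subMap {K : Set ℂ} (h : K ⊆ fin S) : C(K, Pt S) where
  toFun x := pt (h x.2)
  continuous_toFun := (continuous_coe_P1.comp continuous_subtype_val).subtype_mk _

/-- The lift of a path to `ℂ`. -/
theorem exists_lift {x y : Pt S} (γ : Path x y) {K : Set ℂ}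
    (h : ∀ t, ∃ w ∈ K, (γ t : P1) = (w : P1)) :
    ∃ g : C(unitInterval, K), ∀ t, ((g t : ℂ) : P1) = γ t := by
  choose g hg hgt using h
  have : Continuous g := by
    rw [isOpenEmbedding_coe_P1.isEmbedding.continuous_iff]
    have : ((↑) : ℂ → P1) ∘ g = fun t => (γ t : P1) := funext fun t => (hgt t).symm
    rw [this]
    exact continuous_subtype_val.comp γ.continuous
  exact ⟨⟨fun t => ⟨g t, hg t⟩, this.subtype_mk _⟩, fun t => (hgt t).symm⟩

/-- Paths with the same ends in a convex set without points of `S` are homotopic. -/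
theorem homotopic_in_convex {K : Set ℂ} (hK : Convex ℝ K) (hKS : K ⊆ fin S) {x y : Pt S}
    (γ δ : Path x y) (hγ : ∀ t, ∃ w ∈ K, (γ t : P1) = (w : P1))
    (hδ : ∀ t, ∃ w ∈ K, (δ t : P1) = (w : P1)) : γ.Homotopic δ := by
  obtain ⟨g, hg⟩ := exists_lift γ hγ
  obtain ⟨g', hg'⟩ := exists_lift δ hδ
  have := Convex.simplyConnectedSpace hK ⟨_, (g 0).2⟩
  refine homotopic_of_factor (subMap hKS) γ δ g g' (fun t => Subtype.ext (hg t))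
    (fun t => Subtype.ext (hg' t)) ?_ ?_
  · exact Subtype.ext (OnePoint.coe_injective (by rw [hg, hg', γ.source, δ.source]))
  · exact Subtype.ext (OnePoint.coe_injective (by rw [hg, hg', γ.target, δ.target]))

theorem transport_in_convex {K : Set ℂ} (hK : Convex ℝ K) (hKS : K ⊆ fin S) {x y : Pt S}
    (γ δ : Path x y) (hγ : ∀ t, ∃ w ∈ K, (γ t : P1) = (w : P1))
    (hδ : ∀ t, ∃ w ∈ K, (δ t : P1) = (w : P1)) : L.transport γ = L.transport δ :=
  transport_eq (homotopic_in_convex hK hKS γ δ hγ hδ)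

theorem segPath_mem {K : Set ℂ} (hK : Convex ℝ K) {a b : ℂ} (h : segment ℝ a b ⊆ fin S)
    (ha : a ∈ K) (hb : b ∈ K) (t : unitInterval) : ∃ w ∈ K, (segPath h t : P1) = (w : P1) :=
  ⟨_, lineC_mem hK ha hb t, rfl⟩

theorem trans_mem {x y z : Pt S} {γ : Path x y} {δ : Path y z} {P : Pt S → Prop}
    (hγ : ∀ t, P (γ t)) (hδ : ∀ t, P (δ t)) (t : unitInterval) : P (γ.trans δ t) := by
  rw [Path.trans_apply]
  split_ifs
  · exact hγ _
  · exact hδ _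

end Transport

end DeligneMostow
namespace DeligneMostow
open Complex CategoryTheory Filter Topology

/-! ### Angles -/

/-- The angle at `v` subtended by the segment from `x` to `y`. -/
noncomputable def ang (v x y : ℂ) : ℝ := arg ((y - v) / (x - v))

/-- Both arguments lie in `(-π/2, π/2)`, so their difference stays within the principal branch. -/
theorem arg_div_of_re_pos {p q : ℂ} (hp : 0 < p.re) (hq : 0 < q.re) :
    arg (q / p) = arg q - arg p := by
  have hp0 : p ≠ 0 := fun h => by simp [h] at hp
  have hq0 : q ≠ 0 := fun h => by simp [h] at hq
  have h1 := abs_lt.1 (Complex.abs_arg_lt_pi_div_two_iff.2 (Or.inl hp))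
  have h2 := abs_lt.1 (Complex.abs_arg_lt_pi_div_two_iff.2 (Or.inl hq))
  have h3 : arg p⁻¹ = -arg p := by
    rw [Complex.arg_inv, if_neg]
    intro h; linarith [Real.pi_pos]
  rw [div_eq_mul_inv, (Complex.arg_mul_eq_add_arg_iff hq0 (inv_ne_zero hp0)).2, h3, sub_eq_add_neg]
  rw [h3]
  constructor <;> linarith

/-- The open half plane of the points `w` with `Re ((w - v) / u) > 0`. -/
def halfPlane (v u : ℂ) : Set ℂ := {w | 0 < ((w - v) / u).re}

theorem mem_halfPlane {v u w : ℂ} : w ∈ halfPlane v u ↔ 0 < ((w - v) / u).re := Iff.rfl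

/-- On a half plane bounded by a line through `v` the argument about `v` has a continuous branch,
and the subtended angle is its coboundary. The additivity properties of angles, and with them those
of the multipliers and crossing numbers, rest on this. -/
theorem ang_eq_sub {v u x y : ℂ} (hx : x ∈ halfPlane v u) (hy : y ∈ halfPlane v u) :
    ang v x y = arg ((y - v) / u) - arg ((x - v) / u) := by
  have hu : u ≠ 0 := fun h => by simp [halfPlane, h] at hx
  rw [← arg_div_of_re_pos hx hy, ang, div_div_div_cancel_right₀ hu]

theorem ang_add {v u x y w : ℂ} (hx : x ∈ halfPlane v u) (hy : y ∈ halfPlane v u)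
    (hw : w ∈ halfPlane v u) : ang v x y + ang v y w = ang v x w := by
  rw [ang_eq_sub hx hy, ang_eq_sub hy hw, ang_eq_sub hx hw]
  ring

theorem ang_self (v x : ℂ) : ang v x x = 0 := by
  rw [ang]
  rcases eq_or_ne (x - v) 0 with h | h
  · simp [h]
  · simp [div_self h]

theorem isOpen_halfPlane (v u : ℂ) : IsOpen (halfPlane v u) :=
  isOpen_lt continuous_const (by fun_prop)

/-- Relative to `c - v`, a point of the ball is `1` plus a number of modulus less than `1`. -/
theorem ball_subset_halfPlane {v c : ℂ} {r : ℝ} (h : r ≤ ‖c - v‖) (hc : c ≠ v) :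
    Metric.ball c r ⊆ halfPlane v (c - v) := by
  intro w hw
  have hc' : c - v ≠ 0 := sub_ne_zero.2 hc
  have h1 : (w - v) / (c - v) = 1 + (w - c) / (c - v) := by field_simp; ring
  have h2 : ‖(w - c) / (c - v)‖ < 1 := by
    rw [norm_div, div_lt_one (norm_pos_iff.2 hc')]
    exact lt_of_lt_of_le (by simpa [dist_eq_norm] using hw) h
  have h3 := Complex.abs_re_le_norm ((w - c) / (c - v))
  rw [mem_halfPlane, h1, Complex.add_re, Complex.one_re]
  linarith [neg_abs_le ((w - c) / (c - v)).re]

/-- A segment that avoids `v` lies in an open half plane bounded by a line through `v`. -/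
theorem exists_segment_subset_halfPlane {v a b : ℂ} (h : v ∉ segment ℝ a b) :
    ∃ u, segment ℝ a b ⊆ halfPlane v u := by
  obtain ⟨f, c, hfv, hfs⟩ := geometric_hahn_banach_point_closed (convex_segment (𝕜 := ℝ) a b)
    (by rw [segment_eq_image']; exact (isCompact_Icc.image (by fun_prop)).isClosed) h
  have hf : ∀ w : ℂ, f w = w.re * f 1 + w.im * f I := by
    intro w
    conv_lhs => rw [← Complex.re_add_im w]
    rw [map_add, show (w.re : ℂ) = w.re • (1 : ℂ) by simp, show (w.im : ℂ) * I = w.im • I by simp,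
      map_smul, map_smul, smul_eq_mul, smul_eq_mul]
  -- This `u` represents the separating functional: `f w = Re (w * conj u)`, which has the sign of
  -- `Re (w / u)`.
  refine ⟨(f 1 + f I * I : ℂ), fun w hw => ?_⟩
  have h1 : 0 < f (w - v) := by
    have := hfs w hw
    rw [map_sub]; linarith
  have h2 : (f 1 + f I * I : ℂ) ≠ 0 := by
    intro h0
    have e1 : f 1 = 0 := by simpa using congrArg Complex.re h0
    have e2 : f I = 0 := by simpa using congrArg Complex.im h0
    rw [hf, e1, e2] at h1
    simp at h1
  rw [mem_halfPlane, Complex.div_re, ← add_div]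
  refine div_pos ?_ (Complex.normSq_pos.2 h2)
  rw [hf] at h1
  simpa using h1

theorem exp_ang {v x y : ℂ} (hx : x ≠ v) (hy : y ≠ v) :
    exp (I * ang v x y) = ((y - v) / (x - v)) / (‖y - v‖ / ‖x - v‖ : ℝ) := by
  have h0 : (y - v) / (x - v) ≠ 0 := div_ne_zero (sub_ne_zero.2 hy) (sub_ne_zero.2 hx)
  rw [eq_div_iff (by rw [← norm_div]; exact_mod_cast norm_ne_zero_iff.2 h0), ← norm_div, mul_comm,
    mul_comm I]
  exact Complex.norm_mul_exp_arg_mul_I _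

theorem continuousAt_ang_right {v x y : ℂ} (h : (y - v) / (x - v) ∈ slitPlane) :
    ContinuousAt (fun y => ang v x y) y :=
  (Complex.continuousAt_arg h).comp (f := fun y => (y - v) / (x - v)) (by fun_prop)

/-- Both ends lie in one half plane at `v`, so the subtended angle is less than `π` in absolute
value and the argument is continuous there. -/
theorem div_mem_slitPlane_of_notMem_segment {v x y : ℂ} (h : v ∉ segment ℝ x y) :
    (y - v) / (x - v) ∈ slitPlane := by
  obtain ⟨u, hu⟩ := exists_segment_subset_halfPlane h
  have hx := hu (left_mem_segment ℝ x y)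
  have hy := hu (right_mem_segment ℝ x y)
  have h1 := ang_eq_sub hx hy
  have h2 := abs_lt.1 (Complex.abs_arg_lt_pi_div_two_iff.2 (Or.inl hx))
  have h3 := abs_lt.1 (Complex.abs_arg_lt_pi_div_two_iff.2 (Or.inl hy))
  rw [Complex.mem_slitPlane_iff_arg]
  refine ⟨fun h => ?_, div_ne_zero ?_ ?_⟩
  · rw [ang, h] at h1; linarith
  · intro h; simp [mem_halfPlane, h] at hy
  · intro h; simp [mem_halfPlane, h] at hx

/-! ### The multiplier -/

/-- The factor by which the frame is multiplied along the segment from `x` to `y`. -/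
noncomputable def mult (m : ℕ) (z : ℕ → ℂ) (ν : ℕ → ℝ) (x y : ℂ) : ℂ :=
  exp (I * (∑ j ∈ Finset.range m, ν j * ang (z j) x y : ℝ))

section Mult

variable {m : ℕ} {z : ℕ → ℂ} {ν : ℕ → ℝ}

theorem mult_ne_zero (x y : ℂ) : mult m z ν x y ≠ 0 := exp_ne_zero _

theorem norm_mult (x y : ℂ) : ‖mult m z ν x y‖ = 1 := by
  rw [mult, mul_comm, Complex.norm_exp_ofReal_mul_I]

theorem mult_mul_conj (x y : ℂ) : mult m z ν x y * starRingEnd ℂ (mult m z ν x y) = 1 := by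
  rw [Complex.mul_conj, Complex.normSq_eq_norm_sq, norm_mult]; simp

theorem mult_self (x : ℂ) : mult m z ν x x = 1 := by simp [mult, ang_self]

theorem mult_mul {x y w : ℂ}
    (h : ∀ j < m, ang (z j) x y + ang (z j) y w = ang (z j) x w) :
    mult m z ν x y * mult m z ν y w = mult m z ν x w := by
  rw [mult, mult, mult, ← exp_add, ← mul_add, ← Complex.ofReal_add, ← Finset.sum_add_distrib]
  congr 3
  refine Finset.sum_congr rfl fun j hj => ?_
  rw [← h j (Finset.mem_range.1 hj)]
  ring

/-- A region that lies in a half plane at each `z j` sees every angle additively, and so the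
multiplier is a cocycle there. The ball is such a region. -/
theorem mult_mul_of_ball {c : ℂ} {r : ℝ} (hr : ∀ j < m, r ≤ ‖c - z j‖) {x y w : ℂ}
    (hx : x ∈ Metric.ball c r) (hy : y ∈ Metric.ball c r) (hw : w ∈ Metric.ball c r) :
    mult m z ν x y * mult m z ν y w = mult m z ν x w := by
  refine mult_mul fun j hj => ?_
  have hc : c ≠ z j := by
    rintro rfl
    have := hr j hj
    rw [sub_self, norm_zero] at this
    exact absurd (Metric.nonempty_ball.1 ⟨x, hx⟩) (not_lt.2 this)
  have := ball_subset_halfPlane (hr j hj) hc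
  exact ang_add (this hx) (this hy) (this hw)

theorem mult_mul_of_segment {a b : ℂ} (h : ∀ j < m, z j ∉ segment ℝ a b) {x y w : ℂ}
    (hx : x ∈ segment ℝ a b) (hy : y ∈ segment ℝ a b) (hw : w ∈ segment ℝ a b) :
    mult m z ν x y * mult m z ν y w = mult m z ν x w := by
  refine mult_mul fun j hj => ?_
  obtain ⟨u, hu⟩ := exists_segment_subset_halfPlane (h j hj)
  exact ang_add (hu hx) (hu hy) (hu hw)

end Mult

end DeligneMostow
namespace DeligneMostow
open Complex CategoryTheory Filter Topology

/-! ### Local systems of rank one on the complement of finitely many points -/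

/-- The finite points `z 0, …, z (m - 1)` of `S`, and the local monodromy of `L` there. -/
structure Config {S : Set P1} (L : LocalSystem.{u} S) where
  m : ℕ
  z : ℕ → ℂ
  ν : ℕ → ℝ
  mem_iff : ∀ x : ℂ, (x : P1) ∈ S ↔ ∃ j < m, x = z j
  z_inj : ∀ i < m, ∀ j < m, z i = z j → i = j
  ν_pos : ∀ j < m, 0 < ν j
  ν_lt_one : ∀ j < m, ν j < 1
  rank_one : ∀ x, Module.finrank ℂ (L.fibre x) = 1
  monodromy : ∀ j < m, ∀ r > 0, (∀ k < m, k ≠ j → r < ‖z k - z j‖) → ∀ (x : Pt S) (γ : Path x x),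
    (∀ t : unitInterval, (γ t : P1) = ((z j + r * exp (2 * Real.pi * I * ((t : ℝ) : ℂ)) : ℂ) : P1)) →
    ∀ v, L.transport γ v = exp (2 * Real.pi * I * ν j) • v

namespace Config

variable {S : Set P1} {L : LocalSystem.{u} S} (C : Config L)

theorem mem_fin_iff {x : ℂ} : x ∈ fin S ↔ ∀ j < C.m, x ≠ C.z j := by
  have := (C.mem_iff x).not
  push Not at this
  exact this

theorem isOpen_fin (C : Config L) : IsOpen (fin S) := by
  have : fin S = ⋂ j ∈ Finset.range C.m, {C.z j}ᶜ := by
    ext x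
    simp [C.mem_fin_iff]
  rw [this]
  exact isOpen_biInter_finset fun j _ => isOpen_compl_singleton

/-- A distance below which points of `S` are isolated. -/
theorem exists_sep (C : Config L) : ∃ ρ > 0, ∀ j < C.m, ∀ k < C.m, k ≠ j → ρ ≤ ‖C.z k - C.z j‖ := by
  have : ∀ n : ℕ, ∃ ρ > 0, ∀ p ∈ (Finset.range n ×ˢ Finset.range n : Finset (ℕ × ℕ)),
      C.z p.2 ≠ C.z p.1 → ρ ≤ ‖C.z p.2 - C.z p.1‖ := by
    intro n
    induction (Finset.range n ×ˢ Finset.range n : Finset (ℕ × ℕ)) using Finset.induction_on with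
    | empty => exact ⟨1, one_pos, by simp⟩
    | insert p s hp ih =>
      obtain ⟨ρ, hρ, h⟩ := ih
      by_cases h0 : C.z p.2 = C.z p.1
      · refine ⟨ρ, hρ, fun q hq hne => ?_⟩
        rcases Finset.mem_insert.1 hq with rfl | hq
        · exact absurd h0 hne
        · exact h q hq hne
      · refine ⟨min ρ ‖C.z p.2 - C.z p.1‖, lt_min hρ (norm_pos_iff.2 (sub_ne_zero.2 h0)),
          fun q hq hne => ?_⟩
        rcases Finset.mem_insert.1 hq with rfl | hq
        · exact min_le_right _ _
        · exact (min_le_left _ _).trans (h q hq hne)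
  obtain ⟨ρ, hρ, h⟩ := this C.m
  exact ⟨ρ, hρ, fun j hj k hk hkj => h (j, k) (by simp [hj, hk])
    fun e => hkj (C.z_inj k hk j hj e)⟩

theorem exists_smul_eq (C : Config L) {x : Pt S} {e : L.fibre x} (he : e ≠ 0) (v : L.fibre x) : ∃ c : ℂ, v = c • e := by
  obtain ⟨c, hc⟩ := (finrank_eq_one_iff_of_nonzero' e he).1 (C.rank_one x) v
  exact ⟨c, hc.symm⟩

theorem exists_ne_zero (C : Config L) (x : Pt S) : ∃ e : L.fibre x, e ≠ 0 := by
  have : Nontrivial (L.fibre x) := Module.nontrivial_of_finrank_pos (R := ℂ)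
    (by rw [C.rank_one x]; exact one_pos)
  exact exists_ne 0

/-- The frame near a point of `S`, with the angle at this point only. -/
theorem exists_frame_near_aux {j : ℕ} (hj : j < C.m) {ρ : ℝ} (hρ : 0 < ρ)
    (hsep : ∀ k < C.m, k ≠ j → ρ ≤ ‖C.z k - C.z j‖) :
    ∃ e : ∀ x : Pt S, L.fibre x, (∀ x, e x ≠ 0) ∧
      ∀ (a b : ℂ) (h : segment ℝ a b ⊆ fin S), a ∈ Metric.ball (C.z j) ρ →
        b ∈ Metric.ball (C.z j) ρ →
        L.transport (segPath h) (e _) = exp (I * (C.ν j * ang (C.z j) a b : ℝ)) • e _ := by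
  -- This half plane is the universal cover of the punctured disc through `w ↦ z j + exp w`. The
  -- frame is built upstairs and then descended.
  let W : Set ℂ := {w | w.re < Real.log ρ}
  have hWc : Convex ℝ W := convex_halfSpace_re_lt _
  have hWiff : ∀ w : ℂ, w ∈ W ↔ ‖exp w‖ < ρ := fun w => by
    rw [Complex.norm_exp, ← Real.lt_log_iff_exp_lt hρ]; rfl
  have hWfin : ∀ w ∈ W, C.z j + exp w ∈ fin S := by
    intro w hw
    rw [C.mem_fin_iff]
    intro k hk heq
    rcases eq_or_ne k j with rfl | hkj
    · simp [exp_ne_zero] at heq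
    · have := hsep k hk hkj
      rw [← heq, add_sub_cancel_left] at this
      exact absurd ((hWiff w).1 hw) (not_lt.2 this)
  let f : C(W, Pt S) := ⟨fun w => pt (hWfin w w.2),
    (continuous_coe_P1.comp (by fun_prop : Continuous fun w : W => C.z j + exp w)).subtype_mk _⟩
  let w₀ : ℂ := (Real.log (ρ / 2) : ℝ)
  have hw₀ : w₀ ∈ W := by
    change (w₀).re < _
    rw [Complex.ofReal_re]
    exact Real.log_lt_log (by positivity) (by linarith)
  have : SimplyConnectedSpace W := Convex.simplyConnectedSpace hWc ⟨_, hw₀⟩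
  obtain ⟨e₀, he₀⟩ := C.exists_ne_zero (f ⟨w₀, hw₀⟩)
  let gl : ∀ (w w' : ℂ), w ∈ W → w' ∈ W → C(unitInterval, W) := fun w w' hw hw' =>
    ⟨fun t => ⟨lineC w w' t, lineC_mem hWc hw hw' t⟩, (lineC w w').continuous.subtype_mk _⟩
  let q : ∀ (w : ℂ) (hw : w ∈ W) (x : Pt S), f ⟨w, hw⟩ = x → Path (f ⟨w₀, hw₀⟩) x :=
    fun w hw x hx => ⟨f.comp (gl w₀ w hw₀ hw), by simp [gl], by simp [gl, hx]⟩
  -- `T` is the flat section on the cover through `e₀`. The point `x` and the proof that it lies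
  -- below `w` are arguments, so that values at different lifts of `x` have the same type.
  let T : ∀ (w : ℂ) (hw : w ∈ W) (x : Pt S), f ⟨w, hw⟩ = x → L.fibre x :=
    fun w hw x hx => L.transport (q w hw x hx) e₀
  have hT : ∀ {w w' : ℂ} (hw : w ∈ W) (hw' : w' ∈ W) {x y : Pt S} (hx : f ⟨w, hw⟩ = x)
      (hy : f ⟨w', hw'⟩ = y) (γ : Path x y) (g : C(unitInterval, W)), (∀ t, f (g t) = γ t) →
      (g 0 : ℂ) = w → (g 1 : ℂ) = w' → L.transport γ (T w hw x hx) = T w' hw' y hy := by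
    intro w w' hw hw' x y hx hy γ g hg h0 h1
    refine transport_factor f (q w hw x hx) γ (q w' hw' y hy) (gl w₀ w hw₀ hw) g
      (gl w₀ w' hw₀ hw') (fun _ => rfl) hg (fun _ => rfl) ?_ ?_ ?_ e₀
    · exact Subtype.ext (by simp [gl, h0])
    · exact Subtype.ext (by simp [gl])
    · exact Subtype.ext (by simp [gl, h1])
  let α : ℂ := exp (2 * Real.pi * I * C.ν j)
  have hper : ∀ w : ℂ, w ∈ W → w + 2 * Real.pi * I ∈ W := by
    intro w hw
    have h1 : (w + 2 * Real.pi * I).re = w.re := by simp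
    change (w + 2 * Real.pi * I).re < _
    rw [h1]
    exact hw
  have hfper : ∀ (w w' : ℂ) (hw : w ∈ W) (hw' : w' ∈ W), exp w' = exp w →
      f ⟨w', hw'⟩ = f ⟨w, hw⟩ := by
    intro w w' hw hw' h
    exact Subtype.ext (by simp [f, h])
  have hexp2 : ∀ w : ℂ, exp (w + 2 * Real.pi * I) = exp w := exp_periodic
  -- The segment from `w₀` to `w₀ + 2πi` covers the circle of radius `ρ / 2`, to which the monodromy
  -- hypothesis applies.
  have hT0 : T (w₀ + 2 * Real.pi * I) (hper _ hw₀) _ (hfper _ _ hw₀ (hper _ hw₀) (hexp2 _)) =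
      α • e₀ := by
    let g := gl w₀ (w₀ + 2 * Real.pi * I) hw₀ (hper _ hw₀)
    let γ : Path (f ⟨w₀, hw₀⟩) (f ⟨w₀, hw₀⟩) := ⟨f.comp g, by simp [g, gl],
      by simp only [ContinuousMap.toFun_eq_coe, ContinuousMap.comp_apply, g, gl]
         refine Eq.trans ?_ (hfper _ _ hw₀ (hper _ hw₀) (hexp2 _))
         congr 1
         exact Subtype.ext (lineC_one _ _)⟩
    have h1 := hT hw₀ (hper _ hw₀) rfl (hfper _ _ hw₀ (hper _ hw₀) (hexp2 _)) γ g (fun _ => rfl)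
      (by simp [g, gl]) (by simp [g, gl])
    have h2 : T w₀ hw₀ _ rfl = e₀ := by
      have : q w₀ hw₀ _ rfl = Path.refl _ := by
        refine Path.ext (funext fun t => ?_)
        change f (gl w₀ w₀ hw₀ hw₀ t) = f ⟨w₀, hw₀⟩
        congr 1
        exact Subtype.ext (by simp [gl, lineC])
      simp only [T, this, transport_refl]
    rw [← h1, h2]
    refine C.monodromy j hj (ρ / 2) (by positivity) (fun k hk hkj => ?_) _ γ (fun t => ?_) e₀
    · linarith [hsep k hk hkj]
    · change ((C.z j + exp (lineC w₀ (w₀ + 2 * Real.pi * I) t) : ℂ) : P1) = _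
      congr 2
      have : lineC w₀ (w₀ + 2 * Real.pi * I) t = w₀ + 2 * Real.pi * I * ((t : ℝ) : ℂ) := by
        simp only [lineC, ContinuousMap.coe_mk]; ring
      rw [this, exp_add, ← Complex.ofReal_exp, Real.exp_log (by positivity)]
  have hTper : ∀ (w : ℂ) (hw : w ∈ W) (x : Pt S) (hx : f ⟨w, hw⟩ = x),
      T (w + 2 * Real.pi * I) (hper w hw) x ((hfper _ _ hw (hper _ hw) (hexp2 _)).trans hx) =
      α • T w hw x hx := by
    intro w hw x hx
    have h1 := hT (hper _ hw₀) (hper _ hw) (hfper _ _ hw₀ (hper _ hw₀) (hexp2 _))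
      ((hfper _ _ hw (hper _ hw) (hexp2 _)).trans hx) (q w hw x hx)
      (gl (w₀ + 2 * Real.pi * I) (w + 2 * Real.pi * I) (hper _ hw₀) (hper _ hw)) (fun t => ?_)
      (by simp [gl]) (by simp [gl])
    · rw [← h1, hT0, map_smul]
    · refine hfper _ _ _ _ ?_
      have : lineC (w₀ + 2 * Real.pi * I) (w + 2 * Real.pi * I) t =
          lineC w₀ w t + 2 * Real.pi * I := by
        simp only [lineC, ContinuousMap.coe_mk]; ring
      simp only [this, hexp2]
  -- The phase `exp (-i ν Im w)` cancels the monodromy of the flat section, so that `G` is invariant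
  -- under `w ↦ w + 2πi` and descends to the punctured disc.
  let G : ∀ (w : ℂ) (hw : w ∈ W) (x : Pt S), f ⟨w, hw⟩ = x → L.fibre x :=
    fun w hw x hx => exp (-(I * (C.ν j * w.im : ℝ))) • T w hw x hx
  have hGper : ∀ (n : ℕ) (w w' : ℂ) (hw : w ∈ W) (hw' : w' ∈ W) (x : Pt S) (hx : f ⟨w, hw⟩ = x)
      (hx' : f ⟨w', hw'⟩ = x), w' = w + n * (2 * Real.pi * I) → G w' hw' x hx' = G w hw x hx := by
    intro n
    induction n with
    | zero =>
      intro w w' hw hw' x hx hx' h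
      have : w' = w := by simpa using h
      subst this; rfl
    | succ n ih =>
      intro w w' hw hw' x hx hx' h
      have h1 : G (w + 2 * Real.pi * I) (hper w hw) x
        ((hfper _ _ hw (hper _ hw) (hexp2 _)).trans hx) = G w hw x hx := by
        simp only [G]
        rw [hTper w hw x hx, smul_smul, ← exp_add]
        congr 2
        simp
        ring
      rw [← h1]
      exact ih _ _ (hper w hw) hw' x ((hfper _ _ hw (hper _ hw) (hexp2 _)).trans hx) hx'
        (by rw [h]; push_cast; ring)
  have hG : ∀ (w w' : ℂ) (hw : w ∈ W) (hw' : w' ∈ W) (x : Pt S) (hx : f ⟨w, hw⟩ = x)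
      (hx' : f ⟨w', hw'⟩ = x), G w' hw' x hx' = G w hw x hx := by
    intro w w' hw hw' x hx hx'
    have h1 : exp w' = exp w := by
      have := congrArg Subtype.val (hx'.trans hx.symm)
      have := OnePoint.coe_injective this
      simpa using this
    obtain ⟨n, hn⟩ := Complex.exp_eq_exp_iff_exists_int.1 h1
    obtain ⟨k, rfl | rfl⟩ := n.eq_nat_or_neg
    · exact hGper k w w' hw hw' x hx hx' (by rw [hn]; simp)
    · exact (hGper k w' w hw' hw x hx' hx (by rw [hn]; simp)).symm
  classical
  let e : ∀ x : Pt S, L.fibre x := fun x =>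
    if h : ∃ w : W, f w = x then G h.choose.1 h.choose.2 x h.choose_spec
    else (C.exists_ne_zero x).choose
  have heG : ∀ (w : ℂ) (hw : w ∈ W) (x : Pt S) (hx : f ⟨w, hw⟩ = x), e x = G w hw x hx := by
    intro w hw x hx
    have h : ∃ w : W, f w = x := ⟨⟨w, hw⟩, hx⟩
    simp only [e, dif_pos h]
    exact hG w h.choose.1 hw h.choose.2 x hx h.choose_spec
  have hGne : ∀ (w : ℂ) (hw : w ∈ W) (x : Pt S) (hx : f ⟨w, hw⟩ = x), G w hw x hx ≠ 0 := by
    intro w hw x hx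
    refine smul_ne_zero (exp_ne_zero _) ?_
    rw [← map_zero (L.transport (q w hw x hx))]
    exact (transport_injective _).ne he₀
  refine ⟨e, fun x => ?_, fun a b h ha hb => ?_⟩
  · by_cases h : ∃ w : W, f w = x
    · obtain ⟨⟨w, hw⟩, hx⟩ := h
      rw [heG w hw x hx]
      exact hGne w hw x hx
    · simp only [e, dif_neg h]
      exact (C.exists_ne_zero x).choose_spec
  · have hzs : C.z j ∉ segment ℝ a b := fun hz => C.mem_fin_iff.1 (h hz) j hj rfl
    have hane : a - C.z j ≠ 0 := sub_ne_zero.2 (C.mem_fin_iff.1 (h (left_mem_segment ℝ a b)) j hj)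
    -- The segment is lifted to the cover by adding to `wa` the logarithm of a quotient that stays
    -- in the slit plane. The imaginary part then grows exactly by the angle at `z j`.
    let wa : ℂ := log (a - C.z j)
    have hslit : ∀ t, (lineC a b t - C.z j) / (a - C.z j) ∈ slitPlane := fun t =>
      div_mem_slitPlane_of_notMem_segment fun hz => hzs
        ((convex_segment a b).segment_subset (left_mem_segment ℝ a b) (lineC_mem_segment a b t) hz)
    have hexp : ∀ t, exp (wa + log ((lineC a b t - C.z j) / (a - C.z j))) =
        lineC a b t - C.z j := by
      intro t
      rw [exp_add, exp_log hane, exp_log (slitPlane_ne_zero (hslit t))]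
      field_simp
    have hmem : ∀ t, wa + log ((lineC a b t - C.z j) / (a - C.z j)) ∈ W := by
      intro t
      rw [hWiff, hexp]
      simpa [dist_eq_norm] using lineC_mem (convex_ball (C.z j) ρ) ha hb t
    have hcont : Continuous fun t => wa + log ((lineC a b t - C.z j) / (a - C.z j)) := by
      refine continuous_const.add (Continuous.clog ?_ hslit)
      exact ((lineC a b).continuous.sub continuous_const).div_const _
    let g : C(unitInterval, W) := ⟨fun t => ⟨_, hmem t⟩, hcont.subtype_mk _⟩
    have hg : ∀ t, f (g t) = segPath h t := by
      intro t
      refine Subtype.ext ?_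
      change ((C.z j + exp (wa + log ((lineC a b t - C.z j) / (a - C.z j))) : ℂ) : P1) =
        ((lineC a b t : ℂ) : P1)
      rw [hexp, add_sub_cancel]
    have hx := (hg 0).trans (segPath h).source
    have hy := (hg 1).trans (segPath h).target
    rw [heG _ (g 0).2 _ hx, heG _ (g 1).2 _ hy]
    simp only [G]
    rw [map_smul, hT (g 0).2 (g 1).2 hx hy (segPath h) g hg rfl rfl, smul_smul, ← exp_add]
    congr 2
    have h1 : ((g 0 : W) : ℂ).im = wa.im := by
      change (wa + log ((lineC a b 0 - C.z j) / (a - C.z j))).im = _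
      rw [lineC_zero, div_self hane]; simp
    have h2 : ((g 1 : W) : ℂ).im = wa.im + ang (C.z j) a b := by
      change (wa + log ((lineC a b 1 - C.z j) / (a - C.z j))).im = _
      rw [lineC_one, Complex.add_im, Complex.log_im ((b - C.z j) / _), ang]
    rw [h1, h2]
    push_cast
    ring

end Config

end DeligneMostow
namespace DeligneMostow
open Complex CategoryTheory Filter Topology

/-! ### The global frame on the finite part -/

namespace Config

variable {S : Set P1} {L : LocalSystem.{u} S} (C : Config L)

/-- The factor by which the frame is multiplied along the segment from `x` to `y`. -/
noncomputable abbrev E (x y : ℂ) : ℂ := mult C.m C.z C.ν x y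

theorem notMem_segment {a b : ℂ} (h : segment ℝ a b ⊆ fin S) : ∀ j < C.m, C.z j ∉ segment ℝ a b :=
  fun j hj hz => C.mem_fin_iff.1 (h hz) j hj rfl

theorem le_of_ball_subset {c : ℂ} {r : ℝ} (h : Metric.ball c r ⊆ fin S) :
    ∀ j < C.m, r ≤ ‖c - C.z j‖ := by
  intro j hj
  by_contra hlt
  rw [not_le, norm_sub_rev, ← dist_eq_norm] at hlt
  exact C.mem_fin_iff.1 (h hlt) j hj rfl

theorem E_mul_of_ball {c : ℂ} {r : ℝ} (h : Metric.ball c r ⊆ fin S) {x y w : ℂ}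
    (hx : x ∈ Metric.ball c r) (hy : y ∈ Metric.ball c r) (hw : w ∈ Metric.ball c r) :
    C.E x y * C.E y w = C.E x w :=
  mult_mul_of_ball (C.le_of_ball_subset h) hx hy hw

theorem E_mul_of_segment {a b : ℂ} (h : segment ℝ a b ⊆ fin S) {x y w : ℂ}
    (hx : x ∈ segment ℝ a b) (hy : y ∈ segment ℝ a b) (hw : w ∈ segment ℝ a b) :
    C.E x y * C.E y w = C.E x w :=
  mult_mul_of_segment (C.notMem_segment h) hx hy hw

theorem transport_segPath_trans {K : Set ℂ} (hK : Convex ℝ K) (hKS : K ⊆ fin S) {a b c : ℂ}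
    (ha : a ∈ K) (hb : b ∈ K) (hc : c ∈ K) (hab : segment ℝ a b ⊆ fin S)
    (hbc : segment ℝ b c ⊆ fin S) (hac : segment ℝ a c ⊆ fin S) (v) :
    L.transport (segPath hbc) (L.transport (segPath hab) v) = L.transport (segPath hac) v := by
  rw [← transport_trans, transport_in_convex hK hKS ((segPath hab).trans (segPath hbc))
    (segPath hac) (fun t => trans_mem (P := fun x => ∃ w ∈ K, (x : P1) = (w : P1))
      (segPath_mem hK hab ha hb) (segPath_mem hK hbc hb hc) t) (segPath_mem hK hac ha hc)]

/-- The frame near a point of `S`. -/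
theorem exists_frame_near {j : ℕ} (hj : j < C.m) {ρ : ℝ} (hρ : 0 < ρ)
    (hsep : ∀ k < C.m, k ≠ j → ρ ≤ ‖C.z k - C.z j‖) :
    ∃ e : ∀ x : Pt S, L.fibre x, (∀ x, e x ≠ 0) ∧
      ∀ (a b : ℂ) (h : segment ℝ a b ⊆ fin S), a ∈ Metric.ball (C.z j) ρ →
        b ∈ Metric.ball (C.z j) ρ → L.transport (segPath h) (e _) = C.E a b • e _ := by
  obtain ⟨e, he, heq⟩ := C.exists_frame_near_aux hj hρ hsep
  -- On the ball the angles at the other singular points are coboundaries, of the angle measured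
  -- from `z j`, so a change of scale of the frame accounts for them.
  let c : ℂ → ℂ := fun a =>
    exp (-(I * (∑ k ∈ (Finset.range C.m).erase j, C.ν k * ang (C.z k) (C.z j) a : ℝ)))
  refine ⟨fun x => c (coord x) • e x, fun x => smul_ne_zero (exp_ne_zero _) (he x),
    fun a b h ha hb => ?_⟩
  change L.transport (segPath h) (c a • e _) = C.E a b • c b • e _
  rw [map_smul, heq a b h ha hb, smul_smul, smul_smul]
  congr 1
  simp only [c]
  rw [E, mult, ← exp_add, ← exp_add, ← Finset.add_sum_erase _ _ (Finset.mem_range.2 hj)]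
  congr 1
  have : ∑ k ∈ (Finset.range C.m).erase j, C.ν k * ang (C.z k) (C.z j) b =
      ∑ k ∈ (Finset.range C.m).erase j, C.ν k * ang (C.z k) (C.z j) a +
      ∑ k ∈ (Finset.range C.m).erase j, C.ν k * ang (C.z k) a b := by
    rw [← Finset.sum_add_distrib]
    refine Finset.sum_congr rfl fun k hk => ?_
    obtain ⟨hkj, hk⟩ := Finset.mem_erase.1 hk
    have hkm := Finset.mem_range.1 hk
    have hle := hsep k hkm hkj
    have hs := ball_subset_halfPlane (r := ρ) (v := C.z k) (c := C.z j) (by rwa [norm_sub_rev])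
      (fun e => hkj (C.z_inj _ hkm _ hj e.symm))
    rw [← ang_add (hs (Metric.mem_ball_self hρ)) (hs ha) (hs hb), mul_add]
  rw [this]
  push_cast
  ring

/-- A nowhere vanishing section of `L` that is multiplied by `C.E a b` along the segment from
`a` to `b`. -/
theorem exists_frame : ∃ e : ∀ x : Pt S, L.fibre x, (∀ x, e x ≠ 0) ∧
    ∀ (a b : ℂ) (h : segment ℝ a b ⊆ fin S), L.transport (segPath h) (e _) = C.E a b • e _ := by
  classical
  obtain ⟨ρ, hρ, hsep⟩ := C.exists_sep
  have hnear : ∀ j, ∃ e : ∀ x : Pt S, L.fibre x, (∀ x, e x ≠ 0) ∧ (j < C.m →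
      ∀ (a b : ℂ) (h : segment ℝ a b ⊆ fin S), a ∈ Metric.ball (C.z j) ρ →
        b ∈ Metric.ball (C.z j) ρ → L.transport (segPath h) (e _) = C.E a b • e _) := by
    intro j
    by_cases hj : j < C.m
    · obtain ⟨e, he, h⟩ := C.exists_frame_near hj hρ (hsep j hj)
      exact ⟨e, he, fun _ => h⟩
    · exact ⟨fun x => (C.exists_ne_zero x).choose, fun x => (C.exists_ne_zero x).choose_spec,
        fun h => absurd h hj⟩
  choose f hf hfE using hnear
  -- Points close to `z j` get the index `j`, which is unique because the balls of radius `ρ / 2`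
  -- are disjoint. All other points get `C.m`, where the frame `f C.m` is an arbitrary choice of
  -- nonzero vectors.
  let idx : P1 → ℕ := fun x =>
    if h : ∃ j < C.m, coord x ∈ Metric.ball (C.z j) (ρ / 2) then h.choose else C.m
  have hidx : ∀ j < C.m, ∀ a ∈ Metric.ball (C.z j) (ρ / 2), idx (a : P1) = j := by
    intro j hj a ha
    have h : ∃ j < C.m, coord (a : P1) ∈ Metric.ball (C.z j) (ρ / 2) := ⟨j, hj, ha⟩
    simp only [idx, dif_pos h]
    by_contra hne
    have h1 := hsep j hj _ h.choose_spec.1 hne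
    have h2 : dist a (C.z h.choose) < ρ / 2 := h.choose_spec.2
    have h3 : dist a (C.z j) < ρ / 2 := ha
    rw [← dist_eq_norm] at h1
    linarith [dist_triangle_left (C.z h.choose) (C.z j) a]
  let g : ∀ x : Pt S, L.fibre x := fun x => f (idx x) x
  have hg : ∀ x, g x ≠ 0 := fun x => hf _ x
  have hgE : ∀ j < C.m, ∀ (a b : ℂ) (h : segment ℝ a b ⊆ fin S), a ∈ Metric.ball (C.z j) (ρ / 2) →
      b ∈ Metric.ball (C.z j) (ρ / 2) → L.transport (segPath h) (g _) = C.E a b • g _ := by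
    intro j hj a b h ha hb
    simp only [g]
    rw [hidx j hj a ha, hidx j hj b hb]
    exact hfE j hj a b h (Metric.ball_subset_ball (by linarith) ha)
      (Metric.ball_subset_ball (by linarith) hb)
  have hratio : ∀ (a b : ℂ) (h : segment ℝ a b ⊆ fin S), ∃ r : ℂˣ,
      L.transport (segPath h) (g _) = ((r : ℂ) * C.E a b) • g _ := by
    intro a b h
    obtain ⟨c, hc⟩ := C.exists_smul_eq (hg (pt (h (right_mem_segment ℝ a b))))
      (L.transport (segPath h) (g _))
    have hc0 : c ≠ 0 := by
      rintro rfl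
      rw [zero_smul, ← map_zero (L.transport (segPath h))] at hc
      exact hg _ (transport_injective _ hc)
    refine ⟨Units.mk0 (c / C.E a b) (div_ne_zero hc0 (mult_ne_zero _ _)), ?_⟩
    rw [hc, Units.val_mk0, div_mul_cancel₀ _ (mult_ne_zero _ _)]
  -- `D` measures how far `g` is from the required transport rule. Segments that meet `S` get the
  -- neutral value, which is consistent because `D` is neutral near the points of `S` anyway.
  let D : ℂ → ℂ → Additive ℂˣ := fun a b =>
    if h : segment ℝ a b ⊆ fin S then Additive.ofMul (hratio a b h).choose else 0
  have hD : ∀ (a b : ℂ) (h : segment ℝ a b ⊆ fin S),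
      L.transport (segPath h) (g _) = (((D a b).toMul : ℂ) * C.E a b) • g _ := by
    intro a b h
    simp only [D, dif_pos h]
    exact (hratio a b h).choose_spec
  have hDeq : ∀ (a b : ℂ) (h : segment ℝ a b ⊆ fin S) (c : ℂˣ),
      L.transport (segPath h) (g _) = ((c : ℂ) * C.E a b) • g _ → D a b = Additive.ofMul c := by
    intro a b h c hc
    rw [hD a b h] at hc
    have := smul_left_injective ℂ (hg _) hc
    exact congrArg Additive.ofMul (Units.ext (mul_right_cancel₀ (mult_ne_zero _ _) this))
  have hadd : IsLocallyAdditive D := by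
    intro x
    by_cases hx : x ∈ fin S
    · obtain ⟨r, hr, hball⟩ := Metric.isOpen_iff.1 C.isOpen_fin x hx
      refine ⟨Metric.ball x r, Metric.ball_mem_nhds _ hr, fun a ha b hb c hc => ?_⟩
      have hs : ∀ {a b : ℂ}, a ∈ Metric.ball x r → b ∈ Metric.ball x r → segment ℝ a b ⊆ fin S :=
        fun ha hb => ((convex_ball x r).segment_subset ha hb).trans hball
      have h1 := transport_segPath_trans (L := L) (convex_ball x r) hball ha hb hc (hs ha hb)
        (hs hb hc) (hs ha hc) (g _)
      rw [hD a b, map_smul, hD b c, smul_smul] at h1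
      refine hDeq a c (hs ha hc) ((D a b).toMul * (D b c).toMul) ?_
      rw [← h1, ← C.E_mul_of_ball hball ha hb hc, Units.val_mul]
      congr 1
      ring
    · obtain ⟨j, hj, rfl⟩ := (C.mem_iff x).1 (not_not.1 hx)
      have h0 : ∀ a ∈ Metric.ball (C.z j) (ρ / 2), ∀ b ∈ Metric.ball (C.z j) (ρ / 2),
          D a b = 0 := by
        intro a ha b hb
        by_cases h : segment ℝ a b ⊆ fin S
        · refine hDeq a b h 1 ?_
          rw [Units.val_one, one_mul, hgE j hj a b h ha hb]
        · simp only [D, dif_neg h]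
      refine ⟨_, Metric.ball_mem_nhds _ (by positivity : 0 < ρ / 2), fun a ha b hb c hc => ?_⟩
      rw [h0 a ha c hc, h0 a ha b hb, h0 b hb c hc, add_zero]
  -- The defect extends over the singular points, so it is a local cocycle on all of `ℂ` and has a
  -- primitive; this primitive corrects `g`.
  obtain ⟨F, hF⟩ := exists_isPrimitive_of_properSpace hadd
  let e : ∀ x : Pt S, L.fibre x := fun x => ((F (coord x)).toMul : ℂ) • g x
  have he : ∀ x, e x ≠ 0 := fun x => smul_ne_zero (Units.ne_zero _) (hg x)
  have hloc : ∀ x : ℂ, ∃ N ∈ 𝓝 x, ∀ a ∈ N, ∀ b ∈ N, ∀ (h : segment ℝ a b ⊆ fin S),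
      L.transport (segPath h) (e _) = C.E a b • e _ := by
    intro x
    obtain ⟨N, hN, hFN⟩ := hF x
    refine ⟨N, hN, fun a ha b hb h => ?_⟩
    change L.transport (segPath h) (((F a).toMul : ℂ) • g _) = C.E a b • ((F b).toMul : ℂ) • g _
    rw [map_smul, hD a b h, ← hFN a ha b hb, smul_smul, smul_smul]
    congr 1
    rw [toMul_sub, Units.val_div_eq_div_val]
    field_simp
  refine ⟨e, he, fun a b h => ?_⟩
  have hsub : ∀ s t, segment ℝ (lineC a b s) (lineC a b t) ⊆ segment ℝ a b := fun s t =>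
    (convex_segment a b).segment_subset (lineC_mem_segment a b s) (lineC_mem_segment a b t)
  have hsub0 : ∀ t, segment ℝ a (lineC a b t) ⊆ segment ℝ a b := fun t =>
    (convex_segment a b).segment_subset (left_mem_segment ℝ a b) (lineC_mem_segment a b t)
  -- The rule is known for short segments only. Along a long one the ratio `c t` of the actual to
  -- the expected factor is locally constant and equals `1` at the start.
  have hc : ∀ t, ∃ c : ℂ, L.transport (segPath ((hsub0 t).trans h)) (e _) =
      (c * C.E a (lineC a b t)) • e (pt (h (lineC_mem_segment a b t))) := by
    intro t
    obtain ⟨c, hc⟩ := C.exists_smul_eq (he (pt (h (lineC_mem_segment a b t))))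
      (L.transport (segPath ((hsub0 t).trans h)) (e _))
    exact ⟨c / C.E a (lineC a b t), by rw [hc, div_mul_cancel₀ _ (mult_ne_zero _ _)]⟩
  choose c hc using hc
  have hcloc : IsLocallyConstant c := by
    rw [IsLocallyConstant.iff_eventually_eq]
    intro s
    obtain ⟨N, hN, hEN⟩ := hloc (lineC a b s)
    filter_upwards [(lineC a b).continuous.continuousAt hN] with t ht
    have h1 := transport_segPath_trans (L := L) (convex_segment a b) h (left_mem_segment ℝ a b)
      (lineC_mem_segment a b s) (lineC_mem_segment a b t) ((hsub0 s).trans h) ((hsub s t).trans h)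
      ((hsub0 t).trans h) (e _)
    rw [hc s, map_smul, hEN _ (mem_of_mem_nhds hN) _ ht, hc t, smul_smul] at h1
    have h2 := smul_left_injective ℂ (he _) h1
    rw [mul_assoc, C.E_mul_of_segment h (left_mem_segment ℝ a b)
      (lineC_mem_segment a b s) (lineC_mem_segment a b t)] at h2
    exact (mul_right_cancel₀ (mult_ne_zero _ _) h2).symm
  have hc01 : c 1 = c 0 := hcloc.apply_eq_of_preconnectedSpace _ _
  have key : ∀ (x : ℂ) (hx : segment ℝ a x ⊆ fin S) (k : ℂ), x = a →
      L.transport (segPath hx) (e _) = (k * C.E a x) • e (pt (hx (right_mem_segment ℝ a x))) →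
      k = 1 := by
    rintro x hx k rfl hk
    have : segPath hx = Path.refl _ := by
      refine Path.ext (funext fun t => Subtype.ext ?_)
      change ((lineC x x t : ℂ) : P1) = x
      simp [lineC]
    rw [this, transport_refl, E, mult_self, mul_one] at hk
    have h1 : (1 : ℂ) • e (pt (hx (right_mem_segment ℝ x x))) = k • e _ := by rw [one_smul]; exact hk
    exact (smul_left_injective ℂ (he _) h1).symm
  have hc0 := key _ _ _ (lineC_zero a b) (hc 0)
  have key1 : ∀ (x : ℂ) (hx : segment ℝ a x ⊆ fin S) (k : ℂ), x = b →
      L.transport (segPath hx) (e _) = k • e (pt (hx (right_mem_segment ℝ a x))) →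
      L.transport (segPath h) (e _) = k • e _ := by
    rintro x hx k rfl hk
    exact hk
  have := key1 _ _ _ (lineC_one a b) (hc 1)
  rwa [hc01, hc0, one_mul, lineC_one] at this

end Config

end DeligneMostow
-- Coordinates in a frame, transport by arguments, and the chart at infinity
namespace DeligneMostow
open Complex CategoryTheory Filter Topology

@[simp] theorem coord_coe (a : ℂ) : coord (a : P1) = a := rfl

theorem coe_coord {x : P1} (h : x ≠ OnePoint.infty) : ((coord x : ℂ) : P1) = x := by
  induction x using OnePoint.rec with
  | infty => exact absurd rfl h
  | coe x => rfl

/-- A nowhere vanishing section of `L` that is multiplied by `C.E a b` along the segment from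
`a` to `b`. -/
structure Frame {S : Set P1} {L : LocalSystem.{u} S} (C : Config L) where
  e : ∀ x : Pt S, L.fibre x
  ne_zero : ∀ x, e x ≠ 0
  transport_segPath : ∀ (a b : ℂ) (h : segment ℝ a b ⊆ fin S),
    L.transport (segPath h) (e _) = C.E a b • e _

namespace Frame

variable {S : Set P1} {L : LocalSystem.{u} S} {C : Config L} (F : Frame C)

instance : Nonempty (Frame C) :=
  let ⟨e, he, h⟩ := C.exists_frame
  ⟨⟨e, he, h⟩⟩

/-- The coordinate with respect to a frame. -/
noncomputable def co (x : Pt S) : L.fibre x →ₗ[ℂ] ℂ where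
  toFun v := (C.exists_smul_eq (F.ne_zero x) v).choose
  map_add' v w := by
    refine smul_left_injective ℂ (F.ne_zero x) ?_
    simp only [add_smul]
    rw [← (C.exists_smul_eq (F.ne_zero x) v).choose_spec,
      ← (C.exists_smul_eq (F.ne_zero x) w).choose_spec,
      ← (C.exists_smul_eq (F.ne_zero x) (v + w)).choose_spec]
  map_smul' c v := by
    refine smul_left_injective ℂ (F.ne_zero x) ?_
    simp only [RingHom.id_apply, smul_eq_mul, mul_smul]
    rw [← (C.exists_smul_eq (F.ne_zero x) v).choose_spec,
      ← (C.exists_smul_eq (F.ne_zero x) (c • v)).choose_spec]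

@[simp] theorem co_smul_e (x : Pt S) (v : L.fibre x) : F.co x v • F.e x = v :=
  (C.exists_smul_eq (F.ne_zero x) v).choose_spec.symm

@[simp] theorem co_e (x : Pt S) : F.co x (F.e x) = 1 := by
  refine smul_left_injective ℂ (F.ne_zero x) ?_
  simp

theorem co_injective (x : Pt S) : Function.Injective (F.co x) := by
  intro v w h
  rw [← F.co_smul_e x v, h, F.co_smul_e]

theorem transport_e_of_ball {c : ℂ} {r : ℝ} (hb : Metric.ball c r ⊆ fin S) {x y : Pt S}
    (δ : Path x y) (hδ : ∀ t, ∃ w ∈ Metric.ball c r, (δ t : P1) = (w : P1)) :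
    L.transport δ (F.e x) = C.E (coord x) (coord y) • F.e y := by
  obtain ⟨a, ha, hxa⟩ := hδ 0
  obtain ⟨b, hb', hyb⟩ := hδ 1
  rw [δ.source] at hxa
  rw [δ.target] at hyb
  obtain ⟨x, hx⟩ := x
  obtain ⟨y, hy⟩ := y
  simp only at hxa hyb
  subst hxa hyb
  have hs : segment ℝ a b ⊆ Metric.ball c r := (convex_ball c r).segment_subset ha hb'
  rw [coord_coe, coord_coe, ← F.transport_segPath a b (hs.trans hb),
    transport_in_convex (convex_ball c r) hb δ (segPath (hs.trans hb)) hδ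
      (segPath_mem (convex_ball c r) _ ha hb')]

theorem co_transport {x y : Pt S} {δ : Path x y} {c : ℂ} (h : L.transport δ (F.e x) = c • F.e y)
    (v : L.fibre x) : F.co y (L.transport δ v) = F.co x v * c := by
  conv_lhs => rw [← F.co_smul_e x v, map_smul, h, map_smul, map_smul, F.co_e]
  simp

theorem exists_transport_e {x y : Pt S} (δ : Path x y) : ∃ c : ℂ, c ≠ 0 ∧
    L.transport δ (F.e x) = c • F.e y := by
  refine ⟨F.co y (L.transport δ (F.e x)), fun h => ?_, (F.co_smul_e _ _).symm⟩
  have : L.transport δ (F.e x) = 0 := F.co_injective y (by rw [h, map_zero])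
  rw [← map_zero (L.transport δ)] at this
  exact F.ne_zero x (transport_injective _ this)

/-- Transport along a path in terms of continuous choices of the arguments. -/
theorem transport_e_of_args {x y : Pt S} (γ : Path x y) (g : C(unitInterval, ℂ))
    (hg : ∀ t, (γ t : P1) = (g t : P1)) (θ : ℕ → C(unitInterval, ℝ))
    (hθ : ∀ j < C.m, ∀ t, g t - C.z j = ‖g t - C.z j‖ * exp (θ j t * I)) :
    L.transport γ (F.e x) =
      exp (I * (∑ j ∈ Finset.range C.m, C.ν j * (θ j 1 - θ j 0) : ℝ)) • F.e y := by
  have hgfin : ∀ t, g t ∈ fin S := fun t => by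
    have := (γ t).2
    rw [hg] at this
    exact this
  let A : unitInterval → unitInterval → ℂ := fun s t =>
    exp (I * (∑ j ∈ Finset.range C.m, C.ν j * (θ j t - θ j s) : ℝ))
  have hA : ∀ r s t, A r s * A s t = A r t := by
    intro r s t
    simp only [A]
    rw [← exp_add, ← mul_add, ← Complex.ofReal_add, ← Finset.sum_add_distrib]
    congr 3
    exact Finset.sum_congr rfl fun j _ => by ring
  have hA0 : ∀ s t, A s t ≠ 0 := fun s t => exp_ne_zero _
  -- For `t` near `t₀` the subpath stays in a ball without singular points, and each `θ j` changes
  -- by less than `π`, so the change is the principal angle that occurs in `C.E`.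
  have hloc : ∀ t₀, ∀ᶠ t in 𝓝 t₀, L.transport (γ.subpath t₀ t) (F.e _) = A t₀ t • F.e _ := by
    intro t₀
    obtain ⟨r, hr, hball⟩ := Metric.isOpen_iff.1 C.isOpen_fin (g t₀) (hgfin t₀)
    have h1 : ∀ᶠ t in 𝓝 t₀, g t ∈ Metric.ball (g t₀) r :=
      g.continuous.continuousAt (Metric.ball_mem_nhds _ hr)
    have h1' : ∃ ε > 0, ∀ t, dist t t₀ < ε → g t ∈ Metric.ball (g t₀) r := by
      obtain ⟨ε, hε, h⟩ := Metric.eventually_nhds_iff.1 h1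
      exact ⟨ε, hε, fun t ht => h ht⟩
    obtain ⟨ε, hε, h1'⟩ := h1'
    have h2 : ∀ᶠ t in 𝓝 t₀, ∀ j ∈ Finset.range C.m, |θ j t - θ j t₀| < Real.pi := by
      rw [Filter.eventually_all_finset]
      intro j _
      have : Tendsto (fun t => |θ j t - θ j t₀|) (𝓝 t₀) (𝓝 |θ j t₀ - θ j t₀|) :=
        (((θ j).continuous.sub continuous_const).abs).continuousAt
      rw [sub_self, abs_zero] at this
      exact this.eventually_lt_const Real.pi_pos
    filter_upwards [h2, Metric.ball_mem_nhds t₀ hε] with t h2 h3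
    rw [F.transport_e_of_ball hball (γ.subpath t₀ t) (fun s => ?_)]
    · congr 1
      simp only [Config.E, mult, A]
      congr 3
      refine Finset.sum_congr rfl fun j hj => ?_
      congr 1
      rw [hg, hg, coord_coe, coord_coe, ang]
      have hjm := Finset.mem_range.1 hj
      have n1 : 0 < ‖g t - C.z j‖ := norm_pos_iff.2 (sub_ne_zero.2 (C.mem_fin_iff.1 (hgfin t) j hjm))
      have n0 : 0 < ‖g t₀ - C.z j‖ :=
        norm_pos_iff.2 (sub_ne_zero.2 (C.mem_fin_iff.1 (hgfin t₀) j hjm))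
      have : (g t - C.z j) / (g t₀ - C.z j) =
          (‖g t - C.z j‖ / ‖g t₀ - C.z j‖ : ℝ) * exp ((θ j t - θ j t₀ : ℝ) * I) := by
        conv_lhs => rw [hθ j hjm t, hθ j hjm t₀]
        push_cast
        rw [sub_mul, exp_sub]
        field_simp
      have h4 := abs_lt.1 (h2 j hj)
      rw [this, Complex.arg_real_mul _ (div_pos n1 n0), Complex.exp_mul_I,
        Complex.arg_cos_add_sin_mul_I ⟨h4.1, h4.2.le⟩]
    · have hs : γ.subpath t₀ t s ∈ γ '' Set.uIcc t₀ t := by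
        rw [← Path.range_subpath]; exact ⟨s, rfl⟩
      obtain ⟨s', hs', h⟩ := hs
      refine ⟨g s', h1' s' ?_, by rw [← h, hg]⟩
      have h5 : dist (s' : ℝ) t₀ ≤ dist (t : ℝ) t₀ := by
        have h6 : (s' : ℝ) ∈ Set.uIcc (t₀ : ℝ) t := by
          rw [Set.mem_uIcc] at hs' ⊢
          exact hs'
        rw [dist_comm, dist_comm (t : ℝ)]
        exact Real.dist_left_le_of_mem_uIcc h6
      exact lt_of_le_of_lt h5 h3
  -- The ratio of the actual factor on `[0, t]` to the claimed one is locally constant, and it is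
  -- `1` at `t = 0`.
  have hc : ∀ t, ∃ c : ℂ, L.transport (γ.subpath 0 t) (F.e _) = (c * A 0 t) • F.e (γ t) := by
    intro t
    obtain ⟨c, _, hc⟩ := F.exists_transport_e (γ.subpath 0 t)
    exact ⟨c / A 0 t, by rw [hc, div_mul_cancel₀ _ (hA0 _ _)]⟩
  choose c hc using hc
  have hcloc : IsLocallyConstant c := by
    rw [IsLocallyConstant.iff_eventually_eq]
    intro s
    filter_upwards [hloc s] with t ht
    have h1 : L.transport (γ.subpath s t) (L.transport (γ.subpath 0 s) (F.e _)) =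
        L.transport (γ.subpath 0 t) (F.e _) := by
      rw [← transport_trans, transport_eq ⟨Path.Homotopy.subpathTransSubpath γ 0 s t⟩]
    rw [hc, map_smul, ht, hc, smul_smul] at h1
    have h2 := smul_left_injective ℂ (F.ne_zero _) h1
    rw [mul_assoc, hA] at h2
    exact (mul_right_cancel₀ (hA0 _ _) h2).symm
  have hc01 : c 1 = c 0 := hcloc.apply_eq_of_preconnectedSpace _ _
  have hc0 : c 0 = 1 := by
    have h1 := hc 0
    have h2 : A 0 0 = 1 := by simp [A]
    rw [Path.subpath_self, transport_refl, h2, mul_one] at h1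
    have h3 : (1 : ℂ) • F.e (γ 0) = c 0 • F.e (γ 0) := by rw [one_smul]; exact h1
    exact (smul_left_injective ℂ (F.ne_zero _) h3).symm
  have h1 := hc 1
  rw [hc01, hc0, one_mul, Path.subpath_zero_one] at h1
  have key : ∀ {x' y' : Pt S} (hx : x' = x) (hy : y' = y) (k : ℂ),
      L.transport (γ.cast hx hy) (F.e x') = k • F.e y' → L.transport γ (F.e x) = k • F.e y := by
    rintro x' y' rfl rfl k h
    exact h
  exact key γ.source γ.target _ h1

end Frame

/-! ### The point at infinity -/

/-- The map `w ↦ 1 / w` to the projective line. -/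
noncomputable def invP1 (w : ℂ) : P1 := open Classical in if w = 0 then OnePoint.infty else ((w⁻¹ : ℂ) : P1)

theorem continuous_invP1 : Continuous invP1 := by
  rw [continuous_iff_continuousAt]
  intro w
  rcases eq_or_ne w 0 with rfl | hw
  · rw [continuousAt_iff_punctured_nhds]
    have h0 : invP1 0 = OnePoint.infty := if_pos rfl
    rw [h0]
    have h1 : Tendsto (fun w : ℂ => ((w⁻¹ : ℂ) : P1)) (𝓝[≠] 0) (𝓝 OnePoint.infty) := by
      have := OnePoint.tendsto_coe_infty (X := ℂ)
      rw [Filter.coclosedCompact_eq_cocompact, ← Metric.cobounded_eq_cocompact] at this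
      exact this.comp Filter.tendsto_inv₀_nhdsNE_zero
    refine h1.congr' ?_
    filter_upwards [self_mem_nhdsWithin] with w hw
    exact (if_neg hw).symm
  · have h1 : ContinuousAt (fun w : ℂ => ((w⁻¹ : ℂ) : P1)) w :=
      continuous_coe_P1.continuousAt.comp (continuousAt_inv₀ hw)
    refine h1.congr ?_
    filter_upwards [isOpen_compl_singleton.mem_nhds hw] with w hw
    exact (if_neg hw).symm

/-- The inverse of a point of the projective line, with the value `0` at infinity. -/
noncomputable def invC (x : P1) : ℂ := (coord x)⁻¹

theorem continuousAt_invC {x : P1} (hx : x ≠ ((0 : ℂ) : P1)) : ContinuousAt invC x := by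
  induction x using OnePoint.rec with
  | infty =>
    rw [OnePoint.continuousAt_infty', Filter.coclosedCompact_eq_cocompact,
      ← Metric.cobounded_eq_cocompact]
    have : invC OnePoint.infty = 0 := by simp [invC, coord]
    rw [this]
    exact Filter.tendsto_inv₀_cobounded
  | coe x =>
    rw [OnePoint.continuousAt_coe]
    exact continuousAt_inv₀ (fun h => hx (by rw [h]))

end DeligneMostow
-- Path induction, flat metrics, and integrality of the sum of the exponents
namespace DeligneMostow
open Complex CategoryTheory Filter Topology

/-- Induction over paths that run in an open set of `ℂ ∖ S`. -/
theorem path_induction_on {S : Set P1} {U : Set ℂ} (hU : U ⊆ fin S)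
    {P : ∀ {x y : Pt S}, Path x y → Prop}
    (hloc : ∀ c ∈ U, ∃ N ∈ 𝓝 c, ∀ {x y : Pt S} (γ : Path x y),
      (∀ t, ∃ w ∈ N ∩ U, (γ t : P1) = (w : P1)) → P γ)
    (htrans : ∀ {x y z : Pt S} (γ : Path x y) (δ : Path y z), P γ → P δ → P (γ.trans δ))
    (hhom : ∀ {x y : Pt S} (γ δ : Path x y), γ.Homotopic δ → P γ → P δ)
    {x y : Pt S} (γ : Path x y) (hγ : ∀ t, ∃ w ∈ U, (γ t : P1) = (w : P1)) : P γ := by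
  obtain ⟨g, hg⟩ := exists_lift γ hγ
  let f := subMap hU
  have hx : x = f (g 0) := Subtype.ext (by rw [← γ.source]; exact (hg 0).symm)
  have hy : y = f (g 1) := Subtype.ext (by rw [← γ.target]; exact (hg 1).symm)
  subst hx hy
  let g' : Path (g 0) (g 1) := ⟨g, rfl, rfl⟩
  have hγ' : γ = g'.map f.continuous := Path.ext (funext fun t => Subtype.ext (hg t).symm)
  rw [hγ']
  refine path_induction (P := fun {a b : U} (δ : Path a b) => P (δ.map f.continuous)) ?_ ?_ ?_ g'
  · intro c
    obtain ⟨N, hN, h⟩ := hloc c c.2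
    exact ⟨Subtype.val ⁻¹' N, continuous_subtype_val.continuousAt hN, fun {a b} δ hδ =>
      h _ fun t => ⟨δ t, ⟨hδ t, (δ t).2⟩, rfl⟩⟩
  · intro a b c δ δ' h h'
    rw [Path.map_trans]
    exact htrans _ _ h h'
  · intro a b δ δ' h
    exact hhom _ _ (h.map f)

/-- The neighbourhood `{|x| > R} ∪ {∞}` of infinity. -/
def nearInfty (R : ℝ) : Set P1 := {x | x ≠ ((0 : ℂ) : P1) ∧ ‖invC x‖ < R⁻¹}

theorem mem_nearInfty {R : ℝ} {x : P1} :
    x ∈ nearInfty R ↔ x ≠ ((0 : ℂ) : P1) ∧ ‖invC x‖ < R⁻¹ := Iff.rfl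

theorem coe_mem_nearInfty {R : ℝ} (hR : 0 < R) {x : ℂ} : (x : P1) ∈ nearInfty R ↔ R < ‖x‖ := by
  rw [mem_nearInfty, invC, coord_coe, norm_inv]
  constructor
  · rintro ⟨h1, h2⟩
    have : 0 < ‖x‖ := norm_pos_iff.2 fun h => h1 (by rw [h])
    exact (inv_lt_inv₀ this hR).1 h2
  · intro h
    have : 0 < ‖x‖ := hR.trans h
    refine ⟨fun h0 => ?_, (inv_lt_inv₀ this hR).2 h⟩
    rw [OnePoint.coe_injective h0, norm_zero] at this
    exact lt_irrefl _ this

theorem infty_mem_nearInfty {R : ℝ} (hR : 0 < R) : OnePoint.infty ∈ nearInfty R :=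
  ⟨OnePoint.infty_ne_coe _, by simp [invC, coord, hR]⟩

theorem isOpen_nearInfty (R : ℝ) : IsOpen (nearInfty R) := by
  rw [isOpen_iff_mem_nhds]
  rintro x ⟨h0, h⟩
  exact inter_mem (isOpen_compl_singleton.mem_nhds h0)
    ((continuousAt_invC h0).norm.eventually_lt_const h)

theorem invP1_invC {x : P1} (hx : x ≠ ((0 : ℂ) : P1)) : invP1 (invC x) = x := by
  induction x using OnePoint.rec with
  | infty => simp [invC, coord, invP1]
  | coe x =>
    have : x ≠ 0 := fun h => hx (by rw [h])
    simp [invC, invP1, this]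

theorem invP1_mem_nearInfty {R : ℝ} (hR : 0 < R) {w : ℂ} (hw : ‖w‖ < R⁻¹) :
    invP1 w ∈ nearInfty R := by
  rw [invP1]
  split_ifs with h
  · exact infty_mem_nearInfty hR
  · rw [coe_mem_nearInfty hR, norm_inv]
    exact (lt_inv_comm₀ (norm_pos_iff.2 h) hR).1 hw

/-- In the coordinate `1 / w` this neighbourhood of `∞` is a disc, and paths in a convex set are
homotopic. -/
theorem homotopic_near_infty {S : Set P1} {R : ℝ} (hR : 0 < R) (hS : nearInfty R ⊆ Sᶜ) {x y : Pt S}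
    (γ δ : Path x y) (hγ : ∀ t, (γ t : P1) ∈ nearInfty R) (hδ : ∀ t, (δ t : P1) ∈ nearInfty R) :
    γ.Homotopic δ := by
  let f : C(Metric.ball (0 : ℂ) R⁻¹, Pt S) := ⟨fun w => ⟨invP1 w, hS (invP1_mem_nearInfty hR
    (mem_ball_zero_iff.1 w.2))⟩, (continuous_invP1.comp continuous_subtype_val).subtype_mk _⟩
  have hc : ∀ (γ : Path x y), (∀ t, (γ t : P1) ∈ nearInfty R) →
      Continuous fun t => invC (γ t : P1) := fun γ hγ => continuous_iff_continuousAt.2 fun t =>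
    ContinuousAt.comp (f := fun t => (γ t : P1)) (continuousAt_invC (hγ t).1)
      (continuous_subtype_val.comp γ.continuous).continuousAt
  refine homotopic_of_convex (convex_ball (0 : ℂ) R⁻¹) f γ δ ⟨_, hc γ hγ⟩ ⟨_, hc δ hδ⟩
    (fun t => by simpa using (hγ t).2) (fun t => by simpa using (hδ t).2)
    (fun t => Subtype.ext (invP1_invC (hγ t).1)) (fun t => Subtype.ext (invP1_invC (hδ t).1)) ?_ ?_
  · simp
  · simp

/-- The exterior of the disc is the image of a half plane under the exponential. -/
theorem isPathConnected_exterior (R : ℝ) (hR : 0 < R) : IsPathConnected {w : ℂ | R < ‖w‖} := by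
  have h : {w : ℂ | R < ‖w‖} = exp '' {w : ℂ | Real.log R < w.re} := by
    ext w
    constructor
    · intro hw
      have hw' : R < ‖w‖ := hw
      have h0 : w ≠ 0 := norm_pos_iff.1 (hR.trans hw')
      refine ⟨log w, ?_, exp_log h0⟩
      change Real.log R < (log w).re
      rw [log_re]
      exact Real.log_lt_log hR hw'
    · rintro ⟨w, hw, rfl⟩
      change R < ‖exp w‖
      rw [norm_exp]
      exact (Real.log_lt_iff_lt_exp hR).1 hw
  rw [h]
  refine ((convex_halfSpace_re_gt _).isPathConnected ⟨((Real.log R + 1 : ℝ) : ℂ), ?_⟩).image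
    continuous_exp
  change _ < (((Real.log R + 1 : ℝ) : ℂ)).re
  rw [ofReal_re]
  linarith

/-- Induction over paths in terms of finite paths and one path to infinity. -/
theorem path_induction_infty {S : Set P1} {R : ℝ} (hR : 0 < R) (hS : nearInfty R ⊆ Sᶜ)
    (hfin : IsOpen (fin S)) (hinf : OnePoint.infty ∉ S) :
    ∃ (x₁ : ℂ) (h₁ : x₁ ∈ fin S) (p : Path (pt h₁) ⟨OnePoint.infty, hinf⟩),
      ∀ {P : ∀ {x y : Pt S}, Path x y → Prop},
        (∀ {x y z : Pt S} (γ : Path x y) (δ : Path y z), P γ → P δ → P (γ.trans δ)) →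
        (∀ {x y : Pt S} (γ δ : Path x y), γ.Homotopic δ → P γ → P δ) →
        (∀ {x y : Pt S} (γ : Path x y), (∀ t, ∃ w ∈ fin S, (γ t : P1) = (w : P1)) → P γ) →
        P p → P p.symm → ∀ {x y : Pt S} (γ : Path x y), P γ := by
  have hext : ∀ w : ℂ, R < ‖w‖ → w ∈ fin S := fun w hw => hS ((coe_mem_nearInfty hR).2 hw)
  have hx₁ : R < ‖((R + 1 : ℝ) : ℂ)‖ := by
    rw [norm_real, Real.norm_of_nonneg (by linarith)]; linarith
  let w₁ : ℂ := (((R + 1 : ℝ) : ℂ))⁻¹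
  have hw₁ : ‖w₁‖ < R⁻¹ := by
    rw [norm_inv]
    exact (inv_lt_inv₀ (hR.trans hx₁) hR).2 hx₁
  have hw₁0 : w₁ ≠ 0 := inv_ne_zero (norm_pos_iff.1 (hR.trans hx₁))
  have hl : ∀ t, ‖lineC w₁ 0 t‖ < R⁻¹ := fun t => by
    simpa using lineC_mem (convex_ball (0 : ℂ) R⁻¹) (a := w₁) (b := 0) (by simpa using hw₁)
      (by simpa using hR) t
  let p : Path (pt (hext _ hx₁)) (⟨OnePoint.infty, hinf⟩ : Pt S) :=
    ⟨⟨fun t => ⟨invP1 (lineC w₁ 0 t), hS (invP1_mem_nearInfty hR (hl t))⟩,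
      (continuous_invP1.comp (lineC w₁ 0).continuous).subtype_mk _⟩,
      Subtype.ext (by simp only [lineC_zero]; rw [invP1, if_neg hw₁0, inv_inv]),
      Subtype.ext (by simp [invP1])⟩
  have hp : ∀ t, (p t : P1) ∈ nearInfty R := fun t => invP1_mem_nearInfty hR (hl t)
  refine ⟨_, hext _ hx₁, p, ?_⟩
  intro P htrans hhom hPfin hPp hPp'
  -- Every point near `∞` is reached from `x₁` by a path for which `P` is known: by `p` itself if
  -- the point is `∞`, and otherwise by a path in the exterior of the disc.
  have hq : ∀ x : Pt S, (x : P1) ∈ nearInfty R → ∃ q : Path (pt (hext _ hx₁)) x,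
      P q ∧ P q.symm ∧ ∀ t, (q t : P1) ∈ nearInfty R := by
    rintro ⟨x, hxS⟩ hx
    induction x using OnePoint.rec with
    | infty => exact ⟨p, hPp, hPp', hp⟩
    | coe x =>
      have hx' : R < ‖x‖ := (coe_mem_nearInfty hR).1 hx
      have hj := (isPathConnected_exterior R hR).joinedIn _ hx₁ x hx'
      have hm : ∀ t, R < ‖hj.somePath t‖ := fun t => hj.somePath_mem t
      let q : Path (pt (hext _ hx₁)) (⟨(x : P1), hxS⟩ : Pt S) := mkPath
        hj.somePath.toContinuousMap (fun t => hext _ (hm t)) _ _ hj.somePath.source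
        hj.somePath.target
      refine ⟨q, hPfin q fun t => ⟨_, hext _ (hm t), rfl⟩,
        hPfin q.symm fun t => ⟨_, hext _ (hm (unitInterval.symm t)), rfl⟩, fun t => ?_⟩
      exact (coe_mem_nearInfty hR).2 (hm t)
  intro x y γ
  refine path_induction (P := fun {x y} γ => P γ) ?_ htrans hhom γ
  rintro ⟨x, hxS⟩
  induction x using OnePoint.rec with
  | infty =>
    refine ⟨Subtype.val ⁻¹' nearInfty R, continuous_subtype_val.continuousAt
      ((isOpen_nearInfty R).mem_nhds (infty_mem_nearInfty hR)), fun {a b} δ hδ => ?_⟩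
    obtain ⟨q, hq1, hq2, hq3⟩ := hq a (by simpa using hδ 0)
    obtain ⟨q', hq1', hq2', hq3'⟩ := hq b (by simpa using hδ 1)
    -- An arbitrary path near `∞` is homotopic to a detour through `x₁`.
    refine hhom (q.symm.trans q') δ (homotopic_near_infty hR hS _ _ (fun t => ?_) hδ)
      (htrans _ _ hq2 hq1')
    exact trans_mem (P := fun x => (x : P1) ∈ nearInfty R) (γ := q.symm) (fun t => hq3 _) hq3' t
  | coe x =>
    refine ⟨Subtype.val ⁻¹' (((↑) : ℂ → P1) '' fin S), continuous_subtype_val.continuousAt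
      ((isOpenEmbedding_coe_P1.isOpenMap _ hfin).mem_nhds ⟨x, hxS, rfl⟩), fun {a b} δ hδ => ?_⟩
    refine hPfin δ fun t => ?_
    obtain ⟨w, hw, h⟩ := hδ t
    exact ⟨w, hw, h.symm⟩

namespace Config

variable {S : Set P1} {L : LocalSystem.{u} S} (C : Config L)

theorem exists_bound : ∃ R > 0, ∀ j < C.m, ‖C.z j‖ < R := by
  refine ⟨∑ j ∈ Finset.range C.m, ‖C.z j‖ + 1, by positivity, fun j hj => ?_⟩
  have := Finset.single_le_sum (f := fun j => ‖C.z j‖) (fun j _ => norm_nonneg _)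
    (Finset.mem_range.2 hj)
  linarith

theorem mem_fin_of_bound {R : ℝ} (hR : ∀ j < C.m, ‖C.z j‖ < R) {w : ℂ} (hw : R ≤ ‖w‖) :
    w ∈ fin S := by
  rw [C.mem_fin_iff]
  rintro j hj rfl
  exact absurd (hR j hj) (not_lt.2 hw)

theorem nearInfty_subset {R : ℝ} (hR0 : 0 < R) (hR : ∀ j < C.m, ‖C.z j‖ < R)
    (hinf : OnePoint.infty ∉ S) : nearInfty R ⊆ Sᶜ := by
  intro x hx
  induction x using OnePoint.rec with
  | infty => exact hinf
  | coe x => exact C.mem_fin_of_bound hR ((coe_mem_nearInfty hR0).1 hx).le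

theorem isPathConnected_fin (C : Config L) : IsPathConnected (fin S) := by
  have : fin S = (C.z '' (Set.Iio C.m))ᶜ := by
    ext x
    simp [C.mem_fin_iff, eq_comm]
  rw [this]
  exact ((Set.finite_Iio C.m).image _).countable.isPathConnected_compl_of_one_lt_rank
    (by rw [Complex.rank_real_complex]; exact Cardinal.one_lt_two)

end Config

namespace Frame

variable {S : Set P1} {L : LocalSystem.{u} S} {C : Config L} (F : Frame C)

/-- Locally transport multiplies the coordinate by `C.E`, a phase, and phases are stable under
concatenation and homotopy. -/
theorem norm_co_transport {x y : Pt S} (γ : Path x y)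
    (hγ : ∀ t, ∃ w ∈ fin S, (γ t : P1) = (w : P1)) :
    ∃ c : ℂ, ‖c‖ = 1 ∧ ∀ v, F.co y (L.transport γ v) = c * F.co x v := by
  refine path_induction_on (subset_refl (fin S))
    (P := fun {x y} γ => ∃ c : ℂ, ‖c‖ = 1 ∧ ∀ v, F.co y (L.transport γ v) = c * F.co x v)
    ?_ ?_ ?_ γ hγ
  · intro c hc
    obtain ⟨r, hr, hball⟩ := Metric.isOpen_iff.1 C.isOpen_fin c hc
    refine ⟨_, Metric.ball_mem_nhds c hr, fun {x y} γ hγ => ⟨C.E (coord x) (coord y),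
      norm_mult _ _, fun v => ?_⟩⟩
    rw [F.co_transport (F.transport_e_of_ball hball γ fun t => ?_), mul_comm]
    obtain ⟨w, hw, h⟩ := hγ t
    exact ⟨w, hw.1, h⟩
  · rintro x y z γ δ ⟨c, hc, h⟩ ⟨d, hd, h'⟩
    refine ⟨d * c, by rw [norm_mul, hc, hd, one_mul], fun v => ?_⟩
    rw [transport_trans, h', h, mul_assoc]
  · rintro x y γ δ hγδ ⟨c, hc, h⟩
    exact ⟨c, hc, fun v => by rw [← transport_eq hγδ, h]⟩

/-- A rank one local system with unimodular transport has a flat metric. -/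
theorem nonempty_flatMetric_of_co (k : ∀ x : Pt S, L.fibre x →ₗ[ℂ] ℂ)
    (hk : ∀ x v, k x v = 0 → v = 0)
    (h : ∀ {x y : Pt S} (γ : Path x y), ∃ c : ℂ, ‖c‖ = 1 ∧ ∀ v, k y (L.transport γ v) = c * k x v) :
    Nonempty (FlatMetric L) := by
  refine ⟨⟨fun x => LinearMap.mk₂'ₛₗ (RingHom.id ℂ) (starRingEnd ℂ)
    (fun v w => k x v * starRingEnd ℂ (k x w)) ?_ ?_ ?_ ?_, ?_, ?_, ?_⟩⟩
  · intro v v' w; simp [add_mul]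
  · intro c v w; simp [mul_assoc]
  · intro v w w'; simp [mul_add]
  · intro c v w; simp; ring
  · intro x v w; simp [mul_comm]
  · intro x v hv
    simp only [LinearMap.mk₂'ₛₗ_apply, mul_conj, ofReal_re]
    exact normSq_pos.2 fun h => hv (hk x v h)
  · intro x y γ v w
    obtain ⟨c, hc, h⟩ := h γ
    simp only [LinearMap.mk₂'ₛₗ_apply, h, map_mul]
    have : c * starRingEnd ℂ c = 1 := by
      rw [mul_conj, normSq_eq_norm_sq, hc]; simp
    linear_combination (k x v * starRingEnd ℂ (k x w)) * this

/-- The metric is the standard one of `ℂ` in the coordinate of a frame. If `∞` is not singular, the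
coordinate at `∞` is defined by transport back along one path `p`, and path induction reduces
everything to finite paths and `p`. -/
theorem nonempty_flatMetric (C : Config L) : Nonempty (FlatMetric L) := by
  obtain ⟨F⟩ : Nonempty (Frame C) := inferInstance
  have hco : ∀ x v, F.co x v = 0 → v = 0 := fun x v h => F.co_injective x (by rw [h, map_zero])
  by_cases hinf : OnePoint.infty ∈ S
  · refine nonempty_flatMetric_of_co F.co hco fun {x y} γ => F.norm_co_transport γ fun t => ?_
    have : (γ t : P1) ≠ OnePoint.infty := fun h => (γ t).2 (h ▸ hinf)
    refine ⟨coord (γ t), ?_, (coe_coord this).symm⟩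
    change ((coord (γ t) : ℂ) : P1) ∉ S
    rw [coe_coord this]
    exact (γ t).2
  · obtain ⟨R, hR0, hR⟩ := C.exists_bound
    obtain ⟨x₁, h₁, p, hp⟩ := path_induction_infty hR0 (C.nearInfty_subset hR0 hR hinf)
      C.isOpen_fin hinf
    classical
    let k : ∀ x : Pt S, L.fibre x →ₗ[ℂ] ℂ := fun x =>
      if h : x = ⟨OnePoint.infty, hinf⟩ then F.co _ ∘ₗ L.transport (p.symm.cast h rfl) else F.co x
    have hkfin : ∀ x : Pt S, (x : P1) ≠ OnePoint.infty → k x = F.co x := fun x hx =>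
      dif_neg fun h => hx (by rw [h])
    have hkinf : k ⟨OnePoint.infty, hinf⟩ = F.co _ ∘ₗ L.transport p.symm := by
      simp only [k, dif_pos]; rfl
    have hk₁ : k (pt h₁) = F.co _ := hkfin _ (OnePoint.coe_ne_infty _)
    refine nonempty_flatMetric_of_co k (fun x v hv => ?_) fun {x y} γ => ?_
    · by_cases hx : x = ⟨OnePoint.infty, hinf⟩
      · subst hx
        rw [hkinf] at hv
        exact transport_injective p.symm (by rw [map_zero]; exact hco _ _ hv)
      · rw [hkfin x fun h => hx (Subtype.ext h)] at hv
        exact hco _ _ hv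
    · refine hp (P := fun {x y} γ => ∃ c : ℂ, ‖c‖ = 1 ∧
        ∀ v, k y (L.transport γ v) = c * k x v) ?_ ?_ ?_ ?_ ?_ γ
      · rintro x y z γ δ ⟨c, hc, h⟩ ⟨d, hd, h'⟩
        refine ⟨d * c, by rw [norm_mul, hc, hd, one_mul], fun v => ?_⟩
        rw [transport_trans, h', h, mul_assoc]
      · rintro x y γ δ hγδ ⟨c, hc, h⟩
        exact ⟨c, hc, fun v => by rw [← transport_eq hγδ, h]⟩
      · intro x y γ hγ
        have hne : ∀ t, (γ t : P1) ≠ OnePoint.infty := fun t => by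
          obtain ⟨w, _, hw⟩ := hγ t
          rw [hw]; exact OnePoint.coe_ne_infty _
        rw [hkfin x (by simpa using hne 0), hkfin y (by simpa using hne 1)]
        exact F.norm_co_transport γ hγ
      · refine ⟨1, norm_one, fun v => ?_⟩
        rw [hkinf, hk₁, LinearMap.comp_apply, transport_symm_apply, one_mul]
      · refine ⟨1, norm_one, fun v => ?_⟩
        rw [hkinf, hk₁, LinearMap.comp_apply, one_mul]

/-- A frame that is orthonormal at the points of `ℂ`. -/
theorem exists_orthonormal (h : FlatMetric L) : ∃ F : Frame C, ∀ (x : ℂ) (hx : x ∈ fin S),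
    h.form (pt hx) (F.e _) (F.e _) = 1 := by
  obtain ⟨F⟩ : Nonempty (Frame C) := inferInstance
  obtain ⟨x₀, hx₀⟩ := C.isPathConnected_fin.nonempty
  -- The norm of the frame is the same at all finite points, because transport between them is
  -- unimodular and preserves `h`. Dividing by the square root of `N` keeps the transport rule.
  let N : ℝ := (h.form (pt hx₀) (F.e _) (F.e _)).re
  have hN : 0 < N := h.pos _ _ (F.ne_zero _)
  have hNx : ∀ (x : ℂ) (hx : x ∈ fin S), h.form (pt hx) (F.e _) (F.e _) = N := by
    intro x hx
    have hj := C.isPathConnected_fin.joinedIn _ hx₀ x hx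
    let q : Path (pt hx₀) (pt hx) := mkPath hj.somePath.toContinuousMap (fun t => hj.somePath_mem t)
      _ _ hj.somePath.source hj.somePath.target
    obtain ⟨c, hc, h1⟩ := F.norm_co_transport q fun t => ⟨_, hj.somePath_mem t, rfl⟩
    have h2 : L.transport q (F.e _) = c • F.e _ := by
      rw [← F.co_smul_e _ (L.transport q (F.e _)), h1, F.co_e, mul_one]
    have h3 := h.flat q (F.e _) (F.e _)
    rw [h2] at h3
    simp only [map_smul, LinearMap.smul_apply, map_smulₛₗ, smul_eq_mul] at h3
    have h4 : c * starRingEnd ℂ c = 1 := by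
      rw [mul_conj, normSq_eq_norm_sq, hc]; simp
    have h5 : h.form (pt hx) (F.e _) (F.e _) = h.form (pt hx₀) (F.e _) (F.e _) := by
      linear_combination h3 - h.form (pt hx) (F.e _) (F.e _) * h4
    rw [h5]
    exact (Complex.conj_eq_iff_re.1 (h.conj_symm _ _ _).symm).symm
  refine ⟨⟨fun x => ((Real.sqrt N : ℝ) : ℂ)⁻¹ • F.e x, fun x => smul_ne_zero (inv_ne_zero ?_)
    (F.ne_zero x), fun a b hab => ?_⟩, fun x hx => ?_⟩
  · exact_mod_cast (Real.sqrt_pos.2 hN).ne'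
  · rw [map_smul, F.transport_segPath, smul_comm]
  · simp only [map_smul, LinearMap.smul_apply, map_smulₛₗ, smul_eq_mul, hNx]
    rw [map_inv₀, conj_ofReal, ← mul_assoc, ← mul_inv, ← ofReal_mul, Real.mul_self_sqrt hN.le,
      inv_mul_cancel₀]
    exact_mod_cast hN.ne'

/-- The monodromy along a big circle. -/
theorem transport_circle {R : ℝ} (hR : ∀ j < C.m, ‖C.z j‖ < R) {x : Pt S}
    (γ : Path x x) (σ : ℝ) (hγ : ∀ t : unitInterval, (γ t : P1) =
      ((R * exp (σ * (2 * Real.pi * I * ((t : ℝ) : ℂ))) : ℂ) : P1)) :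
    L.transport γ (F.e x) =
      exp (I * (σ * (2 * Real.pi) * ∑ j ∈ Finset.range C.m, C.ν j : ℝ)) • F.e x := by
  have hγ' : (γ 0 : P1) = γ 1 := by simp
  have h01 : (R : ℂ) * exp (σ * (2 * Real.pi * I * ((0 : ℝ) : ℂ))) =
      R * exp (σ * (2 * Real.pi * I * ((1 : ℝ) : ℂ))) := by
    rw [hγ, hγ] at hγ'
    exact OnePoint.coe_injective hγ'
  let g : C(unitInterval, ℂ) := ⟨fun t => R * exp (σ * (2 * Real.pi * I * ((t : ℝ) : ℂ))),
    by fun_prop⟩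
  have hR0 : ∀ j < C.m, 0 < R := fun j hj => (norm_nonneg _).trans_lt (hR j hj)
  have hg : ∀ t, ‖g t‖ = |R| := fun t => by
    have : (σ * (2 * Real.pi * I * ((t : ℝ) : ℂ)) : ℂ) = ((σ * (2 * Real.pi * t) : ℝ) : ℂ) * I := by
      push_cast; ring
    simp only [g, ContinuousMap.coe_mk]
    rw [norm_mul, this, norm_exp_ofReal_mul_I, mul_one, norm_real, Real.norm_eq_abs]
  have hre : ∀ j < C.m, ∀ t, 0 < (1 - C.z j / g t).re := by
    intro j hj t
    have h1 : ‖C.z j / g t‖ < 1 := by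
      rw [norm_div, hg, abs_of_pos (hR0 j hj), div_lt_one (hR0 j hj)]
      exact hR j hj
    have h2 := (Complex.abs_re_le_norm (C.z j / g t)).trans_lt h1
    rw [sub_re, one_re]
    linarith [abs_lt.1 h2]
  -- Since `g - z j = g (1 - z j / g)` and `|z j| < R`, the argument about `z j` is that of the
  -- circle plus a single-valued term, so every `θ j` grows by the same `2πσ`.
  have hθc : ∀ j, ∃ θ : C(unitInterval, ℝ), j < C.m → ∀ t, θ t =
      σ * (2 * Real.pi * t) + arg (1 - C.z j / g t) := by
    intro j
    by_cases hj : j < C.m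
    · refine ⟨⟨fun t => σ * (2 * Real.pi * t) + arg (1 - C.z j / g t), ?_⟩, fun _ t => rfl⟩
      refine Continuous.add (by fun_prop) (continuous_iff_continuousAt.2 fun t => ?_)
      have hg0 : g t ≠ 0 := by
        rw [← norm_pos_iff, hg, abs_of_pos (hR0 j hj)]; exact hR0 j hj
      exact (Complex.continuousAt_arg (Or.inl (hre j hj t))).comp
        (f := fun t => 1 - C.z j / g t)
        (continuousAt_const.sub (continuousAt_const.div g.continuous.continuousAt hg0))
    · exact ⟨0, fun h => absurd h hj⟩
  choose θ hθ using hθc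
  rw [F.transport_e_of_args γ g hγ θ ?_]
  · have : ∑ j ∈ Finset.range C.m, C.ν j * (θ j 1 - θ j 0) =
        σ * (2 * Real.pi) * ∑ j ∈ Finset.range C.m, C.ν j := by
      rw [Finset.mul_sum]
      refine Finset.sum_congr rfl fun j hj => ?_
      have hj' := Finset.mem_range.1 hj
      have : g 0 = g 1 := h01
      rw [hθ j hj', hθ j hj', this]
      simp
      ring
    rw [this]
  · intro j hj t
    have hg0 : g t ≠ 0 := by
      rw [← norm_pos_iff, hg, abs_of_pos (hR0 j hj)]; exact hR0 j hj
    have h1 : g t - C.z j = g t * (1 - C.z j / g t) := by field_simp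
    have h2 : g t = R * exp ((σ * (2 * Real.pi * t) : ℝ) * I) := by
      simp only [g, ContinuousMap.coe_mk]; congr 2; push_cast; ring
    rw [h1, norm_mul, hg, abs_of_pos (hR0 j hj), hθ j hj, ofReal_add, add_mul, exp_add,
      ofReal_mul]
    calc g t * (1 - C.z j / g t) = g t * (‖1 - C.z j / g t‖ * exp (arg (1 - C.z j / g t) * I)) := by
          rw [Complex.norm_mul_exp_arg_mul_I]
      _ = R * exp ((σ * (2 * Real.pi * t) : ℝ) * I) *
          (‖1 - C.z j / g t‖ * exp (arg (1 - C.z j / g t) * I)) := by rw [← h2]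
      _ = _ := by ring

/-- If `∞` is not a singular point, then the monodromy exponents add up to an integer. -/
theorem exists_sum_eq_of_notMem (C : Config L) (hinf : OnePoint.infty ∉ S) :
    ∃ M : ℤ, ∑ j ∈ Finset.range C.m, C.ν j = M := by
  obtain ⟨F⟩ : Nonempty (Frame C) := inferInstance
  obtain ⟨R, hR0, hR⟩ := C.exists_bound
  have hR' : ∀ j < C.m, ‖C.z j‖ < R + 1 := fun j hj => (hR j hj).trans (by linarith)
  let g : C(unitInterval, ℂ) := ⟨fun t => (R + 1 : ℝ) *
    exp ((1 : ℝ) * (2 * Real.pi * I * ((t : ℝ) : ℂ))), by fun_prop⟩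
  have hg : ∀ t, ‖g t‖ = R + 1 := fun t => by
    have : ((1 : ℝ) * (2 * Real.pi * I * ((t : ℝ) : ℂ)) : ℂ) = ((2 * Real.pi * t : ℝ) : ℂ) * I := by
      push_cast; ring
    simp only [g, ContinuousMap.coe_mk]
    rw [norm_mul, this, norm_exp_ofReal_mul_I, mul_one, norm_real, Real.norm_eq_abs,
      abs_of_pos (by linarith)]
  have hgf : ∀ t, g t ∈ fin S := fun t => C.mem_fin_of_bound hR' (hg t).ge
  have h0 : g 0 = (R + 1 : ℝ) := by simp [g]
  have h1 : g 1 = (R + 1 : ℝ) := by simp [g]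
  have hx : ((R + 1 : ℝ) : ℂ) ∈ fin S := h0 ▸ hgf 0
  let γ : Path (pt hx) (pt hx) := mkPath g hgf hx hx h0 h1
  have h2 := F.transport_circle hR' γ 1 fun t => rfl
  have hn : ∀ t, (γ t : P1) ∈ nearInfty R := fun t => (coe_mem_nearInfty hR0).2 (by
    rw [hg]; linarith)
  -- The large circle contracts through `∞`, so its factor `exp (2πi ∑ ν_j)` is `1`.
  rw [transport_eq (homotopic_near_infty hR0 (C.nearInfty_subset hR0 hR hinf) γ (Path.refl _) hn
    fun t => by have := hn 0; rwa [γ.source] at this), transport_refl] at h2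
  have h3 : exp (I * ((1 : ℝ) * (2 * Real.pi) * ∑ j ∈ Finset.range C.m, C.ν j : ℝ)) = 1 :=
    smul_left_injective ℂ (F.ne_zero _) (by simp only [one_smul]; exact h2.symm)
  obtain ⟨n, hn⟩ := Complex.exp_eq_one_iff.1 h3
  refine ⟨n, ?_⟩
  have h4 : (2 * Real.pi * I : ℂ) ≠ 0 := Complex.two_pi_I_ne_zero
  have : ((∑ j ∈ Finset.range C.m, C.ν j : ℝ) : ℂ) = (n : ℂ) := by
    refine mul_right_cancel₀ h4 ?_
    rw [← hn]
    push_cast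
    ring
  exact_mod_cast this

/-- If `∞` is a singular point, then the monodromy exponents add up to an integer. -/
theorem exists_sum_eq_of_mem (C : Config L) {ν : ℝ} (hinf : ∀ r > 0, (∀ j < C.m, ‖C.z j‖ < r) →
    ∀ (x : Pt S) (γ : Path x x), (∀ t : unitInterval,
      (γ t : P1) = ((r * exp (-(2 * Real.pi * I * ((t : ℝ) : ℂ))) : ℂ) : P1)) →
    ∀ v, L.transport γ v = exp (2 * Real.pi * I * ν) • v) :
    ∃ M : ℤ, ∑ j ∈ Finset.range C.m, C.ν j + ν = M := by
  obtain ⟨F⟩ : Nonempty (Frame C) := inferInstance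
  obtain ⟨R, hR0, hR⟩ := C.exists_bound
  let g : C(unitInterval, ℂ) := ⟨fun t => R *
    exp (-(2 * Real.pi * I * ((t : ℝ) : ℂ))), by fun_prop⟩
  have hg : ∀ t, ‖g t‖ = R := fun t => by
    have : (-(2 * Real.pi * I * ((t : ℝ) : ℂ)) : ℂ) = ((-(2 * Real.pi * t) : ℝ) : ℂ) * I := by
      push_cast; ring
    simp only [g, ContinuousMap.coe_mk]
    rw [norm_mul, this, norm_exp_ofReal_mul_I, mul_one, norm_real, Real.norm_eq_abs,
      abs_of_pos hR0]
  have hgf : ∀ t, g t ∈ fin S := fun t => C.mem_fin_of_bound hR (hg t).ge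
  have h0 : g 0 = (R : ℝ) := by simp [g]
  have h1 : g 1 = (R : ℝ) := by simp [g, exp_neg]
  have hx : (R : ℂ) ∈ fin S := h0 ▸ hgf 0
  let γ : Path (pt hx) (pt hx) := mkPath g hgf hx hx h0 h1
  have h2 := F.transport_circle hR γ (-1) fun t => by
    change ((g t : ℂ) : P1) = _
    simp [g]
  -- The clockwise circle has the factor `exp (-2πi ∑ ν_j)` by the frame and `exp (2πi ν)` by the
  -- monodromy at `∞`.
  rw [hinf R hR0 hR _ γ fun t => rfl] at h2
  have h3 := smul_left_injective ℂ (F.ne_zero _) h2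
  obtain ⟨n, hn⟩ := Complex.exp_eq_exp_iff_exists_int.1 h3
  refine ⟨n, ?_⟩
  have h4 : (2 * Real.pi * I : ℂ) ≠ 0 := Complex.two_pi_I_ne_zero
  have : ((∑ j ∈ Finset.range C.m, C.ν j + ν : ℝ) : ℂ) = (n : ℂ) := by
    refine mul_right_cancel₀ h4 ?_
    push_cast at hn ⊢
    linear_combination hn
  exact_mod_cast this

end Frame

end DeligneMostow
namespace DeligneMostow
open Complex CategoryTheory Filter Topology

/-! ### Functionals on chains from local cocycles -/

/-- A cocycle that is defined near the diagonal, with values in the dual of `L`, and that vanishes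
near `S`. -/
structure LocalCocycle {S : Set P1} (L : LocalSystem.{u} S) where
  D : ∀ x : Pt S, Pt S → L.fibre x →ₗ[ℂ] ℂ
  additive : ∀ x₀ : Pt S, ∃ N ∈ 𝓝 (x₀ : P1), N ⊆ Sᶜ ∧ ∀ (x y z : Pt S) (γ : Path x y),
    (∀ t, (γ t : P1) ∈ N) → (z : P1) ∈ N → ∀ v, D x z v = D x y v + D y z (L.transport γ v)
  vanish : ∀ s ∈ S, ∃ N ∈ 𝓝 s, ∀ x y : Pt S, (x : P1) ∈ N → (y : P1) ∈ N → D x y = 0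

namespace LocalCocycle

variable {S : Set P1} {L : LocalSystem.{u} S} (c : LocalCocycle L)

open Classical in
/-- The cocycle on a simplex. -/
noncomputable def onSimplex {i : ℕ} (σ : C(Simplex i, P1)) (v : Coefficient L σ) (a b : Simplex i) :
    ℂ :=
  if h : σ a ∉ S ∧ σ b ∉ S then c.D ⟨σ a, h.1⟩ ⟨σ b, h.2⟩ (v.1 ⟨a, h.1⟩) else 0

theorem onSimplex_of_notMem {i : ℕ} {σ : C(Simplex i, P1)} (v : Coefficient L σ) {a b : Simplex i}
    (ha : σ a ∉ S) (hb : σ b ∉ S) :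
    c.onSimplex σ v a b = c.D ⟨σ a, ha⟩ ⟨σ b, hb⟩ (v.1 ⟨a, ha⟩) :=
  dif_pos ⟨ha, hb⟩

theorem onSimplex_add {i : ℕ} (σ : C(Simplex i, P1)) (v w : Coefficient L σ) (a b : Simplex i) :
    c.onSimplex σ (v + w) a b = c.onSimplex σ v a b + c.onSimplex σ w a b := by
  unfold onSimplex
  split_ifs
  · exact map_add _ _ _
  · simp

theorem onSimplex_smul {i : ℕ} (σ : C(Simplex i, P1)) (k : ℂ) (v : Coefficient L σ)
    (a b : Simplex i) : c.onSimplex σ (k • v) a b = k * c.onSimplex σ v a b := by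
  unfold onSimplex
  split_ifs
  · exact map_smul _ _ _
  · simp

/-- Near a parameter that is mapped into `S` all values are zero. Near a regular one the simplex is
locally convex, and flatness of `v` supplies the transport that occurs in the additivity of the
cocycle. -/
theorem isLocallyAdditive_onSimplex {i : ℕ} (σ : C(Simplex i, P1)) (v : Coefficient L σ) :
    IsLocallyAdditive (c.onSimplex σ v) := by
  intro t₀
  by_cases h₀ : σ t₀ ∈ S
  · obtain ⟨N, hN, h⟩ := c.vanish _ h₀
    have h0 : ∀ a ∈ σ ⁻¹' N, ∀ b ∈ σ ⁻¹' N, c.onSimplex σ v a b = 0 := by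
      intro a ha b hb
      unfold onSimplex
      split_ifs with hab
      · rw [h ⟨σ a, hab.1⟩ ⟨σ b, hab.2⟩ ha hb]; rfl
      · rfl
    refine ⟨σ ⁻¹' N, σ.continuous.continuousAt hN, fun a ha b hb d hd => ?_⟩
    rw [h0 a ha d hd, h0 a ha b hb, h0 b hb d hd, add_zero]
  · obtain ⟨N, hN, hNS, h⟩ := c.additive ⟨σ t₀, h₀⟩
    obtain ⟨r, hr, hball⟩ := Metric.mem_nhds_iff.1 (σ.continuous.continuousAt hN)
    refine ⟨Metric.ball t₀ r, Metric.ball_mem_nhds _ hr, fun a ha b hb d hd => ?_⟩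
    have hreg : ∀ a ∈ Metric.ball t₀ r, σ a ∉ S := fun a ha => hNS (hball ha)
    let g : unitInterval → Simplex i := fun s => ⟨AffineMap.lineMap a.1 b.1 (s : ℝ),
      (convex_stdSimplex ℝ _).lineMap_mem a.2 b.2 s.2⟩
    have hgc : Continuous g := by
      refine Continuous.subtype_mk ?_ _
      simp only [AffineMap.lineMap_apply_module]
      fun_prop
    have hg : ∀ s, g s ∈ Metric.ball t₀ r := fun s =>
      (convex_ball t₀.1 r).lineMap_mem (x := a.1) (y := b.1) ha hb s.2
    let δ : Path (⟨a, hreg a ha⟩ : Regular S σ) ⟨b, hreg b hb⟩ :=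
      ⟨⟨fun s => ⟨g s, hreg _ (hg s)⟩, hgc.subtype_mk _⟩,
        Subtype.ext (Subtype.ext (by simp [g])), Subtype.ext (Subtype.ext (by simp [g]))⟩
    rw [c.onSimplex_of_notMem v (hreg a ha) (hreg d hd),
      c.onSimplex_of_notMem v (hreg a ha) (hreg b hb),
      c.onSimplex_of_notMem v (hreg b hb) (hreg d hd), ← v.2 _ _ δ]
    exact h _ _ ⟨σ d, hreg d hd⟩ (δ.map (regularMap S σ).continuous) (fun s => hball (hg s))
      (hball hd) _

theorem exists_primitive {i : ℕ} (σ : C(Simplex i, P1)) (v : Coefficient L σ) :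
    ∃ F, IsPrimitive (c.onSimplex σ v) F :=
  exists_isPrimitive (convex_stdSimplex ℝ _) (isCompact_stdSimplex ℝ _) (c.isLocallyAdditive_onSimplex σ v)

instance (i : ℕ) : PreconnectedSpace (Simplex i) :=
  Subtype.preconnectedSpace (convex_stdSimplex ℝ (Fin (i + 1))).isPreconnected

/-- The integral of a local cocycle along a path with coefficients. -/
noncomputable def integral (σ : C(Simplex 1, P1)) : Coefficient L σ →ₗ[ℂ] ℂ where
  toFun v := (c.exists_primitive σ v).choose (stdSimplex.vertex 1) -
    (c.exists_primitive σ v).choose (stdSimplex.vertex 0)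
  map_add' v w := by
    have h1 := (c.exists_primitive σ (v + w)).choose_spec
    have h2 := (c.exists_primitive σ v).choose_spec.add (c.exists_primitive σ w).choose_spec
    simp only [← onSimplex_add] at h2
    rw [h1.sub_eq h2]
    ring
  map_smul' k v := by
    have h1 := (c.exists_primitive σ (k • v)).choose_spec
    have h2 : IsPrimitive (c.onSimplex σ (k • v)) fun t => k * (c.exists_primitive σ v).choose t := by
      intro x
      obtain ⟨N, hN, h⟩ := (c.exists_primitive σ v).choose_spec x
      exact ⟨N, hN, fun a ha b hb => by rw [onSimplex_smul, ← h a ha b hb, mul_sub]⟩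
    rw [h1.sub_eq h2, RingHom.id_apply, smul_eq_mul]
    ring

theorem integral_eq (σ : C(Simplex 1, P1)) (v : Coefficient L σ) {F : Simplex 1 → ℂ}
    (hF : IsPrimitive (c.onSimplex σ v) F) :
    c.integral σ v = F (stdSimplex.vertex 1) - F (stdSimplex.vertex 0) :=
  (c.exists_primitive σ v).choose_spec.sub_eq hF _ _

open Classical in
/-- The integral of a local cocycle along a chain. -/
noncomputable def chainIntegral : Chain L 1 →ₗ[ℂ] ℂ := DFinsupp.lsum ℂ fun σ => c.integral σ

open Classical in
theorem chainIntegral_single (σ : C(Simplex 1, P1)) (v : Coefficient L σ) :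
    c.chainIntegral (DFinsupp.single σ v) = c.integral σ v := by
  simp [chainIntegral]

open Classical in
theorem chainIntegral_eq_sum (ξ : Chain L 1) :
    c.chainIntegral ξ = ∑ σ ∈ ξ.support, c.integral σ (ξ σ) := by
  conv_lhs => rw [← DFinsupp.sum_single (f := ξ)]
  rw [DFinsupp.sum, map_sum]
  exact Finset.sum_congr rfl fun σ _ => c.chainIntegral_single _ _

open Classical in
theorem boundary_single (L : LocalSystem.{u} S) {i : ℕ} (σ : C(Simplex (i + 1), P1))
    (v : Coefficient L σ) :
    boundary L i (DFinsupp.single σ v) = ∑ k : Fin (i + 2), ((-1 : ℂ) ^ (k : ℕ)) •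
      (DFinsupp.single (σ.comp (faceMap i k)) (restrictFace L σ k v) : Chain L i) := by
  simp [boundary]

theorem faceMap_vertex (i : ℕ) (k : Fin (i + 2)) (j : Fin (i + 1)) :
    faceMap i k (stdSimplex.vertex j) = stdSimplex.vertex (k.succAbove j) :=
  stdSimplex.map_vertex _ _

/-- A primitive on the triangle restricts to primitives on the three faces, and the differences of
its values at the vertices cancel. The triangle may pass through `S`: the cocycle is zero there, so
the primitive exists all the same. -/
theorem chainIntegral_boundary (ζ : Chain L 2) : c.chainIntegral (boundary L 1 ζ) = 0 := by
  classical
  induction ζ using DFinsupp.induction with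
  | h0 => simp
  | ha σ v ζ _ _ ih =>
    rw [map_add, map_add, ih, add_zero, boundary_single]
    obtain ⟨F, hF⟩ := c.exists_primitive σ v
    have h : ∀ k : Fin 3, c.integral (σ.comp (faceMap 1 k)) (restrictFace L σ k v) =
        F (stdSimplex.vertex (k.succAbove 1)) - F (stdSimplex.vertex (k.succAbove 0)) := by
      intro k
      rw [← faceMap_vertex, ← faceMap_vertex]
      exact c.integral_eq (σ.comp (faceMap 1 k)) (restrictFace L σ k v)
        (hF.comp (faceMap 1 k).continuous)
    simp only [map_sum, map_smul, chainIntegral_single, h]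
    rw [Fin.sum_univ_three]
    have h0 : (0 : Fin 3).succAbove (0 : Fin 2) = 1 := rfl
    have h1 : (0 : Fin 3).succAbove (1 : Fin 2) = 2 := rfl
    have h2 : (1 : Fin 3).succAbove (0 : Fin 2) = 0 := rfl
    have h3 : (1 : Fin 3).succAbove (1 : Fin 2) = 2 := rfl
    have h4 : (2 : Fin 3).succAbove (0 : Fin 2) = 0 := rfl
    have h5 : (2 : Fin 3).succAbove (1 : Fin 2) = 1 := rfl
    simp [h0, h1, h2, h3, h4, h5]

end LocalCocycle

end DeligneMostow
namespace DeligneMostow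
open Complex CategoryTheory Filter Topology

/-! ### The crossing number of two segments -/

/-- The signed number of crossings of the segment from `x` to `y` with the segment from `r` to `s`,
in terms of the angles between the end points. -/
noncomputable def cross (x y r s : ℂ) : ℝ :=
  -(ang y r s - ang x r s - ang s x y + ang r x y) / (2 * Real.pi)

theorem cross_self (x r s : ℂ) : cross x x r s = 0 := by simp [cross, ang_self]

theorem cross_add {x y z r s : ℂ} (hs : ang s x y + ang s y z = ang s x z)
    (hr : ang r x y + ang r y z = ang r x z) : cross x y r s + cross y z r s = cross x z r s := by
  rw [cross, cross, cross, ← hs, ← hr]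
  ring

/-- The four quotients whose arguments occur multiply, with these signs, to `1`. The combination of
angles is thus a multiple of `2π`. -/
theorem exists_int_cross {x y r s : ℂ} (hxr : x ≠ r) (hxs : x ≠ s) (hyr : y ≠ r) (hys : y ≠ s) :
    ∃ n : ℤ, cross x y r s = n := by
  have h : exp (I * (ang y r s - ang x r s - ang s x y + ang r x y : ℝ)) = 1 := by
    have e : I * (ang y r s - ang x r s - ang s x y + ang r x y : ℝ) =
        I * ang y r s + -(I * ang x r s) + -(I * ang s x y) + I * ang r x y := by
      push_cast; ring
    rw [e, exp_add, exp_add, exp_add, exp_neg, exp_neg, exp_ang hyr.symm hys.symm,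
      exp_ang hxr.symm hxs.symm, exp_ang hxs hys, exp_ang hxr hyr, norm_sub_rev s y,
      norm_sub_rev r y, norm_sub_rev s x, norm_sub_rev r x]
    have h1 := sub_ne_zero.2 hxr
    have h2 := sub_ne_zero.2 hxs
    have h3 := sub_ne_zero.2 hyr
    have h4 := sub_ne_zero.2 hys
    rw [← neg_sub y s, ← neg_sub y r, ← neg_sub x s, ← neg_sub x r]
    have n1 : (‖x - r‖ : ℂ) ≠ 0 := by exact_mod_cast norm_ne_zero_iff.2 h1
    have n2 : (‖x - s‖ : ℂ) ≠ 0 := by exact_mod_cast norm_ne_zero_iff.2 h2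
    have n3 : (‖y - r‖ : ℂ) ≠ 0 := by exact_mod_cast norm_ne_zero_iff.2 h3
    have n4 : (‖y - s‖ : ℂ) ≠ 0 := by exact_mod_cast norm_ne_zero_iff.2 h4
    push_cast
    rw [neg_div_neg_eq, neg_div_neg_eq]
    field_simp
  obtain ⟨n, hn⟩ := Complex.exp_eq_one_iff.1 h
  refine ⟨-n, ?_⟩
  have h2 : ((ang y r s - ang x r s - ang s x y + ang r x y : ℝ) : ℂ) = (n * (2 * Real.pi) : ℝ) := by
    refine mul_left_cancel₀ I_ne_zero ?_
    rw [hn]; push_cast; ring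
  rw [cross, Complex.ofReal_injective h2]
  have := Real.pi_ne_zero
  push_cast
  field_simp

theorem eq_of_continuous_of_int {f : unitInterval → ℝ} (hf : Continuous f)
    (h : ∀ t, ∃ n : ℤ, f t = n) (s t : unitInterval) : f s = f t := by
  choose g hg using h
  have hgc : Continuous g := by
    rw [Int.isClosedEmbedding_coe_real.isEmbedding.continuous_iff]
    have : ((↑) : ℤ → ℝ) ∘ g = f := funext fun t => (hg t).symm
    rwa [this]
  rw [hg, hg, PreconnectedSpace.constant inferInstance hgc (x := s) (y := t)]

/-- Let the second end point run from `x` to `y`. No angle reaches the cut, so the crossing number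
is continuous; being an integer it keeps its initial value zero. -/
theorem cross_eq_zero_of_disjoint {x y r s : ℂ} (h : Disjoint (segment ℝ x y) (segment ℝ r s)) :
    cross x y r s = 0 := by
  have hd : ∀ p ∈ segment ℝ x y, ∀ q ∈ segment ℝ r s, p ≠ q := fun p hp q hq hpq =>
    Set.disjoint_left.1 h hp (hpq ▸ hq)
  have hr := left_mem_segment ℝ r s
  have hs := right_mem_segment ℝ r s
  have hx := left_mem_segment ℝ x y
  have hl := lineC_mem_segment x y
  have hv : ∀ v ∈ segment ℝ r s, ∀ t, (lineC x y t - v) / (x - v) ∈ slitPlane := fun v hv t =>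
    div_mem_slitPlane_of_notMem_segment fun h => hd v
      ((convex_segment x y).segment_subset hx (hl t) h) v hv rfl
  have hc : Continuous fun t => cross x (lineC x y t) r s := by
    refine Continuous.div_const (Continuous.neg (Continuous.add (Continuous.sub (Continuous.sub
      ?_ continuous_const) ?_) ?_)) _
    · refine continuous_iff_continuousAt.2 fun t => ?_
      have h1 : (s - lineC x y t) / (r - lineC x y t) ∈ slitPlane :=
        div_mem_slitPlane_of_notMem_segment fun h => hd _ (hl t) _ h rfl
      refine (Complex.continuousAt_arg h1).comp
        (f := fun t => (s - lineC x y t) / (r - lineC x y t)) (ContinuousAt.div (by fun_prop)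
        (by fun_prop) (sub_ne_zero.2 (hd _ (hl t) _ hr).symm))
    · exact continuous_iff_continuousAt.2 fun t => (continuousAt_ang_right (hv s hs t)).comp
        (f := lineC x y) (lineC x y).continuous.continuousAt
    · exact continuous_iff_continuousAt.2 fun t => (continuousAt_ang_right (hv r hr t)).comp
        (f := lineC x y) (lineC x y).continuous.continuousAt
  have := eq_of_continuous_of_int hc (fun t => exists_int_cross (hd _ hx _ hr) (hd _ hx _ hs)
    (hd _ (hl t) _ hr) (hd _ (hl t) _ hs)) 1 0
  simpa [cross_self] using this

theorem ang_neg {v x y : ℂ} (h : (starRingEnd ℂ (x - v) * (y - v)).im < 0) : 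
    -Real.pi < ang v x y ∧ ang v x y < 0 := by
  refine ⟨Complex.neg_pi_lt_arg _, Complex.arg_neg_iff.2 ?_⟩
  have h0 : x - v ≠ 0 := fun h0 => by simp [h0] at h
  have : (y - v) / (x - v) = ((normSq (x - v))⁻¹ : ℝ) * (starRingEnd ℂ (x - v) * (y - v)) := by
    rw [div_eq_mul_inv, Complex.inv_def]; push_cast; ring
  rw [this, im_ofReal_mul]
  exact mul_neg_of_pos_of_neg (inv_pos.2 (normSq_pos.2 h0)) h

theorem ang_pos {v x y : ℂ} (h : 0 < (starRingEnd ℂ (x - v) * (y - v)).im) :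
    0 < ang v x y ∧ ang v x y < Real.pi := by
  have h0 : x - v ≠ 0 := fun h0 => by simp [h0] at h
  have : (y - v) / (x - v) = ((normSq (x - v))⁻¹ : ℝ) * (starRingEnd ℂ (x - v) * (y - v)) := by
    rw [div_eq_mul_inv, Complex.inv_def]; push_cast; ring
  have him : 0 < ((y - v) / (x - v)).im := by
    rw [this, im_ofReal_mul]
    exact mul_pos (inv_pos.2 (normSq_pos.2 h0)) h
  refine ⟨lt_of_le_of_ne (Complex.arg_nonneg_iff.2 him.le) fun h1 => ?_,
    lt_of_le_of_ne (Complex.arg_le_pi _) fun h1 => ?_⟩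
  · have := (Complex.arg_eq_zero_iff.1 h1.symm).2; rw [this] at him; exact lt_irrefl _ him
  · have := (Complex.arg_eq_pi_iff.1 h1).2; rw [this] at him; exact lt_irrefl _ him

/-- Two segments that cross. -/
theorem cross_of_crossing {x y r s : ℂ} {t u : ℝ} (ht : t ∈ Set.Ioo (0 : ℝ) 1)
    (hu : u ∈ Set.Ioo (0 : ℝ) 1) (hp : x + t * (y - x) = r + u * (s - r))
    (hd : (starRingEnd ℂ (y - x) * (s - r)).im ≠ 0) :
    cross x y r s = Real.sign (starRingEnd ℂ (y - x) * (s - r)).im := by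
  obtain ⟨ht0, ht1⟩ := ht
  obtain ⟨hu0, hu1⟩ := hu
  set δ := (starRingEnd ℂ (y - x) * (s - r)).im with hδ
  have hr : r = x + t * (y - x) - u * (s - r) := by rw [hp]; ring
  have hre := congrArg re hp
  have him := congrArg im hp
  simp at hre him
  -- The sine of each of the four angles is a positive multiple of `δ` or `-δ`, which confines the
  -- angle to `(0, π)` or `(-π, 0)`. The crossing number is then an integer strictly between `0` and
  -- `2`, or between `-2` and `0`.
  have h1 : (starRingEnd ℂ (r - y) * (s - y)).im = -((1 - t) * δ) := by
    rw [hδ]; simp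
    linear_combination (s.re - r.re) * him - (s.im - r.im) * hre
  have h2 : (starRingEnd ℂ (r - x) * (s - x)).im = t * δ := by
    rw [hδ]; simp
    linear_combination (s.re - r.re) * him - (s.im - r.im) * hre
  have h3 : (starRingEnd ℂ (x - s) * (y - s)).im = (1 - u) * δ := by
    rw [hδ]; simp
    linear_combination (y.im - x.im) * hre - (y.re - x.re) * him
  have h4 : (starRingEnd ℂ (x - r) * (y - r)).im = -(u * δ) := by
    rw [hδ]; simp
    linear_combination (y.im - x.im) * hre - (y.re - x.re) * him
  have hne : ∀ {a b c : ℂ}, (starRingEnd ℂ (a - c) * (b - c)).im ≠ 0 → a ≠ c ∧ b ≠ c := by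
    intro a b c h
    exact ⟨fun h' => h (by simp [h']), fun h' => h (by simp [h'])⟩
  have p1 : 0 < 1 - t := by linarith
  have p2 : 0 < 1 - u := by linarith
  obtain ⟨e1, e2⟩ := hne (a := r) (b := s) (c := y) (by
    rw [h1]; exact neg_ne_zero.2 (mul_ne_zero p1.ne' hd))
  obtain ⟨e3, e4⟩ := hne (a := r) (b := s) (c := x) (by rw [h2]; exact mul_ne_zero ht0.ne' hd)
  obtain ⟨n, hn⟩ := exists_int_cross e3.symm e4.symm e1.symm e2.symm
  have hpi := Real.pi_pos
  have hn' : -(ang y r s - ang x r s - ang s x y + ang r x y) = n * (2 * Real.pi) := by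
    rw [← hn, cross]; field_simp
  have p3 : (0 : ℝ) ≤ 2 * Real.pi := by linarith
  rcases lt_or_gt_of_ne hd with hlt | hgt
  · have a1 := ang_pos (v := y) (x := r) (y := s)
      (by rw [h1]; exact neg_pos.2 (mul_neg_of_pos_of_neg p1 hlt))
    have a2 := ang_neg (v := x) (x := r) (y := s)
      (by rw [h2]; exact mul_neg_of_pos_of_neg ht0 hlt)
    have a3 := ang_neg (v := s) (x := x) (y := y)
      (by rw [h3]; exact mul_neg_of_pos_of_neg p2 hlt)
    have a4 := ang_pos (v := r) (x := x) (y := y)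
      (by rw [h4]; exact neg_pos.2 (mul_neg_of_pos_of_neg hu0 hlt))
    rw [Real.sign_of_neg hlt, hn]
    have b1 : (n : ℝ) < 0 := lt_of_mul_lt_mul_right (a := 2 * Real.pi) (by linarith) p3
    have b2 : (-2 : ℝ) < n := lt_of_mul_lt_mul_right (a := 2 * Real.pi) (by linarith) p3
    have c1 : n < 0 := by exact_mod_cast b1
    have c2 : -2 < n := by exact_mod_cast b2
    have : n = -1 := by omega
    rw [this]; norm_num
  · have a1 := ang_neg (v := y) (x := r) (y := s)
      (by rw [h1]; exact neg_neg_of_pos (mul_pos p1 hgt))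
    have a2 := ang_pos (v := x) (x := r) (y := s) (by rw [h2]; exact mul_pos ht0 hgt)
    have a3 := ang_pos (v := s) (x := x) (y := y) (by rw [h3]; exact mul_pos p2 hgt)
    have a4 := ang_neg (v := r) (x := x) (y := y)
      (by rw [h4]; exact neg_neg_of_pos (mul_pos hu0 hgt))
    rw [Real.sign_of_pos hgt, hn]
    have b1 : (0 : ℝ) < n := lt_of_mul_lt_mul_right (a := 2 * Real.pi) (by linarith) p3
    have b2 : (n : ℝ) < 2 := lt_of_mul_lt_mul_right (a := 2 * Real.pi) (by linarith) p3
    have c1 : 0 < n := by exact_mod_cast b1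
    have c2 : n < 2 := by exact_mod_cast b2
    have : n = 1 := by omega
    rw [this]; norm_num

end DeligneMostow
namespace DeligneMostow
open Complex CategoryTheory Filter Topology

/-! ### The crossing cocycle of a polygonal cycle -/

open Classical in
/-- A polygonal cycle: segments with the coordinates of flat sections at their starting points. -/
structure PolyCycle {S : Set P1} {L : LocalSystem.{u} S} (C : Config L) (κ : Type*) where
  T : Finset κ
  r : κ → ℂ
  s : κ → ℂ
  w : κ → ℂ
  segment_subset : ∀ τ ∈ T, segment ℝ (r τ) (s τ) ⊆ fin S
  cycle : ∀ x₀, ∑ τ ∈ T, ((if s τ = x₀ then w τ * C.E (r τ) (s τ) else 0) -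
    if r τ = x₀ then w τ else 0) = 0

namespace Config

variable {S : Set P1} {L : LocalSystem.{u} S} (C : Config L)

theorem isClosed (C : Config L) : IsClosed S := by
  have : S ⊆ insert OnePoint.infty ((fun j => (C.z j : P1)) '' Set.Iio C.m) := by
    intro x hx
    induction x using OnePoint.rec with
    | infty => exact Or.inl rfl
    | coe x =>
      obtain ⟨j, hj, rfl⟩ := (C.mem_iff x).1 hx
      exact Or.inr ⟨j, hj, rfl⟩
  exact ((((Set.finite_Iio C.m).image _).insert _).subset this).isClosed

theorem norm_E (x y : ℂ) : ‖C.E x y‖ = 1 := norm_mult _ _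

theorem E_self (x : ℂ) : C.E x x = 1 := mult_self _

theorem E_mul_conj (x y : ℂ) : C.E x y * starRingEnd ℂ (C.E x y) = 1 := mult_mul_conj _ _

/-- For each singular point one half plane contains both the segment and a small ball around `p`.
Hence multipliers also compose between the distant point `r` and points of the ball off the segment.
-/
theorem exists_ball_E {r s p : ℂ} (h : segment ℝ r s ⊆ fin S) (hp : p ∈ segment ℝ r s) :
    ∀ᶠ ρ in 𝓝[>] (0 : ℝ), Metric.ball p ρ ⊆ fin S ∧ ∀ x ∈ Metric.ball p ρ,
      C.E r p * C.E p x = C.E r x ∧ ∀ y ∈ Metric.ball p ρ, C.E r x * C.E x y = C.E r y ∧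
        C.E p x * C.E x y = C.E p y := by
  have h1 : ∀ᶠ ρ in 𝓝[>] (0 : ℝ), ∀ j ∈ Finset.range C.m, ∃ u, r ∈ halfPlane (C.z j) u ∧
      Metric.ball p ρ ⊆ halfPlane (C.z j) u := by
    rw [Filter.eventually_all_finset]
    intro j hj
    obtain ⟨u, hu⟩ := exists_segment_subset_halfPlane (C.notMem_segment h j (Finset.mem_range.1 hj))
    obtain ⟨ρ₀, hρ₀, hball⟩ := Metric.isOpen_iff.1 (isOpen_halfPlane (C.z j) u) p (hu hp)
    filter_upwards [Ioo_mem_nhdsGT hρ₀] with ρ hρ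
    exact ⟨u, hu (left_mem_segment ℝ r s), (Metric.ball_subset_ball hρ.2.le).trans hball⟩
  obtain ⟨ρ₀, hρ₀, hball⟩ := Metric.isOpen_iff.1 C.isOpen_fin p (h hp)
  filter_upwards [h1, Ioo_mem_nhdsGT hρ₀] with ρ h1 hρ
  have hpp : p ∈ Metric.ball p ρ := Metric.mem_ball_self hρ.1
  refine ⟨(Metric.ball_subset_ball hρ.2.le).trans hball, fun x hx => ⟨mult_mul fun j hj => ?_,
    fun y hy => ⟨mult_mul fun j hj => ?_, mult_mul fun j hj => ?_⟩⟩⟩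
  all_goals obtain ⟨u, hu1, hu2⟩ := h1 j (Finset.mem_range.2 hj)
  · exact ang_add hu1 (hu2 hpp) (hu2 hx)
  · exact ang_add hu1 (hu2 hx) (hu2 hy)
  · exact ang_add (hu2 hpp) (hu2 hx) (hu2 hy)

end Config

theorem eventually_ang_add {v p : ℂ} (h : p ≠ v) : ∀ᶠ ρ in 𝓝[>] (0 : ℝ),
    ∀ x ∈ Metric.ball p ρ, ∀ y ∈ Metric.ball p ρ, ∀ z ∈ Metric.ball p ρ,
      ang v x y + ang v y z = ang v x z := by
  filter_upwards [Ioo_mem_nhdsGT (norm_pos_iff.2 (sub_ne_zero.2 h))] with ρ hρ x hx y hy z hz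
  have := ball_subset_halfPlane hρ.2.le h
  exact ang_add (this hx) (this hy) (this hz)

theorem eventually_cross_eq_zero {r s p : ℂ} (h : p ∉ segment ℝ r s) : ∀ᶠ ρ in 𝓝[>] (0 : ℝ),
    ∀ x ∈ Metric.ball p ρ, ∀ y ∈ Metric.ball p ρ, cross x y r s = 0 := by
  have hc : IsClosed (segment ℝ r s) := by
    rw [segment_eq_image']; exact (isCompact_Icc.image (by fun_prop)).isClosed
  obtain ⟨ρ₀, hρ₀, hball⟩ := Metric.isOpen_iff.1 hc.isOpen_compl p h
  filter_upwards [Ioo_mem_nhdsGT hρ₀] with ρ hρ x hx y hy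
  refine cross_eq_zero_of_disjoint (Set.disjoint_left.2 fun q hq => hball
    (Metric.ball_subset_ball hρ.2.le ((convex_ball p ρ).segment_subset hx hy hq)))

namespace PolyCycle

variable {S : Set P1} {L : LocalSystem.{u} S} {C : Config L} {κ : Type*} (η : PolyCycle C κ)

/-- The crossing cocycle in coordinates. -/
noncomputable def val (x y : ℂ) : ℂ :=
  ∑ τ ∈ η.T, (cross x y (η.r τ) (η.s τ) : ℂ) * starRingEnd ℂ (η.w τ * C.E (η.r τ) x)

theorem eventually_val_eq_zero {p : ℂ} (h : ∀ τ ∈ η.T, p ∉ segment ℝ (η.r τ) (η.s τ)) :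
    ∀ᶠ ρ in 𝓝[>] (0 : ℝ), ∀ x ∈ Metric.ball p ρ, ∀ y ∈ Metric.ball p ρ, η.val x y = 0 := by
  have : ∀ᶠ ρ in 𝓝[>] (0 : ℝ), ∀ τ ∈ η.T, ∀ x ∈ Metric.ball p ρ, ∀ y ∈ Metric.ball p ρ,
      cross x y (η.r τ) (η.s τ) = 0 := by
    rw [Filter.eventually_all_finset]
    exact fun τ hτ => eventually_cross_eq_zero (h τ hτ)
  filter_upwards [this] with ρ h x hx y hy
  exact Finset.sum_eq_zero fun τ hτ => by rw [h τ hτ x hx y hy]; simp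

open Classical in
/-- The contribution of one segment, without the part that is singular at `p`. -/
noncomputable def part (p : ℂ) (τ : κ) (x y : ℂ) : ℂ :=
  (cross x y (η.r τ) (η.s τ) : ℂ) * starRingEnd ℂ (η.w τ * C.E (η.r τ) x) -
    ((ang p x y / (2 * Real.pi) : ℝ) : ℂ) * starRingEnd ℂ
      (((if η.s τ = p then η.w τ * C.E (η.r τ) (η.s τ) else 0) - if η.r τ = p then η.w τ else 0) *
        C.E p x)

/-- In `cross` the angles seen from `x` and `y` form a coboundary, and the angles seen from `r` and
`s` are additive near `p` unless that end point is `p`. Exactly the angle at `p` has been subtracted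
in `part`; what remains is additive. -/
theorem eventually_part_add {p : ℂ} {τ : κ} (hτ : τ ∈ η.T) :
    ∀ᶠ ρ in 𝓝[>] (0 : ℝ), ∀ x ∈ Metric.ball p ρ, ∀ y ∈ Metric.ball p ρ, ∀ z ∈ Metric.ball p ρ,
      η.part p τ x z = η.part p τ x y + C.E x y * η.part p τ y z := by
  classical
  by_cases hps : p ∈ segment ℝ (η.r τ) (η.s τ)
  · have h1 : ∀ v, ∀ᶠ ρ in 𝓝[>] (0 : ℝ), v ≠ p → ∀ x ∈ Metric.ball p ρ, ∀ y ∈ Metric.ball p ρ,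
        ∀ z ∈ Metric.ball p ρ, ang v x y + ang v y z = ang v x z := by
      intro v
      by_cases hv : v = p
      · exact Filter.Eventually.of_forall fun _ h => absurd hv h
      · filter_upwards [eventually_ang_add (Ne.symm hv)] with ρ h _
        exact h
    filter_upwards [C.exists_ball_E (η.segment_subset τ hτ) hps, h1 (η.r τ), h1 (η.s τ)] with
      ρ hE hr hs x hx y hy z hz
    obtain ⟨_, hE⟩ := hE
    let B : ℂ → ℂ → ℝ := fun x y => (-(ang y (η.r τ) (η.s τ) - ang x (η.r τ) (η.s τ)) +
      ((if η.s τ = p then 0 else ang (η.s τ) x y) - if η.r τ = p then 0 else ang (η.r τ) x y)) /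
      (2 * Real.pi)
    have hpart : ∀ x ∈ Metric.ball p ρ, ∀ y, η.part p τ x y =
        B x y * starRingEnd ℂ (η.w τ * C.E (η.r τ) x) := by
      intro x hx y
      have e1 := (hE x hx).1
      simp only [part, B, cross]
      split_ifs with hs' hr' hr'
      · rw [hs', hr'] at *; rw [C.E_self]; push_cast; simp
      · rw [hs'] at *; rw [sub_zero, mul_assoc, e1]; push_cast; ring
      · rw [hr'] at *; rw [zero_sub]; push_cast; simp; ring
      · simp only [sub_zero, zero_mul, map_zero, mul_zero]
        push_cast
        ring
    have hB : B x y + B y z = B x z := by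
      simp only [B]
      split_ifs with hs' hr' hr'
      · ring
      · rw [← hr hr' x hx y hy z hz]; ring
      · rw [← hs hs' x hx y hy z hz]; ring
      · rw [← hr hr' x hx y hy z hz, ← hs hs' x hx y hy z hz]; ring
    have e2 := ((hE x hx).2 y hy).1
    rw [hpart x hx, hpart x hx, hpart y hy, ← hB, ← e2]
    push_cast
    simp only [map_mul]
    linear_combination (-(B y z : ℂ) * starRingEnd ℂ (η.w τ) * starRingEnd ℂ (C.E (η.r τ) x)) *
      C.E_mul_conj x y
  · have hr : η.r τ ≠ p := fun h => hps (h ▸ left_mem_segment ℝ _ _)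
    have hs : η.s τ ≠ p := fun h => hps (h ▸ right_mem_segment ℝ _ _)
    filter_upwards [eventually_cross_eq_zero hps] with ρ h x hx y hy z hz
    simp [part, hr, hs, h x hx y hy, h x hx z hz, h y hy z hz]

/-- The subtracted terms all contain the same angle at `p`, multiplied by the boundary coefficient
of the cycle at `p`, and so they add up to zero. -/
theorem eventually_val_add (p : ℂ) :
    ∀ᶠ ρ in 𝓝[>] (0 : ℝ), ∀ x ∈ Metric.ball p ρ, ∀ y ∈ Metric.ball p ρ, ∀ z ∈ Metric.ball p ρ,
      η.val x z = η.val x y + C.E x y * η.val y z := by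
  classical
  have hv : ∀ x y, η.val x y = ∑ τ ∈ η.T, η.part p τ x y := by
    intro x y
    simp only [part, map_mul]
    rw [Finset.sum_sub_distrib, ← Finset.mul_sum, ← Finset.sum_mul, ← map_sum, η.cycle p]
    simp [val]
  have : ∀ᶠ ρ in 𝓝[>] (0 : ℝ), ∀ τ ∈ η.T, ∀ x ∈ Metric.ball p ρ, ∀ y ∈ Metric.ball p ρ,
      ∀ z ∈ Metric.ball p ρ, η.part p τ x z = η.part p τ x y + C.E x y * η.part p τ y z := by
    rw [Filter.eventually_all_finset]
    exact fun τ hτ => η.eventually_part_add hτ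
  filter_upwards [this] with ρ h x hx y hy z hz
  rw [hv, hv, hv, Finset.mul_sum, ← Finset.sum_add_distrib]
  exact Finset.sum_congr rfl fun τ hτ => h τ hτ x hx y hy z hz

/-- A bound for the points of a polygonal cycle. -/
noncomputable def bound : ℝ := ∑ τ ∈ η.T, (‖η.r τ‖ + ‖η.s τ‖) + 1

theorem bound_pos : 0 < η.bound := by unfold bound; positivity

theorem segment_subset_ball {τ : κ} (hτ : τ ∈ η.T) :
    segment ℝ (η.r τ) (η.s τ) ⊆ Metric.ball 0 η.bound := by
  have h := Finset.single_le_sum (f := fun τ => ‖η.r τ‖ + ‖η.s τ‖) (fun τ _ => by positivity) hτ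
  refine (convex_ball (0 : ℂ) η.bound).segment_subset ?_ ?_
  · rw [mem_ball_zero_iff, bound]; linarith [norm_nonneg (η.s τ)]
  · rw [mem_ball_zero_iff, bound]; linarith [norm_nonneg (η.r τ)]

open Classical in
/-- The crossing cocycle. -/
noncomputable def D (F : Frame C) (x y : Pt S) : L.fibre x →ₗ[ℂ] ℂ :=
  if ((x : P1) ≠ OnePoint.infty ∧ ‖coord x‖ < η.bound) ∧
      ((y : P1) ≠ OnePoint.infty ∧ ‖coord y‖ < η.bound) then
    η.val (coord x) (coord y) • F.co x else 0

/-- Away from the cycle there are no crossings. The cut-off at `bound` gives the same at `∞`, where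
coordinates have no meaning. -/
theorem exists_D_eq_zero (F : Frame C) {p : P1}
    (h : ∀ τ ∈ η.T, ∀ q ∈ segment ℝ (η.r τ) (η.s τ), p ≠ (q : P1)) :
    ∃ N ∈ 𝓝 p, ∀ x y : Pt S, (x : P1) ∈ N → (y : P1) ∈ N → η.D F x y = 0 := by
  induction p using OnePoint.rec with
  | infty =>
    refine ⟨_, (isOpen_nearInfty η.bound).mem_nhds (infty_mem_nearInfty η.bound_pos),
      fun x y hx hy => if_neg ?_⟩
    rintro ⟨⟨h1, h2⟩, -⟩
    rw [← coe_coord h1, coe_mem_nearInfty η.bound_pos] at hx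
    exact lt_asymm hx h2
  | coe p =>
    obtain ⟨ρ, hρ, hρ0⟩ := ((η.eventually_val_eq_zero (p := p) fun τ hτ hp =>
      h τ hτ p hp rfl).and self_mem_nhdsWithin).exists
    refine ⟨_, isOpenEmbedding_coe_P1.isOpenMap.image_mem_nhds (Metric.ball_mem_nhds p hρ0), ?_⟩
    rintro x y ⟨a, ha, hxa⟩ ⟨b, hb, hyb⟩
    unfold D
    rw [← hxa, ← hyb, coord_coe, coord_coe, hρ a ha b hb, zero_smul, ite_self]

/-- The crossing cocycle of a polygonal cycle. -/
noncomputable def cocycle (F : Frame C) : LocalCocycle L where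
  D := η.D F
  vanish s hs := η.exists_D_eq_zero F fun τ hτ q hq h => η.segment_subset τ hτ hq (h ▸ hs)
  additive := by
    rintro ⟨p, hpS⟩
    -- At a point of the cycle a small ball avoids both `S` and the cut-off, and the additivity of
    -- `val` applies; elsewhere the cocycle is locally zero.
    by_cases hp : ∃ τ ∈ η.T, ∃ q ∈ segment ℝ (η.r τ) (η.s τ), p = (q : P1)
    · obtain ⟨τ, hτ, q, hq, rfl⟩ := hp
      have hq1 := η.segment_subset_ball hτ hq
      have hq2 : q ∈ fin S := η.segment_subset τ hτ hq
      obtain ⟨ρ₀, hρ₀, hball⟩ := Metric.isOpen_iff.1 Metric.isOpen_ball q hq1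
      obtain ⟨ρ₁, hρ₁, hball'⟩ := Metric.isOpen_iff.1 C.isOpen_fin q hq2
      obtain ⟨ρ, ⟨⟨hρ, hlt⟩, hlt'⟩, hρ0⟩ := (((η.eventually_val_add q).and
        (Ioo_mem_nhdsGT hρ₀)).and (Ioo_mem_nhdsGT hρ₁)).and self_mem_nhdsWithin |>.exists
      have hb : Metric.ball q ρ ⊆ fin S := (Metric.ball_subset_ball hlt'.2.le).trans hball'
      refine ⟨_, isOpenEmbedding_coe_P1.isOpenMap.image_mem_nhds (Metric.ball_mem_nhds q hρ0), ?_,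
        ?_⟩
      · rintro _ ⟨a, ha, rfl⟩
        exact hb ha
      · intro x y z γ hγ hz v
        have key : ∀ x ∈ ((↑) : ℂ → P1) '' Metric.ball q ρ, coord x ∈ Metric.ball q ρ ∧
            (x ≠ OnePoint.infty ∧ ‖coord x‖ < η.bound) := by
          rintro _ ⟨a, ha, rfl⟩
          exact ⟨ha, OnePoint.coe_ne_infty _, mem_ball_zero_iff.1
            (hball (Metric.ball_subset_ball hlt.2.le ha))⟩
        have hx : (x : P1) ∈ ((↑) : ℂ → P1) '' Metric.ball q ρ := by
          have := hγ 0; rwa [γ.source] at this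
        have hy : (y : P1) ∈ ((↑) : ℂ → P1) '' Metric.ball q ρ := by
          have := hγ 1; rwa [γ.target] at this
        unfold D
        rw [if_pos ⟨(key _ hx).2, (key _ hz).2⟩, if_pos ⟨(key _ hx).2, (key _ hy).2⟩,
          if_pos ⟨(key _ hy).2, (key _ hz).2⟩, hρ _ (key _ hx).1 _ (key _ hy).1 _ (key _ hz).1]
        simp only [LinearMap.smul_apply, smul_eq_mul]
        rw [F.co_transport (F.transport_e_of_ball hb γ fun t => ?_)]
        · ring
        · obtain ⟨w, hw, h⟩ := hγ t
          exact ⟨w, hw, h.symm⟩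
    · push Not at hp
      obtain ⟨N, hN, h⟩ := η.exists_D_eq_zero F hp
      refine ⟨N ∩ Sᶜ, inter_mem hN (C.isClosed.isOpen_compl.mem_nhds hpS),
        Set.inter_subset_right, ?_⟩
      intro x y z γ hγ hz v
      have hx : (x : P1) ∈ N := by have := (hγ 0).1; rwa [γ.source] at this
      have hy : (y : P1) ∈ N := by have := (hγ 1).1; rwa [γ.target] at this
      rw [h x z hx hz.1, h x y hx hy, h y z hy hz.1]
      simp

end PolyCycle

end DeligneMostow
namespace DeligneMostow
open Complex CategoryTheory Filter Topology

/-! ### Crossings of segments in general position -/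

theorem mem_segment_iff {a b p : ℂ} : p ∈ segment ℝ a b ↔ ∃ t ∈ Set.Icc (0 : ℝ) 1, p = a + t * (b - a) := by
  rw [segment_eq_image']
  constructor
  · rintro ⟨t, ht, rfl⟩
    exact ⟨t, ht, by simp⟩
  · rintro ⟨t, ht, rfl⟩
    exact ⟨t, ht, by simp⟩

theorem exists_mem_Ioo {a b p : ℂ} (hp : p ∈ segment ℝ a b) (ha : p ≠ a) (hb : p ≠ b) :
    ∃ t ∈ Set.Ioo (0 : ℝ) 1, p = a + t * (b - a) := by
  obtain ⟨t, ht, h⟩ := mem_segment_iff.1 hp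
  refine ⟨t, ⟨lt_of_le_of_ne ht.1 fun h0 => ha ?_, lt_of_le_of_ne ht.2 fun h1 => hb ?_⟩, h⟩
  · rw [h, ← h0]; simp
  · rw [h, h1]; simp

/-- No end point of one of the segments lies on the other one. -/
def GenPos (a b r s : ℂ) : Prop :=
  (r ∉ segment ℝ a b ∧ s ∉ segment ℝ a b) ∧ (a ∉ segment ℝ r s ∧ b ∉ segment ℝ r s)

theorem eq_real_mul_of_im_eq_zero {d f : ℂ} (hd : d ≠ 0) (h : (starRingEnd ℂ d * f).im = 0) :
    ∃ l : ℝ, f = l * d := by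
  refine ⟨(starRingEnd ℂ d * f).re / normSq d, ?_⟩
  have h1 : ((starRingEnd ℂ d * f).re : ℂ) = starRingEnd ℂ d * f := by
    apply Complex.ext <;> simp only [ofReal_re, ofReal_im]
    exact h.symm
  have h2 : (normSq d : ℂ) ≠ 0 := by exact_mod_cast (normSq_pos.2 hd).ne'
  rw [ofReal_div, h1, div_mul_eq_mul_div, eq_div_iff h2, ← mul_conj]
  ring

/-- Parallel segments with a common point lie on one line, and then an end point of one of them lies
on the other. -/
theorem GenPos.im_ne_zero {a b r s p : ℂ} (h : GenPos a b r s) (hrs : r ≠ s)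
    (hp : p ∈ segment ℝ a b) (hp' : p ∈ segment ℝ r s) :
    (starRingEnd ℂ (b - a) * (s - r)).im ≠ 0 := by
  obtain ⟨⟨hr, hs⟩, ha, hb⟩ := h
  obtain ⟨t, ⟨ht0, ht1⟩, h1⟩ := exists_mem_Ioo hp (fun h => ha (h ▸ hp')) (fun h => hb (h ▸ hp'))
  obtain ⟨u, ⟨hu0, hu1⟩, h2⟩ := exists_mem_Ioo hp' (fun h => hr (h ▸ hp)) (fun h => hs (h ▸ hp))
  intro h0
  have hd : b - a ≠ 0 := by
    intro h
    rw [h, mul_zero, add_zero] at h1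
    exact ha (h1 ▸ hp')
  obtain ⟨l, hl⟩ := eq_real_mul_of_im_eq_zero hd h0
  have hl0 : l ≠ 0 := by
    rintro rfl
    exact hrs (sub_eq_zero.1 (by rw [hl]; simp)).symm
  have hlC : (l : ℂ) ≠ 0 := by exact_mod_cast hl0
  -- In the coordinate on the line with `a` at `0` and `b` at `1`, neither `r` nor `s` lies in `[0,
  -- 1]`, but `p` lies between them. So `a` is between `r` and `s`, which is excluded.
  have er : r = a + ((t - u * l : ℝ) : ℂ) * (b - a) := by
    rw [hl] at h2; push_cast; linear_combination h1 - h2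
  have es : s = a + ((t + (1 - u) * l : ℝ) : ℂ) * (b - a) := by
    rw [hl] at h2; push_cast; linear_combination h1 - h2 + hl
  have ea : a = r + (((u * l - t) / l : ℝ) : ℂ) * (s - r) := by
    rw [hl]
    push_cast at er ⊢
    field_simp
    linear_combination -er
  have nr : ¬ (0 ≤ t - u * l ∧ t - u * l ≤ 1) := fun h => hr (mem_segment_iff.2 ⟨_, h, er⟩)
  have ns : ¬ (0 ≤ t + (1 - u) * l ∧ t + (1 - u) * l ≤ 1) :=
    fun h => hs (mem_segment_iff.2 ⟨_, h, es⟩)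
  have na : ¬ (0 ≤ (u * l - t) / l ∧ (u * l - t) / l ≤ 1) :=
    fun h => ha (mem_segment_iff.2 ⟨_, h, ea⟩)
  have hu1' : 0 < 1 - u := by linarith
  rcases lt_or_gt_of_ne hl0 with hneg | hpos
  · have p1 := mul_neg_of_pos_of_neg hu0 hneg
    have p2 := mul_neg_of_pos_of_neg hu1' hneg
    have q1 : 1 < t - u * l := by
      by_contra h; exact nr ⟨by linarith, by linarith⟩
    have q2 : t + (1 - u) * l < 0 := by
      by_contra h; exact ns ⟨by linarith, by linarith⟩
    refine na ⟨div_nonneg_of_nonpos (by linarith) hneg.le, ?_⟩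
    rw [div_le_one_of_neg hneg]
    linarith
  · have p1 := mul_pos hu0 hpos
    have p2 := mul_pos hu1' hpos
    have q1 : t - u * l < 0 := by
      by_contra h; exact nr ⟨by linarith, by linarith⟩
    have q2 : 1 < t + (1 - u) * l := by
      by_contra h; exact ns ⟨by linarith, by linarith⟩
    refine na ⟨div_nonneg (by linarith) hpos.le, ?_⟩
    rw [div_le_one hpos]
    linarith

theorem GenPos.cross_eq {a b r s p : ℂ} (h : GenPos a b r s) (hrs : r ≠ s)
    (hp : p ∈ segment ℝ a b) (hp' : p ∈ segment ℝ r s) :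
    cross a b r s = Real.sign (starRingEnd ℂ (b - a) * (s - r)).im := by
  have hd := h.im_ne_zero hrs hp hp'
  obtain ⟨⟨hr, hs⟩, ha, hb⟩ := h
  obtain ⟨t, ht, h1⟩ := exists_mem_Ioo hp (fun h => ha (h ▸ hp')) (fun h => hb (h ▸ hp'))
  obtain ⟨u, hu, h2⟩ := exists_mem_Ioo hp' (fun h => hr (h ▸ hp)) (fun h => hs (h ▸ hp))
  exact cross_of_crossing ht hu (h1.symm.trans h2) hd

theorem eq_of_mem_segments {a b r s p q : ℂ} (hd : (starRingEnd ℂ (b - a) * (s - r)).im ≠ 0)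
    (hp : p ∈ segment ℝ a b) (hp' : p ∈ segment ℝ r s) (hq : q ∈ segment ℝ a b)
    (hq' : q ∈ segment ℝ r s) : p = q := by
  obtain ⟨t, -, h1⟩ := mem_segment_iff.1 hp
  obtain ⟨t', -, h1'⟩ := mem_segment_iff.1 hq
  obtain ⟨u, -, h2⟩ := mem_segment_iff.1 hp'
  obtain ⟨u', -, h2'⟩ := mem_segment_iff.1 hq'
  have e : ((t - t' : ℝ) : ℂ) * (b - a) = ((u - u' : ℝ) : ℂ) * (s - r) := by
    push_cast; linear_combination h2 - h1 - h2' + h1'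
  have e2 : (t - t') * (starRingEnd ℂ (b - a) * (s - r)).im = 0 := by
    have : starRingEnd ℂ (((t - t' : ℝ) : ℂ) * (b - a)) * (s - r) =
        starRingEnd ℂ (((u - u' : ℝ) : ℂ) * (s - r)) * (s - r) := by rw [e]
    rw [map_mul, map_mul, conj_ofReal, conj_ofReal, mul_assoc, mul_assoc, mul_comm _ (s - r)] at this
    have := congrArg im this
    rw [im_ofReal_mul, mul_comm (starRingEnd ℂ (s - r)), mul_conj, im_ofReal_mul, ofReal_im, mul_zero, mul_comm (s - r)] at this
    exact this
  rcases mul_eq_zero.1 e2 with h | h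
  · rw [h1, h1', show t = t' by linarith]
  · exact absurd h hd

end DeligneMostow
namespace DeligneMostow
open Complex CategoryTheory Filter Topology

/-! ### Segments as singular simplices -/

theorem IsSegment.vertex_zero {σ : C(Simplex 1, P1)} {a b : ℂ} (h : IsSegment σ a b) :
    σ (stdSimplex.vertex 0) = (a : P1) := by
  rw [h.2]; simp

theorem IsSegment.vertex_one {σ : C(Simplex 1, P1)} {a b : ℂ} (h : IsSegment σ a b) :
    σ (stdSimplex.vertex 1) = (b : P1) := by
  rw [h.2]; simp

/-- The point of a segment with given barycentric coordinates. -/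
noncomputable def baryPoint (a b : ℂ) (t : Simplex 1) : ℂ := (t 0 : ℝ) * a + (t 1 : ℝ) * b

theorem baryPoint_eq (a b : ℂ) (t : Simplex 1) : baryPoint a b t = a + (t 1 : ℝ) * (b - a) := by
  have : (t 0 : ℝ) + t 1 = 1 := by
    have := t.2.2
    rwa [Fin.sum_univ_two] at this
  have : ((t 0 : ℝ) : ℂ) = 1 - (t 1 : ℝ) := by
    rw [← ofReal_one, ← ofReal_sub, ← this]; simp
  rw [baryPoint, this]
  ring

theorem baryPoint_mem (a b : ℂ) (t : Simplex 1) : baryPoint a b t ∈ segment ℝ a b := by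
  rw [baryPoint_eq, mem_segment_iff]
  exact ⟨t 1, ⟨t.2.1 1, by
    have := t.2.2
    rw [Fin.sum_univ_two] at this
    have h0 := t.2.1 0
    change t.1 1 ≤ 1
    linarith⟩, rfl⟩

theorem continuous_baryPoint (a b : ℂ) : Continuous (baryPoint a b) := by
  unfold baryPoint
  have h : ∀ i, Continuous fun t : Simplex 1 => t i := fun i =>
    (continuous_apply i).comp continuous_subtype_val
  exact ((continuous_ofReal.comp (h 0)).mul continuous_const).add
    ((continuous_ofReal.comp (h 1)).mul continuous_const)

theorem exists_baryPoint {a b p : ℂ} (hp : p ∈ segment ℝ a b) : ∃ t, baryPoint a b t = p := by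
  obtain ⟨u, hu, rfl⟩ := mem_segment_iff.1 hp
  refine ⟨⟨![1 - u, u], ?_, ?_⟩, ?_⟩
  · intro i
    fin_cases i
    · simpa using hu.2
    · simpa using hu.1
  · simp
  · rw [baryPoint_eq]
    rfl

theorem baryPoint_injective {a b : ℂ} (hab : a ≠ b) : Function.Injective (baryPoint a b) := by
  intro t t' h
  rw [baryPoint_eq, baryPoint_eq] at h
  have h1 : t.1 1 = t'.1 1 := by
    have := mul_right_cancel₀ (sub_ne_zero.2 hab.symm) (add_left_cancel h)
    exact_mod_cast this
  have e := t.2.2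
  have e' := t'.2.2
  rw [Fin.sum_univ_two] at e e'
  refine Subtype.ext (funext fun i => ?_)
  fin_cases i
  · change t.1 0 = t'.1 0
    linarith
  · exact h1

theorem IsSegment.apply {σ : C(Simplex 1, P1)} {a b : ℂ} (h : IsSegment σ a b) (t : Simplex 1) :
    σ t = (baryPoint a b t : P1) := h.2 t

theorem IsSegment.notMem {S : Set P1} {σ : C(Simplex 1, P1)} {a b : ℂ} (h : IsSegment σ a b)
    (hS : segment ℝ a b ⊆ fin S) (t : Simplex 1) : σ t ∉ S := by
  rw [h.apply]
  exact hS (baryPoint_mem a b t)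

namespace Frame

variable {S : Set P1} {L : LocalSystem.{u} S} {C : Config L} (F : Frame C)

theorem transport_e_of_convex {K : Set ℂ} (hK : Convex ℝ K) (hKS : K ⊆ fin S) {x y : Pt S}
    (δ : Path x y) (hδ : ∀ t, ∃ w ∈ K, (δ t : P1) = (w : P1)) :
    L.transport δ (F.e x) = C.E (coord x) (coord y) • F.e y := by
  obtain ⟨a, ha, hxa⟩ := hδ 0
  obtain ⟨b, hb', hyb⟩ := hδ 1
  rw [δ.source] at hxa
  rw [δ.target] at hyb
  obtain ⟨x, hx⟩ := x
  obtain ⟨y, hy⟩ := y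
  simp only at hxa hyb
  subst hxa hyb
  have hs : segment ℝ a b ⊆ K := hK.segment_subset ha hb'
  rw [coord_coe, coord_coe, ← F.transport_segPath a b (hs.trans hKS),
    transport_in_convex hK hKS δ (segPath (hs.trans hKS)) hδ (segPath_mem hK _ ha hb')]

open Classical in
/-- The coordinate of a flat section at the starting point of a simplex. -/
noncomputable def start (σ : C(Simplex 1, P1)) : Coefficient L σ →ₗ[ℂ] ℂ :=
  if h : σ (stdSimplex.vertex 0) ∉ S then
    { toFun := fun v => F.co ⟨_, h⟩ (v.1 ⟨_, h⟩)
      map_add' := fun _ _ => map_add (F.co ⟨_, h⟩) _ _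
      map_smul' := fun _ _ => map_smul (F.co ⟨_, h⟩) _ _ }
  else 0

theorem start_eq {σ : C(Simplex 1, P1)} (h : σ (stdSimplex.vertex 0) ∉ S) (v : Coefficient L σ) :
    F.start σ v = F.co ⟨_, h⟩ (v.1 ⟨_, h⟩) := by
  rw [start, dif_pos h]
  rfl

/-- The coordinates of a flat section over a segment. -/
theorem co_section {σ : C(Simplex 1, P1)} {a b : ℂ} (hσ : IsSegment σ a b)
    (hS : segment ℝ a b ⊆ fin S) (v : Coefficient L σ) (t : Simplex 1) (ht : σ t ∉ S) :
    F.co ⟨σ t, ht⟩ (v.1 ⟨t, ht⟩) = F.start σ v * C.E a (baryPoint a b t) := by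
  have h0 := hσ.notMem hS (stdSimplex.vertex 0)
  let g : unitInterval → Simplex 1 := fun s => ⟨AffineMap.lineMap (stdSimplex.vertex 0).1 t.1 (s : ℝ),
    (convex_stdSimplex ℝ _).lineMap_mem (stdSimplex.vertex 0).2 t.2 s.2⟩
  have hgc : Continuous g := by
    refine Continuous.subtype_mk ?_ _
    simp only [AffineMap.lineMap_apply_module]
    fun_prop
  let δ : Path (⟨stdSimplex.vertex 0, h0⟩ : Regular S σ) ⟨t, ht⟩ :=
    ⟨⟨fun s => ⟨g s, hσ.notMem hS _⟩, hgc.subtype_mk _⟩,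
      Subtype.ext (Subtype.ext (by simp [g])), Subtype.ext (Subtype.ext (by simp [g]))⟩
  have h1 := F.transport_e_of_convex (convex_segment a b) hS (δ.map (regularMap S σ).continuous)
    fun s => ⟨_, baryPoint_mem a b (g s), hσ.apply (g s)⟩
  have h2 := F.co_transport h1 (v.1 ⟨stdSimplex.vertex 0, h0⟩)
  rw [v.2 _ _ δ] at h2
  rw [F.start_eq h0]
  refine h2.trans ?_
  have e1 : coord (σ (stdSimplex.vertex 0)) = a := by rw [hσ.vertex_zero]; rfl
  have e2 : coord (σ t) = baryPoint a b t := by rw [hσ.apply]; rfl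
  change _ * C.E (coord (σ (stdSimplex.vertex 0))) (coord (σ t)) = _
  rw [e1, e2]
  rfl

end Frame

namespace PolyCycle

variable {S : Set P1} {L : LocalSystem.{u} S} {C : Config L} {κ : Type*} (η : PolyCycle C κ)

/-- The integral of the crossing cocycle over a segment. -/
theorem integral_cocycle (F : Frame C) {σ : C(Simplex 1, P1)} {a b : ℂ} (hσ : IsSegment σ a b)
    (hS : segment ℝ a b ⊆ fin S) (v : Coefficient L σ)
    (hgp : ∀ τ ∈ η.T, η.r τ ∉ segment ℝ a b ∧ η.s τ ∉ segment ℝ a b) (K : κ → ℂ)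
    (hK : ∀ τ ∈ η.T, ∀ p ∈ segment ℝ a b, p ∈ segment ℝ (η.r τ) (η.s τ) →
      K τ = F.start σ v * C.E a p * starRingEnd ℂ (η.w τ * C.E (η.r τ) p)) :
    (η.cocycle F).integral σ v = ∑ τ ∈ η.T, K τ * (cross a b (η.r τ) (η.s τ) : ℂ) := by
  classical
  have hadd : ∀ τ ∈ η.T, ∀ x ∈ segment ℝ a b, ∀ y ∈ segment ℝ a b,
      cross a y (η.r τ) (η.s τ) - cross a x (η.r τ) (η.s τ) = cross x y (η.r τ) (η.s τ) := by
    intro τ hτ x hx y hy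
    obtain ⟨u, hu⟩ := exists_segment_subset_halfPlane (hgp τ hτ).1
    obtain ⟨u', hu'⟩ := exists_segment_subset_halfPlane (hgp τ hτ).2
    have ha := left_mem_segment ℝ a b
    rw [← cross_add (ang_add (hu' ha) (hu' hx) (hu' hy)) (ang_add (hu ha) (hu hx) (hu hy))]
    ring
  -- Since `K τ` is the product of the coefficients at the crossing, a primitive is the number of
  -- crossings met so far, weighted by `K τ`.
  have hprim : IsPrimitive ((η.cocycle F).onSimplex σ v)
      fun t => ∑ τ ∈ η.T, K τ * (cross a (baryPoint a b t) (η.r τ) (η.s τ) : ℂ) := by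
    intro t₀
    set p := baryPoint a b t₀ with hp
    have hps := baryPoint_mem a b t₀
    -- Moving from the crossing `p` to `x` multiplies one coefficient by `C.E p x` and the other by
    -- its conjugate, so the product is unchanged. If `p` is not on `τ`, both sides are zero.
    have h1 : ∀ᶠ ρ in 𝓝[>] (0 : ℝ), ∀ τ ∈ η.T, ∀ x ∈ Metric.ball p ρ ∩ segment ℝ a b,
        ∀ y ∈ Metric.ball p ρ ∩ segment ℝ a b,
        K τ * (cross x y (η.r τ) (η.s τ) : ℂ) = F.start σ v * C.E a x *
          ((cross x y (η.r τ) (η.s τ) : ℂ) * starRingEnd ℂ (η.w τ * C.E (η.r τ) x)) := by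
      rw [Filter.eventually_all_finset]
      intro τ hτ
      by_cases hpτ : p ∈ segment ℝ (η.r τ) (η.s τ)
      · filter_upwards [C.exists_ball_E (η.segment_subset τ hτ) hpτ, C.exists_ball_E hS hps] with
          ρ h2 h3 x hx y hy
        rw [hK τ hτ p hps hpτ, ← (h2.2 x hx.1).1, ← (h3.2 x hx.1).1]
        simp only [map_mul]
        linear_combination (-(F.start σ v * C.E a p * starRingEnd ℂ (η.w τ) *
          starRingEnd ℂ (C.E (η.r τ) p) * (cross x y (η.r τ) (η.s τ) : ℂ))) * C.E_mul_conj p x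
      · filter_upwards [eventually_cross_eq_zero hpτ] with ρ h2 x hx y hy
        rw [h2 x hx.1 y hy.1]
        simp
    -- The cut-off of the cocycle at large points loses nothing, because `val` is locally zero where
    -- it takes effect.
    have h2 : ∀ᶠ ρ in 𝓝[>] (0 : ℝ), ∀ x ∈ Metric.ball p ρ, ∀ y ∈ Metric.ball p ρ,
        ¬ (‖x‖ < η.bound ∧ ‖y‖ < η.bound) → η.val x y = 0 := by
      by_cases hpη : ∃ τ ∈ η.T, p ∈ segment ℝ (η.r τ) (η.s τ)
      · obtain ⟨τ, hτ, hpτ⟩ := hpη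
        obtain ⟨ρ₀, hρ₀, hball⟩ := Metric.isOpen_iff.1 Metric.isOpen_ball p
          (η.segment_subset_ball hτ hpτ)
        filter_upwards [Ioo_mem_nhdsGT hρ₀] with ρ hρ x hx y hy hn
        have := (Metric.ball_subset_ball hρ.2.le).trans hball
        exact absurd ⟨mem_ball_zero_iff.1 (this hx), mem_ball_zero_iff.1 (this hy)⟩ hn
      · push Not at hpη
        filter_upwards [η.eventually_val_eq_zero hpη] with ρ h x hx y hy _
        exact h x hx y hy
    obtain ⟨ρ, ⟨h1, h2⟩, hρ⟩ := ((h1.and h2).and self_mem_nhdsWithin).exists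
    refine ⟨baryPoint a b ⁻¹' Metric.ball p ρ,
      (continuous_baryPoint a b).continuousAt (Metric.ball_mem_nhds p hρ), fun t ht t' ht' => ?_⟩
    have hts := baryPoint_mem a b t
    have hts' := baryPoint_mem a b t'
    rw [← Finset.sum_sub_distrib, LocalCocycle.onSimplex_of_notMem _ v (hσ.notMem hS t)
      (hσ.notMem hS t')]
    have e1 : ∀ t, coord (σ t) = baryPoint a b t := fun t => by rw [hσ.apply]; rfl
    have e2 : ∀ t, σ t ≠ OnePoint.infty := fun t => by rw [hσ.apply]; exact OnePoint.coe_ne_infty _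
    have e3 : ((η.cocycle F).D ⟨σ t, hσ.notMem hS t⟩ ⟨σ t', hσ.notMem hS t'⟩)
        (v.1 ⟨t, hσ.notMem hS t⟩) = η.val (baryPoint a b t) (baryPoint a b t') *
        (F.start σ v * C.E a (baryPoint a b t)) := by
      rw [← F.co_section hσ hS v t (hσ.notMem hS t)]
      change η.D F _ _ _ = _
      unfold D
      simp only [e1, e2, ne_eq, not_false_eq_true, true_and]
      split_ifs with hcut
      · rfl
      · rw [h2 _ ht _ ht' hcut, zero_mul]; rfl
    rw [e3, val, mul_comm, Finset.mul_sum]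
    refine Finset.sum_congr rfl fun τ hτ => ?_
    rw [← mul_sub, ← ofReal_sub, hadd τ hτ _ hts _ hts']
    exact h1 τ hτ _ ⟨ht, hts⟩ _ ⟨ht', hts'⟩
  have hv0 : baryPoint a b (stdSimplex.vertex 0) = a := by simp [baryPoint]
  have hv1 : baryPoint a b (stdSimplex.vertex 1) = b := by simp [baryPoint]
  rw [(η.cocycle F).integral_eq σ v hprim]
  simp only [hv0, hv1, cross_self]
  simp

end PolyCycle

/-- The metric in terms of an orthonormal frame. -/
theorem FlatMetric.pair_eq {S : Set P1} {L : LocalSystem.{u} S} {C : Config L} {F : Frame C}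
    {h : FlatMetric L} (hF : ∀ (x : ℂ) (hx : x ∈ fin S), h.form (pt hx) (F.e _) (F.e _) = 1)
    {x y : Pt S} (e : x = y) (hx : (x : P1) ≠ OnePoint.infty) (v : L.fibre x) (w : L.fibre y) :
    h.pair e v w = F.co x v * starRingEnd ℂ (F.co y w) := by
  subst e
  obtain ⟨x, hxS⟩ := x
  induction x using OnePoint.rec with
  | infty => exact absurd rfl hx
  | coe x =>
    change h.form _ v w = _
    conv_lhs => rw [← F.co_smul_e _ v, ← F.co_smul_e _ w]
    simp only [map_smul, LinearMap.smul_apply, map_smulₛₗ, smul_eq_mul]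
    rw [hF x hxS]
    ring

/-- The intersection number of two segments in terms of an orthonormal frame. -/
theorem segmentIntersection_eq {S : Set P1} {L : LocalSystem.{u} S} {C : Config L} {F : Frame C}
    {h : FlatMetric L} (hF : ∀ (x : ℂ) (hx : x ∈ fin S), h.form (pt hx) (F.e _) (F.e _) = 1)
    {σ τ : C(Simplex 1, P1)} {a b r s : ℂ} (hσ : IsSegment σ a b) (hτ : IsSegment τ r s)
    (hσS : segment ℝ a b ⊆ fin S) (hτS : segment ℝ r s ⊆ fin S) (hgp : GenPos a b r s)
    (v : Coefficient L σ) (w : Coefficient L τ) (K : ℂ)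
    (hK : ∀ p ∈ segment ℝ a b, p ∈ segment ℝ r s →
      K = F.start σ v * C.E a p * starRingEnd ℂ (F.start τ w * C.E r p)) :
    segmentIntersection h σ τ v w = K * (cross a b r s : ℂ) := by
  classical
  have key : ∀ p : Regular S σ × Regular S τ, regularMap S σ p.1 = regularMap S τ p.2 →
      baryPoint a b p.1.1 = baryPoint r s p.2.1 := by
    intro p e
    have := congrArg Subtype.val e
    change σ p.1.1 = τ p.2.1 at this
    rw [hσ.apply, hτ.apply] at this
    exact OnePoint.coe_injective this
  unfold segmentIntersection
  by_cases hd : Disjoint (segment ℝ a b) (segment ℝ r s)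
  · rw [cross_eq_zero_of_disjoint hd, ofReal_zero, mul_zero]
    refine finsum_eq_zero_of_forall_eq_zero fun p => dif_neg fun e => ?_
    exact Set.disjoint_left.1 hd (baryPoint_mem a b p.1.1) (by rw [key p e]; exact baryPoint_mem r s _)
  · obtain ⟨p, hp, hp'⟩ := Set.not_disjoint_iff.1 hd
    obtain ⟨t, ht⟩ := exists_baryPoint hp
    obtain ⟨u, hu⟩ := exists_baryPoint hp'
    have htS := hσ.notMem hσS t
    have huS := hτ.notMem hτS u
    have e : regularMap S σ ⟨t, htS⟩ = regularMap S τ ⟨u, huS⟩ := Subtype.ext (by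
      change σ t = τ u
      rw [hσ.apply, hτ.apply, ht, hu])
    -- Segments in general position meet in at most one point, and the barycentric parametrisations
    -- are injective, so one pair of parameters contributes.
    rw [finsum_eq_single _ ((⟨t, htS⟩, ⟨u, huS⟩) : Regular S σ × Regular S τ)]
    · have hinf : (regularMap S σ ⟨t, htS⟩ : P1) ≠ OnePoint.infty := by
        change σ t ≠ _
        rw [hσ.apply]; exact OnePoint.coe_ne_infty _
      rw [dif_pos e, FlatMetric.pair_eq hF e hinf]
      have c1 := F.co_section hσ hσS v t htS
      have c2 := F.co_section hτ hτS w u huS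
      rw [ht] at c1
      rw [hu] at c2
      change _ * (F.co ⟨σ t, htS⟩ (v.1 ⟨t, htS⟩) *
        starRingEnd ℂ (F.co ⟨τ u, huS⟩ (w.1 ⟨u, huS⟩))) = _
      rw [c1, c2, ← hK p hp hp', mul_comm, hgp.cross_eq hτ.1 hp hp', orientationNumber, direction,
        direction, hσ.vertex_zero, hσ.vertex_one, hτ.vertex_zero, hτ.vertex_one]
      rfl
    · rintro q hq
      refine dif_neg fun e' => hq ?_
      have h1 := key q e'
      have hd := hgp.im_ne_zero hτ.1 hp hp'
      have m1 := baryPoint_mem a b q.1.1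
      have m2 := baryPoint_mem r s q.2.1
      have h2 : baryPoint a b q.1.1 = p := eq_of_mem_segments hd m1 (by rw [h1]; exact m2) hp hp'
      have h3 : baryPoint r s q.2.1 = p := by rw [← h1, h2]
      refine Prod.ext (Subtype.ext ?_) (Subtype.ext ?_)
      · exact baryPoint_injective hσ.1 (h2.trans ht.symm)
      · exact baryPoint_injective hτ.1 (h3.trans hu.symm)

end DeligneMostow
namespace DeligneMostow
open Complex CategoryTheory Filter Topology

/-! ### Chains in the nonsingular locus -/

/-- The straight path between two points of a simplex. -/
noncomputable def simplexPath {i : ℕ} (t t' : Simplex i) : Path t t' where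
  toFun s := ⟨AffineMap.lineMap t.1 t'.1 (s : ℝ), (convex_stdSimplex ℝ _).lineMap_mem t.2 t'.2 s.2⟩
  continuous_toFun := by
    refine Continuous.subtype_mk ?_ _
    simp only [AffineMap.lineMap_apply_module]
    fun_prop
  source' := Subtype.ext (by simp)
  target' := Subtype.ext (by simp)

instance (i : ℕ) : SimplyConnectedSpace (Simplex i) :=
  Convex.simplyConnectedSpace (convex_stdSimplex ℝ (Fin (i + 1))) ⟨_, (stdSimplex.vertex 0).2⟩

section

variable {S : Set P1} (L : LocalSystem.{u} S) {i : ℕ}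

/-- A map to the nonsingular locus as a singular simplex. -/
noncomputable def regSimplex (f : C(Simplex i, Pt S)) : C(Simplex i, P1) :=
  ⟨fun t => f t, continuous_subtype_val.comp f.continuous⟩

/-- The flat section over a simplex with a given value. -/
noncomputable def flatSec (f : C(Simplex i, Pt S)) (t₀ : Simplex i) {x : Pt S} (hx : f t₀ = x)
    (v : L.fibre x) : Coefficient L (regSimplex f) :=
  ⟨fun t => L.transport (((simplexPath t₀ t.1).map f.continuous).cast hx.symm rfl) v, by
    intro t t' δ
    exact transport_factor f (((simplexPath t₀ t.1).map f.continuous).cast hx.symm rfl) _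
      (((simplexPath t₀ t'.1).map f.continuous).cast hx.symm rfl)
      (simplexPath t₀ t.1).toContinuousMap
      ⟨fun s => (δ s).1, continuous_subtype_val.comp δ.continuous⟩
      (simplexPath t₀ t'.1).toContinuousMap (fun _ => rfl) (fun _ => rfl) (fun _ => rfl)
      (by simp) (by simp) (by simp) v⟩

variable {L}

theorem regSimplex_notMem (f : C(Simplex i, Pt S)) (t : Simplex i) : regSimplex f t ∉ S := (f t).2

theorem faceMap_succAbove (k : Fin (i + 2)) (t : Simplex i) (j : Fin (i + 1)) :
    (faceMap i k t).1 (k.succAbove j) = t.1 j := by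
  change (FunOnFinite.linearMap ℝ ℝ k.succAbove t.1) (k.succAbove j) = t.1 j
  rw [FunOnFinite.linearMap_apply_apply]
  simp [Finset.filter_eq']

theorem faceMap_self (k : Fin (i + 2)) (t : Simplex i) : (faceMap i k t).1 k = 0 := by
  change (FunOnFinite.linearMap ℝ ℝ k.succAbove t.1) k = 0
  rw [FunOnFinite.linearMap_apply_apply]
  simp [Fin.succAbove_ne]

/-- If the whole simplex is regular, any two of its points are joined by a path, and a flat section
is determined by one value. -/
theorem coefficient_ext {σ : C(Simplex i, P1)} (hσ : ∀ t, σ t ∉ S) (t₀ : Simplex i)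
    {w w' : Coefficient L σ} (h : w.1 ⟨t₀, hσ t₀⟩ = w'.1 ⟨t₀, hσ t₀⟩) : w = w' := by
  refine Subtype.ext (funext fun t => ?_)
  let δ : Path (⟨t₀, hσ t₀⟩ : Regular S σ) t :=
    ⟨⟨fun s => ⟨simplexPath t₀ t.1 s, hσ _⟩, (simplexPath t₀ t.1).continuous.subtype_mk _⟩,
      Subtype.ext (by simp), Subtype.ext (by simp)⟩
  rw [← w.2 _ _ δ, ← w'.2 _ _ δ, h]

open Classical in
-- Faces of explicit simplices agree with path simplices only pointwise. It then suffices to compare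
-- the coefficients heterogeneously at a single point.
theorem single_eq_single {σ σ' : C(Simplex i, P1)} (h : ∀ t, σ t = σ' t) (hσ : ∀ t, σ t ∉ S)
    (t₀ : Simplex i) {w : Coefficient L σ} {w' : Coefficient L σ'} (h0 : σ' t₀ ∉ S)
    (hw : HEq (w.1 ⟨t₀, hσ t₀⟩) (w'.1 ⟨t₀, h0⟩)) :
    (DFinsupp.single σ w : Chain L i) = DFinsupp.single σ' w' := by
  obtain rfl : σ = σ' := ContinuousMap.ext h
  rw [coefficient_ext hσ t₀ (eq_of_heq hw)]

theorem flatSec_heq (f : C(Simplex i, Pt S)) (t₀ : Simplex i) {x : Pt S} (hx : f t₀ = x)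
    (v : L.fibre x) (t : Simplex i) (ht : regSimplex f t ∉ S) {y : Pt S} (γ : Path x y)
    (hγ : ∀ s, f (simplexPath t₀ t s) = γ s) :
    HEq ((flatSec L f t₀ hx v).1 ⟨t, ht⟩) (L.transport γ v) :=
  transport_heq (γ := ((simplexPath t₀ t).map f.continuous).cast hx.symm rfl) hγ HEq.rfl

theorem isAdmissible_of_notMem {σ : C(Simplex i, P1)} (hσ : ∀ t, σ t ∉ S) : IsAdmissible S σ :=
  fun t ht => absurd ht (hσ t)

open Classical in
theorem single_mem_admissible {σ : C(Simplex i, P1)} (hσ : ∀ t, σ t ∉ S) (w : Coefficient L σ) :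
    (DFinsupp.single σ w : Chain L i) ∈ AdmissibleChain L i := by
  intro τ hτ
  have : τ = σ := by
    by_contra hne
    exact hτ (DFinsupp.single_eq_of_ne hne)
  rw [this]
  exact isAdmissible_of_notMem hσ

variable (L) in
open Classical in
/-- A singular simplex with coefficient as a chain. -/
noncomputable abbrev chainOf (σ : C(Simplex i, P1)) (w : Coefficient L σ) : Chain L i :=
  DFinsupp.single σ w

open Classical in
theorem chainOf_add (σ : C(Simplex i, P1)) (w w' : Coefficient L σ) :
    chainOf L σ (w + w') = chainOf L σ w + chainOf L σ w' := DFinsupp.single_add ..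

open Classical in
theorem chainOf_smul (σ : C(Simplex i, P1)) (c : ℂ) (w : Coefficient L σ) :
    chainOf L σ (c • w) = c • chainOf L σ w := DFinsupp.single_smul ..

/-- The second barycentric coordinate. -/
noncomputable def secondCoord : C(Simplex 1, unitInterval) where
  toFun t := ⟨t.1 1, t.2.1 1, by
    have := t.2.2
    rw [Fin.sum_univ_two] at this
    have h0 := t.2.1 0
    linarith⟩
  continuous_toFun := ((continuous_apply 1).comp continuous_subtype_val).subtype_mk _

@[simp] theorem secondCoord_zero : secondCoord (stdSimplex.vertex 0) = 0 :=
  Subtype.ext (by simp [secondCoord])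

@[simp] theorem secondCoord_one : secondCoord (stdSimplex.vertex 1) = 1 :=
  Subtype.ext (by simp [secondCoord])

variable (L) in
open Classical in
/-- A path with coefficients as a singular chain. -/
noncomputable def pathChain {x y : Pt S} (γ : Path x y) (v : L.fibre x) : Chain L 1 :=
  DFinsupp.single (regSimplex (γ.toContinuousMap.comp secondCoord))
    (flatSec L (γ.toContinuousMap.comp secondCoord) (stdSimplex.vertex 0) (by simp) v)

variable (L) in
open Classical in
/-- A point with coefficients as a singular chain. -/
noncomputable def pointChain (x : Pt S) : L.fibre x →ₗ[ℂ] Chain L 0 where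
  toFun v := chainOf L (regSimplex (ContinuousMap.const _ x))
    (flatSec L (ContinuousMap.const _ x) (stdSimplex.vertex 0) rfl v)
  map_add' v w := by
    rw [← chainOf_add]
    exact congrArg _ (Subtype.ext (funext fun t => map_add _ v w))
  map_smul' c v := by
    rw [RingHom.id_apply, ← chainOf_smul]
    exact congrArg _ (Subtype.ext (funext fun t => map_smul _ c v))

open Classical in
theorem pointChain_apply (x : Pt S) (v : L.fibre x) : pointChain L x v =
    chainOf L (regSimplex (ContinuousMap.const _ x))
      (flatSec L (ContinuousMap.const _ x) (stdSimplex.vertex 0) rfl v) := rfl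

open Classical in
theorem pathChain_add {x y : Pt S} (γ : Path x y) (v w : L.fibre x) :
    pathChain L γ (v + w) = pathChain L γ v + pathChain L γ w := by
  rw [pathChain, pathChain, pathChain, ← DFinsupp.single_add]
  exact congrArg _ (Subtype.ext (funext fun t => map_add _ v w))

open Classical in
theorem pathChain_smul {x y : Pt S} (γ : Path x y) (c : ℂ) (v : L.fibre x) :
    pathChain L γ (c • v) = c • pathChain L γ v := by
  rw [pathChain, pathChain, ← DFinsupp.single_smul]
  exact congrArg _ (Subtype.ext (funext fun t => map_smul _ c v))

theorem pathChain_mem_admissible {x y : Pt S} (γ : Path x y) (v : L.fibre x) :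
    pathChain L γ v ∈ AdmissibleChain L 1 :=
  single_mem_admissible (regSimplex_notMem _) _

theorem simplex_zero_eq (t t' : Simplex 0) : t = t' := by
  have e := t.2.2
  have e' := t'.2.2
  rw [Fin.sum_univ_one] at e e'
  refine Subtype.ext (funext fun i => ?_)
  fin_cases i
  exact e.trans e'.symm

theorem boundary_pathChain {x y : Pt S} (γ : Path x y) (v : L.fibre x) :
    boundary L 0 (pathChain L γ v) = pointChain L y (L.transport γ v) - pointChain L x v := by
  classical
  rw [pathChain, LocalCocycle.boundary_single, Fin.sum_univ_two]
  have h0 : faceMap 0 0 (stdSimplex.vertex 0) = stdSimplex.vertex 1 :=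
    LocalCocycle.faceMap_vertex 0 0 0
  have h1 : faceMap 0 1 (stdSimplex.vertex 0) = stdSimplex.vertex 0 :=
    LocalCocycle.faceMap_vertex 0 1 0
  have hl : ∀ s, secondCoord (simplexPath (stdSimplex.vertex 0) (stdSimplex.vertex 1) s) = s := by
    intro s
    refine Subtype.ext ?_
    simp [secondCoord, simplexPath, AffineMap.lineMap_apply]
  rw [sub_eq_add_neg, Fin.val_zero, pow_zero, one_smul, Fin.val_one, pow_one, neg_smul, one_smul]
  congr 1
  · rw [pointChain_apply]
    refine single_eq_single
      (σ := (regSimplex (γ.toContinuousMap.comp secondCoord)).comp (faceMap 0 0))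
      (σ' := regSimplex (ContinuousMap.const _ y)) (fun t => ?_) (fun t => regSimplex_notMem
      (γ.toContinuousMap.comp secondCoord) (faceMap 0 0 t)) (stdSimplex.vertex 0)
      (regSimplex_notMem (ContinuousMap.const _ y) _) ?_
    · rw [simplex_zero_eq t (stdSimplex.vertex 0)]
      change ((γ (secondCoord (faceMap 0 0 _)) : Pt S) : P1) = y
      rw [h0]; simp
    · refine HEq.trans (b := L.transport γ v) ?_ (HEq.symm ?_)
      · refine flatSec_heq (γ.toContinuousMap.comp secondCoord) (stdSimplex.vertex 0) (by simp) v
          (faceMap 0 0 (stdSimplex.vertex 0)) (regSimplex_notMem _ _) γ fun s => ?_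
        rw [h0]
        exact congrArg γ (hl s)
      · refine (flatSec_heq (ContinuousMap.const _ y) (stdSimplex.vertex 0) rfl _
          (stdSimplex.vertex 0) (regSimplex_notMem _ _) (Path.refl y) fun s => rfl).trans ?_
        exact heq_of_eq (transport_refl L _ _)
  · congr 1
    rw [pointChain_apply]
    refine single_eq_single
      (σ := (regSimplex (γ.toContinuousMap.comp secondCoord)).comp (faceMap 0 1))
      (σ' := regSimplex (ContinuousMap.const _ x)) (fun t => ?_) (fun t => regSimplex_notMem
      (γ.toContinuousMap.comp secondCoord) (faceMap 0 1 t)) (stdSimplex.vertex 0)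
      (regSimplex_notMem (ContinuousMap.const _ x) _) ?_
    · rw [simplex_zero_eq t (stdSimplex.vertex 0)]
      change ((γ (secondCoord (faceMap 0 1 _)) : Pt S) : P1) = x
      rw [h1]; simp
    · refine HEq.trans (b := v) ?_ (HEq.symm ?_)
      · refine (flatSec_heq (γ.toContinuousMap.comp secondCoord) (stdSimplex.vertex 0) (by simp) v
          (faceMap 0 1 (stdSimplex.vertex 0)) (regSimplex_notMem _ _) (Path.refl x) fun s => ?_).trans ?_
        · rw [h1]
          have : secondCoord (simplexPath (stdSimplex.vertex 0) (stdSimplex.vertex 0) s) = 0 :=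
            Subtype.ext (by simp [secondCoord, simplexPath])
          change γ (secondCoord _) = x
          rw [this]; simp
        · rw [transport_refl]
      · refine (flatSec_heq (ContinuousMap.const _ x) (stdSimplex.vertex 0) rfl _
          (stdSimplex.vertex 0) (regSimplex_notMem _ _) (Path.refl x) fun s => rfl).trans ?_
        exact heq_of_eq (transport_refl L _ _)

/-- The boundary of a triangle in the nonsingular locus. -/
theorem triangle_mem (f : C(Simplex 2, Pt S)) {x y z : Pt S} (γ : Path x y) (δ : Path y z)
    (ε : Path x z)
    (hγ : ∀ t : Simplex 1, f (faceMap 1 2 t) = γ (secondCoord t))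
    (hδ : ∀ t : Simplex 1, f (faceMap 1 0 t) = δ (secondCoord t))
    (hε : ∀ t : Simplex 1, f (faceMap 1 1 t) = ε (secondCoord t)) (v : L.fibre x) :
    pathChain L δ (L.transport γ v) - pathChain L ε v + pathChain L γ v ∈
      IntersectionBoundary L := by
  classical
  have f0 : ∀ k : Fin 3, f (stdSimplex.vertex k) = ![x, y, z] k := by
    have e0 : faceMap 1 2 (stdSimplex.vertex 0) = stdSimplex.vertex 0 :=
      LocalCocycle.faceMap_vertex 1 2 0
    have e1 : faceMap 1 2 (stdSimplex.vertex 1) = stdSimplex.vertex 1 :=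
      LocalCocycle.faceMap_vertex 1 2 1
    have e2 : faceMap 1 0 (stdSimplex.vertex 1) = stdSimplex.vertex 2 :=
      LocalCocycle.faceMap_vertex 1 0 1
    intro k
    fin_cases k
    · change f (stdSimplex.vertex 0) = x
      rw [← e0, hγ]; simp
    · change f (stdSimplex.vertex 1) = y
      rw [← e1, hγ]; simp
    · change f (stdSimplex.vertex 2) = z
      rw [← e2, hδ]; simp
  have hx : f (stdSimplex.vertex 0) = x := f0 0
  let ζ : Chain L 2 := DFinsupp.single (regSimplex f) (flatSec L f (stdSimplex.vertex 0) hx v)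
  have hl : ∀ s, ∃ t : Simplex 1, secondCoord t = s ∧
      faceMap 1 2 t = simplexPath (stdSimplex.vertex 0) (stdSimplex.vertex 1) s := by
    intro s
    refine ⟨simplexPath (stdSimplex.vertex 0) (stdSimplex.vertex 1) s, Subtype.ext ?_, ?_⟩
    · simp [secondCoord, simplexPath, AffineMap.lineMap_apply]
    · refine Subtype.ext (funext fun k => ?_)
      have h0 := faceMap_succAbove (i := 1) 2 (simplexPath (stdSimplex.vertex 0)
        (stdSimplex.vertex 1) s) 0
      have h1 := faceMap_succAbove (i := 1) 2 (simplexPath (stdSimplex.vertex 0)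
        (stdSimplex.vertex 1) s) 1
      have h2 := faceMap_self (i := 1) 2 (simplexPath (stdSimplex.vertex 0)
        (stdSimplex.vertex 1) s)
      fin_cases k
      · refine h0.trans ?_
        simp [simplexPath, AffineMap.lineMap_apply]
      · refine h1.trans ?_
        simp [simplexPath, AffineMap.lineMap_apply]
      · refine h2.trans ?_
        simp [simplexPath, AffineMap.lineMap_apply]
  have b0 : (DFinsupp.single ((regSimplex f).comp (faceMap 1 0)) (restrictFace L _ 0
      (flatSec L f (stdSimplex.vertex 0) hx v)) : Chain L 1) =
      pathChain L δ (L.transport γ v) := by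
    refine single_eq_single (fun t => congrArg Subtype.val (hδ t)) (fun _ => regSimplex_notMem f _)
      (stdSimplex.vertex 0) (regSimplex_notMem _ _) ?_
    refine HEq.trans (b := L.transport γ v) ?_ (HEq.symm ?_)
    · refine flatSec_heq f (stdSimplex.vertex 0) hx v (faceMap 1 0 (stdSimplex.vertex 0))
        (regSimplex_notMem _ _) γ fun s => ?_
      have : faceMap 1 0 (stdSimplex.vertex 0) = stdSimplex.vertex 1 :=
        LocalCocycle.faceMap_vertex 1 0 0
      rw [this]
      obtain ⟨t, h1, h2⟩ := hl s
      rw [← h2, hγ, h1]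
    · refine (flatSec_heq (δ.toContinuousMap.comp secondCoord) (stdSimplex.vertex 0) (by simp) _
          (stdSimplex.vertex 0) (regSimplex_notMem _ _) (Path.refl y) fun s => ?_).trans ?_
      · have : secondCoord (simplexPath (stdSimplex.vertex 0) (stdSimplex.vertex 0) s) = 0 :=
          Subtype.ext (by simp [secondCoord, simplexPath])
        change δ (secondCoord _) = y
        rw [this]; simp
      · rw [transport_refl]
  have bx : ∀ (k : Fin 3) {w : Pt S} (ε : Path x w),
      (faceMap 1 k (stdSimplex.vertex 0) = stdSimplex.vertex 0) →
      (∀ t : Simplex 1, f (faceMap 1 k t) = ε (secondCoord t)) →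
      (DFinsupp.single ((regSimplex f).comp (faceMap 1 k)) (restrictFace L _ k
      (flatSec L f (stdSimplex.vertex 0) hx v)) : Chain L 1) = pathChain L ε v := by
    intro k w ε hk hε
    refine single_eq_single (fun t => congrArg Subtype.val (hε t)) (fun _ => regSimplex_notMem f _)
      (stdSimplex.vertex 0) (regSimplex_notMem _ _) ?_
    refine HEq.trans (b := v) ?_ (HEq.symm ?_)
    · refine (flatSec_heq f (stdSimplex.vertex 0) hx v (faceMap 1 k (stdSimplex.vertex 0))
        (regSimplex_notMem _ _) (Path.refl x) fun s => ?_).trans ?_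
      · rw [hk]
        have : simplexPath (stdSimplex.vertex 0 : Simplex 2) (stdSimplex.vertex 0) s =
            stdSimplex.vertex 0 := Subtype.ext (by simp [simplexPath])
        rw [this, hx]; rfl
      · rw [transport_refl]
    · refine (flatSec_heq (ε.toContinuousMap.comp secondCoord) (stdSimplex.vertex 0) (by simp) _
          (stdSimplex.vertex 0) (regSimplex_notMem _ _) (Path.refl x) fun s => ?_).trans ?_
      · have : secondCoord (simplexPath (stdSimplex.vertex 0) (stdSimplex.vertex 0) s) = 0 :=
          Subtype.ext (by simp [secondCoord, simplexPath])
        change ε (secondCoord _) = x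
        rw [this]; simp
      · rw [transport_refl]
  have hb : boundary L 1 ζ =
      pathChain L δ (L.transport γ v) - pathChain L ε v + pathChain L γ v := by
    rw [LocalCocycle.boundary_single, Fin.sum_univ_three, b0,
      bx 1 ε (LocalCocycle.faceMap_vertex 1 1 0) hε, bx 2 γ (LocalCocycle.faceMap_vertex 1 2 0) hγ]
    simp [sub_eq_add_neg]
  rw [← hb]
  -- The triangle and its faces avoid `S` altogether, so the admissibility conditions are empty.
  refine ⟨ζ, ⟨single_mem_admissible (regSimplex_notMem _) _, ?_⟩, rfl⟩
  change boundary L 1 ζ ∈ AdmissibleChain L 1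
  rw [hb]
  exact add_mem (sub_mem (pathChain_mem_admissible _ _) (pathChain_mem_admissible _ _))
    (pathChain_mem_admissible _ _)

end

end DeligneMostow
namespace DeligneMostow
open Complex CategoryTheory Filter Topology

/-! ### Cocycles on paths -/

/-- An additive and homotopy invariant function of paths with coefficients. -/
structure PathCocycle {S : Set P1} (L : LocalSystem.{u} S) (A : Type*) [AddCommGroup A]
    [Module ℂ A] where
  val : ∀ {x y : Pt S}, Path x y → L.fibre x →ₗ[ℂ] A
  trans : ∀ {x y z : Pt S} (γ : Path x y) (δ : Path y z) (v : L.fibre x),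
    val (γ.trans δ) v = val γ v + val δ (L.transport γ v)
  homotopic : ∀ {x y : Pt S} (γ δ : Path x y), γ.Homotopic δ → val γ = val δ

namespace PathCocycle

variable {S : Set P1} {L : LocalSystem.{u} S} {A : Type*} [AddCommGroup A] [Module ℂ A]
  (c : PathCocycle L A)

theorem val_refl (x : Pt S) : c.val (Path.refl x) = 0 := by
  refine LinearMap.ext fun v => ?_
  have h := c.trans (Path.refl x) (Path.refl x) v
  rw [transport_refl, Path.refl_trans_refl] at h
  simpa using h

theorem val_symm {x y : Pt S} (γ : Path x y) (v : L.fibre y) :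
    c.val γ.symm v = -c.val γ (L.transport γ.symm v) := by
  have h := c.trans γ.symm γ v
  rw [c.homotopic _ _ (Path.Homotopic.symm_trans γ), c.val_refl] at h
  exact eq_neg_of_add_eq_zero_left h.symm

theorem val_congr {x y x' y' : Pt S} {γ : Path x y} {γ' : Path x' y'} (h : ∀ t, γ t = γ' t)
    {v : L.fibre x} {v' : L.fibre x'} (hv : HEq v v') : c.val γ v = c.val γ' v' := by
  have hx : x = x' := by rw [← γ.source, h, γ'.source]
  have hy : y = y' := by rw [← γ.target, h, γ'.target]
  subst hx hy
  have : γ = γ' := Path.ext (funext h)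
  subst this
  rw [eq_of_heq hv]

/-- `K` is a potential along `γ`. -/
def IsPotentialOn (K : ∀ x : Pt S, L.fibre x →ₗ[ℂ] A) {x y : Pt S} (γ : Path x y) : Prop :=
  ∀ v, c.val γ v = K y (L.transport γ v) - K x v

variable {c} {K : ∀ x : Pt S, L.fibre x →ₗ[ℂ] A}

theorem IsPotentialOn.trans {x y z : Pt S} {γ : Path x y} {δ : Path y z}
    (h : c.IsPotentialOn K γ) (h' : c.IsPotentialOn K δ) : c.IsPotentialOn K (γ.trans δ) := by
  intro v
  rw [c.trans, h, h', transport_trans]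
  abel

theorem IsPotentialOn.homotopic {x y : Pt S} {γ δ : Path x y} (hγδ : γ.Homotopic δ)
    (h : c.IsPotentialOn K γ) : c.IsPotentialOn K δ := by
  intro v
  rw [← c.homotopic _ _ hγδ, ← transport_eq hγδ, h]

theorem IsPotentialOn.symm {x y : Pt S} {γ : Path x y} (h : c.IsPotentialOn K γ) :
    c.IsPotentialOn K γ.symm := by
  intro v
  rw [c.val_symm, h, transport_apply_symm]
  abel

end PathCocycle

section Quotient

variable {S : Set P1} {L : LocalSystem.{u} S}

/-- The triangle is collapsed onto the concatenated path by sending its vertices to the times `0`,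
`1/2` and `1`. -/
theorem pathChain_trans_mem {x y z : Pt S} (γ : Path x y) (δ : Path y z) (v : L.fibre x) :
    pathChain L δ (L.transport γ v) - pathChain L (γ.trans δ) v + pathChain L γ v ∈
      IntersectionBoundary L := by
  have hmem : ∀ t : Simplex 2, t.1 2 + t.1 1 / 2 ∈ unitInterval := by
    intro t
    have e := t.2.2
    rw [Fin.sum_univ_three] at e
    have h0 := t.2.1 0
    have h1 := t.2.1 1
    have h2 := t.2.1 2
    exact ⟨by linarith, by linarith⟩
  let f : C(Simplex 2, Pt S) := ⟨fun t => (γ.trans δ) ⟨t.1 2 + t.1 1 / 2, hmem t⟩, by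
    refine (γ.trans δ).continuous.comp (Continuous.subtype_mk ?_ _)
    have h : ∀ i, Continuous fun t : Simplex 2 => t.1 i := fun i =>
      (continuous_apply i).comp continuous_subtype_val
    exact (h 2).add ((h 1).div_const 2)⟩
  have hsum : ∀ t : Simplex 1, t.1 0 + t.1 1 = 1 ∧ 0 ≤ t.1 0 ∧ 0 ≤ t.1 1 := fun t => by
    have := t.2.2
    rw [Fin.sum_univ_two] at this
    exact ⟨this, t.2.1 0, t.2.1 1⟩
  refine triangle_mem f γ δ (γ.trans δ) (fun t => ?_) (fun t => ?_) (fun t => ?_) v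
  · have e1 : (faceMap 1 2 t).1 1 = t.1 1 := faceMap_succAbove (i := 1) 2 t 1
    have e2 : (faceMap 1 2 t).1 2 = 0 := faceMap_self (i := 1) 2 t
    obtain ⟨h1, h2, h3⟩ := hsum t
    simp only [f, ContinuousMap.coe_mk, e1, e2]
    rw [Path.trans_apply, dif_pos (by simp only; linarith)]
    congr 1
    refine Subtype.ext ?_
    simp only [secondCoord, ContinuousMap.coe_mk]
    ring
  · have e1 : (faceMap 1 0 t).1 1 = t.1 0 := faceMap_succAbove (i := 1) 0 t 0
    have e2 : (faceMap 1 0 t).1 2 = t.1 1 := faceMap_succAbove (i := 1) 0 t 1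
    obtain ⟨h1, h2, h3⟩ := hsum t
    simp only [f, ContinuousMap.coe_mk, e1, e2]
    rw [Path.trans_apply]
    split_ifs with h
    · simp only at h
      have h0 : t.1 1 = 0 := by linarith
      have hA : (⟨2 * (t.1 1 + t.1 0 / 2), by constructor <;> linarith⟩ : unitInterval) = 1 :=
        Subtype.ext (by simp only [Set.Icc.coe_one]; linarith)
      have hB : secondCoord t = 0 := Subtype.ext h0
      rw [hB, δ.source]
      exact (congrArg γ hA).trans γ.target
    · congr 1
      refine Subtype.ext ?_
      simp only [secondCoord, ContinuousMap.coe_mk]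
      linarith
  · have e1 : (faceMap 1 1 t).1 1 = 0 := faceMap_self (i := 1) 1 t
    have e2 : (faceMap 1 1 t).1 2 = t.1 1 := faceMap_succAbove (i := 1) 1 t 1
    simp only [f, ContinuousMap.coe_mk, e1, e2]
    congr 1
    refine Subtype.ext ?_
    simp [secondCoord]

theorem pathChain_refl_mem (x : Pt S) (v : L.fibre x) :
    pathChain L (Path.refl x) v ∈ IntersectionBoundary L := by
  have := pathChain_trans_mem (Path.refl x) (Path.refl x) v
  rw [Path.refl_trans_refl, transport_refl] at this
  simpa using this

/-- The diagonal cuts the square of the homotopy into two triangles. The two sides on which the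
homotopy is constant are boundaries themselves. -/
theorem pathChain_homotopic_mem {x y : Pt S} {γ δ : Path x y} (h : γ.Homotopic δ) (v : L.fibre x) :
    pathChain L γ v - pathChain L δ v ∈ IntersectionBoundary L := by
  obtain ⟨H⟩ := h
  have hb : ∀ t : Simplex 2, t.1 0 + t.1 1 + t.1 2 = 1 ∧ 0 ≤ t.1 0 ∧ 0 ≤ t.1 1 ∧ 0 ≤ t.1 2 := by
    intro t
    have e := t.2.2
    rw [Fin.sum_univ_three] at e
    exact ⟨e, t.2.1 0, t.2.1 1, t.2.1 2⟩
  have hc : ∀ i, Continuous fun t : Simplex 2 => t.1 i := fun i =>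
    (continuous_apply i).comp continuous_subtype_val
  have m2 : ∀ t : Simplex 2, t.1 2 ∈ unitInterval := fun t => by
    obtain ⟨h0, h1, h2, h3⟩ := hb t
    exact ⟨h3, by linarith⟩
  have m12 : ∀ t : Simplex 2, t.1 1 + t.1 2 ∈ unitInterval := fun t => by
    obtain ⟨h0, h1, h2, h3⟩ := hb t
    exact ⟨by linarith, by linarith⟩
  let p2 : C(Simplex 2, unitInterval) := ⟨fun t => ⟨t.1 2, m2 t⟩, (hc 2).subtype_mk m2⟩
  let p12 : C(Simplex 2, unitInterval) := ⟨fun t => ⟨t.1 1 + t.1 2, m12 t⟩,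
    ((hc 1).add (hc 2)).subtype_mk m12⟩
  let diag : Path x y := ⟨⟨fun s => H (s, s), by fun_prop⟩, by simp, by simp⟩
  have hsum : ∀ t : Simplex 1, t.1 0 + t.1 1 = 1 := fun t => by
    have := t.2.2
    rwa [Fin.sum_univ_two] at this
  have a1 : ∀ t, p2 (faceMap 1 2 t) = 0 := fun t => Subtype.ext (faceMap_self (i := 1) 2 t)
  have a2 : ∀ t, p2 (faceMap 1 0 t) = secondCoord t := fun t =>
    Subtype.ext (faceMap_succAbove (i := 1) 0 t 1)
  have a3 : ∀ t, p2 (faceMap 1 1 t) = secondCoord t := fun t =>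
    Subtype.ext (faceMap_succAbove (i := 1) 1 t 1)
  have b1 : ∀ t, p12 (faceMap 1 2 t) = secondCoord t := fun t => by
    have e1 : (faceMap 1 2 t).1 1 = t.1 1 := faceMap_succAbove (i := 1) 2 t 1
    have e2 : (faceMap 1 2 t).1 2 = 0 := faceMap_self (i := 1) 2 t
    exact Subtype.ext (by simp only [p12, secondCoord, ContinuousMap.coe_mk, e1, e2, add_zero])
  have b2 : ∀ t, p12 (faceMap 1 0 t) = 1 := fun t => by
    have e1 : (faceMap 1 0 t).1 1 = t.1 0 := faceMap_succAbove (i := 1) 0 t 0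
    have e2 : (faceMap 1 0 t).1 2 = t.1 1 := faceMap_succAbove (i := 1) 0 t 1
    exact Subtype.ext (by simp only [p12, ContinuousMap.coe_mk, e1, e2, hsum, Set.Icc.coe_one])
  have b3 : ∀ t, p12 (faceMap 1 1 t) = secondCoord t := fun t => by
    have e1 : (faceMap 1 1 t).1 1 = 0 := faceMap_self (i := 1) 1 t
    have e2 : (faceMap 1 1 t).1 2 = t.1 1 := faceMap_succAbove (i := 1) 1 t 1
    exact Subtype.ext (by simp only [p12, secondCoord, ContinuousMap.coe_mk, e1, e2, zero_add])
  have h1 := triangle_mem (L := L) (H.toContinuousMap.comp (p2.prodMk p12)) γ (Path.refl y) diag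
    (fun t => by
      change H (p2 _, p12 _) = _
      rw [a1, b1]; simp)
    (fun t => by
      change H (p2 _, p12 _) = _
      rw [a2, b2]; simp)
    (fun t => by
      change H (p2 _, p12 _) = _
      rw [a3, b3]; rfl) v
  have h2 := triangle_mem (L := L) (H.toContinuousMap.comp (p12.prodMk p2)) (Path.refl x) δ diag
    (fun t => by
      change H (p12 _, p2 _) = _
      rw [a1, b1]; simp)
    (fun t => by
      change H (p12 _, p2 _) = _
      rw [a2, b2]; simp)
    (fun t => by
      change H (p12 _, p2 _) = _
      rw [a3, b3]; rfl) v
  rw [transport_refl] at h2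
  have h3 := sub_mem h1 (pathChain_refl_mem y (L.transport γ v))
  have h4 := sub_mem h2 (pathChain_refl_mem x v)
  have h5 := sub_mem h3 h4
  convert h5 using 1
  abel

/-- The class of a path with coefficients modulo a space of chains that contains the boundaries. -/
noncomputable def quotientCocycle (W : Submodule ℂ (Chain L 1)) (hW : IntersectionBoundary L ≤ W) :
    PathCocycle L (Chain L 1 ⧸ W) where
  val γ :=
    { toFun := fun v => W.mkQ (pathChain L γ v)
      map_add' := fun v w => by rw [pathChain_add, map_add]
      map_smul' := fun c v => by rw [pathChain_smul, map_smul]; rfl }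
  trans γ δ v := by
    have h := (Submodule.Quotient.mk_eq_zero W).2 (hW (pathChain_trans_mem γ δ v))
    rw [← Submodule.mkQ_apply, map_add, map_sub] at h
    change W.mkQ _ = W.mkQ _ + W.mkQ _
    rw [eq_comm, ← sub_eq_zero, ← h]
    abel
  homotopic γ δ h := by
    refine LinearMap.ext fun v => ?_
    have h := (Submodule.Quotient.mk_eq_zero W).2 (hW (pathChain_homotopic_mem h v))
    rw [← Submodule.mkQ_apply, map_sub, sub_eq_zero] at h
    exact h

theorem quotientCocycle_val (W : Submodule ℂ (Chain L 1)) (hW : IntersectionBoundary L ≤ W)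
    {x y : Pt S} (γ : Path x y) (v : L.fibre x) :
    (quotientCocycle W hW).val γ v = W.mkQ (pathChain L γ v) := rfl

/-- Admissibility in dimension one would require a point of `S` to come from a parameter without
nonzero barycentric coordinates. Intersection `1`-cycles therefore avoid `S`, and their simplices
are paths in the nonsingular locus. -/
theorem notMem_of_isAdmissible {σ : C(Simplex 1, P1)} (h : IsAdmissible S σ) (t : Simplex 1) :
    σ t ∉ S := by
  intro ht
  have h1 := h t ht
  have h2 : {k | t k ≠ 0}.ncard = 0 := by omega
  rw [Set.ncard_eq_zero (Set.toFinite _)] at h2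
  have h3 : ∀ k, t.1 k = 0 := fun k => by
    by_contra hk
    exact (Set.eq_empty_iff_forall_notMem.1 h2 k) hk
  have h4 := t.2.2
  simp [h3] at h4

/-- A simplex in the nonsingular locus as a path. -/
noncomputable def simplexToPath (σ : C(Simplex 1, P1)) (hσ : ∀ t, σ t ∉ S) :
    Path (⟨σ (stdSimplex.vertex 0), hσ _⟩ : Pt S) ⟨σ (stdSimplex.vertex 1), hσ _⟩ where
  toFun s := ⟨σ (simplexPath (stdSimplex.vertex 0) (stdSimplex.vertex 1) s), hσ _⟩
  continuous_toFun := (σ.continuous.comp (simplexPath _ _).continuous).subtype_mk _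
  source' := by simp
  target' := by simp

theorem simplexPath_secondCoord (t : Simplex 1) :
    simplexPath (stdSimplex.vertex 0) (stdSimplex.vertex 1) (secondCoord t) = t := by
  have h := t.2.2
  rw [Fin.sum_univ_two] at h
  refine Subtype.ext (funext fun k => ?_)
  fin_cases k
  · simp [simplexPath, secondCoord, AffineMap.lineMap_apply]
    linarith
  · simp [simplexPath, secondCoord, AffineMap.lineMap_apply]

open Classical in
theorem single_eq_pathChain (σ : C(Simplex 1, P1)) (hσ : ∀ t, σ t ∉ S) (w : Coefficient L σ) :
    (DFinsupp.single σ w : Chain L 1) =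
      pathChain L (simplexToPath σ hσ) (w.1 ⟨stdSimplex.vertex 0, hσ _⟩) := by
  refine single_eq_single (fun t => ?_) hσ (stdSimplex.vertex 0) (regSimplex_notMem _ _)
    (HEq.symm ?_)
  · exact congrArg σ (simplexPath_secondCoord t).symm
  · refine (flatSec_heq _ (stdSimplex.vertex 0) (by simp) _ (stdSimplex.vertex 0)
      (regSimplex_notMem _ _) (Path.refl _) fun s => ?_).trans (heq_of_eq (transport_refl L _ _))
    have : secondCoord (simplexPath (stdSimplex.vertex 0) (stdSimplex.vertex 0) s) = 0 :=
      Subtype.ext (by simp [secondCoord, simplexPath])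
    change simplexToPath σ hσ (secondCoord _) = _
    rw [this]; simp

open Classical in
/-- A linear map on chains. -/
noncomputable def chainLift {i : ℕ} {A : Type*} [AddCommGroup A] [Module ℂ A]
    (G : ∀ σ : C(Simplex i, P1), Coefficient L σ →ₗ[ℂ] A) : Chain L i →ₗ[ℂ] A :=
  DFinsupp.lsum ℂ G

open Classical in
theorem chainLift_chainOf {i : ℕ} {A : Type*} [AddCommGroup A] [Module ℂ A]
    (G : ∀ σ : C(Simplex i, P1), Coefficient L σ →ₗ[ℂ] A) (σ : C(Simplex i, P1))
    (w : Coefficient L σ) : chainLift G (chainOf L σ w) = G σ w :=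
  DFinsupp.lsum_single ..

open Classical in
/-- The extension of a potential to `0`-chains. -/
noncomputable def potentialChain {A : Type*} [AddCommGroup A] [Module ℂ A]
    (K : ∀ x : Pt S, L.fibre x →ₗ[ℂ] A) : Chain L 0 →ₗ[ℂ] A :=
  chainLift fun ρ => if h : ρ (stdSimplex.vertex 0) ∉ S then
    { toFun := fun v => K ⟨_, h⟩ (v.1 ⟨_, h⟩)
      map_add' := fun _ _ => map_add (K ⟨_, h⟩) _ _
      map_smul' := fun _ _ => map_smul (K ⟨_, h⟩) _ _ } else 0

theorem potentialChain_pointChain {A : Type*} [AddCommGroup A] [Module ℂ A]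
    (K : ∀ x : Pt S, L.fibre x →ₗ[ℂ] A) (x : Pt S) (v : L.fibre x) :
    potentialChain K (pointChain L x v) = K x v := by
  have hx : regSimplex (ContinuousMap.const (Simplex 0) x) (stdSimplex.vertex 0) ∉ S :=
    regSimplex_notMem _ _
  rw [pointChain_apply, potentialChain, chainLift_chainOf, dif_pos hx]
  change K x ((flatSec L (ContinuousMap.const (Simplex 0) x) (stdSimplex.vertex 0) rfl v).1 ⟨_, hx⟩)
    = K x v
  congr 1
  refine eq_of_heq ((flatSec_heq (ContinuousMap.const _ x) (stdSimplex.vertex 0) rfl v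
    (stdSimplex.vertex 0) hx (Path.refl x) fun s => rfl).trans (heq_of_eq (transport_refl L _ _)))

/-- If the class of paths modulo `W` has a potential, then all cycles lie in `W`. -/
theorem mem_of_potential {W : Submodule ℂ (Chain L 1)} (hW : IntersectionBoundary L ≤ W)
    {K : ∀ x : Pt S, L.fibre x →ₗ[ℂ] Chain L 1 ⧸ W}
    (hK : ∀ {x y : Pt S} (γ : Path x y), (quotientCocycle W hW).IsPotentialOn K γ)
    {ξ : Chain L 1} (hξ : ξ ∈ IntersectionCycle L) : ξ ∈ W := by
  classical
  obtain ⟨⟨hadm, -⟩, hcyc⟩ := hξ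
  have h1 : ∀ σ ∈ ξ.support, W.mkQ (DFinsupp.single σ (ξ σ)) =
      potentialChain K (boundary L 0 (DFinsupp.single σ (ξ σ))) := by
    intro σ hσ
    have hσS := notMem_of_isAdmissible (hadm σ (DFinsupp.mem_support_iff.1 hσ))
    -- On each simplex the class modulo `W` is the potential applied to the boundary, and the
    -- boundary of the whole cycle is zero.
    have key : ∀ {x y : Pt S} (γ : Path x y) (v : L.fibre x), W.mkQ (pathChain L γ v) =
        potentialChain K (boundary L 0 (pathChain L γ v)) := fun γ v => by
      rw [boundary_pathChain, map_sub, potentialChain_pointChain, potentialChain_pointChain, ← hK,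
        quotientCocycle_val]
    rw [single_eq_pathChain σ hσS]
    exact key _ _
  rw [← Submodule.Quotient.mk_eq_zero, ← Submodule.mkQ_apply, ← DFinsupp.sum_single (f := ξ),
    DFinsupp.sum, map_sum, Finset.sum_congr rfl h1, ← map_sum, ← map_sum]
  have h2 : ∑ σ ∈ ξ.support, DFinsupp.single σ (ξ σ) = ξ := DFinsupp.sum_single (f := ξ)
  rw [h2, LinearMap.mem_ker.1 hcyc, map_zero]

end Quotient

end DeligneMostow
namespace DeligneMostow
open Complex CategoryTheory Filter Topology

/-! ### Potentials near a singular point -/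

/-- The amount by which a loop is contracted. -/
noncomputable def loopShrink (t : ℝ) : ℝ := min 1 (min (3 * t) (3 - 3 * t))

/-- The amount by which a loop is rotated. -/
noncomputable def loopTurn (t : ℝ) : ℝ := max 0 (min 1 (3 * t - 1))

/-- A loop through `x` around `z` that is close to `z` for most of the time. -/
noncomputable def loopFn (z : ℂ) (ρ : ℝ) (x : ℂ) (t : ℝ) : ℂ :=
  z + ((1 - loopShrink t + loopShrink t * min 1 (ρ / ‖x - z‖) : ℝ) : ℂ) * (x - z) *
    exp (2 * Real.pi * loopTurn t * I)

/-- In the middle third of the time the loop turns inside the small ball. In the outer thirds it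
runs on the segment between `x` and `z`, which stays in `K` by convexity. -/
theorem loopFn_mem {z x : ℂ} {ρ : ℝ} (hρ : 0 < ρ) (hx : x ≠ z) {K : Set ℂ} (hK : Convex ℝ K)
    (hxK : x ∈ K) (hb : Metric.closedBall z ρ ⊆ K) {t : ℝ} (ht : t ∈ unitInterval) :
    loopFn z ρ x t ∈ K ∧ loopFn z ρ x t ≠ z := by
  have hn : 0 < ‖x - z‖ := norm_pos_iff.2 (sub_ne_zero.2 hx)
  have hm : 0 < min 1 (ρ / ‖x - z‖) := lt_min one_pos (div_pos hρ hn)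
  have hm1 : min 1 (ρ / ‖x - z‖) ≤ 1 := min_le_left _ _
  have hs0 : 0 ≤ loopShrink t := le_min zero_le_one (le_min (by linarith [ht.1]) (by linarith [ht.2]))
  have hs1 : loopShrink t ≤ 1 := min_le_left _ _
  set l := 1 - loopShrink t + loopShrink t * min 1 (ρ / ‖x - z‖) with hl
  have hl0 : 0 < l := by
    rcases eq_or_lt_of_le hs1 with h | h
    · rw [hl, h]; linarith
    · have := mul_nonneg hs0 hm.le
      linarith
  have hl1 : l ≤ 1 := by
    have := mul_le_mul_of_nonneg_left hm1 hs0
    linarith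
  refine ⟨?_, fun h => ?_⟩
  · by_cases h : t ∈ Set.Icc (1 / 3 : ℝ) (2 / 3)
    · refine hb ?_
      have h1 : loopShrink t = 1 := min_eq_left (le_min (by linarith [h.1]) (by linarith [h.2]))
      have h2 : (2 * Real.pi * loopTurn t * I : ℂ) = ((2 * Real.pi * loopTurn t : ℝ) : ℂ) * I := by
        push_cast; ring
      rw [Metric.mem_closedBall, dist_eq_norm, loopFn, add_sub_cancel_left, norm_mul, h2,
        norm_exp_ofReal_mul_I, mul_one, norm_mul, norm_real, Real.norm_of_nonneg hl0.le, hl, h1]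
      calc (1 - 1 + 1 * min 1 (ρ / ‖x - z‖)) * ‖x - z‖ = min 1 (ρ / ‖x - z‖) * ‖x - z‖ := by ring
        _ ≤ ρ / ‖x - z‖ * ‖x - z‖ := mul_le_mul_of_nonneg_right (min_le_right _ _) hn.le
        _ = ρ := div_mul_cancel₀ _ hn.ne'
    · have h1 : exp (2 * Real.pi * loopTurn t * I) = 1 := by
        rcases lt_or_ge t (1 / 3) with h' | h'
        · have : loopTurn t = 0 := max_eq_left ((min_le_right _ _).trans (by linarith))
          rw [this]; simp
        · have h'' : 2 / 3 < t := by
            by_contra h3; exact h ⟨h', not_lt.1 h3⟩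
          have : loopTurn t = 1 := by
            rw [loopTurn, min_eq_left (by linarith), max_eq_right zero_le_one]
          rw [this]; simp [Complex.exp_two_pi_mul_I]
      rw [loopFn, h1, mul_one]
      have hz : z ∈ K := hb (Metric.mem_closedBall_self hρ.le)
      have := hK.add_smul_sub_mem hz hxK ⟨hl0.le, hl1⟩
      rwa [real_smul] at this
  · rw [loopFn, add_eq_left] at h
    refine mul_ne_zero (mul_ne_zero ?_ (sub_ne_zero.2 hx)) (exp_ne_zero _) h
    exact_mod_cast hl0.ne'

theorem continuous_loopFn {X : Type*} [TopologicalSpace X] {z : ℂ} {ρ : ℝ} {f : X → ℂ} {g : X → ℝ}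
    (hf : Continuous f) (hg : Continuous g) (hfz : ∀ x, f x ≠ z) :
    Continuous fun x => loopFn z ρ (f x) (g x) := by
  have hn : ∀ x, ‖f x - z‖ ≠ 0 := fun x => norm_ne_zero_iff.2 (sub_ne_zero.2 (hfz x))
  unfold loopFn loopShrink loopTurn
  fun_prop (disch := exact hn)

theorem loopFn_zero (z : ℂ) (ρ : ℝ) (x : ℂ) : loopFn z ρ x 0 = x := by
  have h1 : loopShrink 0 = 0 := by simp [loopShrink]
  have h2 : loopTurn 0 = 0 := by simp [loopTurn]
  simp [loopFn, h1, h2]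

theorem loopFn_one (z : ℂ) (ρ : ℝ) (x : ℂ) : loopFn z ρ x 1 = x := by
  have h1 : loopShrink 1 = 0 := by norm_num [loopShrink]
  have h2 : loopTurn 1 = 1 := by norm_num [loopTurn]
  simp [loopFn, h1, h2, Complex.exp_two_pi_mul_I]

namespace Config

variable {S : Set P1} {L : LocalSystem.{u} S} (C : Config L)

/-- A convex open set that contains only the singular point `z j`. -/
structure IsolatingSet (j : ℕ) (U : Set ℂ) : Prop where
  convex : Convex ℝ U
  isOpen : IsOpen U
  mem : C.z j ∈ U
  halfPlane : ∀ k < C.m, k ≠ j → ∃ u, U ⊆ halfPlane (C.z k) u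

/-- The local monodromy at `z j`. -/
noncomputable def mon (j : ℕ) : ℂ := exp (2 * Real.pi * I * C.ν j)

/-- An exponent strictly between `0` and `1` is not an integer. Without this there would be neither
local potentials nor regularized arcs. -/
theorem mon_ne_one {j : ℕ} (hj : j < C.m) : C.mon j ≠ 1 := by
  intro h
  obtain ⟨n, hn⟩ := Complex.exp_eq_one_iff.1 h
  rw [mul_comm (n : ℂ)] at hn
  have h1 : (C.ν j : ℂ) = n := mul_left_cancel₀ Complex.two_pi_I_ne_zero hn
  have h2 : C.ν j = n := by exact_mod_cast h1
  have h3 := C.ν_pos j hj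
  have h4 := C.ν_lt_one j hj
  rw [h2] at h3 h4
  have h5 : 0 < n := by exact_mod_cast h3
  have h6 : n < 1 := by exact_mod_cast h4
  omega

theorem IsolatingSet.diff_subset {C : Config L} {j : ℕ} {U : Set ℂ} (hU : C.IsolatingSet j U) :
    U \ {C.z j} ⊆ fin S := by
  rintro x ⟨hx, hxz⟩
  rw [C.mem_fin_iff]
  rintro k hk rfl
  by_cases hkj : k = j
  · exact hxz (by rw [hkj]; rfl)
  · obtain ⟨u, hu⟩ := hU.halfPlane k hk hkj
    have := hu hx
    rw [mem_halfPlane, sub_self, zero_div] at this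
    exact lt_irrefl _ this

variable {C}

/-- A closed path in an isolating set that winds once around the singular point. -/
theorem IsolatingSet.transport_eq_mon {j : ℕ} (hj : j < C.m) {U : Set ℂ}
    (hU : C.IsolatingSet j U) {x : Pt S} (γ : Path x x) (g : C(unitInterval, ℂ))
    (hg : ∀ t, (γ t : P1) = (g t : P1)) (hgU : ∀ t, g t ∈ U) (φ : C(unitInterval, ℝ))
    (hφ : ∀ t, g t - C.z j = ‖g t - C.z j‖ * exp (φ t * I)) (hφ1 : φ 1 - φ 0 = 2 * Real.pi)
    (v : L.fibre x) : L.transport γ v = C.mon j • v := by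
  obtain ⟨F⟩ : Nonempty (Frame C) := inferInstance
  have hg01 : g 0 = g 1 := OnePoint.coe_injective (by rw [← hg, ← hg, γ.source, γ.target])
  -- Around every other singular point the closed path stays in a half plane, so its argument
  -- returns to its initial value; only `z j` contributes.
  have hθ : ∀ k, ∃ θ : C(unitInterval, ℝ), (k < C.m → ∀ t, g t - C.z k =
      ‖g t - C.z k‖ * exp (θ t * I)) ∧ (k < C.m → θ 1 - θ 0 =
      if k = j then 2 * Real.pi else 0) := by
    intro k
    by_cases hk : k < C.m
    · by_cases hkj : k = j
      · subst hkj
        exact ⟨φ, fun _ => hφ, fun _ => by rw [if_pos rfl, hφ1]⟩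
      · obtain ⟨u, hu⟩ := hU.halfPlane k hk hkj
        have hpos : ∀ t : unitInterval, 0 < ((g t - C.z k) / u).re := fun t => hu (hgU t)
        have hu0 : u ≠ 0 := by
          rintro rfl
          have := hpos 0
          simp at this
        refine ⟨⟨fun t => arg ((g t - C.z k) / u) + arg u, ?_⟩, fun _ t => ?_, fun _ => ?_⟩
        · refine Continuous.add (continuous_iff_continuousAt.2 fun t => ?_) continuous_const
          exact (Complex.continuousAt_arg (Or.inl (hpos t))).comp
            (f := fun t => (g t - C.z k) / u)
            ((g.continuous.sub continuous_const).div_const u).continuousAt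
        · have e1 := Complex.norm_mul_exp_arg_mul_I ((g t - C.z k) / u)
          have e2 := Complex.norm_mul_exp_arg_mul_I u
          have e3 : g t - C.z k = (g t - C.z k) / u * u := (div_mul_cancel₀ _ hu0).symm
          have e4 : ‖g t - C.z k‖ = ‖(g t - C.z k) / u‖ * ‖u‖ := by rw [← norm_mul, ← e3]
          change g t - C.z k = _ * exp (((arg ((g t - C.z k) / u) + arg u : ℝ) : ℂ) * I)
          calc g t - C.z k = (‖(g t - C.z k) / u‖ * exp (arg ((g t - C.z k) / u) * I)) *
                (‖u‖ * exp (arg u * I)) := by rw [e1, e2]; exact e3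
            _ = (‖(g t - C.z k) / u‖ * ‖u‖ : ℝ) *
                exp (((arg ((g t - C.z k) / u) + arg u : ℝ) : ℂ) * I) := by
              rw [ofReal_add, add_mul, exp_add]; push_cast; ring
            _ = _ := by rw [← e4]
        · rw [if_neg hkj]
          simp [hg01]
    · exact ⟨0, fun h => absurd h hk, fun h => absurd h hk⟩
  choose θ hθ1 hθ2 using hθ
  have h1 := F.transport_e_of_args γ g hg θ hθ1
  have h2 : ∑ k ∈ Finset.range C.m, C.ν k * (θ k 1 - θ k 0) = C.ν j * (2 * Real.pi) := by
    rw [Finset.sum_eq_single_of_mem j (Finset.mem_range.2 hj)]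
    · rw [hθ2 j hj, if_pos rfl]
    · intro k hk hkj
      rw [hθ2 k (Finset.mem_range.1 hk), if_neg hkj, mul_zero]
  rw [h2] at h1
  rw [← F.co_smul_e _ v, map_smul, h1, smul_comm, mon]
  congr 2
  push_cast
  ring

/-- The local potential of a path cocycle. -/
theorem IsolatingSet.exists_potential {j : ℕ} (hj : j < C.m) {U : Set ℂ} (hU : C.IsolatingSet j U)
    {A : Type*} [AddCommGroup A] [Module ℂ A] (c : PathCocycle L A) :
    ∃ K : ∀ x : Pt S, L.fibre x →ₗ[ℂ] A, ∀ {x y : Pt S} (γ : Path x y),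
      (∀ t, ∃ w ∈ U \ {C.z j}, (γ t : P1) = (w : P1)) → c.IsPotentialOn K γ := by
  obtain ⟨ρ, hρ, hball⟩ : ∃ ρ > 0, Metric.closedBall (C.z j) ρ ⊆ U := by
    obtain ⟨ρ, hρ, h⟩ := Metric.isOpen_iff.1 hU.isOpen _ hU.mem
    exact ⟨ρ / 2, by positivity, (Metric.closedBall_subset_ball (by linarith)).trans h⟩
  have hmem : ∀ x ∈ U \ {C.z j}, ∀ t ∈ unitInterval, loopFn (C.z j) ρ x t ∈ U \ {C.z j} :=
    fun x hx t ht => loopFn_mem hρ hx.2 hU.convex hx.1 hball ht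
  let g : ∀ x ∈ U \ {C.z j}, C(unitInterval, ℂ) := fun x hx =>
    ⟨fun t => loopFn (C.z j) ρ x t, continuous_loopFn continuous_const continuous_subtype_val
      fun _ => hx.2⟩
  let loop : ∀ x (hx : x ∈ U \ {C.z j}),
      Path (pt (hU.diff_subset hx)) (pt (hU.diff_subset hx)) := fun x hx =>
    mkPath (g x hx) (fun t => hU.diff_subset (hmem x hx t t.2)) _ _ (loopFn_zero _ _ _)
      (loopFn_one _ _ _)
  have hmon : ∀ x (hx : x ∈ U \ {C.z j}) v, L.transport (loop x hx) v = C.mon j • v := by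
    intro x hx v
    have hxz : x - C.z j ≠ 0 := sub_ne_zero.2 hx.2
    refine hU.transport_eq_mon hj (loop x hx) (g x hx) (fun _ => rfl)
      (fun t => (hmem x hx t t.2).1) ⟨fun t => arg (x - C.z j) + 2 * Real.pi * loopTurn t, by
        unfold loopTurn; fun_prop⟩ (fun t => ?_) ?_ v
    · have hn : 0 < ‖x - C.z j‖ := norm_pos_iff.2 hxz
      have hm : 0 < min 1 (ρ / ‖x - C.z j‖) := lt_min one_pos (div_pos hρ hn)
      have hs0 : 0 ≤ loopShrink t :=
        le_min zero_le_one (le_min (by linarith [t.2.1]) (by linarith [t.2.2]))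
      have hs1 : loopShrink t ≤ 1 := min_le_left _ _
      have hl0 : 0 ≤ 1 - loopShrink t + loopShrink t * min 1 (ρ / ‖x - C.z j‖) :=
        add_nonneg (by linarith) (mul_nonneg hs0 hm.le)
      set l := 1 - loopShrink t + loopShrink t * min 1 (ρ / ‖x - C.z j‖) with hl
      have e : g x hx t - C.z j = (l : ℂ) * (x - C.z j) *
          exp ((2 * Real.pi * loopTurn t : ℝ) * I) := by
        simp only [g, ContinuousMap.coe_mk, loopFn, add_sub_cancel_left, ← hl]
        push_cast; ring
      rw [e, norm_mul, norm_mul, norm_exp_ofReal_mul_I, norm_real, Real.norm_of_nonneg hl0]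
      have e3 : exp (((arg (x - C.z j) + 2 * Real.pi * loopTurn t : ℝ) : ℂ) * I) =
          exp (arg (x - C.z j) * I) * exp ((2 * Real.pi * loopTurn t : ℝ) * I) := by
        rw [ofReal_add, add_mul, exp_add]
      rw [ContinuousMap.coe_mk, e3, mul_one, ofReal_mul]
      conv_lhs => rw [← Complex.norm_mul_exp_arg_mul_I (x - C.z j)]
      simp only [ofReal_mul]
      ring
    · have h1 : loopTurn 0 = 0 := by simp [loopTurn]
      have h2 : loopTurn 1 = 1 := by norm_num [loopTurn]
      simp [h1, h2]
  classical
  -- Evaluating the cocycle on the homotopic paths `loop_x · γ` and `γ · loop_y` gives `(α - 1) c(γ)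
  -- v = c(loop_y)(γ v) - c(loop_x) v`. So `(α - 1)⁻¹ c(loop)` is a potential.
  let K : ∀ x : Pt S, L.fibre x →ₗ[ℂ] A := fun x =>
    if h : ∃ w : ℂ, ∃ hw : w ∈ U \ {C.z j}, pt (hU.diff_subset hw) = x then
      (C.mon j - 1)⁻¹ • c.val ((loop h.choose h.choose_spec.choose).cast
        h.choose_spec.choose_spec.symm h.choose_spec.choose_spec.symm) else 0
  have hK : ∀ w (hw : w ∈ U \ {C.z j}),
      K (pt (hU.diff_subset hw)) = (C.mon j - 1)⁻¹ • c.val (loop w hw) := by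
    intro w hw
    have h : ∃ w' : ℂ, ∃ hw' : w' ∈ U \ {C.z j}, pt (hU.diff_subset hw') =
      pt (hU.diff_subset hw) := ⟨w, hw, rfl⟩
    have e : h.choose = w :=
      OnePoint.coe_injective (congrArg Subtype.val h.choose_spec.choose_spec)
    simp only [K]
    rw [dif_pos h]
    congr 1
    refine LinearMap.ext fun v => c.val_congr (fun t => ?_) HEq.rfl
    have : ∀ (w' : ℂ) (hw' : w' ∈ U \ {C.z j}), w' = w → loop w' hw' t = loop w hw t := by
      rintro w' hw' rfl; rfl
    exact this _ h.choose_spec.choose e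
  refine ⟨K, fun {x y} γ hγ => ?_⟩
  obtain ⟨f, hf⟩ := exists_lift γ hγ
  have hx : x = pt (hU.diff_subset (f 0).2) := Subtype.ext (by rw [← γ.source]; exact (hf 0).symm)
  have hy : y = pt (hU.diff_subset (f 1).2) := Subtype.ext (by rw [← γ.target]; exact (hf 1).symm)
  subst hx hy
  intro v
  -- The loops based at the points of `γ` form a map from a square. Both ways around its boundary
  -- are homotopic to the diagonal.
  let H : C(unitInterval × unitInterval, Pt S) :=
    ⟨fun p => pt (hU.diff_subset (hmem (f p.2) (f p.2).2 p.1 p.1.2)),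
      (continuous_coe_P1.comp (continuous_loopFn
        (f := fun p : unitInterval × unitInterval => (f p.2 : ℂ)) (by fun_prop) (by fun_prop)
        fun p h => (f p.2).2.2 h)).subtype_mk _⟩
  let diag : Path (pt (hU.diff_subset (f 0).2)) (pt (hU.diff_subset (f 1).2)) :=
    ⟨⟨fun s => H (s, s), by fun_prop⟩, Subtype.ext (by simp [H, loopFn_zero]),
      Subtype.ext (by simp [H, loopFn_one])⟩
  have : ContractibleSpace unitInterval := (convex_Icc (0 : ℝ) 1).contractibleSpace ⟨0, by simp⟩
  have h1 := trans_homotopic_of_factor H (loop (f 0) (f 0).2) γ diag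
    ⟨fun t => (t, 0), by fun_prop⟩ ⟨fun s => (1, s), by fun_prop⟩ ⟨fun s => (s, s), by fun_prop⟩
    (fun t => rfl) (fun s => Subtype.ext (by simpa [H, loopFn_one] using hf s)) (fun s => rfl) rfl rfl rfl
  have h2 := trans_homotopic_of_factor H γ (loop (f 1) (f 1).2) diag
    ⟨fun s => (0, s), by fun_prop⟩ ⟨fun t => (t, 1), by fun_prop⟩ ⟨fun s => (s, s), by fun_prop⟩
    (fun s => Subtype.ext (by simpa [H, loopFn_zero] using hf s)) (fun t => rfl) (fun s => rfl) rfl rfl rfl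
  have h3 := c.trans (loop (f 0) (f 0).2) γ v
  rw [c.homotopic _ _ h1, ← c.homotopic _ _ h2, c.trans, hmon (f 0) (f 0).2, map_smul] at h3
  have hα : C.mon j - 1 ≠ 0 := sub_ne_zero.2 (C.mon_ne_one hj)
  rw [hK (f 0) (f 0).2, hK (f 1) (f 1).2, LinearMap.smul_apply, LinearMap.smul_apply, ← smul_sub, eq_inv_smul_iff₀ hα,
    sub_smul, one_smul, sub_eq_sub_iff_add_eq_add, add_comm, ← h3, add_comm]

end Config

end DeligneMostow
namespace DeligneMostow
open Complex CategoryTheory Filter Topology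

/-! ### Squares, arcs and their classes -/

theorem mem_halfPlane_iff {v u w : ℂ} : w ∈ halfPlane v u ↔ (v / u).re < (w / u).re := by
  rw [mem_halfPlane, sub_div, sub_re, sub_pos]

theorem mem_halfPlane_neg_iff {v u w : ℂ} : w ∈ halfPlane v (-u) ↔ (w / u).re < (v / u).re := by
  rw [mem_halfPlane, div_neg, sub_div, neg_re, sub_re, neg_pos, sub_neg]

/-- The vertices of a square with centre `z`. -/
noncomputable def sqPt (z w : ℂ) (i : Fin 4) : ℂ := z + w * ![1, I, -1, -I] i

theorem sqPt_succ_sub (z w : ℂ) (i : Fin 4) : sqPt z w (i + 1) - z = (sqPt z w i - z) * I := by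
  fin_cases i <;> simp [sqPt]
  · ring_nf; simp
  · ring_nf; simp

theorem norm_sqPt_sub (z w : ℂ) (i : Fin 4) : ‖sqPt z w i - z‖ = ‖w‖ := by
  fin_cases i <;> simp [sqPt]

theorem ang_sqPt {z w : ℂ} (hw : w ≠ 0) (i : Fin 4) :
    ang z (sqPt z w i) (sqPt z w (i + 1)) = Real.pi / 2 := by
  have h : sqPt z w i - z ≠ 0 := by
    rw [← norm_ne_zero_iff, norm_sqPt_sub]; exact norm_ne_zero_iff.2 hw
  rw [ang, sqPt_succ_sub, mul_div_cancel_left₀ _ h, arg_I]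

theorem center_notMem_edge {z w : ℂ} (hw : w ≠ 0) (i : Fin 4) :
    z ∉ segment ℝ (sqPt z w i) (sqPt z w (i + 1)) := by
  intro h
  obtain ⟨t, -, ht⟩ := mem_segment_iff.1 h
  have h1 : (sqPt z w i - z) * (1 + t * (I - 1)) = 0 := by
    linear_combination -ht - t * (sqPt_succ_sub z w i)
  rcases mul_eq_zero.1 h1 with h2 | h2
  · rw [← norm_eq_zero, norm_sqPt_sub, norm_eq_zero] at h2
    exact hw h2
  · have hr := congrArg re h2
    have hi := congrArg im h2
    simp at hr hi
    rw [hi] at hr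
    norm_num at hr

theorem edge_subset_closedBall (z w : ℂ) (i : Fin 4) :
    segment ℝ (sqPt z w i) (sqPt z w (i + 1)) ⊆ Metric.closedBall z ‖w‖ := by
  refine (convex_closedBall z ‖w‖).segment_subset ?_ ?_ <;>
    rw [Metric.mem_closedBall, dist_eq_norm, norm_sqPt_sub]

section

variable {S : Set P1} {L : LocalSystem.{u} S} {C : Config L}

/-- The multiples of a coefficient at the start of the edges of a square. -/
noncomputable def Config.sqCoef (C : Config L) (z w : ℂ) : Fin 4 → ℂ :=
  ![1, C.E (sqPt z w 0) (sqPt z w 1), C.E (sqPt z w 0) (sqPt z w 1) * C.E (sqPt z w 1) (sqPt z w 2),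
    C.E (sqPt z w 0) (sqPt z w 1) * C.E (sqPt z w 1) (sqPt z w 2) * C.E (sqPt z w 2) (sqPt z w 3)]

/-- The four edges are seen from `z j` under quarter turns, which add up to `2π`. From every other
singular point the square lies in a half plane and the angles add up to zero. -/
theorem Config.IsolatingSet.prod_E {j : ℕ} (hj : j < C.m) {U : Set ℂ} (hU : C.IsolatingSet j U)
    {w : ℂ} (hw : w ≠ 0) (hb : Metric.closedBall (C.z j) ‖w‖ ⊆ U) :
    C.sqCoef (C.z j) w 3 * C.E (sqPt (C.z j) w 3) (sqPt (C.z j) w 0) = C.mon j := by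
  have hp : ∀ i, sqPt (C.z j) w i ∈ U := fun i => hb (by
    rw [Metric.mem_closedBall, dist_eq_norm, norm_sqPt_sub])
  simp only [sqCoef, Config.E, mult, Matrix.cons_val, mon]
  rw [← exp_add, ← exp_add, ← exp_add, ← mul_add, ← mul_add, ← mul_add, ← ofReal_add, ← ofReal_add,
    ← ofReal_add, ← Finset.sum_add_distrib, ← Finset.sum_add_distrib, ← Finset.sum_add_distrib,
    Finset.sum_eq_single_of_mem j (Finset.mem_range.2 hj)]
  · have h0 := ang_sqPt (z := C.z j) hw 0
    have h1 := ang_sqPt (z := C.z j) hw 1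
    have h2 := ang_sqPt (z := C.z j) hw 2
    have h3 := ang_sqPt (z := C.z j) hw 3
    simp only [zero_add, Fin.reduceAdd] at h0 h1 h2 h3
    rw [h0, h1, h2, h3]
    congr 1
    push_cast
    ring
  · intro k hk hkj
    obtain ⟨u, hu⟩ := hU.halfPlane k (Finset.mem_range.1 hk) hkj
    have e1 := ang_add (hu (hp 0)) (hu (hp 1)) (hu (hp 2))
    have e2 := ang_add (hu (hp 0)) (hu (hp 2)) (hu (hp 3))
    have e3 := ang_add (hu (hp 0)) (hu (hp 3)) (hu (hp 0))
    rw [ang_self] at e3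
    linear_combination (C.ν k) * (e1 + e2 + e3)

variable (F : Frame C) {A : Type*} [AddCommGroup A] [Module ℂ A]

open Classical in
/-- The value of a path cocycle on a segment with coefficient. -/
noncomputable def PathCocycle.seg (c : PathCocycle L A) (a b k : ℂ) : A :=
  if h : segment ℝ a b ⊆ fin S then c.val (segPath h) (k • F.e _) else 0

open Classical in
/-- The value of a potential. -/
noncomputable def potAt (K : ∀ x : Pt S, L.fibre x →ₗ[ℂ] A) (a : ℂ) : ℂ →ₗ[ℂ] A :=
  if h : a ∈ fin S then
    { toFun := fun k => K (pt h) (k • F.e _)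
      map_add' := fun _ _ => by rw [add_smul, map_add]
      map_smul' := fun _ _ => by rw [smul_assoc, map_smul]; rfl } else 0

variable {F}

theorem potAt_apply {K : ∀ x : Pt S, L.fibre x →ₗ[ℂ] A} {a : ℂ} (h : a ∈ fin S) (k : ℂ) :
    potAt F K a k = K (pt h) (k • F.e _) := by
  rw [potAt, dif_pos h]; rfl

theorem PathCocycle.seg_eq {c : PathCocycle L A} {K : ∀ x : Pt S, L.fibre x →ₗ[ℂ] A} {a b : ℂ}
    (h : segment ℝ a b ⊆ fin S) (hK : c.IsPotentialOn K (segPath h)) (k : ℂ) :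
    c.seg F a b k = potAt F K b (k * C.E a b) - potAt F K a k := by
  rw [seg, dif_pos h, hK, potAt_apply (h (right_mem_segment ℝ a b)),
    potAt_apply (h (left_mem_segment ℝ a b)), map_smul, F.transport_segPath, smul_smul]

/-- The value of a path cocycle on a square. -/
theorem Config.IsolatingSet.sum_square {j : ℕ} (hj : j < C.m) {U : Set ℂ}
    (hU : C.IsolatingSet j U) {c : PathCocycle L A} {K : ∀ x : Pt S, L.fibre x →ₗ[ℂ] A}
    (hK : ∀ {x y : Pt S} (γ : Path x y),
      (∀ t, ∃ w ∈ U \ {C.z j}, (γ t : P1) = (w : P1)) → c.IsPotentialOn K γ)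
    {w : ℂ} (hw : w ≠ 0) (hb : Metric.closedBall (C.z j) ‖w‖ ⊆ U) (k : ℂ) :
    ∑ i : Fin 4, c.seg F (sqPt (C.z j) w i) (sqPt (C.z j) w (i + 1)) (k * C.sqCoef (C.z j) w i) =
      (C.mon j - 1) • potAt F K (C.z j + w) k := by
  have hsub : ∀ i, segment ℝ (sqPt (C.z j) w i) (sqPt (C.z j) w (i + 1)) ⊆ U \ {C.z j} :=
    fun i x hx => ⟨hb (edge_subset_closedBall _ _ i hx), fun h => center_notMem_edge hw i (by
      rw [Set.mem_singleton_iff] at h; rwa [h] at hx)⟩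
  have hseg := fun i => PathCocycle.seg_eq (F := F) (c := c) ((hsub i).trans hU.diff_subset)
    (hK _ fun t => ⟨_, hsub i (lineC_mem_segment _ _ t), rfl⟩)
  have h4 := hU.prod_E hj hw hb
  -- The potentials at successive vertices telescope. What remains is the potential at the starting
  -- vertex after one turn, minus the one before.
  rw [Fin.sum_univ_four, hseg, hseg, hseg, hseg]
  have e0 : sqPt (C.z j) w 0 = C.z j + w := by simp [sqPt]
  simp only [zero_add, Fin.reduceAdd, mul_assoc] at h4 ⊢
  rw [h4]
  simp only [sqCoef, Matrix.cons_val, mul_one, mul_assoc, e0, one_mul]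
  rw [sub_smul, one_smul, ← map_smul, smul_eq_mul, mul_comm (C.mon j)]
  abel

/-- The starting points of the segments of an arc with two squares at its ends. -/
noncomputable def arcR (z z' w w' : ℂ) : Option (Bool × Fin 4) → ℂ
  | none => z + w
  | some (false, i) => sqPt z w i
  | some (true, i) => sqPt z' w' i

/-- The final points of the segments of an arc with two squares at its ends. -/
noncomputable def arcS (z z' w w' : ℂ) : Option (Bool × Fin 4) → ℂ
  | none => z' + w'
  | some (false, i) => sqPt z w (i + 1)
  | some (true, i) => sqPt z' w' (i + 1)

/-- The coefficients of the regularized arc from `z j` to `z (j + 1)`. -/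
noncomputable def Config.arcW (C : Config L) (j : ℕ) (w w' : ℂ) : Option (Bool × Fin 4) → ℂ
  | none => 1
  | some (false, i) => (C.mon j - 1)⁻¹ * C.sqCoef (C.z j) w i
  | some (true, i) => -(C.mon (j + 1) - 1)⁻¹ * C.E (C.z j + w) (C.z (j + 1) + w') *
      C.sqCoef (C.z (j + 1)) w' i

theorem PathCocycle.seg_mul (c : PathCocycle L A) (a b k l : ℂ) :
    c.seg F a b (k * l) = k • c.seg F a b l := by
  unfold seg
  split_ifs
  · rw [mul_smul, map_smul]
  · rw [smul_zero]

/-- The value of a path cocycle on a regularized arc is a difference of local potentials. -/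
theorem sum_arc {j : ℕ} (hj : j + 1 < C.m) {U U' : Set ℂ} (hU : C.IsolatingSet j U)
    (hU' : C.IsolatingSet (j + 1) U') {c : PathCocycle L A}
    {K K' : ∀ x : Pt S, L.fibre x →ₗ[ℂ] A}
    (hK : ∀ {x y : Pt S} (γ : Path x y),
      (∀ t, ∃ w ∈ U \ {C.z j}, (γ t : P1) = (w : P1)) → c.IsPotentialOn K γ)
    (hK' : ∀ {x y : Pt S} (γ : Path x y),
      (∀ t, ∃ w ∈ U' \ {C.z (j + 1)}, (γ t : P1) = (w : P1)) → c.IsPotentialOn K' γ)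
    {w w' : ℂ} (hw : w ≠ 0) (hw' : w' ≠ 0) (hb : Metric.closedBall (C.z j) ‖w‖ ⊆ U)
    (hb' : Metric.closedBall (C.z (j + 1)) ‖w'‖ ⊆ U')
    (hs : segment ℝ (C.z j + w) (C.z (j + 1) + w') ⊆ U \ {C.z j}) :
    ∑ τ, c.seg F (arcR (C.z j) (C.z (j + 1)) w w' τ) (arcS (C.z j) (C.z (j + 1)) w w' τ)
        (C.arcW j w w' τ) =
      potAt F K (C.z (j + 1) + w') (C.E (C.z j + w) (C.z (j + 1) + w')) -
        potAt F K' (C.z (j + 1) + w') (C.E (C.z j + w) (C.z (j + 1) + w')) := by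
  have h1 := sub_ne_zero.2 (C.mon_ne_one (j := j) (by omega))
  have h2 := sub_ne_zero.2 (C.mon_ne_one (j := j + 1) (by omega))
  have e1 := hU.sum_square (F := F) (by omega) hK hw hb 1
  have e2 := hU'.sum_square (F := F) (by omega) hK' hw' hb'
    (C.E (C.z j + w) (C.z (j + 1) + w'))
  rw [Fintype.sum_option, Fintype.sum_prod_type, Fintype.sum_bool]
  simp only [arcR, arcS, Config.arcW, mul_assoc, PathCocycle.seg_mul c _ _ (-(C.mon (j + 1) - 1)⁻¹),
    PathCocycle.seg_mul c _ _ ((C.mon j - 1)⁻¹)]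
  -- The factor of the first square leaves `K` at the start of the segment, that of the second
  -- leaves `-K'` at its end, and the segment adds the difference of `K` between its ends.
  rw [← Finset.smul_sum, ← Finset.smul_sum, e2]
  simp only [one_mul] at e1
  rw [e1, smul_smul, smul_smul, neg_mul, inv_mul_cancel₀ h1, inv_mul_cancel₀ h2,
    PathCocycle.seg_eq (hs.trans hU.diff_subset)
      (hK _ fun t => ⟨_, hs (lineC_mem_segment _ _ t), rfl⟩), one_mul, one_smul, neg_smul, one_smul]
  abel

/-! ### Gluing the local potentials -/

/-- The singular points are ordered by a linear function. -/
structure Config.Sorted (C : Config L) (u : ℂ) : Prop where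
  ne_zero : u ≠ 0
  lt : ∀ i j, i < j → j < C.m → (C.z i / u).re < (C.z j / u).re

/-- The strip between the neighbours of `z j`. -/
def Config.strip (C : Config L) (u : ℂ) (j : ℕ) : Set ℂ :=
  {w | (∀ i < C.m, i < j → (C.z i / u).re < (w / u).re) ∧
    ∀ i < C.m, j < i → (w / u).re < (C.z i / u).re}

theorem convex_re_Ioi (u : ℂ) (a : ℝ) : Convex ℝ {w : ℂ | a < (w / u).re} := by
  have h : IsLinearMap ℝ fun w : ℂ => (w / u).re :=
    ⟨fun x y => by rw [add_div, add_re], fun c x => by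
      rw [real_smul, mul_div_assoc, re_ofReal_mul, smul_eq_mul]⟩
  exact convex_halfSpace_gt h a

theorem convex_re_Iio (u : ℂ) (a : ℝ) : Convex ℝ {w : ℂ | (w / u).re < a} := by
  have h : IsLinearMap ℝ fun w : ℂ => (w / u).re :=
    ⟨fun x y => by rw [add_div, add_re], fun c x => by
      rw [real_smul, mul_div_assoc, re_ofReal_mul, smul_eq_mul]⟩
  exact convex_halfSpace_lt h a

/-- The strip lies strictly on one side of each line through another singular point on which `Re (w
/ u)` is constant. -/
theorem Config.Sorted.isolatingSet_strip {u : ℂ} (hC : C.Sorted u) {j : ℕ} (hj : j < C.m) :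
    C.IsolatingSet j (C.strip u j) where
  convex := by
    have : C.strip u j = (⋂ i, ⋂ (_ : i < C.m), ⋂ (_ : i < j), {w | (C.z i / u).re < (w / u).re}) ∩
        ⋂ i, ⋂ (_ : i < C.m), ⋂ (_ : j < i), {w | (w / u).re < (C.z i / u).re} := by
      ext w; simp [strip]
    rw [this]
    exact (convex_iInter fun i => convex_iInter fun _ => convex_iInter fun _ => convex_re_Ioi _ _).inter
      (convex_iInter fun i => convex_iInter fun _ => convex_iInter fun _ => convex_re_Iio _ _)
  isOpen := by
    have : C.strip u j = (⋂ i ∈ Finset.range C.m, {w | i < j → (C.z i / u).re < (w / u).re}) ∩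
        ⋂ i ∈ Finset.range C.m, {w | j < i → (w / u).re < (C.z i / u).re} := by
      ext w; simp [strip]
    rw [this]
    refine (isOpen_biInter_finset fun i _ => ?_).inter (isOpen_biInter_finset fun i _ => ?_)
    · by_cases h : i < j
      · simp only [h, true_imp_iff]; exact isOpen_lt continuous_const (by fun_prop)
      · simp [h]
    · by_cases h : j < i
      · simp only [h, true_imp_iff]; exact isOpen_lt (by fun_prop) continuous_const
      · simp [h]
  mem := ⟨fun i hi hij => hC.lt i j hij hj, fun i hi hij => hC.lt j i hij hi⟩
  halfPlane k hk hkj := by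
    rcases lt_or_gt_of_ne hkj with h | h
    · exact ⟨u, fun w hw => mem_halfPlane_iff.2 (hw.1 k hk h)⟩
    · exact ⟨-u, fun w hw => mem_halfPlane_neg_iff.2 (hw.2 k hk h)⟩

/-- Every point lies in some strip. -/
theorem Config.exists_strip (C : Config L) {u : ℂ} (hC : C.Sorted u) (hm : 0 < C.m) {x : ℂ}
    (hx : x ∈ fin S) :
    ∃ j < C.m, x ∈ C.strip u j \ {C.z j} ∧ (j = 0 ∨ (C.z j / u).re ≤ (x / u).re) := by
  have hne : ∀ j < C.m, x ∉ ({C.z j} : Set ℂ) := fun j hj => C.mem_fin_iff.1 hx j hj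
  by_cases h : ∃ j < C.m, (C.z j / u).re ≤ (x / u).re
  · classical
    -- The last singular point not beyond `x` is chosen, or the first one if there is none. The
    -- second clause of the conclusion records this; it excludes the last strip for points before
    -- the last singular point.
    let T := (Finset.range C.m).filter fun j => (C.z j / u).re ≤ (x / u).re
    have hT : T.Nonempty := by
      obtain ⟨j, hj, h⟩ := h
      exact ⟨j, by simp [T, hj, h]⟩
    have hmax := T.max'_mem hT
    have hmm : T.max' hT < C.m ∧ (C.z (T.max' hT) / u).re ≤ (x / u).re := by simpa [T] using hmax
    refine ⟨T.max' hT, hmm.1, ⟨⟨fun i hi hij => (hC.lt i _ hij hmm.1).trans_le hmm.2,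
      fun i hi hij => ?_⟩, hne _ hmm.1⟩, Or.inr hmm.2⟩
    by_contra hlt
    exact absurd (T.le_max' i (by simp [T, hi, not_lt.1 hlt])) (not_le.2 hij)
  · push Not at h
    exact ⟨0, hm, ⟨⟨fun i hi hij => absurd hij (Nat.not_lt_zero i), fun i hi _ => h i hi⟩, hne 0 hm⟩,
      Or.inl rfl⟩

end

end DeligneMostow
namespace DeligneMostow
open Complex CategoryTheory Filter Topology

section

variable {S : Set P1} {L : LocalSystem.{u} S} {C : Config L} {A : Type*} [AddCommGroup A] [Module ℂ A]

/-- `K` is a potential along all paths in `U`. -/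
def PathCocycle.PotentialOn (c : PathCocycle L A) (K : ∀ x : Pt S, L.fibre x →ₗ[ℂ] A)
    (U : Set ℂ) : Prop :=
  ∀ {x y : Pt S} (γ : Path x y), (∀ t, ∃ w ∈ U, (γ t : P1) = (w : P1)) → c.IsPotentialOn K γ

theorem transport_surjective {x y : Pt S} (γ : Path x y) : Function.Surjective (L.transport γ) :=
  fun v => ⟨L.transport γ.symm v, transport_apply_symm γ v⟩

/-- Two potentials on a convex set that agree at a point agree everywhere. -/
theorem PathCocycle.PotentialOn.eq_of_convex {c : PathCocycle L A}
    {K K' : ∀ x : Pt S, L.fibre x →ₗ[ℂ] A} {U : Set ℂ} (hU : Convex ℝ U) (hUS : U ⊆ fin S)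
    (hK : c.PotentialOn K U) (hK' : c.PotentialOn K' U) {y : ℂ} (hy : y ∈ U)
    (h : K (pt (hUS hy)) = K' (pt (hUS hy))) {x : ℂ} (hx : x ∈ U) :
    K (pt (hUS hx)) = K' (pt (hUS hx)) := by
  have hs : segment ℝ y x ⊆ fin S := (hU.segment_subset hy hx).trans hUS
  refine LinearMap.ext fun v => ?_
  obtain ⟨v, rfl⟩ := transport_surjective (segPath hs) v
  have e1 := hK (segPath hs) (segPath_mem hU hs hy hx) v
  have e2 := hK' (segPath hs) (segPath_mem hU hs hy hx) v
  rw [h, e2] at e1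
  exact (sub_left_injective e1).symm

/-- The strip between `z j` and its right neighbour. -/
def Config.overlap (C : Config L) (u : ℂ) (j : ℕ) : Set ℂ :=
  {w | (C.z j / u).re < (w / u).re ∧ (w / u).re < (C.z (j + 1) / u).re}

theorem Config.convex_overlap (u : ℂ) (j : ℕ) : Convex ℝ (C.overlap u j) :=
  (convex_re_Ioi _ _).inter (convex_re_Iio _ _)

variable {u : ℂ} (hC : C.Sorted u)

include hC in
theorem Config.Sorted.le {i j : ℕ} (hij : i ≤ j) (hj : j < C.m) :
    (C.z i / u).re ≤ (C.z j / u).re := by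
  rcases hij.eq_or_lt with rfl | h
  · exact le_rfl
  · exact (hC.lt i j h hj).le

include hC in
theorem Config.Sorted.overlap_subset_left {j : ℕ} (hj : j + 1 < C.m) :
    C.overlap u j ⊆ C.strip u j \ {C.z j} := fun x hx =>
  ⟨⟨fun i _ hij => (hC.lt i j hij (by omega)).trans hx.1,
    fun i hi hij => hx.2.trans_le (hC.le hij hi)⟩, fun h => by
      rw [Set.mem_singleton_iff] at h; rw [h] at hx; exact lt_irrefl _ hx.1⟩

include hC in
theorem Config.Sorted.overlap_subset_right {j : ℕ} (hj : j + 1 < C.m) :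
    C.overlap u j ⊆ C.strip u (j + 1) \ {C.z (j + 1)} := fun x hx =>
  ⟨⟨fun i _ hij => (hC.le (Nat.lt_succ_iff.1 hij) (by omega)).trans_lt hx.1,
    fun i hi hij => hx.2.trans (hC.lt _ i hij hi)⟩, fun h => by
      rw [Set.mem_singleton_iff] at h; rw [h] at hx; exact lt_irrefl _ hx.2⟩

include hC in
theorem Config.Sorted.overlap_subset_fin {j : ℕ} (hj : j + 1 < C.m) : C.overlap u j ⊆ fin S :=
  (hC.overlap_subset_left hj).trans (hC.isolatingSet_strip (by omega)).diff_subset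

-- A singular point with an index strictly between `i` and `j` would bound the two strips from
-- opposite sides, so only consecutive strips meet. Compatibility of potentials thus needs to be
-- checked on the overlaps only.
include hC in
theorem Config.Sorted.mem_overlap_of_mem {i j : ℕ} (hij : i < j) (hj : j < C.m) {x : ℂ}
    (hi : x ∈ C.strip u i) (hx : x ∈ C.strip u j) : j = i + 1 ∧ x ∈ C.overlap u i := by
  have : j = i + 1 := by
    by_contra h
    exact lt_asymm (hi.2 (i + 1) (by omega) (by omega)) (hx.1 (i + 1) (by omega) (by omega))
  subst this
  exact ⟨rfl, hx.1 i (by omega) hij, hi.2 _ hj hij⟩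

/-- The union of the first strips without the singular points. -/
def Config.strips (C : Config L) (u : ℂ) (J : ℕ) : Set ℂ :=
  {x | ∃ j < J, x ∈ C.strip u j \ {C.z j}}

include hC in
theorem Config.Sorted.strips_subset {J : ℕ} (hJ : J ≤ C.m) : C.strips u J ⊆ fin S := by
  rintro x ⟨j, hj, hx⟩
  exact (hC.isolatingSet_strip (hj.trans_le hJ)).diff_subset hx

include hC in
theorem Config.Sorted.fin_subset_strips (hm : 0 < C.m) : fin S ⊆ C.strips u C.m := by
  intro x hx
  obtain ⟨j, hj, h, -⟩ := C.exists_strip hC hm hx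
  exact ⟨j, hj, h⟩

include hC in
/-- Potentials on the strips that agree on the overlaps define a potential. -/
theorem PathCocycle.exists_glue {c : PathCocycle L A} {J : ℕ} (hJ : J ≤ C.m)
    {K : ℕ → ∀ x : Pt S, L.fibre x →ₗ[ℂ] A}
    (hK : ∀ j < J, c.PotentialOn (K j) (C.strip u j \ {C.z j}))
    (h : ∀ j, j + 1 < J → ∀ x (hx : x ∈ fin S), x ∈ C.overlap u j →
      K j (pt hx) = K (j + 1) (pt hx)) :
    ∃ K' : ∀ x : Pt S, L.fibre x →ₗ[ℂ] A, c.PotentialOn K' (C.strips u J) ∧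
      ∀ j < J, ∀ x (hx : x ∈ fin S), x ∈ C.strip u j → K' (pt hx) = K j (pt hx) := by
  classical
  have hag : ∀ i < J, ∀ j < J, ∀ x (hx : x ∈ fin S), x ∈ C.strip u i → x ∈ C.strip u j →
      K i (pt hx) = K j (pt hx) := by
    have aux : ∀ i < J, ∀ j < J, i < j → ∀ x (hx : x ∈ fin S), x ∈ C.strip u i →
        x ∈ C.strip u j → K i (pt hx) = K j (pt hx) := by
      intro i hi j hj hij x hx hxi hxj
      obtain ⟨rfl, ho⟩ := hC.mem_overlap_of_mem hij (hj.trans_le hJ) hxi hxj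
      exact h i hj x hx ho
    intro i hi j hj x hx hxi hxj
    rcases lt_trichotomy i j with hij | rfl | hij
    · exact aux i hi j hj hij x hx hxi hxj
    · rfl
    · exact (aux j hj i hi hij x hx hxj hxi).symm
  let K' : ∀ x : Pt S, L.fibre x →ₗ[ℂ] A := fun x =>
    if h : ∃ j < J, coord x ∈ C.strip u j then K h.choose x else 0
  have hK' : ∀ j < J, ∀ x (hx : x ∈ fin S), x ∈ C.strip u j → K' (pt hx) = K j (pt hx) := by
    intro j hj x hx hxj
    have hex : ∃ j < J, coord (pt hx : Pt S) ∈ C.strip u j := ⟨j, hj, by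
      change coord ((x : ℂ) : P1) ∈ _; rwa [coord_coe]⟩
    simp only [K']
    rw [dif_pos hex]
    have hs := hex.choose_spec
    refine hag _ hs.1 j hj x hx ?_ hxj
    generalize hex.choose = i at hs ⊢
    have := hs.2
    change coord ((x : ℂ) : P1) ∈ _ at this
    rwa [coord_coe] at this
  refine ⟨K', fun γ hγ => ?_, hK'⟩
  refine path_induction_on (hC.strips_subset hJ) (P := fun γ => c.IsPotentialOn K' γ) ?_
    (fun γ δ h h' => h.trans h') (fun γ δ e h => h.homotopic e) γ hγ
  rintro a ⟨j, hj, ha⟩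
  have hopen : IsOpen (C.strip u j \ {C.z j}) :=
    (hC.isolatingSet_strip (hj.trans_le hJ)).isOpen.sdiff isClosed_singleton
  refine ⟨_, hopen.mem_nhds ha, fun {x y} γ hγ v => ?_⟩
  have hend : ∀ (x : Pt S) w, w ∈ C.strip u j \ {C.z j} → (x : P1) = (w : P1) → K' x = K j x := by
    intro x w hw hxw
    have hws : w ∈ fin S := (hC.isolatingSet_strip (hj.trans_le hJ)).diff_subset hw
    have : x = pt hws := Subtype.ext hxw
    subst this
    exact hK' j hj w hws hw.1
  obtain ⟨w0, h0, e0⟩ := hγ 0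
  obtain ⟨w1, h1, e1⟩ := hγ 1
  rw [γ.source] at e0
  rw [γ.target] at e1
  rw [hend x w0 h0.1 e0, hend y w1 h1.1 e1]
  exact hK j hj γ (fun t => by obtain ⟨w, hw, e⟩ := hγ t; exact ⟨w, hw.1, e⟩) v

/-- A potential on the finite part extends to infinity. -/
theorem PathCocycle.exists_potential_infty {c : PathCocycle L A}
    (hinf : OnePoint.infty ∉ S) (C : Config L) {K : ∀ x : Pt S, L.fibre x →ₗ[ℂ] A}
    (hK : c.PotentialOn K (fin S)) : ∃ K' : ∀ x : Pt S, L.fibre x →ₗ[ℂ] A,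
      ∀ {x y : Pt S} (γ : Path x y), c.IsPotentialOn K' γ := by
  classical
  obtain ⟨R, hR0, hR⟩ := C.exists_bound
  obtain ⟨x₁, h₁, p, hp⟩ := path_induction_infty hR0 (C.nearInfty_subset hR0 hR hinf)
    C.isOpen_fin hinf
  let b : Pt S := ⟨OnePoint.infty, hinf⟩
  -- The value at `∞` is forced by the single path `p`; path induction extends the potential
  -- property to all paths.
  let K' : ∀ x : Pt S, L.fibre x →ₗ[ℂ] A := fun x =>
    if h : x = b then h ▸ ((K (pt h₁) + c.val p) ∘ₗ L.transport p.symm) else K x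
  have hb : K' b = (K (pt h₁) + c.val p) ∘ₗ L.transport p.symm := by simp [K']
  have hf : ∀ x, x ≠ b → K' x = K x := fun x hx => by simp [K', hx]
  have hpt : ∀ {w : ℂ} {x : Pt S}, (x : P1) = (w : P1) → x ≠ b := by
    rintro w x hx rfl
    exact OnePoint.infty_ne_coe _ hx
  have hpp : c.IsPotentialOn K' p := by
    intro v
    rw [hb, hf _ (hpt rfl), LinearMap.comp_apply, transport_symm_apply, LinearMap.add_apply]
    abel
  refine ⟨K', fun γ => hp (P := fun γ => c.IsPotentialOn K' γ) (fun γ δ h h' => h.trans h')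
    (fun γ δ e h => h.homotopic e) (fun {x y} γ hγ v => ?_) hpp hpp.symm γ⟩
  obtain ⟨w0, h0, e0⟩ := hγ 0
  obtain ⟨w1, h1, e1⟩ := hγ 1
  rw [γ.source] at e0
  rw [γ.target] at e1
  rw [hf _ (hpt e0), hf _ (hpt e1)]
  exact hK γ hγ v

/-- The angles of a triangle around an interior point. -/
theorem ang_triangle {z a b c : ℂ} (hab : 0 < ((b - z) / (a - z)).im)
    (hbc : 0 < ((c - z) / (b - z)).im) (hca : 0 < ((a - z) / (c - z)).im) :
    ang z a b + ang z b c + ang z c a = 2 * Real.pi := by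
  have ne : ∀ {x y : ℂ}, 0 < (y / x).im → x ≠ 0 := by
    rintro x y h rfl
    simp at h
  have ha := ne hab
  have hb := ne hbc
  have hc := ne hca
  have pos : ∀ {x : ℂ}, 0 < x.im → 0 < arg x ∧ arg x < Real.pi := fun {x} hx => by
    refine ⟨lt_of_le_of_ne (arg_nonneg_iff.2 hx.le) fun h => ?_,
      lt_of_le_of_ne (arg_le_pi x) fun h => ?_⟩
    · exact hx.ne' ((arg_eq_zero_iff.1 h.symm).2)
    · exact hx.ne' ((arg_eq_pi_iff.1 h).2)
  have p1 := pos hab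
  have p2 := pos hbc
  have p3 := pos hca
  have h : exp (I * (ang z a b + ang z b c + ang z c a : ℝ)) = 1 := by
    have e : ∀ x : ℂ, x ≠ 0 → exp (I * arg x) = x / ‖x‖ := fun x hx => by
      rw [eq_div_iff (by exact_mod_cast norm_ne_zero_iff.2 hx), mul_comm, mul_comm I,
        norm_mul_exp_arg_mul_I]
    rw [ofReal_add, ofReal_add, mul_add, mul_add, exp_add, exp_add, ang, ang, ang,
      e _ (div_ne_zero hb ha), e _ (div_ne_zero hc hb), e _ (div_ne_zero ha hc), norm_div, norm_div,
      norm_div]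
    have na : (‖a - z‖ : ℂ) ≠ 0 := by exact_mod_cast norm_ne_zero_iff.2 ha
    have nb : (‖b - z‖ : ℂ) ≠ 0 := by exact_mod_cast norm_ne_zero_iff.2 hb
    have nc : (‖c - z‖ : ℂ) ≠ 0 := by exact_mod_cast norm_ne_zero_iff.2 hc
    push_cast
    field_simp
  obtain ⟨n, hn⟩ := Complex.exp_eq_one_iff.1 h
  have h2 : ang z a b + ang z b c + ang z c a = n * (2 * Real.pi) := by
    have : I * (ang z a b + ang z b c + ang z c a : ℝ) = I * (n * (2 * Real.pi) : ℝ) := by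
      rw [hn]; push_cast; ring
    exact_mod_cast mul_left_cancel₀ I_ne_zero this
  unfold ang at h2 ⊢
  -- Three angles in `(0, π)` whose sum is a multiple of `2π` add up to exactly one turn.
  have hn0 : 0 < (n : ℝ) := by
    by_contra hneg
    nlinarith [Real.pi_pos, not_lt.1 hneg]
  have hn2 : (n : ℝ) < 2 := by
    by_contra hneg
    nlinarith [Real.pi_pos, not_lt.1 hneg]
  have : n = 1 := by
    have h1 : 0 < n := by exact_mod_cast hn0
    have h2 : n < 2 := by exact_mod_cast hn2
    omega
  rw [h2, this]; simp

/-- The true distance from the centre to an edge is `‖w‖ / √2`; the cruder bound is enough for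
placing large squares near infinity. -/
theorem half_le_norm_of_mem_edge {z w x : ℂ} {i : Fin 4}
    (hx : x ∈ segment ℝ (sqPt z w i) (sqPt z w (i + 1))) : ‖w‖ / 2 ≤ ‖x - z‖ := by
  obtain ⟨t, -, ht⟩ := mem_segment_iff.1 hx
  have h1 : x - z = (sqPt z w i - z) * (1 + t * (I - 1)) := by
    linear_combination ht + t * (sqPt_succ_sub z w i)
  rw [h1, norm_mul, norm_sqPt_sub, div_eq_mul_inv]
  refine mul_le_mul_of_nonneg_left ?_ (norm_nonneg _)
  rcases le_total t (1 / 2) with h | h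
  · have := abs_re_le_norm (1 + t * (I - 1) : ℂ)
    simp at this
    exact le_trans (by norm_num at h ⊢; linarith [le_abs_self (1 + -t)]) this
  · have := abs_im_le_norm (1 + t * (I - 1) : ℂ)
    simp at this
    exact le_trans (by norm_num at h ⊢; linarith [le_abs_self t]) this

variable {F : Frame C}

/-- A quadrilateral near infinity. -/
theorem PathCocycle.seg_quad (c : PathCocycle L A) {R : ℝ} (hR : 0 < R)
    (hS : nearInfty R ⊆ Sᶜ) {a b d e : ℂ} (hab : ∀ x ∈ segment ℝ a b, R < ‖x‖)
    (hbd : ∀ x ∈ segment ℝ b d, R < ‖x‖) (hde : ∀ x ∈ segment ℝ d e, R < ‖x‖)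
    (hea : ∀ x ∈ segment ℝ e a, R < ‖x‖) :
    C.E a b * C.E b d * C.E d e * C.E e a = 1 ∧
      c.seg F a b 1 + c.seg F b d (C.E a b) + c.seg F d e (C.E a b * C.E b d) +
        c.seg F e a (C.E a b * C.E b d * C.E d e) = 0 := by
  have hfin : ∀ {x y : ℂ}, (∀ w ∈ segment ℝ x y, R < ‖w‖) → segment ℝ x y ⊆ fin S :=
    fun h w hw => hS ((coe_mem_nearInfty hR).2 (h w hw))
  have hnear : ∀ {x y : ℂ} (h : ∀ w ∈ segment ℝ x y, R < ‖w‖) t,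
      (segPath (hfin h) t : P1) ∈ nearInfty R := fun h t =>
    (coe_mem_nearInfty hR).2 (h _ (lineC_mem_segment _ _ t))
  let γ := (((segPath (hfin hab)).trans (segPath (hfin hbd))).trans (segPath (hfin hde))).trans
    (segPath (hfin hea))
  -- The quadrilateral contracts through `∞`. Comparing frames gives the first statement and
  -- evaluating the cocycle the second.
  have hγ : γ.Homotopic (Path.refl _) := by
    refine homotopic_near_infty hR hS _ _ ?_ (fun t => ?_)
    · exact trans_mem (P := fun x => (x : P1) ∈ nearInfty R) (trans_mem
        (P := fun x => (x : P1) ∈ nearInfty R) (trans_mem (P := fun x => (x : P1) ∈ nearInfty R)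
        (hnear hab) (hnear hbd)) (hnear hde)) (hnear hea)
    · exact (coe_mem_nearInfty hR).2 (hab _ (left_mem_segment ℝ a b))
  have hF := fun {x y : ℂ} (h : segment ℝ x y ⊆ fin S) => F.transport_segPath x y h
  constructor
  · have h := congrArg (fun f => f (F.e _)) (transport_eq (L := L) hγ)
    simp only [γ, transport_trans, transport_refl, hF, map_smul, smul_smul] at h
    have h2 : (C.E a b * C.E b d * C.E d e * C.E e a) • F.e (pt (hfin hab (left_mem_segment ℝ a b))) =
        (1 : ℂ) • F.e _ := by
      rw [one_smul]; exact h
    exact smul_left_injective ℂ (F.ne_zero _) h2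
  · have h := c.homotopic _ _ hγ
    rw [c.val_refl] at h
    have h := congrArg (fun f => f (F.e _)) h
    simp only [γ, c.trans, transport_trans, hF, map_smul, smul_smul, LinearMap.zero_apply] at h
    rw [seg, seg, seg, seg, dif_pos (hfin hab), dif_pos (hfin hbd), dif_pos (hfin hde),
      dif_pos (hfin hea), one_smul, map_smul, map_smul, map_smul]
    exact h

end

end DeligneMostow
-- The last overlap when infinity is not singular
namespace DeligneMostow
open Complex CategoryTheory Filter Topology

section

variable {S : Set P1} {L : LocalSystem.{u} S} {C : Config L} {A : Type*} [AddCommGroup A] [Module ℂ A]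
  {u : ℂ} {F : Frame C}

theorem edge_subset_re_lt {p w : ℂ} {i : Fin 4} {a : ℝ} (h0 : (sqPt p w i / u).re < a)
    (h1 : (sqPt p w (i + 1) / u).re < a) {x : ℂ}
    (hx : x ∈ segment ℝ (sqPt p w i) (sqPt p w (i + 1))) : (x / u).re < a :=
  (convex_re_Iio u a).segment_subset h0 h1 hx

/-- Potentials on the last strip and on the other ones that fit together at infinity agree. -/
theorem PathCocycle.eq_on_last_overlap (hC : C.Sorted u) {N : ℕ} (hm : C.m = N + 2)
    (hinf : OnePoint.infty ∉ S) {c : PathCocycle L A} {K K' : ∀ x : Pt S, L.fibre x →ₗ[ℂ] A}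
    (hK : c.PotentialOn K (C.strips u (N + 1)))
    (hK' : c.PotentialOn K' (C.strip u (N + 1) \ {C.z (N + 1)})) {x : ℂ} (hx : x ∈ fin S)
    (hxo : x ∈ C.overlap u N) : K (pt hx) = K' (pt hx) := by
  obtain ⟨F⟩ : Nonempty (Frame C) := inferInstance
  obtain ⟨R, hR0, hR⟩ := C.exists_bound
  have hu : u ≠ 0 := hC.ne_zero
  set z := C.z (N + 1) with hz
  have hlt : (C.z N / u).re < (z / u).re := hC.lt N (N + 1) (by omega) (by omega)
  -- The centre `p` lies in the middle of the last overlap, and `T` is so large that the square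
  -- around `p` encloses all singular points at a safe distance. The vertices `0` and `2` lie in the
  -- overlap, vertex `1` far to the left and vertex `3` far to the right.
  set s : ℝ := ((z / u).re - (C.z N / u).re) / 2 with hs
  have hs0 : 0 < s := by rw [hs]; linarith
  set p : ℂ := z - s * u with hp
  set T : ℝ := 2 * (R + ‖p‖ + 1) / ‖u‖ + s with hT
  have hnu : 0 < ‖u‖ := norm_pos_iff.2 hu
  have hTs : s < T := by rw [hT]; linarith [show 0 < 2 * (R + ‖p‖ + 1) / ‖u‖ by positivity]
  have hT0 : 0 < T := hs0.trans hTs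
  set w : ℂ := I * T * u with hw
  have hwn : 2 * (R + ‖p‖ + 1) ≤ ‖w‖ := by
    rw [hw, norm_mul, norm_mul, norm_I, one_mul, norm_real, Real.norm_of_nonneg hT0.le, hT, add_mul,
      div_mul_cancel₀ _ hnu.ne']
    linarith [mul_pos hs0 hnu]
  have hw0 : w ≠ 0 := mul_ne_zero (mul_ne_zero I_ne_zero (by exact_mod_cast hT0.ne')) hu
  have hbig : ∀ i, ∀ x ∈ segment ℝ (sqPt p w i) (sqPt p w (i + 1)), R < ‖x‖ := by
    intro i x hx
    have h1 := half_le_norm_of_mem_edge hx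
    have h2 := norm_sub_le x p
    linarith
  have hbigS : ∀ i, segment ℝ (sqPt p w i) (sqPt p w (i + 1)) ⊆ fin S := fun i x hx =>
    C.mem_fin_of_bound hR (hbig i x hx).le
  have hq : ∀ i, sqPt p w i / u = z / u - s + I * T * ![1, I, -1, -I] i := by
    intro i
    rw [sqPt, hp, hw]
    field_simp
  have hℓ : ∀ i, (sqPt p w i / u).re = (z / u).re - s + ![0, -T, 0, T] i := by
    intro i
    rw [hq, add_re, sub_re, ofReal_re]
    congr 1
    fin_cases i <;> simp
  have hNs : (C.z N / u).re = (z / u).re - 2 * s := by rw [hs]; ring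
  have hleft : ∀ x ∈ fin S, (x / u).re < (z / u).re → x ∈ C.strips u (N + 1) := by
    intro x hx hlt
    obtain ⟨j, hj, hxj, h⟩ := C.exists_strip hC (by omega) hx
    refine ⟨j, ?_, hxj⟩
    by_contra hjN
    have : j = N + 1 := by omega
    subst this
    rcases h with h | h
    · omega
    · exact absurd hlt (not_lt.2 h)
  have hright : ∀ x ∈ fin S, (C.z N / u).re < (x / u).re → x ∈ C.strip u (N + 1) \ {z} := by
    intro x hx hlt
    exact ⟨⟨fun i hi hij => (hC.le (Nat.lt_succ_iff.1 hij) (by omega)).trans_lt hlt,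
      fun i hi hij => by omega⟩, C.mem_fin_iff.1 hx _ (by omega)⟩
  -- The left half of the square is governed by `K` and the right half by `K'`. The vertical
  -- diagonal lies in the overlap and is governed by both.
  have hl0 : ∀ i : Fin 4, i = 0 ∨ i = 1 → segment ℝ (sqPt p w i) (sqPt p w (i + 1)) ⊆
      C.strips u (N + 1) := by
    intro i hi x hx
    refine hleft x (hbigS i hx) (edge_subset_re_lt ?_ ?_ hx) <;> rw [hℓ] <;>
      rcases hi with rfl | rfl <;> simp <;> linarith
  have hr0 : ∀ i : Fin 4, i = 2 ∨ i = 3 → segment ℝ (sqPt p w i) (sqPt p w (i + 1)) ⊆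
      C.strip u (N + 1) \ {z} := by
    intro i hi x hx
    refine hright x (hbigS i hx) ((convex_re_Ioi u _).segment_subset ?_ ?_ hx) <;>
      rw [Set.mem_ofPred_eq, hℓ, hNs] <;> rcases hi with rfl | rfl <;> simp <;> linarith
  have hov : ∀ i : Fin 4, i = 0 ∨ i = 2 → sqPt p w i ∈ C.overlap u N := by
    intro i hi
    change (C.z N / u).re < (sqPt p w i / u).re ∧ (sqPt p w i / u).re < (z / u).re
    rw [hℓ, hNs]
    rcases hi with rfl | rfl <;> simp <;> constructor <;> linarith
  have hos : segment ℝ (sqPt p w 0) (sqPt p w 2) ⊆ C.overlap u N :=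
    (Config.convex_overlap u N).segment_subset (hov 0 (Or.inl rfl)) (hov 2 (Or.inr rfl))
  have hofin : C.overlap u N ⊆ fin S := hC.overlap_subset_fin (by omega)
  have hoK : C.overlap u N ⊆ C.strips u (N + 1) := fun x hx =>
    ⟨N, by omega, hC.overlap_subset_left (by omega) hx⟩
  have hoK' : C.overlap u N ⊆ C.strip u (N + 1) \ {z} := hC.overlap_subset_right (by omega)
  obtain ⟨hE, hsum⟩ := c.seg_quad (F := F) (a := sqPt p w 0) (b := sqPt p w 1) (d := sqPt p w 2)
    (e := sqPt p w 3) hR0 (C.nearInfty_subset hR0 hR hinf) (hbig 0) (hbig 1) (hbig 2) (hbig 3)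
  have mem : ∀ {a b : ℂ} {U : Set ℂ} (h : segment ℝ a b ⊆ U) (h' : segment ℝ a b ⊆ fin S) t,
      ∃ w ∈ U, (segPath h' t : P1) = (w : P1) := fun h h' t =>
    ⟨_, h (lineC_mem_segment _ _ t), rfl⟩
  rw [PathCocycle.seg_eq (a := sqPt p w 0) (b := sqPt p w 1) (hbigS 0)
      (hK _ (mem (hl0 0 (Or.inl rfl)) _)),
    PathCocycle.seg_eq (a := sqPt p w 1) (b := sqPt p w 2) (hbigS 1)
      (hK _ (mem (hl0 1 (Or.inr rfl)) _)),
    PathCocycle.seg_eq (a := sqPt p w 2) (b := sqPt p w 3) (hbigS 2)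
      (hK' _ (mem (hr0 2 (Or.inl rfl)) _)),
    PathCocycle.seg_eq (a := sqPt p w 3) (b := sqPt p w 0) (hbigS 3)
      (hK' _ (mem (hr0 3 (Or.inr rfl)) _)), hE] at hsum
  have e1 := PathCocycle.seg_eq (F := F) (hos.trans hofin) (hK _ (mem (hos.trans hoK) _)) 1
  have e2 := PathCocycle.seg_eq (F := F) (hos.trans hofin) (hK' _ (mem (hos.trans hoK') _)) 1
  rw [e1] at e2
  simp only [one_mul] at hsum e2
  set a := sqPt p w 0
  set d := sqPt p w 1
  set b := sqPt p w 2
  set e := sqPt p w 3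
  -- The triangle formed by the diagonal and the right half of the square winds around `z (N + 1)`
  -- only.
  have hang : ∑ j ∈ Finset.range C.m, C.ν j * (ang (C.z j) a b + ang (C.z j) b e + ang (C.z j) e a) =
      C.ν (N + 1) * (2 * Real.pi) := by
    rw [Finset.sum_eq_single_of_mem (N + 1) (Finset.mem_range.2 (by omega))]
    · congr 1
      have hv : ∀ i, sqPt p w i - z = u * (-s + I * T * ![1, I, -1, -I] i) := by
        intro i
        rw [sqPt, hp, hw]
        ring
      have hdiv : ∀ i k, (sqPt p w i - z) / (sqPt p w k - z) =
          (-s + I * T * ![1, I, -1, -I] i) / (-s + I * T * ![1, I, -1, -I] k) := fun i k => by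
        rw [hv, hv, mul_div_mul_left _ _ hu]
      have e := ang_triangle (z := z) (a := b) (b := e) (c := a) ?_ ?_ ?_
      · linarith
      all_goals
        rw [hdiv, div_im]
        simp [normSq_apply]
      · have : 0 < s * s + T * T := by positivity
        field_simp
        nlinarith
      · have : 0 < T - s := by linarith
        have : 0 < -s + T := by linarith
        positivity
      · have : 0 < s * s + T * T := by positivity
        field_simp
        nlinarith [mul_pos hs0 hT0]
    · intro j hj hjN
      have hj' : (C.z j / u).re ≤ (C.z N / u).re := hC.le (by
        have := Finset.mem_range.1 hj
        omega) (by omega)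
      have hh : ∀ i : Fin 4, i ≠ 1 → sqPt p w i ∈ halfPlane (C.z j) u := by
        intro i hi
        rw [mem_halfPlane_iff, hℓ]
        rw [hNs] at hj'
        fin_cases i <;> simp at hi ⊢ <;> linarith
      rw [ang_add (hh 0 (by decide)) (hh 2 (by decide)) (hh 3 (by decide)),
        ang_add (hh 0 (by decide)) (hh 3 (by decide)) (hh 0 (by decide)), ang_self, mul_zero]
  have hmon : C.E a b * (C.E b e * C.E e a) = C.mon (N + 1) := by
    simp only [Config.E, mult, Config.mon]
    rw [← exp_add, ← exp_add, ← mul_add, ← mul_add, ← ofReal_add, ← ofReal_add,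
      ← Finset.sum_add_distrib, ← Finset.sum_add_distrib]
    rw [Finset.sum_congr rfl fun j _ => show C.ν j * ang (C.z j) a b + (C.ν j * ang (C.z j) b e +
      C.ν j * ang (C.z j) e a) = C.ν j * (ang (C.z j) a b + ang (C.z j) b e + ang (C.z j) e a) by
        ring, hang]
    congr 1
    push_cast
    ring
  -- The whole square has trivial monodromy while its right half has monodromy `C.mon (N + 1) ≠ 1`.
  -- Hence transport from `a` to `b` along the left half differs from transport along the diagonal.
  -- As `K - K'` takes the same value on both transported vectors, it vanishes at `b`.
  have hne : C.E a d * C.E d b - C.E a b ≠ 0 := by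
    intro h
    refine C.mon_ne_one (j := N + 1) (by omega) ?_
    rw [← hmon, ← sub_eq_zero.1 h, ← hE]
    ring
  have hD : potAt F K b (C.E a d * C.E d b - C.E a b) = potAt F K' b (C.E a d * C.E d b - C.E a b) := by
    rw [map_sub, map_sub, sub_eq_sub_iff_sub_eq_sub]
    rw [← sub_eq_zero] at e2 ⊢
    have h := congrArg₂ (· - ·) hsum e2
    simp only [sub_zero] at h
    rw [← h]
    abel
  have hbK : K (pt (hofin (hov 2 (Or.inr rfl)))) = K' (pt (hofin (hov 2 (Or.inr rfl)))) := by
    refine LinearMap.ext fun v => ?_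
    rw [← F.co_smul_e _ v]
    rw [potAt_apply (hofin (hov 2 (Or.inr rfl))), potAt_apply (hofin (hov 2 (Or.inr rfl))), map_smul, map_smul] at hD
    have := (smul_right_injective A hne) hD
    rw [map_smul, map_smul]
    exact congrArg _ this
  exact PathCocycle.PotentialOn.eq_of_convex (Config.convex_overlap u N) hofin
    (fun γ hγ => hK γ fun t => (hγ t).imp fun w h => ⟨hoK h.1, h.2⟩)
    (fun γ hγ => hK' γ fun t => (hγ t).imp fun w h => ⟨hoK' h.1, h.2⟩) (hov 2 (Or.inr rfl)) hbK hxo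

end

end DeligneMostow
-- Regularized arcs control potentials
namespace DeligneMostow
open Complex CategoryTheory Filter Topology

section

variable {S : Set P1} {L : LocalSystem.{u} S} {C : Config L} {A : Type*} [AddCommGroup A] [Module ℂ A]
  {u : ℂ}

/-- The conditions under which squares around `z k` and `z (k + 1)` and the segment that joins them
form a regularized arc. -/
structure Config.IsArc (C : Config L) (u : ℂ) (k : ℕ) (w w' : ℂ) : Prop where
  left_ne_zero : w ≠ 0
  right_ne_zero : w' ≠ 0
  left_ball : Metric.closedBall (C.z k) ‖w‖ ⊆ C.strip u k
  right_ball : Metric.closedBall (C.z (k + 1)) ‖w'‖ ⊆ C.strip u (k + 1)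
  segment_subset : segment ℝ (C.z k + w) (C.z (k + 1) + w') ⊆ C.overlap u k
  ne : C.z k + w ≠ C.z (k + 1) + w'

variable {F : Frame C}

theorem Config.IsArc.sum_seg (hC : C.Sorted u) {k : ℕ} (hk : k + 1 < C.m) {w w' : ℂ}
    (h : C.IsArc u k w w') {c : PathCocycle L A} {K K' : ∀ x : Pt S, L.fibre x →ₗ[ℂ] A}
    (hK : c.PotentialOn K (C.strip u k \ {C.z k}))
    (hK' : c.PotentialOn K' (C.strip u (k + 1) \ {C.z (k + 1)})) :
    ∑ τ, c.seg F (arcR (C.z k) (C.z (k + 1)) w w' τ) (arcS (C.z k) (C.z (k + 1)) w w' τ)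
        (C.arcW k w w' τ) =
      potAt F K (C.z (k + 1) + w') (C.E (C.z k + w) (C.z (k + 1) + w')) -
        potAt F K' (C.z (k + 1) + w') (C.E (C.z k + w) (C.z (k + 1) + w')) :=
  sum_arc hk (hC.isolatingSet_strip (by omega)) (hC.isolatingSet_strip hk) hK hK' h.left_ne_zero
    h.right_ne_zero h.left_ball h.right_ball
    (h.segment_subset.trans (hC.overlap_subset_left hk))

theorem PathCocycle.PotentialOn.mono {c : PathCocycle L A} {K : ∀ x : Pt S, L.fibre x →ₗ[ℂ] A}
    {U V : Set ℂ} (h : c.PotentialOn K V) (hUV : U ⊆ V) : c.PotentialOn K U :=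
  fun γ hγ => h γ fun t => (hγ t).imp fun _ h => ⟨hUV h.1, h.2⟩

theorem Config.E_ne_zero (x y : ℂ) : C.E x y ≠ 0 := exp_ne_zero _

/-- Local potentials agree if the cocycle vanishes on a regularized arc. -/
theorem PathCocycle.eq_on_overlap (hC : C.Sorted u) {k : ℕ} (hk : k + 1 < C.m) {w w' : ℂ}
    (h : C.IsArc u k w w') {c : PathCocycle L A} {K K' : ∀ x : Pt S, L.fibre x →ₗ[ℂ] A}
    (hK : c.PotentialOn K (C.strip u k \ {C.z k}))
    (hK' : c.PotentialOn K' (C.strip u (k + 1) \ {C.z (k + 1)}))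
    (hsum : ∑ τ, c.seg F (arcR (C.z k) (C.z (k + 1)) w w' τ) (arcS (C.z k) (C.z (k + 1)) w w' τ)
        (C.arcW k w w' τ) = 0) {x : ℂ} (hx : x ∈ fin S) (hxo : x ∈ C.overlap u k) :
    K (pt hx) = K' (pt hx) := by
  have hof := hC.overlap_subset_fin hk
  have hy : C.z (k + 1) + w' ∈ C.overlap u k := h.segment_subset (right_mem_segment ℝ _ _)
  rw [h.sum_seg hC hk hK hK', sub_eq_zero, potAt_apply (hof hy), potAt_apply (hof hy), map_smul,
    map_smul] at hsum
  have h1 := smul_right_injective A (C.E_ne_zero _ _) hsum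
  refine PathCocycle.PotentialOn.eq_of_convex (Config.convex_overlap u k) hof
    (hK.mono (hC.overlap_subset_left hk)) (hK'.mono (hC.overlap_subset_right hk)) hy
    (LinearMap.ext fun v => ?_) hxo
  rw [← F.co_smul_e _ v, map_smul, map_smul]
  exact congrArg _ h1

variable (C) in
/-- `N` is the number of regularized arcs that generate the homology. -/
def Config.HasArcs (N : ℕ) : Prop :=
  (OnePoint.infty ∈ S ∧ C.m = N + 1) ∨ (OnePoint.infty ∉ S ∧ C.m = N + 2)

theorem Config.HasArcs.lt {N : ℕ} (hN : C.HasArcs N) {k : ℕ} (hk : k < N) : k + 1 < C.m := by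
  rcases hN with h | h <;> omega

theorem exists_mem_fin (hinf : OnePoint.infty ∈ S) (x : Pt S) : ∃ w ∈ fin S, (x : P1) = (w : P1) := by
  have : (x : P1) ≠ OnePoint.infty := fun h => x.2 (h ▸ hinf)
  refine ⟨coord x, ?_, (coe_coord this).symm⟩
  change ((coord x : ℂ) : P1) ∉ S
  rw [coe_coord this]
  exact x.2

/-- A path cocycle that vanishes on all regularized arcs has a potential. -/
theorem PathCocycle.exists_potential_of_arcs (hC : C.Sorted u) {N : ℕ} (hN : C.HasArcs N)
    (c : PathCocycle L A) {w w' : ℕ → ℂ} (harc : ∀ k < N, C.IsArc u k (w k) (w' k))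
    (hsum : ∀ k < N, ∑ τ, c.seg F (arcR (C.z k) (C.z (k + 1)) (w k) (w' k) τ)
      (arcS (C.z k) (C.z (k + 1)) (w k) (w' k) τ) (C.arcW k (w k) (w' k) τ) = 0) :
    ∃ K : ∀ x : Pt S, L.fibre x →ₗ[ℂ] A, ∀ {x y : Pt S} (γ : Path x y), c.IsPotentialOn K γ := by
  have hex : ∀ j, ∃ K : ∀ x : Pt S, L.fibre x →ₗ[ℂ] A,
      j < C.m → c.PotentialOn K (C.strip u j \ {C.z j}) := by
    intro j
    by_cases hj : j < C.m
    · obtain ⟨K, hK⟩ := (hC.isolatingSet_strip hj).exists_potential hj c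
      exact ⟨K, fun _ => hK⟩
    · exact ⟨0, fun h => absurd h hj⟩
  choose K hK using hex
  have hagree : ∀ j < N, ∀ x (hx : x ∈ fin S), x ∈ C.overlap u j →
      K j (pt hx) = K (j + 1) (pt hx) := fun j hj x hx hxo => by
    have hm := hN.lt hj
    exact PathCocycle.eq_on_overlap hC hm (harc j hj) (hK j (by omega)) (hK (j + 1) hm) (hsum j hj)
      hx hxo
  -- If `∞` is singular, the arcs cover all overlaps of the strips. Otherwise they cover all but the
  -- last one.
  rcases hN with ⟨hinf, hm⟩ | ⟨hinf, hm⟩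
  · obtain ⟨K', hK', -⟩ := PathCocycle.exists_glue hC le_rfl (fun j hj => hK j hj)
      fun j hj => hagree j (by omega)
    exact ⟨K', fun γ => hK'.mono (hC.fin_subset_strips (by omega)) γ fun t => exists_mem_fin hinf _⟩
  -- The potentials on all strips but the last are glued first. The glued potential is then compared
  -- with the last one by a loop near infinity.
  · obtain ⟨K', hK', hKK'⟩ := PathCocycle.exists_glue hC (J := N + 1) (by omega)
      (fun j hj => hK j (by omega)) fun j hj => hagree j (by omega)
    obtain ⟨K'', hK'', -⟩ := PathCocycle.exists_glue hC le_rfl (fun j hj => hK j hj)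
      (fun j hj x hx hxo => by
        rcases Nat.lt_or_ge j N with h | h
        · exact hagree j h x hx hxo
        · obtain rfl : j = N := by omega
          rw [← hKK' j (by omega) x hx (hC.overlap_subset_left (by omega) hxo).1]
          exact PathCocycle.eq_on_last_overlap hC hm hinf hK' (hK (j + 1) (by omega)) hx hxo)
    exact PathCocycle.exists_potential_infty hinf C
      (hK''.mono (hC.fin_subset_strips (by omega)))

/-! ### The classes of regularized arcs -/

open Classical in
variable (F) in
/-- A segment with coefficient as a singular chain. -/
noncomputable def segChain (a b k : ℂ) : Chain L 1 :=
  if h : segment ℝ a b ⊆ fin S then pathChain L (segPath h) (k • F.e _) else 0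

variable (F) in
/-- The regularized arc from `z k` to `z (k + 1)`. -/
noncomputable def arcChain (k : ℕ) (w w' : ℂ) : Chain L 1 :=
  ∑ τ, segChain F (arcR (C.z k) (C.z (k + 1)) w w' τ) (arcS (C.z k) (C.z (k + 1)) w w' τ)
    (C.arcW k w w' τ)

variable (L) in
/-- The boundary of a path as a cocycle. -/
noncomputable def boundaryCocycle : PathCocycle L (Chain L 0) where
  val {x y} γ := pointChain L y ∘ₗ L.transport γ - pointChain L x
  trans γ δ v := by
    simp only [LinearMap.sub_apply, LinearMap.comp_apply, transport_trans]
    abel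
  homotopic γ δ h := by rw [transport_eq h]

theorem boundaryCocycle_potential {x y : Pt S} (γ : Path x y) :
    (boundaryCocycle L).IsPotentialOn (pointChain L) γ := fun _ => rfl

theorem boundary_segChain (a b k : ℂ) :
    boundary L 0 (segChain F a b k) = (boundaryCocycle L).seg F a b k := by
  rw [segChain, PathCocycle.seg]
  split_ifs with h
  · rw [boundary_pathChain]; rfl
  · rw [map_zero]

theorem quotientCocycle_seg {W : Submodule ℂ (Chain L 1)} (hW : IntersectionBoundary L ≤ W)
    (a b k : ℂ) : (quotientCocycle W hW).seg F a b k = W.mkQ (segChain F a b k) := by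
  rw [segChain, PathCocycle.seg]
  split_ifs with h
  · rfl
  · rw [map_zero]

theorem segChain_mem_admissible (a b k : ℂ) : segChain F a b k ∈ AdmissibleChain L 1 := by
  rw [segChain]
  split_ifs with h
  · exact pathChain_mem_admissible _ _
  · exact zero_mem _

/-- Taking boundaries of paths is a cocycle with a global potential. Its value on the arc is the
difference of this potential with itself, so the arc is a cycle. -/
theorem arcChain_mem (hC : C.Sorted u) {k : ℕ} (hk : k + 1 < C.m) {w w' : ℂ}
    (h : C.IsArc u k w w') : arcChain F k w w' ∈ IntersectionCycle L := by
  have hb : boundary L 0 (arcChain F k w w') = 0 := by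
    rw [arcChain, map_sum]
    simp only [boundary_segChain]
    rw [h.sum_seg hC hk (K := pointChain L) (K' := pointChain L)
      (fun γ _ => boundaryCocycle_potential γ) (fun γ _ => boundaryCocycle_potential γ), sub_self]
  refine ⟨⟨Submodule.sum_mem _ fun τ _ => segChain_mem_admissible _ _ _, ?_⟩, hb⟩
  change boundary L 0 _ ∈ AdmissibleChain L 0
  rw [hb]
  exact zero_mem _

/-- The regularized arcs generate the intersection homology. -/
theorem mem_sup_span_arcChain (hC : C.Sorted u) {N : ℕ} (hN : C.HasArcs N) (F : Frame C)
    {w w' : ℕ → ℂ} (harc : ∀ k < N, C.IsArc u k (w k) (w' k)) {ξ : Chain L 1}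
    (hξ : ξ ∈ IntersectionCycle L) :
    ξ ∈ IntersectionBoundary L ⊔
      Submodule.span ℂ (Set.range fun k : Fin N => arcChain F k (w k) (w' k)) := by
  obtain ⟨K, hK⟩ := (quotientCocycle _ (le_sup_left (a := IntersectionBoundary L)
    (b := Submodule.span ℂ (Set.range fun k : Fin N => arcChain F k (w k) (w' k))))).exists_potential_of_arcs
    (F := F) hC hN harc fun k hk => by
      simp only [quotientCocycle_seg]
      rw [← map_sum, Submodule.mkQ_apply, Submodule.Quotient.mk_eq_zero]
      exact Submodule.mem_sup_right (Submodule.subset_span ⟨⟨k, hk⟩, rfl⟩)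
  exact mem_of_potential _ hK hξ

/-- The class of a regularized arc does not depend on the squares, up to a phase. -/
theorem arcChain_sub_mem (hC : C.Sorted u) {k : ℕ} (hk : k + 1 < C.m) {w₁ w₁' w₂ w₂' : ℂ}
    (h₁ : C.IsArc u k w₁ w₁') (h₂ : C.IsArc u k w₂ w₂') :
    arcChain F k w₁ w₁' - C.E (C.z k + w₁) (C.z k + w₂) • arcChain F k w₂ w₂' ∈
      IntersectionBoundary L := by
  obtain ⟨K, hK⟩ := (hC.isolatingSet_strip (j := k) (by omega)).exists_potential (by omega)
    (quotientCocycle (IntersectionBoundary L) le_rfl)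
  obtain ⟨K', hK'⟩ := (hC.isolatingSet_strip hk).exists_potential hk
    (quotientCocycle (IntersectionBoundary L) le_rfl)
  have hof := hC.overlap_subset_fin hk
  have hco := Config.convex_overlap (C := C) u k
  -- Both are potentials of the same cocycle, so their difference is flat on the overlap.
  have move : ∀ {a b : ℂ}, a ∈ C.overlap u k → b ∈ C.overlap u k → ∀ l : ℂ,
      potAt F K b (l * C.E a b) - potAt F K' b (l * C.E a b) = potAt F K a l - potAt F K' a l := by
    intro a b ha hb l
    have hs := hco.segment_subset ha hb
    have e1 := PathCocycle.seg_eq (F := F) (hs.trans hof) (hK _ fun t =>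
      ⟨_, (hs.trans (hC.overlap_subset_left hk)) (lineC_mem_segment _ _ t), rfl⟩) l
    rw [PathCocycle.seg_eq (F := F) (hs.trans hof) (hK' _ fun t =>
      ⟨_, (hs.trans (hC.overlap_subset_right hk)) (lineC_mem_segment _ _ t), rfl⟩) l] at e1
    rw [sub_eq_sub_iff_sub_eq_sub, ← e1]
  -- The class of the arc is this flat difference at the starting point of its segment. The squares
  -- enter only through the position of that point.
  have key : ∀ {w w' : ℂ}, C.IsArc u k w w' → (IntersectionBoundary L).mkQ (arcChain F k w w') =
      potAt F K (C.z k + w) 1 - potAt F K' (C.z k + w) 1 := by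
    intro w w' h
    have e := h.sum_seg (F := F) hC hk hK hK'
    simp only [quotientCocycle_seg] at e
    rw [arcChain, map_sum, e]
    have := move (h.segment_subset (left_mem_segment ℝ _ _))
      (h.segment_subset (right_mem_segment ℝ _ _)) 1
    rwa [one_mul] at this
  rw [← Submodule.Quotient.mk_eq_zero, ← Submodule.mkQ_apply, map_sub, map_smul, key h₁, key h₂,
    ← move (h₁.segment_subset (left_mem_segment ℝ _ _)) (h₂.segment_subset (left_mem_segment ℝ _ _)),
    one_mul, smul_sub, ← map_smul, ← map_smul, smul_eq_mul, mul_one, sub_self]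

end

end DeligneMostow
namespace DeligneMostow
open Complex CategoryTheory Filter Topology

section

variable {S : Set P1} {L : LocalSystem.{u} S} {C : Config L}

/-! ### The crossing form on chains -/

open Classical in
/-- The crossing number of two segments, with the comparison of the frames at the crossing. -/
noncomputable def Config.crossE (C : Config L) (a b r s : ℂ) : ℂ :=
  if h : ∃ p, p ∈ segment ℝ a b ∧ p ∈ segment ℝ r s then
    C.E a h.choose * starRingEnd ℂ (C.E r h.choose) * (cross a b r s : ℂ) else 0

theorem Config.crossE_of_disjoint {a b r s : ℂ} (h : Disjoint (segment ℝ a b) (segment ℝ r s)) :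
    C.crossE a b r s = 0 :=
  dif_neg fun ⟨_, hp, hp'⟩ => Set.disjoint_left.1 h hp hp'

theorem GenPos.symm {a b r s : ℂ} (h : GenPos a b r s) : GenPos r s a b := ⟨h.2, h.1⟩

theorem GenPos.ne {a b r s p : ℂ} (h : GenPos a b r s) (hp : p ∈ segment ℝ a b)
    (hp' : p ∈ segment ℝ r s) : r ≠ s := by
  rintro rfl
  rw [segment_same, Set.mem_singleton_iff] at hp'
  exact h.1.1 (hp' ▸ hp)

theorem Config.crossE_eq {a b r s p : ℂ} (h : GenPos a b r s) (hp : p ∈ segment ℝ a b)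
    (hp' : p ∈ segment ℝ r s) :
    C.crossE a b r s = C.E a p * starRingEnd ℂ (C.E r p) * (cross a b r s : ℂ) := by
  have hex : ∃ p, p ∈ segment ℝ a b ∧ p ∈ segment ℝ r s := ⟨p, hp, hp'⟩
  rw [crossE, dif_pos hex, eq_of_mem_segments (h.im_ne_zero (h.ne hp hp') hp hp') hex.choose_spec.1
    hex.choose_spec.2 hp hp']

theorem Config.exists_crossE (C : Config L) {a b r s : ℂ} (h : GenPos a b r s) : ∃ K : ℂ,
    C.crossE a b r s = K * (cross a b r s : ℂ) ∧ ∀ p ∈ segment ℝ a b, p ∈ segment ℝ r s →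
      K = C.E a p * starRingEnd ℂ (C.E r p) := by
  by_cases hex : ∃ p, p ∈ segment ℝ a b ∧ p ∈ segment ℝ r s
  · obtain ⟨p, hp, hp'⟩ := hex
    refine ⟨_, crossE_eq h hp hp', fun q hq hq' => ?_⟩
    rw [eq_of_mem_segments (h.im_ne_zero (h.ne hp hp') hp hp') hp hp' hq hq']
  · refine ⟨0, ?_, fun p hp hp' => absurd ⟨p, hp, hp'⟩ hex⟩
    rw [crossE, dif_neg hex, zero_mul]

/-- Exchanging the segments reverses the orientation sign and conjugates the product of the phases.
This is the source of the skew-Hermitian symmetry. -/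
theorem Config.crossE_swap {a b r s : ℂ} (h : GenPos a b r s) :
    C.crossE a b r s = -starRingEnd ℂ (C.crossE r s a b) := by
  by_cases hex : ∃ p, p ∈ segment ℝ a b ∧ p ∈ segment ℝ r s
  · obtain ⟨p, hp, hp'⟩ := hex
    rw [crossE_eq h hp hp', crossE_eq h.symm hp' hp, h.cross_eq (h.ne hp hp') hp hp',
      h.symm.cross_eq (h.symm.ne hp' hp) hp' hp]
    have : (starRingEnd ℂ (s - r) * (b - a)).im = -(starRingEnd ℂ (b - a) * (s - r)).im := by
      rw [← conj_im]; simp [mul_comm]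
    rw [this, Real.sign_neg]
    simp only [map_mul, ofReal_neg, map_neg, conj_ofReal, conj_conj]
    ring
  · rw [crossE, dif_neg hex, crossE, dif_neg fun ⟨p, hp, hp'⟩ => hex ⟨p, hp', hp⟩]
    simp

open Classical in
theorem chainLift_eq_sum {i : ℕ} {A : Type*} [AddCommGroup A] [Module ℂ A]
    (G : ∀ σ : C(Simplex i, P1), Coefficient L σ →ₗ[ℂ] A) (ξ : Chain L i) :
    chainLift G ξ = ∑ σ ∈ ξ.support, G σ (ξ σ) := by
  conv_lhs => rw [← DFinsupp.sum_single (f := ξ)]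
  rw [DFinsupp.sum, map_sum]
  exact Finset.sum_congr rfl fun σ _ => chainLift_chainOf _ _ _

/-- The starting point of a singular simplex. -/
noncomputable def tail (σ : C(Simplex 1, P1)) : ℂ := coord (σ (stdSimplex.vertex 0))

/-- The final point of a singular simplex. -/
noncomputable def head (σ : C(Simplex 1, P1)) : ℂ := coord (σ (stdSimplex.vertex 1))

variable (F : Frame C)

/-- The crossings of a chain with a simplex. -/
noncomputable def crossWith (τ : C(Simplex 1, P1)) : Chain L 1 →ₗ[ℂ] ℂ :=
  chainLift fun σ => C.crossE (tail σ) (head σ) (tail τ) (head τ) • F.start σ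

/-- The crossing form. -/
noncomputable def crossForm (ξ η : Chain L 1) : ℂ :=
  starRingEnd ℂ (chainLift (fun τ => starRingEnd ℂ (crossWith F τ ξ) • F.start τ) η)

open Classical in
theorem crossForm_eq_sum (ξ η : Chain L 1) : crossForm F ξ η = ∑ σ ∈ ξ.support, ∑ τ ∈ η.support,
    F.start σ (ξ σ) * starRingEnd ℂ (F.start τ (η τ)) *
      C.crossE (tail σ) (head σ) (tail τ) (head τ) := by
  rw [crossForm, chainLift_eq_sum, map_sum, Finset.sum_comm]
  refine Finset.sum_congr rfl fun τ _ => ?_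
  rw [LinearMap.smul_apply, smul_eq_mul, map_mul, conj_conj, crossWith, chainLift_eq_sum,
    Finset.sum_mul]
  refine Finset.sum_congr rfl fun σ _ => ?_
  rw [LinearMap.smul_apply, smul_eq_mul]
  ring

/-- All simplices are straight segments in `ℂ` without the singular points. -/
def IsFinitePolygonal (ξ : Chain L 1) : Prop :=
  ∀ σ, ξ σ ≠ 0 → IsSegment σ (tail σ) (head σ) ∧ segment ℝ (tail σ) (head σ) ⊆ fin S

theorem IsSegment.tail_eq {σ : C(Simplex 1, P1)} {a b : ℂ} (h : IsSegment σ a b) : tail σ = a := by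
  rw [tail, h.vertex_zero]; rfl

theorem IsSegment.head_eq {σ : C(Simplex 1, P1)} {a b : ℂ} (h : IsSegment σ a b) : head σ = b := by
  rw [head, h.vertex_one]; rfl

theorem IsPolygonal.finite {ξ : Chain L 1} (h : IsPolygonal ξ) (hξ : ξ ∈ IntersectionCycle L) :
    IsFinitePolygonal ξ := by
  intro σ hσ
  obtain ⟨a, b, hab⟩ := h σ hσ
  rw [hab.tail_eq, hab.head_eq]
  refine ⟨hab, fun p hp => ?_⟩
  obtain ⟨t, rfl⟩ := exists_baryPoint hp
  have := notMem_of_isAdmissible (hξ.1.1 σ hσ) t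
  rwa [hab.apply] at this

theorem InGeneralPosition.genPos {ξ η : Chain L 1} (h : InGeneralPosition ξ η)
    (hξ : IsFinitePolygonal ξ) (hη : IsFinitePolygonal η) {σ τ : C(Simplex 1, P1)} (hσ : ξ σ ≠ 0)
    (hτ : η τ ≠ 0) : GenPos (tail σ) (head σ) (tail τ) (head τ) := by
  have s1 := (hξ σ hσ).1
  have s2 := (hη τ hτ).1
  refine ⟨⟨fun hp => ?_, fun hp => ?_⟩, fun hp => ?_, fun hp => ?_⟩ <;>
    obtain ⟨t, ht⟩ := exists_baryPoint hp
  · exact (h σ τ hσ hτ 0 t).2 (by rw [s1.apply, s2.vertex_zero, ht])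
  · exact (h σ τ hσ hτ 1 t).2 (by rw [s1.apply, s2.vertex_one, ht])
  · exact (h σ τ hσ hτ 0 t).1 (by rw [s2.apply, s1.vertex_zero, ht])
  · exact (h σ τ hσ hτ 1 t).1 (by rw [s2.apply, s1.vertex_one, ht])

/-- The crossing form is the geometric intersection number. -/
theorem intersectionNumber_eq {F : Frame C} {h : FlatMetric L}
    (hF : ∀ (x : ℂ) (hx : x ∈ fin S), h.form (pt hx) (F.e _) (F.e _) = 1) {ξ η : Chain L 1}
    (hξ : IsFinitePolygonal ξ) (hη : IsFinitePolygonal η) (hgp : InGeneralPosition ξ η) :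
    intersectionNumber h ξ η = crossForm F ξ η := by
  classical
  rw [crossForm_eq_sum, intersectionNumber]
  refine Finset.sum_congr (by congr) fun σ hσ => Finset.sum_congr (by congr) fun τ hτ => ?_
  have hσ := DFinsupp.mem_support_iff.1 hσ
  have hτ := DFinsupp.mem_support_iff.1 hτ
  have g := hgp.genPos hξ hη hσ hτ
  obtain ⟨K, hK, hKp⟩ := C.exists_crossE g
  rw [segmentIntersection_eq hF (hξ σ hσ).1 (hη τ hτ).1 (hξ σ hσ).2 (hη τ hτ).2 g (ξ σ) (η τ)
    (F.start σ (ξ σ) * starRingEnd ℂ (F.start τ (η τ)) * K), hK]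
  · ring
  · intro p hp hp'
    rw [hKp p hp hp', map_mul]
    ring

theorem crossForm_swap {ξ η : Chain L 1} (hξ : IsFinitePolygonal ξ) (hη : IsFinitePolygonal η)
    (hgp : InGeneralPosition ξ η) : crossForm F ξ η = -starRingEnd ℂ (crossForm F η ξ) := by
  classical
  rw [crossForm_eq_sum, crossForm_eq_sum, Finset.sum_comm, map_sum, ← Finset.sum_neg_distrib]
  refine Finset.sum_congr rfl fun τ hτ => ?_
  rw [map_sum, ← Finset.sum_neg_distrib]
  refine Finset.sum_congr rfl fun σ hσ => ?_
  rw [Config.crossE_swap (hgp.genPos hξ hη (DFinsupp.mem_support_iff.1 hσ)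
    (DFinsupp.mem_support_iff.1 hτ))]
  simp only [map_mul, conj_conj]
  ring

open Classical in
/-- The polygonal cycle of a chain. -/
noncomputable def toPolyCycle {η : Chain L 1} (hη : IsFinitePolygonal η)
    (hb : boundary L 0 η = 0) : PolyCycle C C(Simplex 1, P1) where
  T := η.support
  r := tail
  s := head
  w τ := F.start τ (η τ)
  segment_subset τ hτ := (hη τ (DFinsupp.mem_support_iff.1 hτ)).2
  cycle x₀ := by
    -- Extended to `0`-chains, this function reads off the coefficient at `x₀`; applied to `∂η = 0`
    -- it gives the cycle condition in coordinates.
    let K : ∀ x : Pt S, L.fibre x →ₗ[ℂ] ℂ := fun x => if coord x = x₀ then F.co x else 0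
    have hK : potentialChain K (boundary L 0 η) = 0 := by rw [hb, map_zero]
    rw [← DFinsupp.sum_single (f := η), DFinsupp.sum, map_sum, map_sum] at hK
    refine Eq.trans (Finset.sum_congr rfl fun τ hτ => ?_) hK
    have hs := hη τ (DFinsupp.mem_support_iff.1 hτ)
    have hτS := hs.1.notMem hs.2
    have key : ∀ {x y : Pt S} (γ : Path x y) (v : L.fibre x),
        potentialChain K (boundary L 0 (pathChain L γ v)) = K y (L.transport γ v) - K x v :=
      fun γ v => by
        rw [boundary_pathChain, map_sub, potentialChain_pointChain, potentialChain_pointChain]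
    rw [single_eq_pathChain τ hτS]
    refine Eq.trans ?_ (key (simplexToPath τ hτS) _).symm
    have h1 := F.transport_e_of_convex (convex_segment (tail τ) (head τ)) hs.2 (simplexToPath τ hτS)
      fun t => ⟨_, baryPoint_mem _ _ _, hs.1.apply _⟩
    have h2 := F.co_transport h1 ((η τ).1 ⟨stdSimplex.vertex 0, hτS _⟩)
    rw [F.start_eq (hτS (stdSimplex.vertex 0))]
    simp only [K]
    congr 1
    · change _ = (if head τ = x₀ then _ else _ : _ →ₗ[ℂ] ℂ) _
      split_ifs
      · exact h2.symm
      · rfl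
    · change _ = (if tail τ = x₀ then _ else _ : _ →ₗ[ℂ] ℂ) _
      split_ifs <;> rfl

/-- The intersection with a polygonal cycle, as a functional on chains. -/
noncomputable def dual {η : Chain L 1} (hη : IsFinitePolygonal η) (hb : boundary L 0 η = 0) :
    Chain L 1 →ₗ[ℂ] ℂ :=
  ((toPolyCycle F hη hb).cocycle F).chainIntegral

theorem dual_eq_zero {η : Chain L 1} (hη : IsFinitePolygonal η) (hb : boundary L 0 η = 0)
    {ξ : Chain L 1} (hξ : ξ ∈ IntersectionBoundary L) : dual F hη hb ξ = 0 := by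
  obtain ⟨ζ, -, rfl⟩ := hξ
  exact LocalCocycle.chainIntegral_boundary _ ζ

/-- Over each segment the integral of the crossing cocycle is a sum of weighted crossings, the
weight being constant because there is at most one crossing. This identifies the homologically
invariant functional with the geometric count. -/
theorem dual_eq {η : Chain L 1} (hη : IsFinitePolygonal η) (hb : boundary L 0 η = 0)
    {ξ : Chain L 1} (hξ : IsFinitePolygonal ξ) (hgp : InGeneralPosition ξ η) :
    dual F hη hb ξ = crossForm F ξ η := by
  classical
  rw [dual, LocalCocycle.chainIntegral_eq_sum, crossForm_eq_sum]
  refine Finset.sum_congr rfl fun σ hσ => ?_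
  have hσ := DFinsupp.mem_support_iff.1 hσ
  have g : ∀ τ ∈ η.support, GenPos (tail σ) (head σ) (tail τ) (head τ) := fun τ hτ =>
    hgp.genPos hξ hη hσ (DFinsupp.mem_support_iff.1 hτ)
  have hex : ∀ τ, ∃ K : ℂ, τ ∈ η.support → C.crossE (tail σ) (head σ) (tail τ) (head τ) =
      K * (cross (tail σ) (head σ) (tail τ) (head τ) : ℂ) ∧
      ∀ p ∈ segment ℝ (tail σ) (head σ), p ∈ segment ℝ (tail τ) (head τ) →
      K = C.E (tail σ) p * starRingEnd ℂ (C.E (tail τ) p) := by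
    intro τ
    by_cases hτ : τ ∈ η.support
    · obtain ⟨K, hK⟩ := C.exists_crossE (g τ hτ)
      exact ⟨K, fun _ => hK⟩
    · exact ⟨0, fun h => absurd h hτ⟩
  choose K hK using hex
  rw [(toPolyCycle F hη hb).integral_cocycle F (hξ σ hσ).1 (hξ σ hσ).2 (ξ σ)
    (fun τ hτ => (g τ hτ).1)
    (fun τ => F.start σ (ξ σ) * starRingEnd ℂ (F.start τ (η τ)) * K τ)]
  · refine Finset.sum_congr rfl fun τ hτ => ?_
    rw [(hK τ hτ).1]
    simp only [toPolyCycle]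
    ring
  · intro τ hτ p hp hp'
    rw [(hK τ hτ).2 p hp hp']
    simp only [toPolyCycle, map_mul]
    ring

end

end DeligneMostow
namespace DeligneMostow
open Complex CategoryTheory Filter Topology

section

variable {S : Set P1} {L : LocalSystem.{u} S} {C : Config L} {u : ℂ}

/-! ### The crossing form on regularized arcs -/

/-- A segment as a singular simplex. -/
noncomputable def segSimplex {a b : ℂ} (h : segment ℝ a b ⊆ fin S) : C(Simplex 1, P1) :=
  regSimplex ((segPath h).toContinuousMap.comp secondCoord)

theorem isSegment_segSimplex {a b : ℂ} (h : segment ℝ a b ⊆ fin S) (hab : a ≠ b) :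
    IsSegment (segSimplex h) a b := by
  refine ⟨hab, fun t => ?_⟩
  change ((lineC a b (secondCoord t) : ℂ) : P1) = ((baryPoint a b t : ℂ) : P1)
  rw [baryPoint_eq]
  rfl

variable (F : Frame C)

open Classical in
theorem segChain_eq {a b : ℂ} (h : segment ℝ a b ⊆ fin S) (k : ℂ) :
    ∃ w : Coefficient L (segSimplex h), F.start _ w = k ∧
      segChain F a b k = chainOf L (segSimplex h) w := by
  refine ⟨flatSec L ((segPath h).toContinuousMap.comp secondCoord) (stdSimplex.vertex 0)
    (x := pt (h (left_mem_segment ℝ a b))) (by simp) (k • F.e _), ?_, ?_⟩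
  · have h0 : segSimplex h (stdSimplex.vertex 0) ∉ S := regSimplex_notMem _ _
    refine (F.start_eq h0 _).trans ?_
    have e := flatSec_heq (L := L) ((segPath h).toContinuousMap.comp secondCoord)
      (stdSimplex.vertex 0) (x := pt (h (left_mem_segment ℝ a b))) (by simp) (k • F.e _)
      (stdSimplex.vertex 0) h0
      (Path.refl (pt (h (left_mem_segment ℝ a b)))) fun s => by
        have : secondCoord (simplexPath (stdSimplex.vertex 0) (stdSimplex.vertex 0) s) = 0 :=
          Subtype.ext (by simp [secondCoord, simplexPath])
        change segPath h (secondCoord _) = _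
        rw [this]; simp
    rw [transport_refl] at e
    have hx : (⟨segSimplex h (stdSimplex.vertex 0), h0⟩ : Pt S) =
        pt (h (left_mem_segment ℝ a b)) := Subtype.ext (by
      change (segPath h (secondCoord _) : P1) = _
      rw [secondCoord_zero, (segPath h).source])
    have key : ∀ (x y : Pt S) (hxy : x = y) (v : L.fibre x), HEq v (k • F.e y) → F.co x v = k := by
      rintro x _ rfl v hv
      rw [eq_of_heq hv, map_smul, F.co_e, smul_eq_mul, mul_one]
    exact key _ _ hx _ e
  · rw [segChain, dif_pos h]
    rfl

theorem segChain_ne_zero {a b k : ℂ} (hab : a ≠ b) {σ : C(Simplex 1, P1)}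
    (hσ : segChain F a b k σ ≠ 0) : IsSegment σ a b ∧ segment ℝ a b ⊆ fin S := by
  classical
  by_cases h : segment ℝ a b ⊆ fin S
  · obtain ⟨w, -, hw⟩ := segChain_eq F h k
    rw [hw] at hσ
    have : σ = segSimplex h := by
      by_contra hne
      exact hσ (DFinsupp.single_eq_of_ne hne)
    exact ⟨this ▸ isSegment_segSimplex h hab, h⟩
  · rw [segChain, dif_neg h] at hσ
    exact absurd rfl hσ

theorem crossWith_segChain {a b : ℂ} (h : segment ℝ a b ⊆ fin S) (hab : a ≠ b) (k : ℂ)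
    (τ : C(Simplex 1, P1)) :
    crossWith F τ (segChain F a b k) = k * C.crossE a b (tail τ) (head τ) := by
  obtain ⟨w, hw, e⟩ := segChain_eq F h k
  have hs := isSegment_segSimplex h hab
  rw [e, crossWith, chainLift_chainOf, LinearMap.smul_apply, hw, hs.tail_eq, hs.head_eq, smul_eq_mul,
    mul_comm]

/-- The crossing form of two families of segments. -/
theorem crossForm_sum {ι κ : Type*} [Fintype ι] [Fintype κ] {a b k : ι → ℂ} {r s l : κ → ℂ}
    (hab : ∀ i, segment ℝ (a i) (b i) ⊆ fin S) (hne : ∀ i, a i ≠ b i)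
    (hrs : ∀ i, segment ℝ (r i) (s i) ⊆ fin S) (hne' : ∀ i, r i ≠ s i) :
    crossForm F (∑ i, segChain F (a i) (b i) (k i)) (∑ j, segChain F (r j) (s j) (l j)) =
      ∑ i, ∑ j, k i * starRingEnd ℂ (l j) * C.crossE (a i) (b i) (r j) (s j) := by
  rw [crossForm, map_sum, map_sum, Finset.sum_comm]
  refine Finset.sum_congr rfl fun j _ => ?_
  obtain ⟨w, hw, e⟩ := segChain_eq F (hrs j) (l j)
  have hs := isSegment_segSimplex (hrs j) (hne' j)
  rw [e, chainLift_chainOf, LinearMap.smul_apply, hw, map_sum, smul_eq_mul, map_mul, conj_conj,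
    Finset.sum_mul]
  refine Finset.sum_congr rfl fun i _ => ?_
  rw [crossWith_segChain F (hab i) (hne i), hs.tail_eq, hs.head_eq]
  ring

theorem inGeneralPosition_of_genPos {ξ η : Chain L 1} (hξ : IsFinitePolygonal ξ)
    (hη : IsFinitePolygonal η) (h : ∀ σ τ, ξ σ ≠ 0 → η τ ≠ 0 →
      GenPos (tail σ) (head σ) (tail τ) (head τ)) : InGeneralPosition ξ η := by
  intro σ τ hσ hτ k t
  have s1 := (hξ σ hσ).1
  have s2 := (hη τ hτ).1
  obtain ⟨⟨h1, h2⟩, h3, h4⟩ := h σ τ hσ hτ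
  have m1 := baryPoint_mem (tail σ) (head σ) t
  have m2 := baryPoint_mem (tail τ) (head τ) t
  constructor <;> intro e <;> rw [s1.apply, s2.apply, OnePoint.coe_eq_coe] at e <;>
    fin_cases k <;> simp [baryPoint] at e
  · exact h3 (by rw [e]; exact m2)
  · exact h4 (by rw [e]; exact m2)
  · exact h1 (by rw [← e]; exact m1)
  · exact h2 (by rw [← e]; exact m1)

theorem InGeneralPosition.symm {ξ η : Chain L 1} (h : InGeneralPosition ξ η) :
    InGeneralPosition η ξ := fun σ τ hσ hτ k t =>
  ⟨fun e => (h τ σ hτ hσ k t).2 e.symm, fun e => (h τ σ hτ hσ k t).1 e.symm⟩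

theorem sqPt_ne {z w : ℂ} (hw : w ≠ 0) (i : Fin 4) : sqPt z w i ≠ sqPt z w (i + 1) := by
  intro h
  have h1 := sqPt_succ_sub z w i
  rw [← h] at h1
  have h2 : (sqPt z w i - z) * (1 - I) = 0 := by linear_combination h1
  rcases mul_eq_zero.1 h2 with h | h
  · rw [← norm_eq_zero, norm_sqPt_sub, norm_eq_zero] at h
    exact hw h
  · have := congrArg re h
    simp at this

variable {F}

theorem Config.IsArc.arc_ne {k : ℕ} {w w' : ℂ} (h : C.IsArc u k w w') (τ : Option (Bool × Fin 4)) :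
    arcR (C.z k) (C.z (k + 1)) w w' τ ≠ arcS (C.z k) (C.z (k + 1)) w w' τ := by
  rcases τ with _ | ⟨_ | _, i⟩
  · exact h.ne
  · exact sqPt_ne h.left_ne_zero i
  · exact sqPt_ne h.right_ne_zero i

theorem Config.IsArc.arc_subset (hC : C.Sorted u) {k : ℕ} (hk : k + 1 < C.m) {w w' : ℂ}
    (h : C.IsArc u k w w') (τ : Option (Bool × Fin 4)) :
    segment ℝ (arcR (C.z k) (C.z (k + 1)) w w' τ) (arcS (C.z k) (C.z (k + 1)) w w' τ) ⊆ fin S := by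
  have hsq : ∀ {j : ℕ} {w : ℂ}, j < C.m → w ≠ 0 → Metric.closedBall (C.z j) ‖w‖ ⊆ C.strip u j →
      ∀ i, segment ℝ (sqPt (C.z j) w i) (sqPt (C.z j) w (i + 1)) ⊆ fin S := fun hj hw hb i x hx =>
    (hC.isolatingSet_strip hj).diff_subset ⟨hb (edge_subset_closedBall _ _ i hx), fun h =>
      center_notMem_edge hw i (by rw [Set.mem_singleton_iff] at h; rwa [h] at hx)⟩
  rcases τ with _ | ⟨_ | _, i⟩
  · exact h.segment_subset.trans (hC.overlap_subset_fin hk)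
  · exact hsq (by omega) h.left_ne_zero h.left_ball i
  · exact hsq hk h.right_ne_zero h.right_ball i

theorem Config.IsArc.exists_of_ne_zero {k : ℕ} {w w' : ℂ} (h : C.IsArc u k w w')
    {σ : C(Simplex 1, P1)} (hσ : arcChain F k w w' σ ≠ 0) :
    ∃ τ, IsSegment σ (arcR (C.z k) (C.z (k + 1)) w w' τ) (arcS (C.z k) (C.z (k + 1)) w w' τ) ∧
      segment ℝ (arcR (C.z k) (C.z (k + 1)) w w' τ) (arcS (C.z k) (C.z (k + 1)) w w' τ) ⊆ fin S := by
  rw [arcChain, DFinsupp.finsetSum_apply] at hσ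
  obtain ⟨τ, -, hτ⟩ := Finset.exists_ne_zero_of_sum_ne_zero hσ
  exact ⟨τ, segChain_ne_zero F (h.arc_ne τ) hτ⟩

theorem Config.IsArc.isPolygonal {k : ℕ} {w w' : ℂ} (h : C.IsArc u k w w') :
    IsPolygonal (arcChain F k w w') := fun σ hσ => by
  obtain ⟨τ, hτ, -⟩ := h.exists_of_ne_zero hσ
  exact ⟨_, _, hτ⟩

theorem Config.IsArc.isFinitePolygonal {k : ℕ} {w w' : ℂ} (h : C.IsArc u k w w') :
    IsFinitePolygonal (arcChain F k w w') := fun σ hσ => by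
  obtain ⟨τ, hτ, hS⟩ := h.exists_of_ne_zero hσ
  rw [hτ.tail_eq, hτ.head_eq]
  exact ⟨hτ, hS⟩

/-- A regularized arc is in general position with respect to a segment. -/
def ArcGenPos (C : Config L) (k : ℕ) (w w' r s : ℂ) : Prop :=
  ∀ τ, GenPos (arcR (C.z k) (C.z (k + 1)) w w' τ) (arcS (C.z k) (C.z (k + 1)) w w' τ) r s

theorem Config.IsArc.inGeneralPosition {k : ℕ} {w w' : ℂ} (h : C.IsArc u k w w') {η : Chain L 1}
    (hη : IsFinitePolygonal η) (hgp : ∀ τ, η τ ≠ 0 → ArcGenPos C k w w' (tail τ) (head τ)) :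
    InGeneralPosition (arcChain F k w w') η := by
  refine inGeneralPosition_of_genPos h.isFinitePolygonal hη fun σ τ hσ hτ => ?_
  obtain ⟨ρ, hρ, -⟩ := h.exists_of_ne_zero hσ
  rw [hρ.tail_eq, hρ.head_eq]
  exact hgp τ hτ ρ

variable (F) in
theorem crossForm_arc (hC : C.Sorted u) {k j : ℕ} (hk : k + 1 < C.m) (hj : j + 1 < C.m)
    {w w' v v' : ℂ} (h : C.IsArc u k w w') (h' : C.IsArc u j v v') :
    crossForm F (arcChain F k w w') (arcChain F j v v') = ∑ τ, ∑ ρ,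
      C.arcW k w w' τ * starRingEnd ℂ (C.arcW j v v' ρ) *
        C.crossE (arcR (C.z k) (C.z (k + 1)) w w' τ) (arcS (C.z k) (C.z (k + 1)) w w' τ)
          (arcR (C.z j) (C.z (j + 1)) v v' ρ) (arcS (C.z j) (C.z (j + 1)) v v' ρ) :=
  crossForm_sum F (h.arc_subset hC hk) h.arc_ne (h'.arc_subset hC hj) h'.arc_ne

end

end DeligneMostow
namespace DeligneMostow
open Complex CategoryTheory Filter Topology

/-! ### Small regularized arcs -/

/-- The filter of pairs of positive numbers `(ε, δ)` where `ε` is small and `δ` is small in terms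
of `ε`. -/
noncomputable def smallPairs : Filter (ℝ × ℝ) := (𝓝[>] (0 : ℝ)).curry (𝓝[>] (0 : ℝ))

instance : smallPairs.NeBot := by
  refine ⟨fun h => ?_⟩
  have h1 : ∀ᶠ _x in smallPairs, False := by rw [h]; exact Filter.eventually_bot
  rw [smallPairs, eventually_curry_iff] at h1
  have h2 : (𝓝[>] (0 : ℝ)) = ⊥ := by simpa using h1
  exact NeBot.ne inferInstance h2

/-- It suffices to fix `ε` and let `δ` tend to `0`. Conditions that hold for all small `δ`, with a
bound depending on `ε`, are thus available at the same time as conditions that are open near `(0,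
0)`. -/
theorem eventually_smallPairs {p : ℝ × ℝ → Prop}
    (h : ∀ ε > 0, ∀ᶠ δ in 𝓝[>] (0 : ℝ), p (ε, δ)) : ∀ᶠ x in smallPairs, p x :=
  eventually_curry_iff.2 (eventually_mem_nhdsWithin.mono h)

theorem smallPairs_pos : ∀ᶠ x in smallPairs, 0 < x.1 ∧ 0 < x.2 :=
  eventually_smallPairs fun _ hε => eventually_mem_nhdsWithin.mono fun _ h => ⟨hε, h⟩

theorem smallPairs_le : smallPairs ≤ 𝓝 (0, 0) := by
  rw [nhds_prod_eq]
  exact curry_le_prod.trans (Filter.prod_mono nhdsWithin_le_nhds nhdsWithin_le_nhds)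

theorem eventually_lt_of_continuous {f g : ℝ × ℝ → ℝ} (hf : Continuous f) (hg : Continuous g)
    (h : f (0, 0) < g (0, 0)) : ∀ᶠ x in smallPairs, f x < g x :=
  smallPairs_le ((isOpen_lt hf hg).mem_nhds h)

/-- A small vector near the direction of `c`. -/
noncomputable def tilt (c : ℂ) (t : ℝ) (x : ℝ × ℝ) : ℂ := x.1 * c * (1 + t * x.2 * I)

theorem continuous_tilt (c : ℂ) (t : ℝ) : Continuous (tilt c t) := by
  unfold tilt
  fun_prop

theorem tilt_zero (c : ℂ) (t : ℝ) : tilt c t (0, 0) = 0 := by simp [tilt]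

theorem tilt_mul (c e : ℂ) (t : ℝ) (x : ℝ × ℝ) : tilt (c * e) t x = tilt c t x * e := by
  unfold tilt; ring

theorem tilt_re_pos {c : ℂ} (hc : 0 < c.re) (t : ℝ) : ∀ᶠ x in smallPairs, 0 < (tilt c t x).re := by
  refine eventually_smallPairs fun ε hε => ?_
  have h : Continuous fun δ : ℝ => (c * (1 + t * δ * I)).re := by fun_prop
  have h1 : ∀ᶠ δ : ℝ in 𝓝 (0 : ℝ), 0 < (c * (1 + t * δ * I)).re :=
    (isOpen_lt continuous_const h).mem_nhds (by simpa using hc)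
  filter_upwards [nhdsWithin_le_nhds h1] with δ hδ
  rw [tilt, mul_assoc, re_ofReal_mul]
  exact mul_pos hε hδ

theorem tilt_im_pos {c : ℂ} (hc : 0 < c.im) (t : ℝ) : ∀ᶠ x in smallPairs, 0 < (tilt c t x).im := by
  filter_upwards [tilt_re_pos (c := c * -I) (by simpa using hc) t] with x hx
  rw [tilt_mul] at hx
  simpa using hx

section

variable {S : Set P1} {L : LocalSystem.{u} S} (C : Config L) {u : ℂ}

/-- The vector from `z k` to `z (k + 1)`. -/
noncomputable def Config.gap (k : ℕ) : ℂ := C.z (k + 1) - C.z k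

/-- The radius of the first square of a small regularized arc. -/
noncomputable def Config.armL (k : ℕ) (x : ℝ × ℝ) : ℂ := tilt (C.gap k) 1 x

/-- The radius of the second square of a small regularized arc. -/
noncomputable def Config.armR (k : ℕ) (x : ℝ × ℝ) : ℂ := tilt (-C.gap k) (-1) x

variable {C}

/-- The two radii differ by a real multiple of the gap. The segment between the squares is therefore
parallel to the line through the two singular points, at relative height `x.1 * x.2`. -/
theorem Config.armR_sub (k : ℕ) (x : ℝ × ℝ) : C.armR k x = C.armL k x - 2 * x.1 * C.gap k := by
  simp only [armR, armL, tilt]; push_cast; ring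

theorem Config.Sorted.gap_re_pos (hC : C.Sorted u) {k : ℕ} (hk : k + 1 < C.m) :
    0 < (C.gap k / u).re := by
  rw [gap, sub_div, sub_re]
  linarith [hC.lt k (k + 1) (by omega) hk]

theorem Config.Sorted.gap_ne_zero (hC : C.Sorted u) {k : ℕ} (hk : k + 1 < C.m) : C.gap k ≠ 0 := by
  intro h
  have := hC.gap_re_pos hk
  rw [h, zero_div] at this
  exact lt_irrefl _ this

theorem eventually_norm_tilt_lt (c : ℂ) (t : ℝ) {ρ : ℝ} (hρ : 0 < ρ) :
    ∀ᶠ x in smallPairs, ‖tilt c t x‖ < ρ :=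
  eventually_lt_of_continuous (continuous_tilt c t).norm continuous_const (by
    rw [tilt_zero, norm_zero]; exact hρ)

theorem eventually_closedBall_tilt (z c : ℂ) (t : ℝ) {U : Set ℂ} (hU : U ∈ 𝓝 z) :
    ∀ᶠ x in smallPairs, Metric.closedBall z ‖tilt c t x‖ ⊆ U := by
  obtain ⟨ρ, hρ, h⟩ := Metric.mem_nhds_iff.1 hU
  filter_upwards [eventually_norm_tilt_lt c t hρ] with x hx
  exact (Metric.closedBall_subset_ball hx).trans h

/-- Small regularized arcs exist. -/
theorem eventually_isArc (hC : C.Sorted u) {k : ℕ} (hk : k + 1 < C.m) :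
    ∀ᶠ x in smallPairs, C.IsArc u k (C.armL k x) (C.armR k x) := by
  have hu : u ≠ 0 := hC.ne_zero
  have hp := hC.gap_re_pos hk
  have hlt := hC.lt k (k + 1) (by omega) hk
  have hn : ∀ j, j < C.m → C.strip u j ∈ 𝓝 (C.z j) := fun j hj =>
    (hC.isolatingSet_strip hj).isOpen.mem_nhds (hC.isolatingSet_strip hj).mem
  have c1 := continuous_tilt (C.gap k) 1
  have c2 := continuous_tilt (-C.gap k) (-1)
  filter_upwards [tilt_re_pos (c := C.gap k / u) hp 1,
    tilt_re_pos (c := C.gap k / u) hp (-1),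
    eventually_closedBall_tilt (C.z k) (C.gap k) 1 (hn k (by omega)),
    eventually_closedBall_tilt (C.z (k + 1)) (-C.gap k) (-1) (hn (k + 1) hk),
    eventually_lt_of_continuous (f := fun x => ((C.z k + tilt (C.gap k) 1 x) / u).re)
      (g := fun _ => (C.z (k + 1) / u).re) (by fun_prop) continuous_const (by
        rw [tilt_zero, add_zero]; exact hlt),
    eventually_lt_of_continuous (f := fun _ => (C.z k / u).re)
      (g := fun x => ((C.z (k + 1) + tilt (-C.gap k) (-1) x) / u).re) continuous_const (by fun_prop)
      (by rw [tilt_zero, add_zero]; exact hlt),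
    eventually_lt_of_continuous (f := fun x => x.1) (g := fun _ => 1 / 2) (by fun_prop)
      continuous_const (by norm_num)] with x h1 h2 h3 h4 h5 h6 h7
  have e1 : tilt (C.gap k / u) 1 x = C.armL k x / u := by rw [div_eq_mul_inv, tilt_mul]; rfl
  have e2 : tilt (C.gap k / u) (-1) x = -(C.armR k x / u) := by
    rw [Config.armR, tilt, tilt]; push_cast; ring
  rw [e1] at h1
  rw [e2, neg_re] at h2
  refine ⟨fun h => ?_, fun h => ?_, h3, h4, (Config.convex_overlap u k).segment_subset ⟨?_, h5⟩
    ⟨h6, ?_⟩, fun h => ?_⟩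
  · rw [h, zero_div] at h1; exact lt_irrefl _ h1
  · rw [h, zero_div] at h2; simp at h2
  · rw [add_div, add_re]; linarith
  · rw [add_div, add_re]; linarith
  · rw [Config.armR_sub] at h
    have : C.gap k * (1 - 2 * x.1) = 0 := by
      have e : C.gap k = C.z (k + 1) - C.z k := rfl
      linear_combination -h + e
    rcases mul_eq_zero.1 this with h' | h'
    · exact hC.gap_ne_zero hk h'
    · have h8 : (1 - 2 * x.1 : ℝ) = 0 := by exact_mod_cast h'
      linarith

theorem genPos_of_disjoint {a b r s : ℂ} (h : Disjoint (segment ℝ a b) (segment ℝ r s)) :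
    GenPos a b r s :=
  ⟨⟨fun h' => Set.disjoint_left.1 h h' (left_mem_segment ℝ r s),
    fun h' => Set.disjoint_left.1 h h' (right_mem_segment ℝ r s)⟩,
    fun h' => Set.disjoint_left.1 h (left_mem_segment ℝ a b) h',
    fun h' => Set.disjoint_left.1 h (right_mem_segment ℝ a b) h'⟩

theorem isClosed_segment (r s : ℂ) : IsClosed (segment ℝ r s) := by
  rw [segment_eq_image']
  exact (isCompact_Icc.image (by fun_prop)).isClosed

/-- Small squares do not meet a segment without singular points. -/
theorem eventually_disjoint_squares {k : ℕ} (hk : k + 1 < C.m) {r s : ℂ}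
    (hrs : segment ℝ r s ⊆ fin S) : ∀ᶠ x in smallPairs,
      Disjoint (Metric.closedBall (C.z k) ‖C.armL k x‖) (segment ℝ r s) ∧
      Disjoint (Metric.closedBall (C.z (k + 1)) ‖C.armR k x‖) (segment ℝ r s) := by
  have hn : ∀ j < C.m, (segment ℝ r s)ᶜ ∈ 𝓝 (C.z j) := fun j hj =>
    (isClosed_segment r s).isOpen_compl.mem_nhds (C.notMem_segment hrs j hj)
  filter_upwards [eventually_closedBall_tilt (C.z k) (C.gap k) 1 (hn k (by omega)),
    eventually_closedBall_tilt (C.z (k + 1)) (-C.gap k) (-1) (hn (k + 1) hk)] with x h1 h2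
  exact ⟨Set.disjoint_left.2 fun _ h => h1 h, Set.disjoint_left.2 fun _ h => h2 h⟩

theorem eventually_mul_ne {ε : ℝ} (hε : 0 < ε) (c : ℝ) : ∀ᶠ δ in 𝓝[>] (0 : ℝ), ε * δ ≠ c := by
  by_cases hc : c = 0
  · filter_upwards [self_mem_nhdsWithin] with δ hδ
    rw [hc]
    exact (mul_pos hε hδ).ne'
  · refine nhdsWithin_le_nhds ((isOpen_ne_fun (by fun_prop) continuous_const).mem_nhds ?_)
    simpa using Ne.symm hc

/-- The height of the segment of a small regularized arc. -/
theorem height_of_mem (hC : C.Sorted u) {k : ℕ} (hk : k + 1 < C.m) {x : ℝ × ℝ} {p : ℂ}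
    (hp : p ∈ segment ℝ (C.z k + C.armL k x) (C.z (k + 1) + C.armR k x)) :
    ((p - C.z k) / C.gap k).im = x.1 * x.2 := by
  have hd := hC.gap_ne_zero hk
  obtain ⟨t, -, rfl⟩ := mem_segment_iff.1 hp
  have : (C.z k + C.armL k x + t * (C.z (k + 1) + C.armR k x - (C.z k + C.armL k x)) - C.z k) /
      C.gap k = ((x.1 + t * (1 - 2 * x.1) : ℝ) : ℂ) + ((x.1 * x.2 : ℝ) : ℂ) * I := by
    rw [Config.armR_sub, div_eq_iff hd, show C.z (k + 1) = C.z k + C.gap k by rw [Config.gap]; ring,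
      Config.armL, tilt]
    push_cast
    ring
  rw [this]
  simp

/-- Small regularized arcs are in general position with respect to a given segment. -/
theorem eventually_arcGenPos (hC : C.Sorted u) {k : ℕ} (hk : k + 1 < C.m) {r s : ℂ}
    (hrs : segment ℝ r s ⊆ fin S) :
    ∀ᶠ x in smallPairs, ArcGenPos C k (C.armL k x) (C.armR k x) r s := by
  -- All points of the long segment have the same height, which is made different from the heights
  -- of `r` and `s`; so neither of them lies on it.
  have hne : ∀ p : ℂ, ∀ᶠ x in smallPairs, x.1 * x.2 ≠ ((p - C.z k) / C.gap k).im := fun p =>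
    eventually_smallPairs fun ε hε => eventually_mul_ne hε _
  filter_upwards [eventually_disjoint_squares hk hrs, hne r, hne s] with x ⟨h1, h2⟩ hr hs τ
  have hmem : ∀ z w : ℂ, ∀ i, sqPt z w i ∈ Metric.closedBall z ‖w‖ := fun z w i => by
    rw [Metric.mem_closedBall, dist_eq_norm, norm_sqPt_sub]
  rcases τ with _ | ⟨_ | _, i⟩
  · refine ⟨⟨fun h => hr (height_of_mem hC hk h).symm, fun h => hs (height_of_mem hC hk h).symm⟩,
      fun h => ?_, fun h => ?_⟩
    · refine Set.disjoint_left.1 h1 (hmem _ _ 0) ?_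
      simpa [sqPt, arcR] using h
    · refine Set.disjoint_left.1 h2 (hmem _ _ 0) ?_
      simpa [sqPt, arcS] using h
  · exact genPos_of_disjoint (h1.mono_left (edge_subset_closedBall _ _ i))
  · exact genPos_of_disjoint (h2.mono_left (edge_subset_closedBall _ _ i))

/-- Small regularized arcs are in general position with respect to a given polygonal chain. -/
theorem eventually_inGeneralPosition (hC : C.Sorted u) (F : Frame C) {k : ℕ} (hk : k + 1 < C.m)
    {η : Chain L 1} (hη : IsFinitePolygonal η) :
    ∀ᶠ x in smallPairs, InGeneralPosition (arcChain F k (C.armL k x) (C.armR k x)) η := by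
  classical
  have h : ∀ᶠ x in smallPairs, ∀ τ ∈ η.support,
      ArcGenPos C k (C.armL k x) (C.armR k x) (tail τ) (head τ) := by
    rw [Filter.eventually_all_finset]
    exact fun τ hτ => eventually_arcGenPos hC hk (hη τ (DFinsupp.mem_support_iff.1 hτ)).2
  filter_upwards [h, eventually_isArc hC hk] with x hx harc
  exact harc.inGeneralPosition hη fun τ hτ => hx τ (DFinsupp.mem_support_iff.2 hτ)

end

end DeligneMostow
namespace DeligneMostow
open Complex CategoryTheory Filter Topology

/-! ### The crossing of a ray with a square -/

/-- A point of the open first quadrant. -/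
def InQuadrant (x : ℂ) : Prop := 0 < x.re ∧ 0 < x.im

theorem InQuadrant.one_lt {x : ℂ} (h : InQuadrant x) (h1 : 1 < ‖x‖) : 1 < x.re + x.im := by
  have := norm_le_abs_re_add_abs_im x
  rw [abs_of_pos h.1, abs_of_pos h.2] at this
  linarith

theorem inQuadrant_of_mem {v z a b x : ℂ} (ha : InQuadrant ((a - z) / v))
    (hb : InQuadrant ((b - z) / v)) (hx : x ∈ segment ℝ a b) : InQuadrant ((x - z) / v) := by
  obtain ⟨t, ⟨h0, h1⟩, rfl⟩ := mem_segment_iff.1 hx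
  have e : (a + t * (b - a) - z) / v = ((1 - t : ℝ) : ℂ) * ((a - z) / v) + (t : ℝ) * ((b - z) / v) := by
    push_cast; ring
  have key : ∀ p q : ℝ, 0 < p → 0 < q → 0 < (1 - t) * p + t * q := by
    intro p q hp hq
    rcases eq_or_lt_of_le h0 with h | h
    · rw [← h]; linarith
    · have := mul_pos h hq
      have := mul_nonneg (sub_nonneg.2 h1) hp.le
      linarith
  rw [e]
  constructor
  · rw [add_re, re_ofReal_mul, re_ofReal_mul]; exact key _ _ ha.1 hb.1
  · rw [add_im, im_ofReal_mul, im_ofReal_mul]; exact key _ _ ha.2 hb.2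

/-- A segment in the sector of an edge does not meet the other edges. -/
theorem disjoint_edge {z w a b : ℂ} {i : Fin 4} (ha : InQuadrant ((a - z) / (sqPt z w i - z)))
    (hb : InQuadrant ((b - z) / (sqPt z w i - z))) {k : Fin 4} (hk : k ≠ i) :
    Disjoint (segment ℝ a b) (segment ℝ (sqPt z w k) (sqPt z w (k + 1))) := by
  refine Set.disjoint_left.2 fun x hx hx' => ?_
  have hq := inQuadrant_of_mem ha hb hx
  set v := sqPt z w i - z with hv
  have hv0 : v ≠ 0 := by
    intro h
    rw [h, div_zero] at hq
    exact lt_irrefl _ hq.1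
  obtain ⟨t, ⟨h0, h1⟩, ht⟩ := mem_segment_iff.1 hx'
  have e : (x - z) / v = (sqPt z w k - z) / v * (1 + t * (I - 1)) := by
    rw [ht]
    have := sqPt_succ_sub z w k
    field_simp
    linear_combination t * this
  -- With `v` as unit the edge `i` lies in the closed first quadrant. The other edges arise from it
  -- by quarter turns and miss the open quadrant.
  have hk' : k = i + 1 ∨ k = i + 1 + 1 ∨ k = i + 1 + 1 + 1 := by
    have : ∀ k i : Fin 4, k ≠ i → k = i + 1 ∨ k = i + 1 + 1 ∨ k = i + 1 + 1 + 1 := by decide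
    exact this k i hk
  rw [e] at hq
  rcases hk' with rfl | rfl | rfl
  · rw [sqPt_succ_sub, ← hv, mul_div_cancel_left₀ _ hv0] at hq
    have := hq.1
    simp at this
    linarith
  · rw [sqPt_succ_sub, sqPt_succ_sub, ← hv, mul_assoc, mul_div_cancel_left₀ _ hv0] at hq
    have := hq.1
    simp at this
    linarith
  · rw [sqPt_succ_sub, sqPt_succ_sub, sqPt_succ_sub, ← hv, mul_assoc, mul_assoc,
      mul_div_cancel_left₀ _ hv0] at hq
    have := hq.2
    simp at this
    linarith

/-- A segment that leaves a square in the sector of an edge crosses this edge. -/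
theorem exists_mem_edge {z w a b : ℂ} {i : Fin 4} (ha : InQuadrant ((a - z) / (sqPt z w i - z)))
    (ha1 : ((a - z) / (sqPt z w i - z)).re + ((a - z) / (sqPt z w i - z)).im < 1)
    (hb : InQuadrant ((b - z) / (sqPt z w i - z)))
    (hb1 : 1 < ((b - z) / (sqPt z w i - z)).re + ((b - z) / (sqPt z w i - z)).im) :
    (∃ p ∈ segment ℝ a b, p ∈ segment ℝ (sqPt z w i) (sqPt z w (i + 1))) ∧
      0 < (starRingEnd ℂ (b - a) * (sqPt z w (i + 1) - sqPt z w i)).im := by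
  have hs := sqPt_succ_sub z w i
  set v := sqPt z w i - z with hv
  have hv0 : v ≠ 0 := by
    intro h
    rw [h, div_zero] at ha
    exact lt_irrefl _ ha.1
  set A := (a - z) / v with hA
  set B := (b - z) / v with hB
  have eA : a = z + v * A := by rw [hA, mul_div_cancel₀ _ hv0]; ring
  have eB : b = z + v * B := by rw [hB, mul_div_cancel₀ _ hv0]; ring
  have e0 : sqPt z w i = z + v := by rw [hv]; ring
  have e1 : sqPt z w (i + 1) = z + v * I := by rw [← hs]; ring
  constructor
  -- In the coordinates of the quadrant the edge is given by `re + im = 1`; `t` solves this equation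
  -- along the segment.
  · set t := (1 - (A.re + A.im)) / (B.re + B.im - (A.re + A.im)) with ht
    have hden : 0 < B.re + B.im - (A.re + A.im) := by linarith
    have ht0 : t ∈ Set.Icc (0 : ℝ) 1 :=
      ⟨div_nonneg (by linarith) hden.le, (div_le_one hden).2 (by linarith)⟩
    have hp : a + t * (b - a) ∈ segment ℝ a b := mem_segment_iff.2 ⟨t, ht0, rfl⟩
    refine ⟨_, hp, ?_⟩
    have hq := inQuadrant_of_mem ha hb hp
    set X := (a + t * (b - a) - z) / v with hX
    have eX : X = A + t * (B - A) := by
      rw [hX, eA, eB]; field_simp; ring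
    have hsum : X.re + X.im = 1 := by
      have : t * (B.re + B.im - (A.re + A.im)) = 1 - (A.re + A.im) := div_mul_cancel₀ _ hden.ne'
      rw [eX]
      simp only [add_re, add_im, re_ofReal_mul, im_ofReal_mul, sub_re, sub_im]
      linarith
    refine mem_segment_iff.2 ⟨X.im, ⟨hq.2.le, by linarith [hq.1]⟩, ?_⟩
    have e2 : X = 1 - X.im + X.im * I := by
      apply Complex.ext
      · simp; linarith
      · simp
    have e3 : a + t * (b - a) = z + v * X := by rw [hX, mul_div_cancel₀ _ hv0]; ring
    rw [e3, e0, e1]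
    linear_combination v * e2
  · have e : starRingEnd ℂ (b - a) * (sqPt z w (i + 1) - sqPt z w i) =
        (normSq v : ℝ) * (starRingEnd ℂ (B - A) * (I - 1)) := by
      rw [eA, eB, e0, e1, normSq_eq_conj_mul_self]
      simp only [map_sub, map_add, map_mul]
      ring
    rw [e, im_ofReal_mul]
    refine mul_pos (normSq_pos.2 hv0) ?_
    simp
    linarith

/-- Short segments near the centre of a square and long ones are in the sector of an edge. -/
theorem eventually_sector {D v : ℂ} (h : InQuadrant (D / v)) (hn : ‖v‖ < ‖D‖) (t : ℝ) :
    ∀ᶠ x in smallPairs, (InQuadrant (tilt D t x / v) ∧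
      (tilt D t x / v).re + (tilt D t x / v).im < 1) ∧
      InQuadrant ((D + tilt (-D) (-t) x) / v) ∧
      1 < ((D + tilt (-D) (-t) x) / v).re + ((D + tilt (-D) (-t) x) / v).im := by
  have hv0 : v ≠ 0 := by
    rintro rfl
    rw [div_zero] at h
    exact lt_irrefl _ h.1
  have h1 : 1 < (D / v).re + (D / v).im :=
    h.one_lt (by rwa [norm_div, one_lt_div (norm_pos_iff.2 hv0)])
  have e : ∀ x, tilt D t x / v = tilt (D / v) t x := fun x => by
    rw [div_eq_mul_inv, div_eq_mul_inv, tilt_mul]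
  have c1 := continuous_tilt D t
  have c2 := continuous_tilt (-D) (-t)
  have z1 := tilt_zero D t
  have z2 := tilt_zero (-D) (-t)
  have r0 := tilt_re_pos h.1 t
  have i0 := tilt_im_pos h.2 t
  simp only [← e] at r0 i0
  filter_upwards [r0, i0, eventually_lt_of_continuous
      (f := fun x => (tilt D t x / v).re + (tilt D t x / v).im) (g := fun _ => 1) (by fun_prop)
      (by fun_prop) (by rw [z1]; simp),
    eventually_lt_of_continuous (f := fun _ => 0)
      (g := fun x => ((D + tilt (-D) (-t) x) / v).re) (by fun_prop)
      (by fun_prop) (by rw [z2, add_zero]; exact h.1),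
    eventually_lt_of_continuous (f := fun _ => 0)
      (g := fun x => ((D + tilt (-D) (-t) x) / v).im) (by fun_prop)
      (by fun_prop) (by rw [z2, add_zero]; exact h.2),
    eventually_lt_of_continuous (f := fun _ => 1)
      (g := fun x => ((D + tilt (-D) (-t) x) / v).re + ((D + tilt (-D) (-t) x) / v).im) (by fun_prop)
      (by fun_prop) (by rw [z2, add_zero]; exact h1)] with x a1 a2 a3 a4 a5 a6
  exact ⟨⟨⟨a1, a2⟩, a3⟩, ⟨a4, a5⟩, a6⟩

section

variable {S : Set P1} {L : LocalSystem.{u} S} {C : Config L} {u : ℂ}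

theorem Config.crossE_eq_one {a b r s p : ℂ} (h : GenPos a b r s) (hp : p ∈ segment ℝ a b)
    (hp' : p ∈ segment ℝ r s) (hs : 0 < (starRingEnd ℂ (b - a) * (s - r)).im) :
    C.crossE a b r s = C.E a p * starRingEnd ℂ (C.E r p) := by
  rw [crossE_eq h hp hp', h.cross_eq (h.ne hp hp') hp hp', Real.sign_of_pos hs, ofReal_one, mul_one]

theorem Config.crossE_eq_neg_one {a b r s p : ℂ} (h : GenPos a b r s) (hp : p ∈ segment ℝ a b)
    (hp' : p ∈ segment ℝ r s) (hs : (starRingEnd ℂ (b - a) * (s - r)).im < 0) :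
    C.crossE a b r s = -(C.E a p * starRingEnd ℂ (C.E r p)) := by
  rw [crossE_eq h hp hp', h.cross_eq (h.ne hp hp') hp hp', Real.sign_of_neg hs]
  simp

/-- The crossings of a segment that leaves a square. -/
theorem sum_crossE_out {z w a b : ℂ} {i : Fin 4} (ha : InQuadrant ((a - z) / (sqPt z w i - z)) ∧
      ((a - z) / (sqPt z w i - z)).re + ((a - z) / (sqPt z w i - z)).im < 1)
    (hb : InQuadrant ((b - z) / (sqPt z w i - z)) ∧
      1 < ((b - z) / (sqPt z w i - z)).re + ((b - z) / (sqPt z w i - z)).im)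
    (hgp : GenPos a b (sqPt z w i) (sqPt z w (i + 1))) (k : Fin 4 → ℂ) :
    ∃ p ∈ segment ℝ a b, p ∈ segment ℝ (sqPt z w i) (sqPt z w (i + 1)) ∧
      ∑ j, k j * C.crossE a b (sqPt z w j) (sqPt z w (j + 1)) =
        k i * (C.E a p * starRingEnd ℂ (C.E (sqPt z w i) p)) := by
  obtain ⟨⟨p, hp, hp'⟩, hs⟩ := exists_mem_edge ha.1 ha.2 hb.1 hb.2
  refine ⟨p, hp, hp', ?_⟩
  rw [Finset.sum_eq_single i, Config.crossE_eq_one hgp hp hp' hs]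
  · intro j _ hj
    rw [Config.crossE_of_disjoint (disjoint_edge ha.1 hb.1 hj), mul_zero]
  · simp

/-- The crossings of a segment that enters a square. -/
theorem sum_crossE_in {z w a b : ℂ} {i : Fin 4} (hb : InQuadrant ((b - z) / (sqPt z w i - z)) ∧
      ((b - z) / (sqPt z w i - z)).re + ((b - z) / (sqPt z w i - z)).im < 1)
    (ha : InQuadrant ((a - z) / (sqPt z w i - z)) ∧
      1 < ((a - z) / (sqPt z w i - z)).re + ((a - z) / (sqPt z w i - z)).im)
    (hgp : GenPos a b (sqPt z w i) (sqPt z w (i + 1))) (k : Fin 4 → ℂ) :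
    ∃ p ∈ segment ℝ a b, p ∈ segment ℝ (sqPt z w i) (sqPt z w (i + 1)) ∧
      ∑ j, k j * C.crossE a b (sqPt z w j) (sqPt z w (j + 1)) =
        -(k i * (C.E a p * starRingEnd ℂ (C.E (sqPt z w i) p))) := by
  obtain ⟨⟨p, hp, hp'⟩, hs⟩ := exists_mem_edge hb.1 hb.2 ha.1 ha.2
  rw [segment_symm] at hp
  refine ⟨p, hp, hp', ?_⟩
  rw [Finset.sum_eq_single i, Config.crossE_eq_neg_one hgp hp hp', mul_neg]
  · rw [← neg_sub b a, map_neg, neg_mul, neg_im] at hs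
    linarith
  · intro j _ hj
    rw [Config.crossE_of_disjoint (disjoint_edge ha.1 hb.1 hj), mul_zero]
  · simp

/-! ### The Gram matrix -/

/-- Only the long segment of a small regularized arc meets a given one. -/
theorem eventually_crossForm (hC : C.Sorted u) (F : Frame C) {k j : ℕ} (hk : k + 1 < C.m)
    (hj : j + 1 < C.m) {v v' : ℂ} (h : C.IsArc u j v v') : ∀ᶠ x in smallPairs,
      C.IsArc u k (C.armL k x) (C.armR k x) ∧
      (∀ ρ, GenPos (C.z k + C.armL k x) (C.z (k + 1) + C.armR k x)
        (arcR (C.z j) (C.z (j + 1)) v v' ρ) (arcS (C.z j) (C.z (j + 1)) v v' ρ)) ∧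
      crossForm F (arcChain F k (C.armL k x) (C.armR k x)) (arcChain F j v v') =
        C.crossE (C.z k + C.armL k x) (C.z (k + 1) + C.armR k x) (C.z j + v) (C.z (j + 1) + v') +
        (∑ i, starRingEnd ℂ ((C.mon (j + 1) - 1)⁻¹ * C.E (C.z j + v) (C.z (j + 1) + v') *
            C.sqCoef (C.z (j + 1)) v' i) *
          -C.crossE (C.z k + C.armL k x) (C.z (k + 1) + C.armR k x) (sqPt (C.z (j + 1)) v' i)
            (sqPt (C.z (j + 1)) v' (i + 1)) +
        ∑ i, starRingEnd ℂ ((C.mon j - 1)⁻¹ * C.sqCoef (C.z j) v i) *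
          C.crossE (C.z k + C.armL k x) (C.z (k + 1) + C.armR k x) (sqPt (C.z j) v i)
            (sqPt (C.z j) v (i + 1))) := by
  have h1 : ∀ᶠ x in smallPairs, ∀ ρ ∈ (Finset.univ : Finset (Option (Bool × Fin 4))), _ :=
    (Filter.eventually_all_finset _).2 fun ρ _ =>
      (eventually_disjoint_squares hk (h.arc_subset hC hj ρ)).and
        (eventually_arcGenPos hC hk (h.arc_subset hC hj ρ))
  filter_upwards [h1, eventually_isArc hC hk] with x h1 harc
  refine ⟨harc, fun ρ => (h1 ρ (Finset.mem_univ _)).2 none, ?_⟩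
  rw [crossForm_arc F hC hk hj harc h, Fintype.sum_option, Finset.sum_eq_zero (s := Finset.univ)
    (f := fun τ : Bool × Fin 4 => ∑ ρ, _), add_zero]
  · rw [Fintype.sum_option, Fintype.sum_prod_type, Fintype.sum_bool]
    simp only [arcR, arcS, Config.arcW, map_one, one_mul, neg_mul, map_neg, mul_neg]
  · rintro ⟨_ | _, i⟩ -
    · refine Finset.sum_eq_zero fun ρ _ => ?_
      rw [Config.crossE_of_disjoint, mul_zero]
      exact (h1 ρ (Finset.mem_univ _)).1.1.mono_left (edge_subset_closedBall _ _ i)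
    · refine Finset.sum_eq_zero fun ρ _ => ?_
      rw [Config.crossE_of_disjoint, mul_zero]
      exact (h1 ρ (Finset.mem_univ _)).1.2.mono_left (edge_subset_closedBall _ _ i)

theorem Config.disjoint_overlap_strip {k j : ℕ} (hk : k + 1 < C.m)
    (h : j ≠ k) (h' : j ≠ k + 1) : Disjoint (C.overlap u k) (C.strip u j) := by
  refine Set.disjoint_left.2 fun x hx hxj => ?_
  rcases lt_or_gt_of_ne h with h | h
  · exact lt_asymm hx.1 (hxj.2 k (by omega) h)
  · exact lt_asymm hx.2 (hxj.1 (k + 1) hk (by omega))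

theorem edge_subset_strip {j : ℕ} {w : ℂ} (h : Metric.closedBall (C.z j) ‖w‖ ⊆ C.strip u j)
    (i : Fin 4) : segment ℝ (sqPt (C.z j) w i) (sqPt (C.z j) w (i + 1)) ⊆ C.strip u j :=
  (edge_subset_closedBall _ _ i).trans h

/-- Distant regularized arcs do not meet. -/
theorem eventually_crossForm_far (hC : C.Sorted u) (F : Frame C) {k j : ℕ} (hk : k + 1 < C.m)
    (hj : j + 1 < C.m) (hkj : j + 1 < k ∨ k + 1 < j) {v v' : ℂ} (h : C.IsArc u j v v') :
    ∀ᶠ x in smallPairs,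
      crossForm F (arcChain F k (C.armL k x) (C.armR k x)) (arcChain F j v v') = 0 := by
  filter_upwards [eventually_crossForm hC F hk hj h] with x hx
  obtain ⟨harc, -, e⟩ := hx
  have d1 := Config.disjoint_overlap_strip (C := C) (u := u) hk (j := j) (by omega) (by omega)
  have d2 := Config.disjoint_overlap_strip (C := C) (u := u) hk (j := j + 1) (by omega) (by omega)
  rw [e, Config.crossE_of_disjoint (d1.mono harc.segment_subset (h.segment_subset.trans
    ((hC.overlap_subset_left hj).trans Set.sdiff_subset))), zero_add]
  refine (congrArg₂ _ (Finset.sum_eq_zero fun i _ => ?_) (Finset.sum_eq_zero fun i _ => ?_)).trans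
    (add_zero 0)
  · rw [Config.crossE_of_disjoint (d2.mono harc.segment_subset (edge_subset_strip h.right_ball i)),
      neg_zero, mul_zero]
  · rw [Config.crossE_of_disjoint (d1.mono harc.segment_subset (edge_subset_strip h.left_ball i)),
      mul_zero]

theorem norm_sqCoef (z w : ℂ) (i : Fin 4) : ‖C.sqCoef z w i‖ = 1 := by
  fin_cases i <;> simp [Config.sqCoef, C.norm_E]

/-- A direction off the two diagonals of the square lies in the open sector of exactly one edge, so
a segment in this direction leaves the square through the interior of that edge. -/
theorem exists_inQuadrant {c : ℂ} (z w : ℂ) (hr : (c / w).re ≠ 0)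
    (hi : (c / w).im ≠ 0) : ∃ i, InQuadrant (c / (sqPt z w i - z)) := by
  have e : ∀ i, c / (sqPt z w i - z) = c / w / ![1, I, -1, -I] i := fun i => by
    rw [sqPt, add_sub_cancel_left, div_div]
  simp only [e]
  generalize c / w = a at hr hi
  rcases lt_or_gt_of_ne hr with hr | hr <;> rcases lt_or_gt_of_ne hi with hi | hi
  · exact ⟨2, by simp [InQuadrant, div_neg, hr, hi]⟩
  · exact ⟨1, by simp [InQuadrant, hr, hi]⟩
  · exact ⟨3, by simp [InQuadrant, div_neg, hr, hi]⟩
  · exact ⟨0, by simp [InQuadrant, hr, hi]⟩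

/-- Consecutive regularized arcs. -/
theorem eventually_crossForm_succ (hC : C.Sorted u) (F : Frame C) {j : ℕ} (hj : j + 1 + 1 < C.m)
    {v v' : ℂ} (h : C.IsArc u j v v') (hr : (C.gap (j + 1) / v').re ≠ 0)
    (hi : (C.gap (j + 1) / v').im ≠ 0) : ∀ᶠ x in smallPairs,
      ‖crossForm F (arcChain F (j + 1) (C.armL (j + 1) x) (C.armR (j + 1) x)) (arcChain F j v v')‖ =
        ‖(C.mon (j + 1) - 1)⁻¹‖ := by
  obtain ⟨i, hq⟩ := exists_inQuadrant (C.z (j + 1)) v' hr hi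
  -- The ball around the square lies in the strip of `z (j + 1)`, which does not contain the next
  -- singular point. The long segment thus starts inside the square and ends outside, and this is
  -- the only crossing.
  have hn : ‖sqPt (C.z (j + 1)) v' i - C.z (j + 1)‖ < ‖C.gap (j + 1)‖ := by
    rw [norm_sqPt_sub]
    by_contra hle
    have hm : C.z (j + 1 + 1) ∈ C.strip u (j + 1) := h.right_ball (by
      rw [Metric.mem_closedBall, dist_eq_norm]; exact not_lt.1 hle)
    exact lt_irrefl _ (hm.2 (j + 1 + 1) hj (by omega))
  filter_upwards [eventually_crossForm hC F hj (j := j) (by omega) h, eventually_sector hq hn 1] with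
    x ⟨harc, hgp, e⟩ ⟨hs1, hs2⟩
  have d1 := Config.disjoint_overlap_strip (C := C) (u := u) hj (j := j) (by omega) (by omega)
  have e1 : (C.z (j + 1) + C.armL (j + 1) x - C.z (j + 1)) = tilt (C.gap (j + 1)) 1 x := by
    rw [add_sub_cancel_left]; rfl
  have e2 : (C.z (j + 1 + 1) + C.armR (j + 1) x - C.z (j + 1)) =
      C.gap (j + 1) + tilt (-C.gap (j + 1)) (-1) x := by
    rw [Config.gap, Config.armR, Config.gap]; ring
  rw [← e1] at hs1
  rw [← e2] at hs2
  obtain ⟨p, -, -, hp⟩ := sum_crossE_out (C := C) hs1 hs2 (hgp (some (true, i)))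
    fun i => -starRingEnd ℂ ((C.mon (j + 1) - 1)⁻¹ * C.E (C.z j + v) (C.z (j + 1) + v') *
            C.sqCoef (C.z (j + 1)) v' i)
  rw [e, Config.crossE_of_disjoint (d1.mono harc.segment_subset (h.segment_subset.trans
    ((hC.overlap_subset_left (by omega)).trans Set.sdiff_subset))), zero_add,
    Finset.sum_eq_zero (f := fun i => starRingEnd ℂ ((C.mon j - 1)⁻¹ * _) * _), add_zero]
  · simp only [neg_mul] at hp
    simp only [mul_neg]
    rw [hp]
    simp [norm_sqCoef, C.norm_E, -map_inv₀, -map_sub, -norm_inv]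
  · intro i _
    rw [Config.crossE_of_disjoint (d1.mono harc.segment_subset (edge_subset_strip h.left_ball i)),
      mul_zero]

end

end DeligneMostow
-- The self-intersection of a regularized arc
namespace DeligneMostow
open Complex CategoryTheory Filter Topology

section

variable {S : Set P1} {L : LocalSystem.{u} S} {C : Config L} {u : ℂ}

/-- The overlap lies on one side of every singular point, so all angles are additive on it. -/
theorem Config.E_mul_of_overlap (hC : C.Sorted u) {k : ℕ} (hk : k + 1 < C.m) {x y w : ℂ}
    (hx : x ∈ C.overlap u k) (hy : y ∈ C.overlap u k) (hw : w ∈ C.overlap u k) :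
    C.E x y * C.E y w = C.E x w := by
  refine mult_mul fun j hj => ?_
  rcases Nat.lt_or_ge k j with h | h
  · have key : ∀ a ∈ C.overlap u k, a ∈ halfPlane (C.z j) (-u) := fun a ha =>
      mem_halfPlane_neg_iff.2 (ha.2.trans_le (hC.le h hj))
    exact ang_add (key x hx) (key y hy) (key w hw)
  · have key : ∀ a ∈ C.overlap u k, a ∈ halfPlane (C.z j) u := fun a ha =>
      mem_halfPlane_iff.2 ((hC.le h (by omega)).trans_lt ha.1)
    exact ang_add (key x hx) (key y hy) (key w hw)

theorem Config.conj_E (hC : C.Sorted u) {k : ℕ} (hk : k + 1 < C.m) {x y : ℂ}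
    (hx : x ∈ C.overlap u k) (hy : y ∈ C.overlap u k) : starRingEnd ℂ (C.E x y) = C.E y x := by
  refine mul_left_cancel₀ (C.E_ne_zero x y) ?_
  rw [C.E_mul_conj, Config.E_mul_of_overlap hC hk hx hy hx, C.E_self]

theorem Config.conj_mon (k : ℕ) : starRingEnd ℂ (C.mon k) = (C.mon k)⁻¹ := by
  rw [mon, ← exp_conj, ← exp_neg]
  congr 1
  simp only [map_mul, conj_I, conj_ofReal, Complex.conj_ofNat]
  ring

theorem Config.mon_ne_zero (k : ℕ) : C.mon k ≠ 0 := exp_ne_zero _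

theorem tilt_div {c : ℂ} (hc : c ≠ 0) (t : ℝ) (x : ℝ × ℝ) : c / tilt c t x = 1 / tilt 1 t x := by
  rw [show c = 1 * c by ring, tilt_mul, one_mul]
  by_cases h : tilt 1 t x = 0
  · simp [h]
  · field_simp

/-- The self-intersection of a regularized arc. -/
theorem eventually_crossForm_self (hC : C.Sorted u) (F : Frame C) {k : ℕ} (hk : k + 1 < C.m)
    {y : ℝ × ℝ} (hy1 : 0 < y.1) (hy2 : 0 < y.2) (h : C.IsArc u k (C.armL k y) (C.armR k y)) :
    ∀ᶠ x in smallPairs,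
      crossForm F (arcChain F k (C.armL k x) (C.armR k x)) (arcChain F k (C.armL k y) (C.armR k y)) =
        C.E (C.z k + C.armL k x) (C.z k + C.armL k y) *
          ((1 - C.mon k)⁻¹ + (1 - C.mon (k + 1))⁻¹ - 1) := by
  have hg := hC.gap_ne_zero hk
  set v := C.armL k y with hv
  set v' := C.armR k y with hv'
  set z := C.z k with hz
  set z' := C.z (k + 1) with hz'
  have hpos : 0 < y.1 * (1 + y.2 ^ 2) := by positivity
  -- The radius `v` is tilted counterclockwise from the gap, so seen from `v` the gap points
  -- slightly clockwise, into the sector of the last edge.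
  have hq3 : InQuadrant (C.gap k / (sqPt z v 3 - z)) := by
    have e : C.gap k / (sqPt z v 3 - z) = ((y.1 * (1 + y.2 ^ 2))⁻¹ : ℝ) * (y.2 + I) := by
      have e1 : sqPt z v 3 - z = v * -I := by simp [sqPt]
      rw [e1, ← div_div, hv, Config.armL, tilt_div hg, tilt]
      have h1 : (y.1 : ℂ) ≠ 0 := by exact_mod_cast hy1.ne'
      have h2 : (1 + y.2 * I : ℂ) ≠ 0 := fun h => by
        have := congrArg re h
        simp at this
      have h3 : (1 + (y.2 : ℂ) ^ 2) ≠ 0 := by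
        have : (0 : ℝ) < 1 + y.2 ^ 2 := by positivity
        exact_mod_cast this.ne'
      push_cast
      simp only [mul_one, one_mul]
      field_simp
      linear_combination (-(y.2 : ℂ) * I - (y.2 : ℂ) ^ 2 - 1) * I_sq
    rw [e]
    constructor
    · rw [re_ofReal_mul]; simp; positivity
    · rw [im_ofReal_mul]; simp; positivity
  -- At the other end the tilt is clockwise from `-gap`, and `-gap` points into the sector of the
  -- first edge.
  have hq0 : InQuadrant (-C.gap k / (sqPt z' v' 0 - z')) := by
    have e : -C.gap k / (sqPt z' v' 0 - z') = ((y.1 * (1 + y.2 ^ 2))⁻¹ : ℝ) * (1 + y.2 * I) := by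
      have e1 : sqPt z' v' 0 - z' = v' := by simp [sqPt]
      rw [e1, hv', Config.armR, tilt_div (neg_ne_zero.2 hg), tilt]
      have h1 : (y.1 : ℂ) ≠ 0 := by exact_mod_cast hy1.ne'
      have h2 : (1 - y.2 * I : ℂ) ≠ 0 := fun h => by
        have := congrArg re h
        simp at this
      have h3 : (1 + (y.2 : ℂ) ^ 2) ≠ 0 := by
        have : (0 : ℝ) < 1 + y.2 ^ 2 := by positivity
        exact_mod_cast this.ne'
      push_cast
      have h4 : (1 + -1 * (y.2 : ℂ) * I) = 1 - y.2 * I := by ring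
      rw [h4]
      simp only [mul_one]
      field_simp
      linear_combination (y.2 : ℂ) ^ 2 * I_sq
    rw [e]
    constructor
    · rw [re_ofReal_mul]; simp; positivity
    · rw [im_ofReal_mul]; simp; positivity
  have hn3 : ‖sqPt z v 3 - z‖ < ‖C.gap k‖ := by
    rw [norm_sqPt_sub]
    by_contra hle
    have hm : z' ∈ C.strip u k := h.left_ball (by
      rw [Metric.mem_closedBall, dist_eq_norm]; exact not_lt.1 hle)
    exact lt_irrefl _ (hm.2 (k + 1) hk (by omega))
  have hn0 : ‖sqPt z' v' 0 - z'‖ < ‖-C.gap k‖ := by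
    rw [norm_sqPt_sub]
    by_contra hle
    have hm : z ∈ C.strip u (k + 1) := h.right_ball (by
      rw [Metric.mem_closedBall, dist_eq_norm, norm_sub_rev, ← norm_neg]
      rw [norm_neg] at hle ⊢
      exact not_lt.1 hle)
    exact lt_irrefl _ (hm.1 k (by omega) (by omega))
  filter_upwards [eventually_crossForm hC F hk hk h, eventually_sector hq3 hn3 1,
    eventually_sector hq0 hn0 (-1), eventually_lt_of_continuous (f := fun x => x.1 * x.2)
      (g := fun _ => y.1 * y.2) (by fun_prop) continuous_const (by simpa using mul_pos hy1 hy2)] with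
    x ⟨harc, hgp, e⟩ ⟨hs1, hs2⟩ ⟨ht1, ht2⟩ hlt
  set a := z + C.armL k x with ha
  set b := z' + C.armR k x with hb
  have e1 : a - z = tilt (C.gap k) 1 x := by rw [ha, add_sub_cancel_left]; rfl
  have e2 : b - z = C.gap k + tilt (-C.gap k) (-1) x := by
    rw [hb, Config.armR, Config.gap]; ring
  have e3 : b - z' = tilt (-C.gap k) (-1) x := by rw [hb, add_sub_cancel_left]; rfl
  have e4 : a - z' = -C.gap k + tilt (- -C.gap k) (- -1) x := by
    rw [ha, Config.armL, neg_neg, neg_neg, Config.gap]; ring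
  rw [← e1] at hs1
  rw [← e2] at hs2
  rw [← e3] at ht1
  rw [← e4] at ht2
  obtain ⟨p, hp, hp', hsum⟩ := sum_crossE_out (C := C) hs1 hs2 (hgp (some (false, 3)))
    fun i => starRingEnd ℂ ((C.mon k - 1)⁻¹ * C.sqCoef z v i)
  obtain ⟨q, hq, hq', hsum'⟩ := sum_crossE_in (C := C) ht1 ht2 (hgp (some (true, 0)))
    fun i => -starRingEnd ℂ ((C.mon (k + 1) - 1)⁻¹ * C.E (z + v) (z' + v') * C.sqCoef z' v' i)
  -- The long segments are parallel, and the smaller arc has the smaller height.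
  have hd : Disjoint (segment ℝ a b) (segment ℝ (z + v) (z' + v')) := by
    refine Set.disjoint_left.2 fun w hw hw' => ?_
    have h1 := height_of_mem hC hk hw
    rw [height_of_mem hC hk hw'] at h1
    exact hlt.ne h1.symm
  simp only [neg_mul] at hsum'
  simp only [mul_neg] at e
  rw [e, Config.crossE_of_disjoint hd, zero_add, hsum, hsum']
  have hO := harc.segment_subset
  have mO := h.segment_subset
  have oa : a ∈ C.overlap u k := hO (left_mem_segment ℝ a b)
  have oP : z + v ∈ C.overlap u k := mO (left_mem_segment ℝ _ _)
  have oP' : z' + v' ∈ C.overlap u k := mO (right_mem_segment ℝ _ _)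
  have s0 : ∀ (z v : ℂ), sqPt z v 0 = z + v := fun z v => by simp [sqPt]
  have h0 : C.sqCoef z' v' 0 = 1 := by simp [Config.sqCoef]
  have hprod := (hC.isolatingSet_strip (j := k) (by omega)).prod_E (by omega) h.left_ne_zero
    h.left_ball
  have hedge := Config.E_mul_of_segment C (h.arc_subset hC hk (some (false, 3)))
    (left_mem_segment ℝ _ _) hp' (right_mem_segment ℝ _ _)
  change C.E (sqPt z v 3) p * C.E p (sqPt z v 0) = C.E (sqPt z v 3) (sqPt z v 0) at hedge
  rw [← hedge, s0] at hprod
  -- Completing the turn from the crossing `p` on the last edge to the first vertex would give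
  -- `C.mon k`. The conjugate coefficient at `p` therefore carries its inverse.
  have c1 : starRingEnd ℂ (C.sqCoef z v 3) * starRingEnd ℂ (C.E (sqPt z v 3) p) =
      (C.mon k)⁻¹ * C.E p (z + v) := by
    rw [← Config.conj_mon, ← hprod]
    simp only [map_mul]
    linear_combination (-(starRingEnd ℂ (C.sqCoef z v 3) * starRingEnd ℂ (C.E (sqPt z v 3) p))) *
      C.E_mul_conj p (z + v)
  have c2 : starRingEnd ℂ (C.E (z + v) (z' + v')) * (C.E a q *
      starRingEnd ℂ (C.E (z' + v') q)) = C.E a (z + v) := by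
    rw [Config.conj_E hC hk oP oP', Config.conj_E hC hk oP' (hO hq),
      Config.E_mul_of_overlap hC hk oa (hO hq) oP', mul_comm,
      Config.E_mul_of_overlap hC hk oa oP' oP]
  have c3 := Config.E_mul_of_overlap hC hk oa (hO hp) oP
  have m1 := C.mon_ne_zero k
  have m2 := C.mon_ne_zero (k + 1)
  have n1 : 1 - C.mon k ≠ 0 := sub_ne_zero.2 (C.mon_ne_one (j := k) (by omega)).symm
  have n2 : 1 - C.mon (k + 1) ≠ 0 := sub_ne_zero.2 (C.mon_ne_one hk).symm
  -- The two ends are not symmetric: the first crossing comes after nearly a full turn, which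
  -- supplies the factor `(C.mon k)⁻¹`, and the second comes before any turn. This asymmetry
  -- produces the summand `-1`.
  have d1 : starRingEnd ℂ ((C.mon k - 1)⁻¹) * (C.mon k)⁻¹ = (1 - C.mon k)⁻¹ := by
    rw [map_inv₀, map_sub, Config.conj_mon, map_one, ← mul_inv, sub_mul, inv_mul_cancel₀ m1, one_mul]
  have d2 : starRingEnd ℂ ((C.mon (k + 1) - 1)⁻¹) = (1 - C.mon (k + 1))⁻¹ - 1 := by
    rw [map_inv₀, map_sub, Config.conj_mon, map_one]
    have : (C.mon (k + 1))⁻¹ - 1 = (1 - C.mon (k + 1)) / C.mon (k + 1) := by field_simp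
    rw [this]
    field_simp
    ring
  rw [h0, s0, mul_one, map_mul, map_mul, d2]
  linear_combination (starRingEnd ℂ ((C.mon k - 1)⁻¹) * C.E a p) * c1 + C.E a p * C.E p (z + v) * d1 +
    (1 - C.mon k)⁻¹ * c3 + ((1 - C.mon (k + 1))⁻¹ - 1) * c2

end

end DeligneMostow
namespace DeligneMostow
open Complex CategoryTheory Filter Topology

/-! ### The signature of a tridiagonal Hermitian form -/

theorem sum_tridiagonal (f : ℕ → ℕ → ℂ) (hf : ∀ j k, j + 1 < k ∨ k + 1 < j → f j k = 0) (n : ℕ) :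
    ∑ j ∈ Finset.range (n + 1), ∑ k ∈ Finset.range (n + 1), f j k =
      f n n + ∑ k ∈ Finset.range n, (f k k + f (k + 1) k + f k (k + 1)) := by
  induction n with
  | zero => simp
  | succ n ih =>
    have h1 : ∑ j ∈ Finset.range (n + 1), f j (n + 1) = f n (n + 1) :=
      Finset.sum_eq_single_of_mem n (by simp) fun j hj hjn => hf _ _ (Or.inl (by
        have := Finset.mem_range.1 hj; omega))
    have h2 : ∑ k ∈ Finset.range (n + 1), f (n + 1) k = f (n + 1) n :=
      Finset.sum_eq_single_of_mem n (by simp) fun j hj hjn => hf _ _ (Or.inr (by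
        have := Finset.mem_range.1 hj; omega))
    rw [Finset.sum_range_succ]
    simp only [Finset.sum_range_succ _ (n + 1)]
    rw [Finset.sum_add_distrib, ih, h1, h2, Finset.sum_range_succ _ n]
    ring

/-- This is the addition theorem for the sine. The last bracket has the form `φ (i + 1) - φ i` when
`B` is replaced by partial sums, and so it telescopes. -/
theorem sin_mul_sin_eq {a B : ℝ} (ha : Real.sin a ≠ 0) (x y : ℂ) :
    Real.sin B * Real.sin (B + a) / Real.sin a * ‖y - x‖ ^ 2 =
      Real.cot a * ‖Real.sin (B + a) * y‖ ^ 2 + Real.cot a * ‖Real.sin B * x‖ ^ 2 -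
        2 * ((Real.sin (B + a) * y * starRingEnd ℂ (Real.sin B * x)).re / Real.sin a) -
        (Real.cos (B + a) * Real.sin (B + a) * ‖y‖ ^ 2 - Real.cos B * Real.sin B * ‖x‖ ^ 2) := by
  have e : (Real.sin (B + a) * y * starRingEnd ℂ (Real.sin B * x)).re =
      Real.sin (B + a) * Real.sin B * (y * starRingEnd ℂ x).re := by
    rw [map_mul, conj_ofReal, show (Real.sin (B + a) * y * (Real.sin B * starRingEnd ℂ x) : ℂ) =
      ((Real.sin (B + a) * Real.sin B : ℝ) : ℂ) * (y * starRingEnd ℂ x) by push_cast; ring,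
      re_ofReal_mul]
  have n1 : ‖y - x‖ ^ 2 = ‖y‖ ^ 2 + ‖x‖ ^ 2 - 2 * (y * starRingEnd ℂ x).re := by
    rw [← normSq_eq_norm_sq, ← normSq_eq_norm_sq, ← normSq_eq_norm_sq, normSq_sub]
  have h1 : Real.cos a * Real.sin (B + a) - Real.cos (B + a) * Real.sin a = Real.sin B := by
    rw [mul_comm (Real.cos a), ← Real.sin_sub, add_sub_cancel_right]
  have h2 : Real.cos a * Real.sin B + Real.cos B * Real.sin a = Real.sin (B + a) := by
    rw [Real.sin_add]; ring
  rw [e, n1, norm_mul, norm_mul, norm_real, norm_real, mul_pow, mul_pow, Real.norm_eq_abs,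
    Real.norm_eq_abs, sq_abs, sq_abs, Real.cot_eq_cos_div_sin]
  field_simp
  linear_combination (-(Real.sin (B + a) * ‖y‖ ^ 2)) * h1 - Real.sin B * ‖x‖ ^ 2 * h2

/-- Completing the squares in a tridiagonal form. -/
theorem sum_squares {a B : ℕ → ℝ} {n : ℕ} (ha : ∀ i ≤ n, Real.sin (a i) ≠ 0)
    (hB : ∀ i, B (i + 1) = B i + a i) {g : ℕ → ℂ} (h0 : g 0 = 0) (hn : g (n + 1) = 0) :
    ∑ i ∈ Finset.range (n + 1),
        Real.sin (B i) * Real.sin (B (i + 1)) / Real.sin (a i) * ‖g (i + 1) - g i‖ ^ 2 =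
      ∑ k ∈ Finset.range n, ((Real.cot (a k) + Real.cot (a (k + 1))) *
        ‖Real.sin (B (k + 1)) * g (k + 1)‖ ^ 2 - 2 * ((Real.sin (B (k + 1 + 1)) * g (k + 1 + 1) *
          starRingEnd ℂ (Real.sin (B (k + 1)) * g (k + 1))).re / Real.sin (a (k + 1)))) := by
  rw [Finset.sum_congr rfl fun i hi => by
    rw [hB i, sin_mul_sin_eq (ha i (Nat.lt_succ_iff.1 (Finset.mem_range.1 hi))), ← hB i]]
  rw [Finset.sum_sub_distrib, Finset.sum_sub_distrib, Finset.sum_add_distrib,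
    Finset.sum_range_sub (fun i => Real.cos (B i) * Real.sin (B i) * ‖g i‖ ^ 2),
    Finset.sum_range_succ (fun i => Real.cot (a i) * ‖Real.sin (B (i + 1)) * g (i + 1)‖ ^ 2),
    Finset.sum_range_succ' (fun i => Real.cot (a i) * ‖Real.sin (B i) * g i‖ ^ 2),
    Finset.sum_range_succ' (fun i => 2 * ((Real.sin (B (i + 1)) * g (i + 1) *
      starRingEnd ℂ (Real.sin (B i) * g i)).re / Real.sin (a i))), h0, hn]
  simp only [mul_zero, norm_zero, map_zero, zero_re, zero_div, ne_eq, OfNat.ofNat_ne_zero,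
    not_false_eq_true, zero_pow, add_zero, sub_zero]
  rw [← Finset.sum_add_distrib, ← Finset.sum_sub_distrib]
  refine Finset.sum_congr rfl fun k _ => ?_
  ring

/-- The sign changes of the sine along a sequence with small steps. -/
theorem card_sign_changes {B : ℕ → ℝ} {n : ℕ} (h0 : ∀ i ≤ n, Real.sin (B i) ≠ 0)
    (h1 : ∀ i < n, B i < B (i + 1)) (h2 : ∀ i < n, B (i + 1) < B i + Real.pi) :
    (((Finset.range n).filter fun i => Real.sin (B i) * Real.sin (B (i + 1)) < 0).card : ℤ) =
      ⌊B n / Real.pi⌋ - ⌊B 0 / Real.pi⌋ := by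
  induction n with
  | zero => simp
  | succ n ih =>
    have hpi := Real.pi_pos
    -- The parity of `⌊x / π⌋` is the sign of the sine. As steps are positive and shorter than `π`,
    -- the floor grows by `0` or `1`, and by `1` exactly at a sign change.
    have key : ∀ x, Real.sin x ≠ 0 → ∃ s > 0, Real.sin x = (-1) ^ ⌊x / Real.pi⌋ * s := by
      intro x hx
      have h3 := Int.floor_le (x / Real.pi)
      have h4 := Int.lt_floor_add_one (x / Real.pi)
      rw [le_div_iff₀ hpi] at h3
      rw [div_lt_iff₀ hpi] at h4
      have h5 : Real.sin (x - ⌊x / Real.pi⌋ * Real.pi) = (-1) ^ ⌊x / Real.pi⌋ * Real.sin x :=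
        Real.sin_sub_int_mul_pi x _
      refine ⟨Real.sin (x - ⌊x / Real.pi⌋ * Real.pi), ?_, ?_⟩
      · refine lt_of_le_of_ne (Real.sin_nonneg_of_nonneg_of_le_pi (by linarith) (by linarith)) ?_
        rw [h5]
        exact (mul_ne_zero (zpow_ne_zero _ (by norm_num)) hx).symm
      · rw [h5, ← mul_assoc, ← mul_zpow]
        simp
    have ih := ih (fun i hi => h0 i (by omega)) (fun i hi => h1 i (by omega))
      fun i hi => h2 i (by omega)
    obtain ⟨s, hs, es⟩ := key _ (h0 n (by omega))
    obtain ⟨t, ht, et⟩ := key _ (h0 (n + 1) le_rfl)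
    have hle : ⌊B n / Real.pi⌋ ≤ ⌊B (n + 1) / Real.pi⌋ :=
      Int.floor_le_floor (div_le_div_of_nonneg_right (h1 n (by omega)).le hpi.le)
    have hlt : ⌊B (n + 1) / Real.pi⌋ ≤ ⌊B n / Real.pi⌋ + 1 := by
      rw [← Int.floor_add_one]
      refine Int.floor_le_floor ?_
      rw [div_add_one hpi.ne']
      exact div_le_div_of_nonneg_right (h2 n (by omega)).le hpi.le
    rw [Finset.range_add_one, Finset.filter_insert]
    rcases (by omega : ⌊B (n + 1) / Real.pi⌋ = ⌊B n / Real.pi⌋ ∨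
      ⌊B (n + 1) / Real.pi⌋ = ⌊B n / Real.pi⌋ + 1) with h | h
    · rw [if_neg, ih, h]
      rw [es, et, h, not_lt, mul_mul_mul_comm, ← mul_zpow]
      simp [(mul_pos hs ht).le]
    · rw [if_pos, Finset.card_insert_of_notMem (by simp), Nat.cast_add, ih, h]
      · push_cast; ring
      · have h3 : ((-1 : ℝ) ^ ⌊B n / Real.pi⌋) * (-1) ^ ⌊B n / Real.pi⌋ = 1 := by
          rw [← mul_zpow]; simp
        rw [es, et, h, zpow_add_one₀ (by norm_num)]
        have h4 := mul_pos hs ht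
        calc _ = -((-1 : ℝ) ^ ⌊B n / Real.pi⌋ * (-1) ^ ⌊B n / Real.pi⌋) * (s * t) := by ring
          _ < 0 := by rw [h3]; linarith

section

variable {V : Type*} [AddCommGroup V] [Module ℂ V]

/-- A Hermitian form on a sum of a positive and a negative definite subspace. -/
theorem hasSignature_of_definite [Module.Finite ℂ V] {H : V →ₗ[ℂ] V →ₗ⋆[ℂ] ℂ}
    (hH : IsHermitianForm H) {P Q : Submodule ℂ V} (hP : ∀ v ∈ P, v ≠ 0 → 0 < (H v v).re)
    (hQ : ∀ v ∈ Q, v ≠ 0 → (H v v).re < 0) {p q : ℕ} (hp : p ≤ Module.finrank ℂ P)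
    (hq : q ≤ Module.finrank ℂ Q) (hpq : Module.finrank ℂ V = p + q) : HasSignature H p q := by
  have disj : ∀ P Q : Submodule ℂ V, (∀ v ∈ P, v ≠ 0 → 0 < (H v v).re) →
      (∀ v ∈ Q, v ≠ 0 → (H v v).re < 0) → Disjoint P Q := fun P Q hP hQ => by
    refine Submodule.disjoint_def.2 fun v h1 h2 => ?_
    by_contra hv
    exact lt_asymm (hP v h1 hv) (hQ v h2 hv)
  have dim : ∀ P Q : Submodule ℂ V, (∀ v ∈ P, v ≠ 0 → 0 < (H v v).re) →
      (∀ v ∈ Q, v ≠ 0 → (H v v).re < 0) → Module.finrank ℂ P + Module.finrank ℂ Q ≤ p + q :=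
    fun P Q hP hQ => by
      rw [← hpq]
      exact Submodule.finrank_add_finrank_le_of_disjoint (disj P Q hP hQ)
  have h0 := dim P Q hP hQ
  refine ⟨fun v hv => ?_, ⟨⟨P, inferInstance, by omega, hP⟩, ?_⟩, ⟨Q, inferInstance, by omega, hQ⟩, ?_⟩
  · have htop : P ⊔ Q = ⊤ := by
      refine Submodule.eq_top_of_finrank_eq ?_
      have h1 := Submodule.finrank_sup_add_finrank_inf_eq P Q
      rw [(disj P Q hP hQ).eq_bot, finrank_bot] at h1
      omega
    obtain ⟨x, hx, y, hy, rfl⟩ := Submodule.mem_sup.1 (htop ▸ Submodule.mem_top : v ∈ P ⊔ Q)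
    -- For `v = x + y` in the radical, pairing with `x` and with `y` gives `Re H(x, x) = Re H(y,
    -- y)`, where the left side is nonnegative and the right side is not positive.
    have h1 := congrArg re (hv x)
    have h2 := congrArg re (hv y)
    have h3 := congrArg re (hH x y)
    simp only [map_add, LinearMap.add_apply, add_re, zero_re, conj_re] at h1 h2 h3
    have hx0 : x = 0 := by
      by_contra hne
      have h4 := hP x hx hne
      have h5 : (H y y).re ≤ 0 := by
        by_cases hy0 : y = 0
        · rw [hy0]; simp
        · exact (hQ y hy hy0).le
      linarith
    have hy0 : y = 0 := by
      by_contra hne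
      have h4 := hQ y hy hne
      rw [hx0] at h2
      simp only [map_zero, LinearMap.zero_apply, zero_re] at h2
      linarith
    rw [hx0, hy0, add_zero]
  · rintro d ⟨W, -, rfl, hW⟩
    have := dim W Q hW hQ
    omega
  · rintro d ⟨W, -, rfl, hW⟩
    have := dim P W hP hW
    omega

end

end DeligneMostow
-- Diagonalisation and signature of a tridiagonal form
namespace DeligneMostow
open Complex CategoryTheory Filter Topology

section

variable {V : Type*} [AddCommGroup V] [Module ℂ V] {N : ℕ}

/-- The entries of a vector, preceded and followed by zeros. -/
noncomputable def zeroExt (N : ℕ) : ℕ → (Fin N → ℂ) →ₗ[ℂ] ℂ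
  | 0 => 0
  | k + 1 => if h : k < N then LinearMap.proj ⟨k, h⟩ else 0

theorem zeroExt_succ (g : Fin N → ℂ) (k : Fin N) : zeroExt N (k + 1) g = g k := by
  rw [zeroExt, dif_pos k.2]; rfl

theorem zeroExt_of_lt (g : Fin N → ℂ) {k : ℕ} (hk : N < k) : zeroExt N k g = 0 := by
  obtain ⟨k, rfl⟩ := Nat.exists_eq_add_of_lt hk
  rw [zeroExt, dif_neg (by omega)]; rfl

/-- The data of the Gram matrix of a tridiagonal Hermitian form. -/
structure IsTridiagonal (b : Module.Basis (Fin N) ℂ V) (H : V →ₗ[ℂ] V →ₗ⋆[ℂ] ℂ) (a : ℕ → ℝ) :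
    Prop where
  hermitian : IsHermitianForm H
  diag : ∀ k : Fin N, (H (b k) (b k)).re = -(Real.cot (a k) + Real.cot (a (k + 1))) / 2
  succ : ∀ j k : Fin N, (j : ℕ) = k + 1 → ‖H (b j) (b k)‖ = 1 / (2 * Real.sin (a j))
  far : ∀ j k : Fin N, (j + 1 < (k : ℕ) ∨ k + 1 < (j : ℕ)) → H (b j) (b k) = 0

/-- Phases make the entries next to the diagonal positive, and scaling the `k`-th basis vector by
`sin (B (k + 1))` brings the form into the shape of `sum_squares`. -/
theorem IsTridiagonal.exists_diagonal {b : Module.Basis (Fin N) ℂ V} {H : V →ₗ[ℂ] V →ₗ⋆[ℂ] ℂ}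
    {a : ℕ → ℝ} (hH : IsTridiagonal b H a) (ha : ∀ i ≤ N, 0 < Real.sin (a i)) {B : ℕ → ℝ}
    (hB : ∀ i, B (i + 1) = B i + a i) (hB0 : ∀ i ≤ N, Real.sin (B i) ≠ 0) :
    ∃ T : (Fin N → ℂ) →ₗ[ℂ] V, Function.Injective T ∧ ∀ g, (H (T g) (T g)).re =
      -(∑ i ∈ Finset.range (N + 1), Real.sin (B i) * Real.sin (B (i + 1)) / Real.sin (a i) *
        ‖zeroExt N (i + 1) g - zeroExt N i g‖ ^ 2) / 2 := by
  classical
  let G : ℕ → ℕ → ℂ := fun j k =>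
    if h : j < N ∧ k < N then H (b ⟨j, h.1⟩) (b ⟨k, h.2⟩) else 0
  have hG : ∀ j k : Fin N, H (b j) (b k) = G j k := fun j k => by
    simp only [G]; rw [dif_pos ⟨j.2, k.2⟩]
  -- A tridiagonal matrix has no cycles of entries, so the phases can be removed one after the other
  -- by accumulating them in `φ`.
  choose u hu hu' using fun k => Complex.exists_norm_eq_mul_self (G (k + 1) k)
  let φ : ℕ → ℂ := fun k => ∏ i ∈ Finset.range k, u i
  have hφ : ∀ k, ‖φ k‖ = 1 := fun k => by
    rw [norm_prod]; exact Finset.prod_eq_one fun i _ => hu i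
  have hφ2 : ∀ k, φ k * starRingEnd ℂ (φ k) = 1 := fun k => by
    rw [mul_conj, normSq_eq_norm_sq, hφ]; norm_num
  let c : Fin N → ℂ := fun k => φ k * Real.sin (B (k + 1))
  have hc : ∀ k, c k ≠ 0 := fun k => mul_ne_zero
    (by rw [← norm_ne_zero_iff, hφ]; norm_num) (ofReal_ne_zero.2 (hB0 _ k.2))
  let T : (Fin N → ℂ) →ₗ[ℂ] V := b.equivFun.symm.toLinearMap ∘ₗ
    LinearMap.pi fun k => c k • LinearMap.proj k
  have hT : ∀ g, T g = ∑ k, (c k * g k) • b k := fun g => by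
    simp [T, Module.Basis.equivFun_symm_apply]
  refine ⟨T, ?_, fun g => ?_⟩
  · refine b.equivFun.symm.injective.comp fun g g' h => funext fun k => ?_
    exact mul_left_cancel₀ (hc k) (congrFun h k)
  let y : ℕ → ℂ := fun k => Real.sin (B (k + 1)) * zeroExt N (k + 1) g
  have hy : ∀ k, N ≤ k → y k = 0 := fun k hk => by
    simp only [y]; rw [zeroExt_of_lt g (by omega), mul_zero]
  let f : ℕ → ℕ → ℂ := fun j k => φ j * y j * starRingEnd ℂ (φ k * y k) * G j k
  have hfar : ∀ j k, j + 1 < k ∨ k + 1 < j → f j k = 0 := fun j k h => by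
    by_cases hjk : j < N ∧ k < N
    · simp only [f]
      rw [← hG ⟨j, hjk.1⟩ ⟨k, hjk.2⟩, hH.far _ _ h, mul_zero]
    · simp only [f, G]; rw [dif_neg hjk, mul_zero]
  have hsum : H (T g) (T g) = ∑ j ∈ Finset.range (N + 1), ∑ k ∈ Finset.range (N + 1), f j k := by
    have h1 : ∀ j, f j N = 0 := fun j => by simp only [f]; rw [hy N le_rfl]; simp
    have h2 : ∀ j, f N j = 0 := fun j => by simp only [f]; rw [hy N le_rfl]; simp
    simp only [Finset.sum_range_succ, h1, h2, add_zero, Finset.sum_const_zero]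
    rw [hT, map_sum H, LinearMap.sum_apply, ← Fin.sum_univ_eq_sum_range (fun j =>
      ∑ k ∈ Finset.range N, f j k)]
    refine Finset.sum_congr rfl fun j _ => ?_
    rw [map_sum, ← Fin.sum_univ_eq_sum_range (fun k => f j k)]
    refine Finset.sum_congr rfl fun k _ => ?_
    simp only [map_smul, LinearMap.smul_apply, LinearMap.map_smulₛₗ, smul_eq_mul, hG]
    simp only [f, c, y]
    rw [zeroExt_succ, zeroExt_succ, map_mul, map_mul, map_mul, map_mul]
    ring
  have hfN : f N N = 0 := by simp only [f]; rw [hy N le_rfl]; simp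
  rw [hsum, sum_tridiagonal f hfar, hfN, zero_add, re_sum,
    sum_squares (g := fun i => zeroExt N i g) (fun i hi => (ha i hi).ne') hB rfl (zeroExt_of_lt g (Nat.lt_succ_self N)), neg_div, Finset.sum_div, ← Finset.sum_neg_distrib]
  refine Finset.sum_congr rfl fun k hk => ?_
  have hk := Finset.mem_range.1 hk
  have e1 : (f k k).re = -(Real.cot (a k) + Real.cot (a (k + 1))) / 2 * ‖y k‖ ^ 2 := by
    have : f k k = ((‖y k‖ ^ 2 : ℝ) : ℂ) * G k k := by
      simp only [f]
      rw [map_mul, mul_mul_mul_comm (φ k), hφ2, one_mul, mul_conj, normSq_eq_norm_sq]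
    rw [this, re_ofReal_mul, ← hG ⟨k, hk⟩ ⟨k, hk⟩, hH.diag, mul_comm]
  have e2 : f k (k + 1) = starRingEnd ℂ (f (k + 1) k) := by
    have : G k (k + 1) = starRingEnd ℂ (G (k + 1) k) := by
      by_cases h : k + 1 < N
      · rw [← hG ⟨k, hk⟩ ⟨k + 1, h⟩, ← hG ⟨k + 1, h⟩ ⟨k, hk⟩]
        exact hH.hermitian _ _
      · simp only [G]
        rw [dif_neg (by omega), dif_neg (by omega), map_zero]
    simp only [f]
    rw [this]
    simp only [map_mul, conj_conj]
    ring
  have e3 : (f (k + 1) k).re = (y (k + 1) * starRingEnd ℂ (y k)).re / (2 * Real.sin (a (k + 1))) := by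
    by_cases h : k + 1 < N
    · have : f (k + 1) k = ((1 / (2 * Real.sin (a (k + 1))) : ℝ) : ℂ) *
          (y (k + 1) * starRingEnd ℂ (y k)) := by
        rw [← hH.succ ⟨k + 1, h⟩ ⟨k, hk⟩ rfl, hG, hu']
        simp only [f, φ]
        rw [Finset.prod_range_succ, map_mul]
        linear_combination (u k * y (k + 1) * starRingEnd ℂ (y k) * G (k + 1) k) * hφ2 k
      rw [this, re_ofReal_mul]
      ring
    · simp only [f]
      rw [hy (k + 1) (by omega)]
      simp
  rw [add_re, add_re, e2, conj_re, e1, e3]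
  simp only [y]
  have := (ha (k + 1) hk).ne'
  field_simp
  ring

/-- The conditions that the differences with index in `s` vanish cost at most `s.card` dimensions,
and only weights of the sign of `ε` remain. -/
theorem IsTridiagonal.exists_definite {b : Module.Basis (Fin N) ℂ V} {H : V →ₗ[ℂ] V →ₗ⋆[ℂ] ℂ}
    {a : ℕ → ℝ} (hH : IsTridiagonal b H a) (ha : ∀ i ≤ N, 0 < Real.sin (a i)) {B : ℕ → ℝ}
    (hB : ∀ i, B (i + 1) = B i + a i) (hB0 : ∀ i ≤ N, Real.sin (B i) ≠ 0) {ε : ℝ} {s : Finset ℕ}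
    (hs : ∀ i ≤ N, i ∉ s → 0 < ε * (Real.sin (B i) * Real.sin (B (i + 1)))) :
    ∃ W : Submodule ℂ V, N ≤ Module.finrank ℂ W + s.card ∧
      ∀ v ∈ W, v ≠ 0 → ε * (H v v).re < 0 := by
  obtain ⟨T, hT, hTH⟩ := hH.exists_diagonal ha hB hB0
  let D : (Fin N → ℂ) →ₗ[ℂ] (s → ℂ) :=
    LinearMap.pi fun i => zeroExt N (i + 1) - zeroExt N i
  refine ⟨(LinearMap.ker D).map T, ?_, ?_⟩
  · have h1 := LinearMap.finrank_range_add_finrank_ker D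
    have h2 := Submodule.finrank_le (LinearMap.range D)
    rw [Module.finrank_fintype_fun_eq_card, Fintype.card_coe] at h2
    rw [Module.finrank_fintype_fun_eq_card, Fintype.card_fin] at h1
    rw [← (Submodule.equivMapOfInjective T hT (LinearMap.ker D)).finrank_eq]
    omega
  · rintro _ ⟨g, hg, rfl⟩ hv
    have hD : ∀ i ∈ s, zeroExt N (i + 1) g - zeroExt N i g = 0 := fun i hi =>
      congrFun (LinearMap.mem_ker.1 hg) ⟨i, hi⟩
    have hnn : ∀ i ∈ Finset.range (N + 1), 0 ≤ ε * (Real.sin (B i) * Real.sin (B (i + 1)) /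
        Real.sin (a i) * ‖zeroExt N (i + 1) g - zeroExt N i g‖ ^ 2) := fun i hi => by
      have hi := Nat.lt_succ_iff.1 (Finset.mem_range.1 hi)
      by_cases his : i ∈ s
      · rw [hD i his]; simp
      · rw [← mul_assoc, ← mul_div_assoc]
        exact mul_nonneg (div_pos (hs i hi his) (ha i hi)).le (sq_nonneg _)
    rw [hTH, neg_div, mul_neg, neg_lt_zero, ← mul_div_assoc, Finset.mul_sum]
    refine half_pos (lt_of_le_of_ne (Finset.sum_nonneg hnn) fun h0 => hv ?_)
    have h1 := (Finset.sum_eq_zero_iff_of_nonneg hnn).1 h0.symm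
    -- If the value is zero, all differences vanish, and the sequence starts at zero; this gives
    -- definiteness and not only semidefiniteness.
    have h2 : ∀ i ≤ N + 1, zeroExt N i g = 0 := fun i => by
      induction i with
      | zero => exact fun _ => rfl
      | succ i ih =>
        intro hi
        by_cases his : i ∈ s
        · rw [← sub_eq_zero.1 (hD i his) |>.symm, ih (by omega)]
        · have h3 := h1 i (Finset.mem_range.2 (by omega))
          rw [← mul_assoc, ← mul_div_assoc] at h3
          rcases mul_eq_zero.1 h3 with h3 | h3
          · exact absurd h3 (div_pos (hs i (by omega) his) (ha i (by omega))).ne'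
          · rw [sub_eq_zero.1 (norm_eq_zero.1 (pow_eq_zero_iff (two_ne_zero) |>.1 h3)),
              ih (by omega)]
    rw [show g = 0 from funext fun k => by rw [← zeroExt_succ g k, h2 _ (by omega)]; rfl, map_zero]

theorem eventually_sin_add_ne_zero (x : ℝ) : ∀ᶠ θ in 𝓝[≠] (0 : ℝ), Real.sin (θ + x) ≠ 0 := by
  have hd : HasDerivAt (fun θ => Real.sin (θ + x)) (Real.cos (0 + x)) 0 := by
    simpa using ((hasDerivAt_id (0 : ℝ)).add_const x).sin
  by_cases h : Real.sin x = 0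
  · refine hd.eventually_ne fun hc => ?_
    have := Real.sin_sq_add_cos_sq x
    rw [h, ← zero_add x, hc] at this
    norm_num at this
  · exact (hd.continuousAt.eventually_ne (by simpa using h)).filter_mono nhdsWithin_le_nhds

/-- The signature of a tridiagonal Hermitian form. -/
theorem IsTridiagonal.hasSignature {b : Module.Basis (Fin N) ℂ V} {H : V →ₗ[ℂ] V →ₗ⋆[ℂ] ℂ}
    {ν : ℕ → ℝ} (hH : IsTridiagonal b H fun i => Real.pi * ν i) (h0 : ∀ i ≤ N, 0 < ν i)
    (h1 : ∀ i ≤ N, ν i < 1) {p q : ℕ} (hpq : p + q = N)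
    (hp : (p : ℝ) < ∑ i ∈ Finset.range (N + 1), ν i)
    (hp' : ∑ i ∈ Finset.range (N + 1), ν i < p + 1) : HasSignature H p q := by
  have hpi := Real.pi_pos
  have : Module.Finite ℂ V := Module.Finite.of_basis b
  have ha : ∀ i ≤ N, 0 < Real.sin (Real.pi * ν i) := fun i hi =>
    Real.sin_pos_of_pos_of_lt_pi (mul_pos hpi (h0 i hi)) (by nlinarith [h1 i hi])
  -- At `θ = 0` the first sine vanishes, and others may vanish as well. A small shift of either sign
  -- removes this without moving the last value out of `(pπ, (p + 1)π)`.
  let B : ℝ → ℕ → ℝ := fun θ i => θ + Real.pi * ∑ j ∈ Finset.range i, ν j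
  have hB : ∀ θ i, B θ (i + 1) = B θ i + Real.pi * ν i := fun θ i => by
    simp only [B]; rw [Finset.sum_range_succ]; ring
  have hne : ∀ᶠ θ in 𝓝[≠] (0 : ℝ), ∀ i ∈ Finset.range (N + 2), Real.sin (B θ i) ≠ 0 :=
    (Filter.eventually_all_finset _).2 fun i _ => eventually_sin_add_ne_zero _
  have hlast : ∀ᶠ θ in 𝓝 (0 : ℝ), p * Real.pi < B θ (N + 1) ∧ B θ (N + 1) < (p + 1) * Real.pi := by
    have hc : Continuous fun θ => B θ (N + 1) := by fun_prop
    refine (hc.tendsto 0).eventually (Ioo_mem_nhds ?_ ?_) <;> simp only [B] <;> nlinarith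
  have hcard : ∀ θ, (∀ i ∈ Finset.range (N + 2), Real.sin (B θ i) ≠ 0) →
      (p * Real.pi < B θ (N + 1) ∧ B θ (N + 1) < (p + 1) * Real.pi) →
      (((Finset.range (N + 1)).filter fun i => Real.sin (B θ i) * Real.sin (B θ (i + 1)) < 0).card
        : ℤ) = p - ⌊θ / Real.pi⌋ := fun θ hθ hl => by
    rw [card_sign_changes (fun i hi => hθ i (Finset.mem_range.2 (by omega)))
      (fun i hi => by rw [hB]; nlinarith [h0 i (by omega)])
      (fun i hi => by rw [hB]; nlinarith [h1 i (by omega)])]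
    congr 1
    · rw [Int.floor_eq_iff, le_div_iff₀ hpi, div_lt_iff₀ hpi]
      push_cast
      exact ⟨hl.1.le, hl.2⟩
    · simp [B]
  have hgt : 𝓝[>] (0 : ℝ) ≤ 𝓝[≠] 0 := nhdsWithin_mono _ fun x hx => ne_of_gt hx
  have hlt : 𝓝[<] (0 : ℝ) ≤ 𝓝[≠] 0 := nhdsWithin_mono _ fun x hx => ne_of_lt hx
  -- For `θ > 0` there are `p` negative weights, and eliminating them leaves a negative definite
  -- space of dimension at least `N - p = q`. For `θ' < 0` there are `p + 1`, so `q` positive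
  -- weights, and eliminating these leaves a positive definite space of dimension at least `p`.
  obtain ⟨θ, ⟨⟨hθ1, hθ2⟩, hθ3⟩, hθ4⟩ := ((hne.filter_mono hgt).and
    (hlast.filter_mono nhdsWithin_le_nhds) |>.and self_mem_nhdsWithin |>.and
    (Ioo_mem_nhdsGT hpi)).exists
  obtain ⟨θ', ⟨⟨hθ1', hθ2'⟩, hθ3'⟩, hθ4'⟩ := ((hne.filter_mono hlt).and
    (hlast.filter_mono nhdsWithin_le_nhds) |>.and self_mem_nhdsWithin |>.and
    (Ioo_mem_nhdsLT (neg_lt_zero.2 hpi))).exists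
  have f1 : ⌊θ / Real.pi⌋ = 0 := by
    rw [Int.floor_eq_iff, le_div_iff₀ hpi, div_lt_iff₀ hpi]
    push_cast
    exact ⟨by linarith [hθ4.1], by linarith [hθ4.2]⟩
  have f2 : ⌊θ' / Real.pi⌋ = -1 := by
    rw [Int.floor_eq_iff, le_div_iff₀ hpi, div_lt_iff₀ hpi]
    push_cast
    exact ⟨by linarith [hθ4'.1], by linarith [hθ4'.2]⟩
  have c1 := hcard θ hθ1 hθ2
  have c2 := hcard θ' hθ1' hθ2'
  rw [f1] at c1
  rw [f2] at c2
  have hB0 : ∀ θ, (∀ i ∈ Finset.range (N + 2), Real.sin (B θ i) ≠ 0) →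
      ∀ i ≤ N + 1, Real.sin (B θ i) ≠ 0 := fun θ h i hi => h i (Finset.mem_range.2 (by omega))
  obtain ⟨Q, hQ, hQ'⟩ := hH.exists_definite ha (hB θ) (fun i hi => hB0 θ hθ1 i (by omega)) (ε := 1)
    (s := (Finset.range (N + 1)).filter fun i => Real.sin (B θ i) * Real.sin (B θ (i + 1)) < 0)
    fun i hi his => by
      rw [Finset.mem_filter, Finset.mem_range, not_and, not_lt] at his
      rw [one_mul]
      exact lt_of_le_of_ne (his (by omega))
        (mul_ne_zero (hB0 θ hθ1 i (by omega)) (hB0 θ hθ1 (i + 1) (by omega))).symm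
  obtain ⟨P, hP, hP'⟩ := hH.exists_definite ha (hB θ') (fun i hi => hB0 θ' hθ1' i (by omega))
    (ε := -1) (s := (Finset.range (N + 1)).filter fun i =>
      ¬ Real.sin (B θ' i) * Real.sin (B θ' (i + 1)) < 0)
    fun i hi his => by
      rw [Finset.mem_filter, Finset.mem_range, not_and, not_not] at his
      linarith [his (by omega)]
  have c3 := Finset.card_filter_add_card_filter_not (s := Finset.range (N + 1))
    (fun i => Real.sin (B θ' i) * Real.sin (B θ' (i + 1)) < 0)
  rw [Finset.card_range] at c3
  refine hasSignature_of_definite hH.hermitian (P := P) (Q := Q)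
    (fun v hv hv0 => by linarith [hP' v hv hv0]) (fun v hv hv0 => by linarith [hQ' v hv hv0])
    (by omega) (by omega) ?_
  rw [Module.finrank_eq_card_basis b, Fintype.card_fin, hpq]

end

end DeligneMostow
-- A system of arcs and its Gram matrix
namespace DeligneMostow
open Complex CategoryTheory Filter Topology

section

variable {S : Set P1} {L : LocalSystem.{u} S} {C : Config L} {u : ℂ} {N : ℕ}

theorem eventually_sub_mul_ne {a b : ℝ} (h : a ≠ 0 ∨ b ≠ 0) :
    ∀ᶠ δ in 𝓝[>] (0 : ℝ), a - δ * b ≠ 0 := by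
  by_cases hb : b = 0
  · exact Filter.Eventually.of_forall fun δ => by rw [hb]; simpa [hb] using h
  · filter_upwards [eventually_mul_ne one_pos (a / b)] with δ hδ h0
    exact hδ (by rw [eq_div_iff hb]; linarith)

/-- Each fixed direction is parallel to a diagonal of the tilted square for at most finitely many
tilts. Applied to the next gap this puts the next arc into the open sector of an edge. -/
theorem eventually_div_armR {k : ℕ} {c : ℂ} (hc : c ≠ 0) (hk : C.gap k ≠ 0) :
    ∀ᶠ x in smallPairs, (c / C.armR k x).re ≠ 0 ∧ (c / C.armR k x).im ≠ 0 := by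
  have hc' := div_ne_zero hc hk
  refine eventually_smallPairs fun ε hε => ?_
  have h1 : (c / C.gap k).re ≠ 0 ∨ (c / C.gap k).im ≠ 0 := by
    by_contra! h
    exact hc' (Complex.ext h.1 h.2)
  filter_upwards [eventually_sub_mul_ne h1,
    eventually_sub_mul_ne (b := -(c / C.gap k).re) (h1.symm.imp_right neg_ne_zero.2)] with δ h2 h3
  have hn : (1 : ℂ) - δ * I ≠ 0 := fun h => by simpa using congrArg re h
  have hp : (0 : ℝ) < 1 + δ ^ 2 := by positivity
  have hε' : (ε : ℂ) ≠ 0 := ofReal_ne_zero.2 hε.ne'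
  have e : c / C.armR k (ε, δ) =
      ((-(ε * (1 + δ ^ 2))⁻¹ : ℝ) : ℂ) * (c / C.gap k * (1 + δ * I)) := by
    have hp' : (1 : ℂ) + δ ^ 2 ≠ 0 := by exact_mod_cast hp.ne'
    have e1 : (1 : ℂ) + (-1) * δ * I = 1 - δ * I := by ring
    rw [Config.armR, tilt]
    push_cast
    rw [e1]
    field_simp
    linear_combination (-(δ : ℂ) ^ 2) * I_sq
  rw [e, re_ofReal_mul, im_ofReal_mul]
  have h4 : -(ε * (1 + δ ^ 2))⁻¹ ≠ 0 := neg_ne_zero.2 (inv_ne_zero (mul_pos hε hp).ne')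
  refine ⟨mul_ne_zero h4 fun h => h2 ?_, mul_ne_zero h4 fun h => h3 ?_⟩ <;>
    simp at h <;> linarith

/-- A choice of a regularized arc between each point and its successor. -/
structure Config.ArcSystem (C : Config L) (u : ℂ) (N : ℕ) where
  y : ℕ → ℝ × ℝ
  pos : ∀ k < N, 0 < (y k).1 ∧ 0 < (y k).2
  isArc : ∀ k < N, C.IsArc u k (C.armL k (y k)) (C.armR k (y k))
  succ : ∀ k, k + 1 < N → (C.gap (k + 1) / C.armR k (y k)).re ≠ 0 ∧
    (C.gap (k + 1) / C.armR k (y k)).im ≠ 0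

theorem Config.nonempty_arcSystem (hC : C.Sorted u) (hN : C.HasArcs N) :
    Nonempty (C.ArcSystem u N) := by
  have h : ∀ k, ∃ x : ℝ × ℝ, k < N → (0 < x.1 ∧ 0 < x.2) ∧
      C.IsArc u k (C.armL k x) (C.armR k x) ∧ (k + 1 < N → (C.gap (k + 1) / C.armR k x).re ≠ 0 ∧
        (C.gap (k + 1) / C.armR k x).im ≠ 0) := fun k => by
    by_cases hk : k < N
    · have h1 := smallPairs_pos.and (eventually_isArc hC (hN.lt hk))
      by_cases hk' : k + 1 < N
      · obtain ⟨x, hx, hx'⟩ := (h1.and (eventually_div_armR (hC.gap_ne_zero (hN.lt hk'))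
          (hC.gap_ne_zero (hN.lt hk)))).exists
        exact ⟨x, fun _ => ⟨hx.1, hx.2, fun _ => hx'⟩⟩
      · obtain ⟨x, hx⟩ := h1.exists
        exact ⟨x, fun _ => ⟨hx.1, hx.2, fun h => absurd h hk'⟩⟩
    · exact ⟨0, fun h => absurd h hk⟩
  choose y hy using h
  exact ⟨⟨y, fun k hk => (hy k hk).1, fun k hk => (hy k hk).2.1,
    fun k hk => (hy k (by omega)).2.2 hk⟩⟩

namespace Config.ArcSystem

variable (A : C.ArcSystem u N) (F : Frame C) (hC : C.Sorted u) (hN : C.HasArcs N)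

/-- The chosen regularized arcs. -/
noncomputable def chain (k : Fin N) : Chain L 1 :=
  arcChain F k (C.armL k (A.y k)) (C.armR k (A.y k))

theorem isFinitePolygonal (k : Fin N) : IsFinitePolygonal (A.chain F k) :=
  (A.isArc k k.2).isFinitePolygonal

include hC hN

theorem chain_mem (k : Fin N) : A.chain F k ∈ IntersectionCycle L :=
  arcChain_mem hC (hN.lt k.2) (A.isArc k k.2)

theorem mem_sup_span {ξ : Chain L 1} (hξ : ξ ∈ IntersectionCycle L) :
    ξ ∈ IntersectionBoundary L ⊔ Submodule.span ℂ (Set.range (A.chain F)) :=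
  mem_sup_span_arcChain hC hN F A.isArc hξ

/-- Up to a phase, a chosen arc is homologous to every sufficiently small arc between the same
points. Such a copy can be moved into general position before crossings are counted. -/
theorem exists_small (k : Fin N) {p : ℝ × ℝ → Prop} (hp : ∀ᶠ x in smallPairs, p x) :
    ∃ x, p x ∧ C.IsArc u k (C.armL k x) (C.armR k x) ∧ A.chain F k -
      C.E (C.z k + C.armL k (A.y k)) (C.z k + C.armL k x) •
        arcChain F k (C.armL k x) (C.armR k x) ∈ IntersectionBoundary L := by
  obtain ⟨x, hx, hx'⟩ := (hp.and (eventually_isArc hC (hN.lt k.2))).exists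
  exact ⟨x, hx, hx', arcChain_sub_mem hC (hN.lt k.2) (A.isArc k k.2) hx'⟩

/-- The intersection with a chosen arc. -/
noncomputable def dual (k : Fin N) : Chain L 1 →ₗ[ℂ] ℂ :=
  DeligneMostow.dual F (A.isFinitePolygonal F k) (A.chain_mem F hC hN k).2

theorem dual_eq_zero (k : Fin N) {ξ : Chain L 1} (hξ : ξ ∈ IntersectionBoundary L) :
    A.dual F hC hN k ξ = 0 :=
  DeligneMostow.dual_eq_zero _ _ _ hξ

theorem dual_eq (k : Fin N) {ξ : Chain L 1} (hξ : IsFinitePolygonal ξ)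
    (hgp : InGeneralPosition ξ (A.chain F k)) :
    A.dual F hC hN k ξ = crossForm F ξ (A.chain F k) :=
  DeligneMostow.dual_eq _ _ _ hξ hgp

/-- The intersection with a cycle depends on its class only. -/
theorem dual_of_sub_mem {η : Chain L 1} (hη : IsFinitePolygonal η) (hb : boundary L 0 η = 0)
    {c : Fin N → ℂ} (hc : η - ∑ k, c k • A.chain F k ∈ IntersectionBoundary L) {ξ : Chain L 1}
    (hξ : ξ ∈ IntersectionCycle L) :
    DeligneMostow.dual F hη hb ξ = ∑ k, starRingEnd ℂ (c k) * A.dual F hC hN k ξ := by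
  -- It suffices to test the difference on boundaries and on the generating arcs. For an arc, a
  -- small copy is in general position with everything, so crossings may be swapped; then the
  -- homology sits in the linear variable, where invariance is known.
  let D : Chain L 1 →ₗ[ℂ] ℂ :=
    DeligneMostow.dual F hη hb - ∑ k, starRingEnd ℂ (c k) • A.dual F hC hN k
  have hD : ∀ ζ, D ζ = DeligneMostow.dual F hη hb ζ -
      ∑ k, starRingEnd ℂ (c k) * A.dual F hC hN k ζ := fun ζ => by simp [D]
  have hD0 : ∀ ζ ∈ IntersectionBoundary L, D ζ = 0 := fun ζ hζ => by
    rw [hD, DeligneMostow.dual_eq_zero _ _ _ hζ,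
      Finset.sum_eq_zero fun k _ => by rw [A.dual_eq_zero F hC hN k hζ, mul_zero], sub_zero]
  suffices h : IntersectionBoundary L ⊔ Submodule.span ℂ (Set.range (A.chain F)) ≤ LinearMap.ker D by
    have := LinearMap.mem_ker.1 (h (A.mem_sup_span F hC hN hξ))
    rwa [hD, sub_eq_zero] at this
  refine sup_le (fun ζ hζ => LinearMap.mem_ker.2 (hD0 ζ hζ)) (Submodule.span_le.2 ?_)
  rintro _ ⟨j, rfl⟩
  obtain ⟨x, ⟨hx, hx'⟩, harc, hsub⟩ := A.exists_small F hC hN j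
    ((eventually_inGeneralPosition hC F (hN.lt j.2) hη).and (Filter.eventually_all.2 fun k =>
      eventually_inGeneralPosition hC F (hN.lt j.2) (A.isFinitePolygonal F k)))
  have hfp : IsFinitePolygonal (arcChain F j (C.armL j x) (C.armR j x)) := harc.isFinitePolygonal
  have hcyc := (arcChain_mem (F := F) hC (hN.lt j.2) harc).2
  have h1 := hD0 _ hsub
  rw [map_sub, map_smul, sub_eq_zero] at h1
  change D _ = 0
  rw [h1, hD, DeligneMostow.dual_eq _ _ _ hfp hx, crossForm_swap F hfp hη hx,
    ← DeligneMostow.dual_eq F hfp hcyc hη hx.symm]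
  have h2 := DeligneMostow.dual_eq_zero F hfp hcyc hc
  rw [map_sub, map_sum, sub_eq_zero] at h2
  rw [h2, map_sum, ← Finset.sum_neg_distrib, sub_eq_zero.2, smul_zero]
  refine Finset.sum_congr rfl fun k _ => ?_
  rw [A.dual_eq F hC hN k hfp (hx' k), crossForm_swap F hfp (A.isFinitePolygonal F k) (hx' k),
    map_smul, smul_eq_mul, map_mul,
    DeligneMostow.dual_eq F hfp hcyc (A.isFinitePolygonal F k) (hx' k).symm, mul_neg]

theorem dual_chain_eq (j k : Fin N) {x : ℝ × ℝ} (harc : C.IsArc u j (C.armL j x) (C.armR j x))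
    (hsub : A.chain F j - C.E (C.z j + C.armL j (A.y j)) (C.z j + C.armL j x) •
      arcChain F j (C.armL j x) (C.armR j x) ∈ IntersectionBoundary L)
    (hx : InGeneralPosition (arcChain F j (C.armL j x) (C.armR j x)) (A.chain F k)) :
    A.dual F hC hN k (A.chain F j) = C.E (C.z j + C.armL j (A.y j)) (C.z j + C.armL j x) *
      crossForm F (arcChain F j (C.armL j x) (C.armR j x)) (A.chain F k) := by
  have h1 := A.dual_eq_zero F hC hN k hsub
  rwa [map_sub, map_smul, sub_eq_zero, smul_eq_mul,
    A.dual_eq F hC hN k harc.isFinitePolygonal hx] at h1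

/-- The antisymmetry of crossings applies to a small copy of arc `j`. Returning to the chosen arc in
the dual variable introduces the inverse phase, conjugated, which cancels the first phase. -/
theorem dual_swap (j k : Fin N) : A.dual F hC hN k (A.chain F j) =
    -starRingEnd ℂ (A.dual F hC hN j (A.chain F k)) := by
  obtain ⟨x, hx, harc, hsub⟩ := A.exists_small F hC hN j
    (eventually_inGeneralPosition hC F (hN.lt j.2) (A.isFinitePolygonal F k))
  have hfp : IsFinitePolygonal (arcChain F j (C.armL j x) (C.armR j x)) := harc.isFinitePolygonal
  have hcyc := (arcChain_mem (F := F) hC (hN.lt j.2) harc).2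
  rw [A.dual_chain_eq F hC hN j k harc hsub hx, crossForm_swap F hfp (A.isFinitePolygonal F k) hx,
    ← DeligneMostow.dual_eq F hfp hcyc (A.isFinitePolygonal F k) hx.symm]
  have hE := C.E_ne_zero (C.z j + C.armL j (A.y j)) (C.z j + C.armL j x)
  rw [A.dual_of_sub_mem F hC hN hfp hcyc (c := Pi.single j
    (C.E (C.z j + C.armL j (A.y j)) (C.z j + C.armL j x))⁻¹) ?_ (A.chain_mem F hC hN k),
    Finset.sum_eq_single_of_mem j (Finset.mem_univ j) fun i _ hi => by
      rw [Pi.single_eq_of_ne hi, map_zero, zero_mul], Pi.single_eq_same, map_mul, conj_conj,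
    mul_neg, ← mul_assoc, mul_inv_cancel₀ hE, one_mul]
  have h1 := (IntersectionBoundary L).smul_mem
    (-(C.E (C.z j + C.armL j (A.y j)) (C.z j + C.armL j x))⁻¹) hsub
  rw [Finset.sum_eq_single_of_mem j (Finset.mem_univ j) fun i _ hi => by
    rw [Pi.single_eq_of_ne hi, zero_smul], Pi.single_eq_same]
  rwa [smul_sub, neg_smul, neg_smul, smul_smul, inv_mul_cancel₀ hE, one_smul, sub_neg_eq_add,
    neg_add_eq_sub] at h1

theorem dual_self (k : Fin N) : A.dual F hC hN k (A.chain F k) =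
    (1 - C.mon k)⁻¹ + (1 - C.mon (k + 1))⁻¹ - 1 := by
  have hk := hN.lt k.2
  obtain ⟨x, ⟨hx, hx'⟩, harc, hsub⟩ := A.exists_small F hC hN k
    ((eventually_inGeneralPosition hC F hk (A.isFinitePolygonal F k)).and
      (eventually_crossForm_self hC F hk (A.pos k k.2).1 (A.pos k k.2).2 (A.isArc k k.2)))
  have h1 := harc.segment_subset (left_mem_segment ℝ _ _)
  have h2 := (A.isArc k k.2).segment_subset (left_mem_segment ℝ _ _)
  rw [A.dual_chain_eq F hC hN k k harc hsub hx, chain, hx', ← mul_assoc,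
    Config.E_mul_of_overlap hC hk h2 h1 h2, C.E_self, one_mul]

theorem norm_dual_succ (j k : Fin N) (hjk : (j : ℕ) = k + 1) :
    ‖A.dual F hC hN k (A.chain F j)‖ = ‖(C.mon j - 1)⁻¹‖ := by
  obtain ⟨j, hj⟩ := j
  obtain rfl : j = k + 1 := hjk
  have hs := A.succ k hj
  obtain ⟨x, ⟨hx, hx'⟩, harc, hsub⟩ := A.exists_small F hC hN ⟨k + 1, hj⟩
    ((eventually_inGeneralPosition hC F (hN.lt hj) (A.isFinitePolygonal F k)).and
      (eventually_crossForm_succ hC F (hN.lt hj) (A.isArc k k.2) hs.1 hs.2))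
  rw [A.dual_chain_eq F hC hN ⟨k + 1, hj⟩ k harc hsub hx, norm_mul, C.norm_E, one_mul]
  exact hx'

theorem dual_far (j k : Fin N) (hjk : (j : ℕ) + 1 < k ∨ (k : ℕ) + 1 < j) :
    A.dual F hC hN k (A.chain F j) = 0 := by
  obtain ⟨x, ⟨hx, hx'⟩, harc, hsub⟩ := A.exists_small F hC hN j
    ((eventually_inGeneralPosition hC F (hN.lt j.2) (A.isFinitePolygonal F k)).and
      (eventually_crossForm_far hC F (hN.lt j.2) (hN.lt k.2) hjk.symm (A.isArc k k.2)))
  rw [A.dual_chain_eq F hC hN j k harc hsub hx, chain, hx', mul_zero]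

end Config.ArcSystem

end

end DeligneMostow
-- The form with this Gram matrix, the basis of arcs, and the intersection pairing
namespace DeligneMostow
open Complex CategoryTheory Filter Topology

section

variable {V : Type*} [AddCommGroup V] [Module ℂ V] {N : ℕ}

/-- The sesquilinear form with a given Gram matrix. -/
noncomputable def formOf (b : Module.Basis (Fin N) ℂ V) (G : Fin N → Fin N → ℂ) :
    V →ₗ[ℂ] V →ₗ⋆[ℂ] ℂ :=
  LinearMap.mk₂'ₛₗ (RingHom.id ℂ) (starRingEnd ℂ)
    (fun v w => ∑ k, starRingEnd ℂ (b.repr w k) * ∑ j, b.repr v j * G j k)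
    (fun v v' w => by simp [add_mul, mul_add, Finset.sum_add_distrib])
    (fun c v w => by simp [Finset.mul_sum, mul_assoc, mul_left_comm])
    (fun v w w' => by simp [add_mul, Finset.sum_add_distrib])
    (fun c v w => by simp [Finset.mul_sum, mul_assoc])

theorem formOf_apply (b : Module.Basis (Fin N) ℂ V) (G : Fin N → Fin N → ℂ) (v w : V) :
    formOf b G v w = ∑ k, starRingEnd ℂ (b.repr w k) * ∑ j, b.repr v j * G j k := rfl

theorem formOf_basis (b : Module.Basis (Fin N) ℂ V) (G : Fin N → Fin N → ℂ) (j k : Fin N) :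
    formOf b G (b j) (b k) = G j k := by
  classical
  rw [formOf_apply, Finset.sum_eq_single_of_mem k (Finset.mem_univ k) fun i _ hi => by
    rw [b.repr_self, Finsupp.single_eq_of_ne hi, map_zero, zero_mul],
    Finset.sum_eq_single_of_mem j (Finset.mem_univ j) fun i _ hi => by
      rw [b.repr_self, Finsupp.single_eq_of_ne hi, zero_mul]]
  simp

theorem ext_basis_sesquilinear (b : Module.Basis (Fin N) ℂ V) {B B' : V →ₗ[ℂ] V →ₗ⋆[ℂ] ℂ}
    (h : ∀ j k, B (b j) (b k) = B' (b j) (b k)) : B = B' :=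
  b.ext fun j => b.ext (f₁ := B (b j)) (f₂ := B' (b j)) (h j)

theorem isTridiagonal_formOf (b : Module.Basis (Fin N) ℂ V) {G : Fin N → Fin N → ℂ} {a : ℕ → ℝ}
    (h : ∀ j k, G j k = -starRingEnd ℂ (G k j))
    (hd : ∀ k, G k k = I / 2 * (Real.cot (a k) + Real.cot (a (k + 1)) : ℝ))
    (hs : ∀ j k : Fin N, (j : ℕ) = k + 1 → ‖G j k‖ = 1 / (2 * Real.sin (a j)))
    (hf : ∀ j k : Fin N, (j + 1 < (k : ℕ) ∨ k + 1 < (j : ℕ)) → G j k = 0) :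
    IsTridiagonal b (I • formOf b G) a where
  hermitian v w := by
    simp only [LinearMap.smul_apply, smul_eq_mul, formOf_apply, map_mul, conj_I, map_sum, conj_conj,
      Finset.mul_sum]
    rw [Finset.sum_comm]
    refine Finset.sum_congr rfl fun j _ => Finset.sum_congr rfl fun k _ => ?_
    rw [h j k]
    ring
  diag k := by
    rw [LinearMap.smul_apply, LinearMap.smul_apply, formOf_basis, hd, smul_eq_mul,
      show I * (I / 2 * ((Real.cot (a k) + Real.cot (a (k + 1)) : ℝ) : ℂ)) =
        ((-(Real.cot (a k) + Real.cot (a (k + 1))) / 2 : ℝ) : ℂ) by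
          rw [ofReal_div, ofReal_neg, ofReal_ofNat]
          linear_combination ((Real.cot (a k) + Real.cot (a (k + 1)) : ℝ) : ℂ) / 2 * I_sq, ofReal_re]
  succ j k hjk := by
    rw [LinearMap.smul_apply, LinearMap.smul_apply, formOf_basis, norm_smul, norm_I, one_mul,
      hs j k hjk]
  far j k hjk := by
    rw [LinearMap.smul_apply, LinearMap.smul_apply, formOf_basis, hf j k hjk, smul_zero]

end

section

variable {S : Set P1} {L : LocalSystem.{u} S} {C : Config L} {u : ℂ} {N : ℕ}

theorem Config.mon_eq (k : ℕ) : C.mon k =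
    (Real.cos (Real.pi * C.ν k) + Real.sin (Real.pi * C.ν k) * I) ^ 2 := by
  rw [Config.mon, ofReal_cos, ofReal_sin, ← exp_mul_I, ← exp_nat_mul]
  congr 1
  push_cast
  ring

theorem Config.sin_pos {k : ℕ} (hk : k < C.m) : 0 < Real.sin (Real.pi * C.ν k) :=
  Real.sin_pos_of_pos_of_lt_pi (mul_pos Real.pi_pos (C.ν_pos k hk))
    (by nlinarith [C.ν_lt_one k hk, Real.pi_pos])

theorem Config.inv_one_sub_mon {k : ℕ} (hk : k < C.m) :
    (1 - C.mon k)⁻¹ = 1 / 2 + I / 2 * (Real.cot (Real.pi * C.ν k) : ℝ) := by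
  have hs : (Real.sin (Real.pi * C.ν k) : ℂ) ≠ 0 := ofReal_ne_zero.2 (Config.sin_pos hk).ne'
  have h2 : (Real.sin (Real.pi * C.ν k) : ℂ) ^ 2 + (Real.cos (Real.pi * C.ν k) : ℂ) ^ 2 = 1 := by
    exact_mod_cast Real.sin_sq_add_cos_sq _
  refine inv_eq_of_mul_eq_one_right ?_
  rw [Config.mon_eq, Real.cot_eq_cos_div_sin, ofReal_div]
  generalize (Real.sin (Real.pi * C.ν k) : ℂ) = x at hs h2 ⊢
  generalize (Real.cos (Real.pi * C.ν k) : ℂ) = y at h2 ⊢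
  field_simp
  linear_combination (2 * x - (x + I * y)) * h2 - (x ^ 3 + x ^ 2 * y * I + 2 * x * y ^ 2) * I_sq

theorem Config.norm_inv_mon_sub_one {k : ℕ} (hk : k < C.m) :
    ‖(C.mon k - 1)⁻¹‖ = 1 / (2 * Real.sin (Real.pi * C.ν k)) := by
  have e : C.mon k - 1 = ((2 * Real.sin (Real.pi * C.ν k) : ℝ) : ℂ) *
      (I * exp ((Real.pi * C.ν k : ℝ) * I)) := by
    have h2 : (Real.sin (Real.pi * C.ν k) : ℂ) ^ 2 + (Real.cos (Real.pi * C.ν k) : ℂ) ^ 2 = 1 := by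
      exact_mod_cast Real.sin_sq_add_cos_sq _
    rw [Config.mon_eq, exp_mul_I, ← ofReal_cos, ← ofReal_sin, ofReal_mul]
    generalize (Real.sin (Real.pi * C.ν k) : ℂ) = x at h2 ⊢
    generalize (Real.cos (Real.pi * C.ν k) : ℂ) = y at h2 ⊢
    push_cast
    linear_combination h2 - x ^ 2 * I_sq
  rw [norm_inv, e, norm_mul, norm_mul, norm_I, norm_exp_ofReal_mul_I, norm_real, one_div,
    Real.norm_of_nonneg (by linarith [Config.sin_pos hk])]
  simp

namespace Config.ArcSystem

variable (A : C.ArcSystem u N) (F : Frame C) (hC : C.Sorted u) (hN : C.HasArcs N)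

include hC hN in
theorem isTridiagonal {V : Type*} [AddCommGroup V] [Module ℂ V] (b : Module.Basis (Fin N) ℂ V) :
    IsTridiagonal b (I • formOf b fun j k => A.dual F hC hN k (A.chain F j))
      fun i => Real.pi * C.ν i :=
  isTridiagonal_formOf b (fun j k => A.dual_swap F hC hN j k)
    (fun k => by
      have hk := hN.lt k.2
      rw [A.dual_self, inv_one_sub_mon hk, inv_one_sub_mon (by omega)]
      push_cast
      ring)
    (fun j k hjk => by
      rw [A.norm_dual_succ F hC hN j k hjk, norm_inv_mon_sub_one (by have := hN.lt j.2; omega)])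
    fun j k hjk => A.dual_far F hC hN j k hjk

/-- The classes of the chosen arcs. -/
noncomputable def cls (k : Fin N) : IH1 L := IH1.mk L ⟨A.chain F k, A.chain_mem F hC hN k⟩

theorem mk_eq_sum {ξ : IntersectionCycle L} {c : Fin N → ℂ} :
    IH1.mk L ξ = ∑ k, c k • A.cls F hC hN k ↔
      ξ.1 - ∑ k, c k • A.chain F k ∈ IntersectionBoundary L := by
  have e : ∑ k, c k • A.cls F hC hN k =
      IH1.mk L (∑ k, c k • ⟨A.chain F k, A.chain_mem F hC hN k⟩) := by
    simp only [cls, IH1.mk, ← Submodule.mkQ_apply, map_sum, map_smul]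
  rw [e, IH1.mk, IH1.mk, Submodule.Quotient.eq, Submodule.mem_comap]
  simp

theorem top_le_span : ⊤ ≤ Submodule.span ℂ (Set.range (A.cls F hC hN)) := by
  rintro ⟨ξ⟩ -
  obtain ⟨β, hβ, ζ, hζ, h⟩ := Submodule.mem_sup.1 (A.mem_sup_span F hC hN ξ.2)
  obtain ⟨c, rfl⟩ := (Submodule.mem_span_range_iff_exists_fun ℂ).1 hζ
  refine (Submodule.mem_span_range_iff_exists_fun ℂ).2 ⟨c, ((A.mk_eq_sum F hC hN).2 ?_).symm⟩
  rw [← h, add_sub_cancel_right]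
  exact hβ

variable {p q : ℕ} (hpq : p + q = N) (hp : (p : ℝ) < ∑ i ∈ Finset.range (N + 1), C.ν i)
  (hp' : ∑ i ∈ Finset.range (N + 1), C.ν i < p + 1)

include hpq hp hp'

theorem hasSignature {V : Type*} [AddCommGroup V] [Module ℂ V] (b : Module.Basis (Fin N) ℂ V)
    (hm : N < C.m) : HasSignature (I • formOf b fun j k => A.dual F hC hN k (A.chain F j)) p q :=
  (A.isTridiagonal F hC hN b).hasSignature (fun i hi => C.ν_pos i (by omega))
    (fun i hi => C.ν_lt_one i (by omega)) hpq hp hp'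

/-- The coefficients of a relation lie in the radical of the Gram form on `ℂ^N`, which is zero by
the signature. The abstract form on `ℂ^N` is used because the basis of `IH_1` is not yet available.
-/
theorem linearIndependent (hm : N < C.m) : LinearIndependent ℂ (A.cls F hC hN) := by
  refine Fintype.linearIndependent_iff.2 fun c hc => ?_
  have h1 := (A.mk_eq_sum F hC hN (ξ := 0) (c := c)).1 (hc.symm ▸ rfl)
  have h2 : ∀ k, ∑ j, c j * A.dual F hC hN k (A.chain F j) = 0 := fun k => by
    have := A.dual_eq_zero F hC hN k h1
    rw [map_sub, map_sum] at this
    simpa using this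
  have h3 := (A.hasSignature F hC hN hpq hp hp' (Pi.basisFun ℂ (Fin N)) hm).1 c fun w => by
    rw [LinearMap.smul_apply, LinearMap.smul_apply, formOf_apply]
    simp only [Pi.basisFun_repr, h2]
    simp
  exact fun k => congrFun h3 k

end Config.ArcSystem

/-- The intersection pairing of a configuration and its signature. -/
theorem Config.exists_pairing (hC : C.Sorted u) (hN : C.HasArcs N) (h : FlatMetric L) {p q : ℕ}
    (hpq : p + q = N) (hp : (p : ℝ) < ∑ i ∈ Finset.range (N + 1), C.ν i)
    (hp' : ∑ i ∈ Finset.range (N + 1), C.ν i < p + 1) :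
    ∃ B : IH1 L →ₗ[ℂ] IH1 L →ₗ⋆[ℂ] ℂ,
      (IsIntersectionPairing h B ∧ ∀ B', IsIntersectionPairing h B' → B' = B) ∧
      IsHermitianForm (I • B) ∧ HasSignature (I • B) p q := by
  have hm : N < C.m := by rcases hN with h | h <;> omega
  obtain ⟨F, hF⟩ := Frame.exists_orthonormal h (C := C)
  obtain ⟨A⟩ := nonempty_arcSystem hC hN
  let b := Module.Basis.mk (A.linearIndependent F hC hN hpq hp hp' hm) (A.top_le_span F hC hN)
  have hb : ∀ k, b k = A.cls F hC hN k := fun k => Module.Basis.mk_apply _ _ k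
  have hrepr : ∀ ξ : IntersectionCycle L,
      ξ.1 - ∑ k, b.repr (IH1.mk L ξ) k • A.chain F k ∈ IntersectionBoundary L := fun ξ => by
    refine (A.mk_eq_sum F hC hN).1 ?_
    conv_lhs => rw [← b.sum_repr (IH1.mk L ξ)]
    exact Finset.sum_congr rfl fun k _ => by rw [hb]
  refine ⟨formOf b fun j k => A.dual F hC hN k (A.chain F j), ⟨fun ξ η hξ hη hgp => ?_,
    fun B' hB' => ext_basis_sesquilinear b fun j k => ?_⟩, (A.isTridiagonal F hC hN b).hermitian,
    A.hasSignature F hC hN hpq hp hp' b hm⟩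
  -- Geometric number, crossing form, and functional of `η` agree in turn; the functional depends
  -- only on the class of `η`, and each resulting term only on the class of `ξ`.
  · have hξ' := hξ.finite ξ.2
    have hη' := hη.finite η.2
    rw [intersectionNumber_eq hF hξ' hη' hgp, ← dual_eq F hη' η.2.2 hξ' hgp,
      A.dual_of_sub_mem F hC hN hη' η.2.2 (hrepr η) ξ.2, formOf_apply]
    refine Finset.sum_congr rfl fun k _ => ?_
    have h1 := A.dual_eq_zero F hC hN k (hrepr ξ)
    rw [map_sub, map_sum, sub_eq_zero] at h1
    rw [h1]
    simp only [map_smul, smul_eq_mul]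
  -- Two chosen arcs need not be in general position. Replacing arc `j` by a small copy makes them
  -- so, and the defining property then determines the entry.
  · obtain ⟨x, hx, harc, hsub⟩ := A.exists_small F hC hN j
      (eventually_inGeneralPosition hC F (hN.lt j.2) (A.isFinitePolygonal F k))
    have h1 : b j = C.E (C.z j + C.armL j (A.y j)) (C.z j + C.armL j x) •
        IH1.mk L ⟨_, arcChain_mem (F := F) hC (hN.lt j.2) harc⟩ := by
      rw [hb, ArcSystem.cls, IH1.mk, IH1.mk, ← Submodule.Quotient.mk_smul, Submodule.Quotient.eq]
      exact hsub
    have h2 := hB' ⟨_, arcChain_mem (F := F) hC (hN.lt j.2) harc⟩ ⟨_, A.chain_mem F hC hN k⟩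
      harc.isPolygonal (A.isArc k k.2).isPolygonal hx
    rw [formOf_basis, A.dual_chain_eq F hC hN j k harc hsub hx, h1, map_smul, LinearMap.smul_apply,
      hb, ArcSystem.cls, h2, smul_eq_mul, intersectionNumber_eq hF harc.isFinitePolygonal
        (A.isFinitePolygonal F k) hx]

end

end DeligneMostow
-- From the given points to a sorted configuration
namespace DeligneMostow
open Complex CategoryTheory Filter Topology

section

variable {n : ℕ} {s : Fin (n + 1) → P1}

/-- A numbering of the points, with increasing real parts after a rotation, and `∞` last. -/
theorem exists_sorting (hs : Function.Injective s) : ∃ (u : ℂ) (σ : Equiv.Perm (Fin (n + 1))),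
    u ≠ 0 ∧ (∀ i, i ≠ Fin.last n → s (σ i) ≠ OnePoint.infty) ∧ ∀ i j, i < j →
      s (σ j) ≠ OnePoint.infty → (coord (s (σ i)) / u).re < (coord (s (σ j)) / u).re := by
  classical
  -- All but finitely many slopes `δ` separate the finite points under `w ↦ Re ((1 + iδ) w)`.
  have h1 : ∀ᶠ δ in 𝓝[>] (0 : ℝ), ∀ i j, coord (s i) ≠ coord (s j) →
      (coord (s i) - coord (s j)).re - δ * (coord (s i) - coord (s j)).im ≠ 0 := by
    refine Filter.eventually_all.2 fun i => Filter.eventually_all.2 fun j => ?_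
    by_cases hij : coord (s i) = coord (s j)
    · exact Filter.Eventually.of_forall fun δ h => absurd hij h
    · refine (eventually_sub_mul_ne ?_).mono fun δ h _ => h
      by_contra! h
      exact hij (sub_eq_zero.1 (Complex.ext h.1 h.2))
  obtain ⟨δ, hδ⟩ := h1.exists
  have hu : (1 : ℂ) + δ * I ≠ 0 := fun h => by simpa using congrArg re h
  let l : Fin (n + 1) → ℝ := fun i => (coord (s i) / (1 + δ * I)⁻¹).re
  have hl : ∀ i j, coord (s i) ≠ coord (s j) → l i ≠ l j := fun i j hij h => by
    refine hδ i j hij ?_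
    simp only [l, div_inv_eq_mul, mul_re, add_re, add_im, one_re, one_im, I_re, I_im, mul_im,
      ofReal_re, ofReal_im] at h
    rw [sub_re, sub_im]
    linarith
  -- The key for `∞` exceeds all others, so that sorting puts `∞` last.
  let κ : Fin (n + 1) → ℝ := fun i => if s i = OnePoint.infty then ∑ j, |l j| + 1 else l i
  have hb : ∀ i, l i < ∑ j, |l j| + 1 := fun i => by
    have := Finset.single_le_sum (fun j _ => abs_nonneg (l j)) (Finset.mem_univ i)
    linarith [le_abs_self (l i)]
  have hκ : Function.Injective κ := fun i j hij => by
    simp only [κ] at hij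
    by_cases hi : s i = OnePoint.infty <;> by_cases hj : s j = OnePoint.infty
    · exact hs (hi.trans hj.symm)
    · rw [if_pos hi, if_neg hj] at hij
      exact absurd hij (hb j).ne'
    · rw [if_neg hi, if_pos hj] at hij
      exact absurd hij (hb i).ne
    · rw [if_neg hi, if_neg hj] at hij
      by_contra hne
      refine hl i j (fun h => hne (hs ?_)) hij
      rw [← coe_coord hi, h, coe_coord hj]
  have hmono : StrictMono (κ ∘ Tuple.sort κ) :=
    (Tuple.monotone_sort κ).strictMono_of_injective (hκ.comp (Tuple.sort κ).injective)
  have hle : ∀ i, κ i ≤ ∑ j, |l j| + 1 := fun i => by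
    simp only [κ]; split_ifs
    exacts [le_rfl, (hb i).le]
  have hlt : ∀ i j, i < j → s (Tuple.sort κ i) ≠ OnePoint.infty := fun i j hij hi => by
    refine (hle (Tuple.sort κ j)).not_gt ((hmono hij).trans_le' (le_of_eq ?_))
    simp only [Function.comp, κ]
    rw [if_pos hi]
  refine ⟨_, Tuple.sort κ, inv_ne_zero hu, fun i hi => hlt i _ (Fin.lt_last_iff_ne_last.2 hi),
    fun i j hij hj => ?_⟩
  have h2 := hmono hij
  simp only [Function.comp, κ] at h2
  rwa [if_neg (hlt i j hij), if_neg hj] at h2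

/-- The index `j₀` is the last one in the order, and it belongs to `∞` if `∞` is singular. In both
cases the first `n` exponents are those of finite points, and leaving out `j₀` gives the sum that
governs the signature. -/
theorem IsDeligneMostow.exists_config (hs : Function.Injective s) {μ : Fin (n + 1) → ℚ}
    (hμ : ∀ j, 0 < μ j ∧ μ j < 1) {L : LocalSystem.{u} (Set.range s)} (hL : IsDeligneMostow s μ L) :
    ∃ (C : Config L) (u : ℂ) (j₀ : Fin (n + 1)), C.Sorted u ∧
      ((OnePoint.infty ∈ Set.range s ∧ C.m = n) ∨ (OnePoint.infty ∉ Set.range s ∧ C.m = n + 1)) ∧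
      ∑ i ∈ Finset.range n, C.ν i + (μ j₀ : ℝ) = ((∑ j, μ j : ℚ) : ℝ) ∧
      ∃ M : ℤ, ∑ j, μ j = M := by
  classical
  obtain ⟨u, σ, hu, hfin, hlt⟩ := exists_sorting hs
  -- The minimum makes the numbering total on `ℕ`; values beyond `n` are never used.
  let t : ℕ → Fin (n + 1) := fun i => σ ⟨min i n, by omega⟩
  have ht : ∀ i (h : i < n + 1), t i = σ ⟨i, h⟩ := fun i h =>
    congrArg σ (Fin.ext (min_eq_left (by omega)))
  have ht' : ∀ k, ∃ i ≤ n, k = t i := fun k => ⟨σ.symm k, by omega, by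
    rw [ht _ (σ.symm k).2]; simp⟩
  have htinj : ∀ i ≤ n, ∀ j ≤ n, t i = t j → i = j := fun i hi j hj h => by
    rw [ht i (by omega), ht j (by omega)] at h
    exact congrArg Fin.val (σ.injective h)
  have hfin' : ∀ i < n, s (t i) ≠ OnePoint.infty := fun i hi => by
    rw [ht i (by omega)]
    exact hfin _ fun h => hi.ne (congrArg Fin.val h)
  let m := if s (t n) = OnePoint.infty then n else n + 1
  have hm : ∀ i, i < m ↔ i ≤ n ∧ s (t i) ≠ OnePoint.infty := fun i => by
    simp only [m]
    split_ifs with h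
    · exact ⟨fun hi => ⟨hi.le, hfin' i hi⟩, fun ⟨hi, hi'⟩ => lt_of_le_of_ne hi fun h0 =>
        hi' (h0 ▸ h)⟩
    · refine ⟨fun hi => ⟨by omega, ?_⟩, fun hi => by omega⟩
      rcases (by omega : i < n ∨ i = n) with h0 | rfl
      exacts [hfin' i h0, h]
  let C : Config L :=
    { m := m
      z := fun i => coord (s (t i))
      ν := fun i => (μ (t i) : ℝ)
      mem_iff := fun x => by
        constructor
        · rintro ⟨k, hk⟩
          obtain ⟨i, hi, rfl⟩ := ht' k
          exact ⟨i, (hm i).2 ⟨hi, hk ▸ OnePoint.coe_ne_infty x⟩, by rw [hk]; rfl⟩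
        · rintro ⟨i, hi, rfl⟩
          exact ⟨t i, (coe_coord ((hm i).1 hi).2).symm⟩
      z_inj := fun i hi j hj h => htinj i ((hm i).1 hi).1 j ((hm j).1 hj).1 (hs (by
        rw [← coe_coord ((hm i).1 hi).2, h, coe_coord ((hm j).1 hj).2]))
      ν_pos := fun j _ => by exact_mod_cast (hμ (t j)).1
      ν_lt_one := fun j _ => by exact_mod_cast (hμ (t j)).2
      rank_one := hL.rank_one
      monodromy := fun j hj r hr h x γ hγ v => by
        have h1 := hL.monodromy (t j) x γ (Or.inl ⟨coord (s (t j)), r,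
          (coe_coord ((hm j).1 hj).2).symm, hr, fun k hk w hw => ?_, hγ⟩) v
        · rw [h1]; push_cast; rfl
        · obtain ⟨i, hi, rfl⟩ := ht' k
          have h2 := h i ((hm i).2 ⟨hi, hw ▸ OnePoint.coe_ne_infty w⟩) fun h => hk (by rw [h])
          rwa [hw] at h2 }
  have hsum : ∑ i ∈ Finset.range (n + 1), (μ (t i) : ℝ) = ((∑ j, μ j : ℚ) : ℝ) := by
    rw [← Fin.sum_univ_eq_sum_range (fun i => (μ (t i) : ℝ)), ← Equiv.sum_comp σ μ]
    push_cast
    exact Finset.sum_congr rfl fun i _ => by rw [ht i i.2]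
  refine ⟨C, u, t n, ⟨hu, fun i j hij hj => ?_⟩, ?_, ?_, ?_⟩
  · have hj' := (hm j).1 hj
    have h1 := hlt ⟨i, by omega⟩ ⟨j, by omega⟩ hij (by rw [← ht]; exact hj'.2)
    rwa [← ht, ← ht] at h1
  · by_cases h : s (t n) = OnePoint.infty
    · exact Or.inl ⟨⟨_, h⟩, if_pos h⟩
    · refine Or.inr ⟨?_, if_neg h⟩
      rintro ⟨k, hk⟩
      obtain ⟨i, hi, rfl⟩ := ht' k
      rcases (by omega : i < n ∨ i = n) with h0 | rfl
      exacts [hfin' i h0 hk, h hk]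
  · rw [← hsum, Finset.sum_range_succ]
  · suffices ∃ M : ℤ, ((∑ j, μ j : ℚ) : ℝ) = M by
      obtain ⟨M, hM⟩ := this
      exact ⟨M, by exact_mod_cast hM⟩
    by_cases h : s (t n) = OnePoint.infty
    · have hCm : C.m = n := if_pos h
      obtain ⟨M, hM⟩ := Frame.exists_sum_eq_of_mem C (ν := μ (t n)) fun r hr hz x γ hγ v => by
        have h1 := hL.monodromy (t n) x γ (Or.inr ⟨h, r, hr, fun k w hw => ?_, hγ⟩) v
        · rw [h1]; push_cast; rfl
        · obtain ⟨i, hi, rfl⟩ := ht' k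
          have h2 := hz i ((hm i).2 ⟨hi, hw ▸ OnePoint.coe_ne_infty w⟩)
          have h3 : C.z i = w := by change coord (s (t i)) = w; rw [hw]; rfl
          rwa [h3] at h2
      refine ⟨M, ?_⟩
      rw [← hsum, Finset.sum_range_succ, ← hM, hCm]
    · have hCm : C.m = n + 1 := if_neg h
      obtain ⟨M, hM⟩ := Frame.exists_sum_eq_of_notMem C (by
        rintro ⟨k, hk⟩
        obtain ⟨i, hi, rfl⟩ := ht' k
        rcases (by omega : i < n ∨ i = n) with h0 | rfl
        exacts [hfin' i h0 hk, h hk])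
      exact ⟨M, by rw [← hsum, ← hM, hCm]⟩

end

end DeligneMostow
-- Assembly of the theorem
theorem mainTheorem12 {n : ℕ} (hn : 0 < n) (s : Fin n → DeligneMostow.P1)
    (hs : Function.Injective s) (μ : Fin n → ℚ) (hμ : ∀ j, 0 < μ j ∧ μ j < 1)
    (L : DeligneMostow.LocalSystem.{u} (Set.range s))
    (hL : DeligneMostow.IsDeligneMostow s μ L) :
    Nonempty (DeligneMostow.FlatMetric L) ∧
    ∀ h : DeligneMostow.FlatMetric L,
      ∃ B : DeligneMostow.IH1 L →ₗ[ℂ] DeligneMostow.IH1 L →ₗ⋆[ℂ] ℂ,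
        (DeligneMostow.IsIntersectionPairing h B ∧
          ∀ B', DeligneMostow.IsIntersectionPairing h B' → B' = B) ∧
        DeligneMostow.IsHermitianForm (Complex.I • B) ∧
        (∃ p q : ℕ, (p : ℚ) = (∑ j, μ j) - 1 ∧ (q : ℚ) = (∑ j, (1 - μ j)) - 1 ∧
          DeligneMostow.HasSignature (Complex.I • B) p q) ∧
        ((∑ j, μ j) = 2 → 3 ≤ n ∧ DeligneMostow.HasSignature (Complex.I • B) 1 (n - 3)) := by
  cases n with
  | zero => exact absurd hn (lt_irrefl 0)
  | succ n =>
  obtain ⟨C, u, j₀, hC, hm, hν, M, hM⟩ := hL.exists_config hs hμ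
  have hj₀ : (0 : ℝ) < μ j₀ ∧ (μ j₀ : ℝ) < 1 := ⟨by exact_mod_cast (hμ j₀).1, by
    exact_mod_cast (hμ j₀).2⟩
  rw [hM, Rat.cast_intCast] at hν
  cases n with
  | zero =>
    -- A single singular point is impossible: its exponent would be an integer strictly between `0`
    -- and `1`.
    rw [Finset.sum_range_zero, zero_add] at hν
    have h0 : (0 : ℤ) < M := by exact_mod_cast hν ▸ hj₀.1
    have h1 : M < 1 := by exact_mod_cast hν ▸ hj₀.2
    omega
  | succ N =>
  have hN : C.HasArcs N := hm.imp (fun h => h) fun h => h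
  have hpos : 0 < ∑ i ∈ Finset.range (N + 1), C.ν i :=
    Finset.sum_pos (fun i hi => C.ν_pos i (by have := Finset.mem_range.1 hi; omega)) ⟨0, by simp⟩
  have hlt : ∑ i ∈ Finset.range (N + 1), C.ν i < (N + 1 : ℕ) := by
    have := Finset.sum_lt_sum_of_nonempty (s := Finset.range (N + 1)) ⟨0, by simp⟩ fun i hi =>
      C.ν_lt_one i (by have := Finset.mem_range.1 hi; omega)
    simpa using this
  have h0 : (0 : ℤ) < M := by
    have : (0 : ℝ) < M := by linarith
    exact_mod_cast this
  -- All exponents add up to `p + 1`, and the omitted one lies in `(0, 1)`, so the sum of the others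
  -- lies strictly between `p` and `p + 1`.
  obtain ⟨p, rfl⟩ : ∃ p : ℕ, M = p + 1 := ⟨(M - 1).toNat, by omega⟩
  push_cast at hν hM
  have hp : p ≤ N := by
    have : (p : ℝ) < (N + 1 : ℕ) := by linarith
    have : p < N + 1 := by exact_mod_cast this
    omega
  have hq : ∑ j, (1 - μ j) = ((N - p : ℕ) : ℚ) + 1 := by
    rw [Finset.sum_sub_distrib, hM, Nat.cast_sub hp]
    simp
    ring
  refine ⟨DeligneMostow.Frame.nonempty_flatMetric C, fun h => ?_⟩
  obtain ⟨B, hB, hB', hsig⟩ := DeligneMostow.Config.exists_pairing hC hN h (p := p) (q := N - p)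
    (by omega) (by linarith) (by linarith)
  refine ⟨B, hB, hB', ⟨p, N - p, by rw [hM]; ring, by rw [hq]; ring, hsig⟩, fun h2 => ?_⟩
  -- Here `p = 1`, and `p ≤ N` yields at least `N + 2 ≥ 3` points.
  rw [h2] at hM
  obtain rfl : p = 1 := by
    have : (p : ℚ) = 1 := by linarith
    exact_mod_cast this
  exact ⟨by omega, hsig⟩
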